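/- **Theorem 2.2 (Smoothness).** *Setting.* Let $d\ge 1$ and let $\mathcal M_\delta(\mathbb R^d)$ be the space of $\sigma$-finite measures on $\mathbb R^d$ that are sums of Dirac masses, with the $\sigma$-algebra generated by the maps $\mu\mapsto\mu(V)$, $V$ Borel. Let $\mathbf a_\circ:\mathcal M_\delta(\mathbb R^d)\to\mathbb R^{d\times d}_{\rm sym}$ be measurable, with $\mathrm{Id}\le \mathbf a_\circ(\mu)\le\Lambda\,\mathrm{Id}$ and $\mathbf a_\circ(\mu)=\mathbf a_\circ(\mu|_{B_{1/2}})$ for every $\mu$, where $\mu|_U := \mu(U\cap\cdot)$ and $B_{1/2}$ is the Euclidean ball of radius $1/2$ centred at the origin. Put $\mathbf a(\mu,x):=\mathbf a_\circ(\tau_{-x}\mu)$ with $\tau_{-x}\mu(U)=\mu(x+U)$. For $\rho_0>0$ let $\mathbb P_{\rho_0}$ be the law on $\mathcal M_\delta(\mathbb R^d)$ of the Poisson point process with constant intensity $\rho_0$, and $\mathbb E_{\rho_0}$ its expectation. For a bounded open set $U$, let $C^\infty(U)$ be the set of measurable $f:\mathcal M_\delta(\mathbb R^d)\to\mathbb R$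 such that $(x_1,\dots,x_n)\mapsto f(\sum_{i}\delta_{x_i}+\mu|_{U^c})$ is infinitely differentiable on $U^n$ for all $\mu$ and $n$. If $\mu$ has a particle at $x$, let $\nabla f(\mu,x)$ be the vector with coordinates $\frac{d}{dh}\big|_{h=0}f(\mu-\delta_x+\delta_{x+he_j})$, $1\le j\le d$; otherwise $\nabla f(\mu,x):=0$. Let $\mathcal H^1(U)$ be the completion of $\{f\in C^\infty(U):\|f\|<\infty\}$ for the norm $\|f\|^2=\mathbb E_{\rho_0}[f^2]+\mathbb E_{\rho_0}[\int_U|\nabla f|^2\,d\mu]$; each $f \in \mathcal H^1(U)$ has a gradient $\nabla f$ defined by continuity. For $q\in\mathbb R^d$ set $$\nu_*(U,q,\rho_0):=\sup_{u\in\mathcal H^1(U)}\mathbb E_{\rho_0}\Big[\tfrac1{\rho_0|U|}\int_U\big(-\tfrac12\nabla u\cdot\mathbf a\nabla u+q\cdot\nabla u\big)\,d\mu\Big].$$ Let $\square_m:=(-3^m/2,3^m/2)^d$, $m\in\mathbb N$. There are symmetric matrices $\bar{\mathbf a}_*(\square_m,\rho_0)$ with $\mathrm{Id}\le\bar{\mathbf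 a}_*(\square_m,\rho_0)\le\Lambda\,\mathrm{Id}$ and $\nu_*(\square_m,p,\rho_0)=\frac12p\cdot\bar{\mathbf a}_*^{-1}(\square_m,\rho_0)p$ for all $p\in\mathbb R^d$; the limit $\bar{\mathbf a}(\rho_0):=\lim_{m\to\infty}\bar{\mathbf a}_*(\square_m,\rho_0)$ exists (the bulk diffusion matrix); and $\nu_*(\square_m,q,\rho_0)$ has an optimizer $\psi_m\in\mathcal H^1(\square_m)$. For points $x_1,\dots,x_k\in\mathbb R^d$ and a function $g$ on $\mathcal M_\delta(\mathbb R^d)$ let $D_ig:=g(\cdot+\delta_{x_i})-g$ and $D_{[\![1,k]\!]}:=D_1\cdots D_k$. In an expression with superscripts $\#$ these operators act on the configuration variable of the factors marked by $\#$ only, the others being frozen at $\mu$. *Statement.* Fix $q\in\mathbb R^d$. For every $k\ge1$ and $\rho_0>0$, the limit $$c_k(\rho_0):=\lim_{m\to\infty}\int_{(\mathbb R^d)^k}\mathbb E_{\rho_0}\Big[\tfrac1{\rho_0|\square_m|}\int_{\square_m}\nabla\psi_m\cdot D_{[\![1,k]\!]}\big((\mathbf a-\mathbf a^\#)\nabla\psi_m^\#\big)\,d\mu\Big]\,dx_1\cdots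 dx_k$$ is well defined (the integrals over $\mathbb P_{\rho_0}$ and over $(\mathbb R^d)^k$ converge absolutely, for almost every $(x_1,\dots,x_k)$ in the case of the inner one; the value does not depend on the choice of the optimizers) and finite. Moreover, for every $k\ge1$ there is a constant $C$, depending only on $d$, $\Lambda$, $k$ and $|q|$ (not on $\rho_0$), such that for all $\rho_0>0$ and all $\rho\in\mathbb R$ with $\rho_0+\rho>0$, $$\Big|q\cdot\bar{\mathbf a}^{-1}(\rho_0+\rho)q-q\cdot\bar{\mathbf a}^{-1}(\rho_0)q-\sum_{\ell=1}^kc_\ell(\rho_0)\frac{\rho^\ell}{\ell!}\Big|\le C|\rho|^{k+1}.$$ In particular, $\rho_0\mapsto q\cdot\bar{\mathbf a}^{-1}(\rho_0)q$ is infinitely differentiable on $(0,\infty)$, and its $\ell$-th derivative is $c_\ell$ for every $\ell\ge1$. -/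

import Mathlib

open MeasureTheory ProbabilityTheory Filter Topology Set
open scoped ENNReal NNReal

noncomputable section

namespace Bulk

/-- Euclidean space `ℝ^d`. -/
abbrev E (d : ℕ) : Type := EuclideanSpace ℝ (Fin d)

/-! ### Configuration space -/

/-- A cloud of particles: a σ-finite measure that is a (countable) sum of Dirac masses. -/
def IsCloud {d : ℕ} (μ : Measure (E d)) : Prop :=
  SigmaFinite μ ∧ ∃ (ι : Type) (_ : Countable ι) (x : ι → E d),
    μ = Measure.sum fun i => Measure.dirac (x i)

theorem IsCloud.zero {d : ℕ} : IsCloud (0 : Measure (E d)) :=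
  ⟨inferInstance, Empty, inferInstance, Empty.elim, by ext s hs; simp⟩

theorem IsCloud.add {d : ℕ} {μ ν : Measure (E d)} (hμ : IsCloud μ) (hν : IsCloud ν) :
    IsCloud (μ + ν) := by
  obtain ⟨h1, ι, _, x, rfl⟩ := hμ
  obtain ⟨h2, κ, _, y, rfl⟩ := hν
  refine ⟨inferInstance, ι ⊕ κ, inferInstance, Sum.elim x y, ?_⟩
  ext s hs
  simp only [Measure.add_apply, Measure.sum_apply _ hs]
  rw [ENNReal.summable.tsum_sum (f := fun b : ι ⊕ κ => Measure.dirac (Sum.elim x y b) s)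
    ENNReal.summable]
  rfl

theorem IsCloud.dirac {d : ℕ} (x : E d) : IsCloud (Measure.dirac x) := by
  refine ⟨inferInstance, Unit, inferInstance, fun _ => x, ?_⟩
  ext s hs
  simp

theorem IsCloud.restrict {d : ℕ} {μ : Measure (E d)} (hμ : IsCloud μ) (U : Set (E d)) :
    IsCloud (μ.restrict U) := by
  classical
  obtain ⟨h1, ι, _, x, rfl⟩ := hμ
  refine ⟨inferInstance, {i // x i ∈ U}, inferInstance, fun i => x i, ?_⟩
  rw [Measure.restrict_sum_of_countable]
  ext s hs
  rw [Measure.sum_apply _ hs, Measure.sum_apply _ hs]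
  refine Eq.trans ?_ (tsum_subtype {i | x i ∈ U} (fun i => Measure.dirac (x i) s)).symm
  refine tsum_congr fun i => ?_
  rw [MeasureTheory.restrict_dirac]
  by_cases hi : x i ∈ U <;> simp [hi]

theorem IsCloud.translate {d : ℕ} {μ : Measure (E d)} (hμ : IsCloud μ) (x : E d) :
    IsCloud (μ.map fun y => y - x) := by
  obtain ⟨h1, ι, _, z, rfl⟩ := hμ
  refine ⟨(MeasurableEquiv.subRight x).sigmaFinite_map, ι, inferInstance, fun i => z i - x, ?_⟩
  have hm : Measurable fun y : E d => y - x := measurable_id.sub_const x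
  rw [Measure.map_sum hm.aemeasurable]
  simp only [Measure.map_dirac' hm]

/-- The configuration space `M_δ(ℝ^d)`, as an additive submonoid of the measures on `ℝ^d`. -/
def clouds (d : ℕ) : AddSubmonoid (Measure (E d)) where
  carrier := {μ | IsCloud μ}
  zero_mem' := IsCloud.zero
  add_mem' := IsCloud.add

/-- The type of configurations. It carries the σ-algebra generated by the maps `μ ↦ μ(V)`,
`V` Borel. -/
abbrev Config (d : ℕ) : Type := clouds d

/-- One particle at `x`. -/
def particle {d : ℕ} (x : E d) : Config d := ⟨Measure.dirac x, IsCloud.dirac x⟩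

/-- The restriction of a configuration to `U`. -/
def restr {d : ℕ} (μ : Config d) (U : Set (E d)) : Config d :=
  ⟨(μ : Measure (E d)).restrict U, IsCloud.restrict μ.2 U⟩

/-- The translate `τ_{-x} μ`, with `τ_{-x} μ (U) = μ (x + U)`. -/
def shift {d : ℕ} (x : E d) (μ : Config d) : Config d :=
  ⟨(μ : Measure (E d)).map fun y => y - x, IsCloud.translate μ.2 x⟩

/-! ### The Poisson point process of constant intensity

On each unit cell `z + [0,1]^d`, `z ∈ ℤ^d`, throw a Poisson number (of parameter `ρ`) of
independent uniform points, independently over the cells. -/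

/-- For every cell, a number of points and an infinite list of positions in the unit cube. -/
abbrev Seed (d : ℕ) : Type := (Fin d → ℤ) → ℕ × (ℕ → Fin d → unitInterval)

def seedLaw (d : ℕ) (ρ : ℝ) : Measure (Seed d) :=
  Measure.infinitePi fun _ : Fin d → ℤ =>
    (poissonMeasure ρ.toNNReal).prod
      (Measure.infinitePi fun _ : ℕ => (volume : Measure (Fin d → unitInterval)))

instance (d : ℕ) (ρ : ℝ) : IsProbabilityMeasure (seedLaw d ρ) := by
  unfold seedLaw; infer_instance

/-- The point of the cell of `z` with relative position `u`. -/
def cellPoint {d : ℕ} (z : Fin d → ℤ) (u : Fin d → unitInterval) : E d :=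
  WithLp.toLp 2 fun j => (z j : ℝ) + (u j : ℝ)

/-- Keep, in each cell, as many of the listed points as prescribed. -/
def sampleMeasure {d : ℕ} (ω : Seed d) : Measure (E d) :=
  Measure.sum fun p : (Σ z : Fin d → ℤ, Fin (ω z).1) =>
    Measure.dirac (cellPoint p.1 ((ω p.1).2 p.2))

theorem sampleMeasure_apply {d : ℕ} (ω : Seed d) {s : Set (E d)} (hs : MeasurableSet s) :
    sampleMeasure ω s = ∑' z : Fin d → ℤ, ∑ i ∈ Finset.range (ω z).1,
      s.indicator 1 (cellPoint z ((ω z).2 i)) := by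
  rw [sampleMeasure, Measure.sum_apply _ hs, ENNReal.tsum_sigma']
  refine tsum_congr fun z => ?_
  rw [tsum_fintype, Finset.sum_range]
  simp only [Measure.dirac_apply' _ hs]

theorem isCloud_sampleMeasure {d : ℕ} (ω : Seed d) : IsCloud (sampleMeasure ω) := by
  refine ⟨?_, _, inferInstance, _, rfl⟩
  have hfin : ∀ n : ℕ, sampleMeasure ω (Metric.ball 0 n) < ∞ := by
    intro n
    rw [sampleMeasure_apply ω Metric.isOpen_ball.measurableSet]
    have hF : (Set.pi Set.univ fun _ : Fin d => Set.Icc (-(n : ℤ) - 1) n).Finite :=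
      Set.Finite.pi fun _ => Set.finite_Icc _ _
    rw [tsum_eq_sum (s := hF.toFinset)]
    · refine ENNReal.sum_lt_top.2 fun z _ => ENNReal.sum_lt_top.2 fun i _ => ?_
      by_cases h : cellPoint z ((ω z).2 i) ∈ Metric.ball (0 : E d) n <;> simp [Set.indicator, h]
    · intro z hz
      refine Finset.sum_eq_zero fun i _ => Set.indicator_of_notMem ?_ _
      intro hmem
      apply hz
      rw [Set.Finite.mem_toFinset, Set.mem_univ_pi]
      intro j
      have h1 : ‖cellPoint z ((ω z).2 i)‖ < n := by simpa using hmem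
      have h2 := PiLp.norm_apply_le (cellPoint z ((ω z).2 i)) j
      have h3 : |(z j : ℝ) + ((ω z).2 i j : ℝ)| < n := lt_of_le_of_lt h2 h1
      have h4 := ((ω z).2 i j).2.1
      have h5 := ((ω z).2 i j).2.2
      rw [abs_lt] at h3
      constructor
      · have : (-(n : ℝ) - 1) < z j := by linarith [h3.1]
        exact_mod_cast this.le
      · have : (z j : ℝ) < n := by linarith [h3.2]
        exact_mod_cast this.le
  refine ⟨⟨⟨fun n : ℕ => Metric.ball 0 n, fun _ => trivial, hfin, ?_⟩⟩⟩
  exact Metric.iUnion_ball_nat 0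

/-- The configuration drawn from a seed. -/
def sample {d : ℕ} (ω : Seed d) : Config d := ⟨sampleMeasure ω, isCloud_sampleMeasure ω⟩

theorem measurable_cellPoint {d : ℕ} (z : Fin d → ℤ) : Measurable (cellPoint z) := by
  unfold cellPoint
  fun_prop

theorem measurable_sample (d : ℕ) : Measurable (sample : Seed d → Config d) := by
  refine Measurable.subtype_mk (Measure.measurable_of_measurable_coe _ fun s hs => ?_)
  simp only [sampleMeasure_apply _ hs]
  refine Measurable.tsum fun z => ?_
  have h : Measurable fun p : ℕ × (ℕ → Fin d → unitInterval) =>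
      ∑ i ∈ Finset.range p.1, s.indicator (1 : E d → ℝ≥0∞) (cellPoint z (p.2 i)) := by
    refine measurable_from_prod_countable_right fun n => ?_
    change Measurable fun y : ℕ → Fin d → unitInterval =>
      ∑ i ∈ Finset.range n, s.indicator (1 : E d → ℝ≥0∞) (cellPoint z (y i))
    refine Finset.measurable_fun_sum _ fun i _ => ?_
    exact (measurable_one.indicator hs).comp
      ((measurable_cellPoint z).comp (measurable_pi_apply i))
  exact h.comp (measurable_pi_apply z)

/-- The law `P_ρ` of the Poisson point process on `ℝ^d` of constant intensity `ρ`. -/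
def poissonLaw (d : ℕ) (ρ : ℝ) : Measure (Config d) := (seedLaw d ρ).map sample

instance (d : ℕ) (ρ : ℝ) : IsProbabilityMeasure (poissonLaw d ρ) :=
  Measure.isProbabilityMeasure_map (measurable_sample d).aemeasurable

/-! ### The diffusion matrix of a particle -/

/-- The standing assumptions on `a_∘`: measurability, uniform ellipticity
`Id ≤ a_∘ ≤ Λ Id` (in particular, symmetry), and finite range of dependence. -/
structure Admissible {d : ℕ} (Λ : ℝ) (a₀ : Config d → Matrix (Fin d) (Fin d) ℝ) : Prop where
  measurable : ∀ i j, Measurable fun μ => a₀ μ i j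
  symm : ∀ μ, (a₀ μ).IsSymm
  lower : ∀ μ, (a₀ μ - 1).PosSemidef
  upper : ∀ μ, (Λ • (1 : Matrix (Fin d) (Fin d) ℝ) - a₀ μ).PosSemidef
  finite_range : ∀ μ, a₀ μ = a₀ (restr μ (Metric.ball 0 (1 / 2)))

/-- The stationary extension `a(μ, x) = a_∘(τ_{-x} μ)`. -/
def aField {d : ℕ} (a₀ : Config d → Matrix (Fin d) (Fin d) ℝ) (μ : Config d) (x : E d) :
    Matrix (Fin d) (Fin d) ℝ :=
  a₀ (shift x μ)

/-! ### Function spaces -/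

open Classical in
/-- The gradient `∇f(μ, x)`: the vector of the derivatives at `h = 0` of
`h ↦ f(μ - δ_x + δ_{x + h e_k})` if `μ` has a particle at `x`, and `0` otherwise. Here
`μ - δ_x` is the (unique) configuration `ν` with `μ = ν + δ_x`. -/
def grad {d : ℕ} (f : Config d → ℝ) (μ : Config d) (x : E d) : E d :=
  if h : ∃ ν : Config d, μ = ν + particle x then
    WithLp.toLp 2 fun k =>
      lineDeriv ℝ (fun y => f (h.choose + particle y)) x (EuclideanSpace.single k 1)
  else 0

/-- The class `C^∞(U)`: measurable functions whose canonical projections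
`(x_1, …, x_n) ↦ f(∑ δ_{x_i} + μ ⌞ Uᶜ)` are smooth on `U^n`. -/
def SmoothIn {d : ℕ} (U : Set (E d)) (f : Config d → ℝ) : Prop :=
  Measurable f ∧ ∀ (μ : Config d) (n : ℕ),
    ContDiffOn ℝ ((⊤ : ℕ∞) : WithTop ℕ∞) (fun x : Fin n → E d => f (∑ i, particle (x i) + restr μ Uᶜ))
      {x | ∀ i, x i ∈ U}

/-- `E_ρ[f²] + E_ρ[∫_U |G(μ, x)|² dμ(x)]`; for `G = ∇f`, the squared norm of `H¹(U)`. -/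
def h1NormSq {d : ℕ} (ρ : ℝ) (U : Set (E d)) (f : Config d → ℝ) (G : Config d → E d → E d) :
    ℝ≥0∞ :=
  ∫⁻ μ, ‖f μ‖ₑ ^ 2 ∂poissonLaw d ρ +
    ∫⁻ μ, ∫⁻ x in U, ‖G μ x‖ₑ ^ 2 ∂(μ : Measure (E d)) ∂poissonLaw d ρ

/-- `f ∈ H¹(U)` with gradient `G`: the pair `(f, G)` lies in the closure, for the norm of
`H¹(U)`, of the pairs `(φ, ∇φ)` with `φ ∈ C^∞(U)` of finite norm. -/
def MemH1 {d : ℕ} (ρ : ℝ) (U : Set (E d)) (f : Config d → ℝ) (G : Config d → E d → E d) :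
    Prop :=
  Measurable f ∧ Measurable (Function.uncurry G) ∧
    ∃ φ : ℕ → Config d → ℝ,
      (∀ j, SmoothIn U (φ j) ∧ h1NormSq ρ U (φ j) (grad (φ j)) < ∞) ∧
      Tendsto (fun j => h1NormSq ρ U (fun μ => φ j μ - f μ)
        (fun μ x => grad (φ j) μ x - G μ x)) atTop (𝓝 0)

/-! ### The dual subadditive quantity and the bulk diffusion matrix -/

/-- `E_ρ[(ρ|U|)⁻¹ ∫_U (-½ G · a G + q · G) dμ]`. -/
def dualEnergy {d : ℕ} (a₀ : Config d → Matrix (Fin d) (Fin d) ℝ) (ρ : ℝ) (U : Set (E d))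
    (q : E d) (G : Config d → E d → E d) : ℝ :=
  ∫ μ, (ρ * volume.real U)⁻¹ *
      ∫ x in U, (-(1 / 2) * inner ℝ (G μ x) ((aField a₀ μ x).toEuclideanLin (G μ x))
        + inner ℝ q (G μ x)) ∂(μ : Measure (E d)) ∂poissonLaw d ρ

/-- `ν_*(U, q, ρ)`. -/
def nuStar {d : ℕ} (a₀ : Config d → Matrix (Fin d) (Fin d) ℝ) (U : Set (E d)) (q : E d)
    (ρ : ℝ) : ℝ :=
  sSup {t | ∃ u G, MemH1 ρ U u G ∧ t = dualEnergy a₀ ρ U q G}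

/-- `ψ`, with gradient `G`, is an optimizer in the definition of `ν_*(U, q, ρ)`. -/
def IsOptimizer {d : ℕ} (a₀ : Config d → Matrix (Fin d) (Fin d) ℝ) (U : Set (E d)) (q : E d)
    (ρ : ℝ) (ψ : Config d → ℝ) (G : Config d → E d → E d) : Prop :=
  MemH1 ρ U ψ G ∧
    ∀ u H, MemH1 ρ U u H → dualEnergy a₀ ρ U q H ≤ dualEnergy a₀ ρ U q G

/-- The open cube `□_m` of side length `3^m` centred at the origin. -/
def cube (d m : ℕ) : Set (E d) := {x | ∀ i, -((3 : ℝ) ^ m / 2) < x i ∧ x i < (3 : ℝ) ^ m / 2}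

/-- The matrix of the quadratic form `q ↦ 2 ν_*(U, q, ρ)`, read off by polarization. -/
def aStarInv {d : ℕ} (a₀ : Config d → Matrix (Fin d) (Fin d) ℝ) (U : Set (E d)) (ρ : ℝ) :
    Matrix (Fin d) (Fin d) ℝ :=
  Matrix.of fun i j =>
    nuStar a₀ U (EuclideanSpace.single i 1 + EuclideanSpace.single j 1) ρ
      - nuStar a₀ U (EuclideanSpace.single i 1) ρ - nuStar a₀ U (EuclideanSpace.single j 1) ρ

/-- `ā_*(U, ρ)`, the matrix with `ν_*(U, q, ρ) = ½ q · ā_*(U, ρ)⁻¹ q`. -/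
def aStar {d : ℕ} (a₀ : Config d → Matrix (Fin d) (Fin d) ℝ) (U : Set (E d)) (ρ : ℝ) :
    Matrix (Fin d) (Fin d) ℝ :=
  (aStarInv a₀ U ρ)⁻¹

/-- The bulk diffusion matrix `ā(ρ) = lim_m ā_*(□_m, ρ)`. -/
def aBar {d : ℕ} (a₀ : Config d → Matrix (Fin d) (Fin d) ℝ) (ρ : ℝ) :
    Matrix (Fin d) (Fin d) ℝ :=
  limUnder atTop fun m : ℕ => aStar a₀ (cube d m) ρ

/-- The quadratic form `q · A⁻¹ q`. -/
def invForm {d : ℕ} (A : Matrix (Fin d) (Fin d) ℝ) (q : E d) : ℝ :=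
  inner ℝ q ((A⁻¹).toEuclideanLin q)

/-! ### Finite differences and the coefficients of the expansion -/

/-- The difference operator `D f = f(· + δ_x) - f`. -/
def addDiff {d : ℕ} {V : Type*} [AddCommGroup V] (x : E d) (f : Config d → V) (μ : Config d) :
    V :=
  f (μ + particle x) - f μ

/-- `D_{⟦1,k⟧} f = D_1 ⋯ D_k f`, where `D_i` adds a particle at `x_i`. -/
def iterDiff {d : ℕ} {V : Type*} [AddCommGroup V] :
    (k : ℕ) → (Fin k → E d) → (Config d → V) → Config d → V
  | 0, _, f => f
  | k + 1, x, f => addDiff (x 0) (iterDiff k (fun i => x i.succ) f)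

/-- `(ρ|□_m|)⁻¹ ∫_{□_m} G · D_{⟦1,k⟧}((a - a^#) G^#) dμ`, where `G` stands for `∇ψ_m`; the
difference operators act on `μ'` (the factors marked by `#`), and `μ` stays frozen. -/
def coeffIntegrand {d : ℕ} (a₀ : Config d → Matrix (Fin d) (Fin d) ℝ) (ρ : ℝ) (m k : ℕ)
    (G : Config d → E d → E d) (x : Fin k → E d) (μ : Config d) : ℝ :=
  (ρ * volume.real (cube d m))⁻¹ *
    ∫ z in cube d m, inner ℝ (G μ z)
      (iterDiff k x
        (fun μ' => (aField a₀ μ z - aField a₀ μ' z).toEuclideanLin (G μ' z)) μ)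
      ∂(μ : Measure (E d))

/-- `c_{k,m}(ρ)`: integrate over the configuration and then over the `k` added particles. -/
def coeff {d : ℕ} (a₀ : Config d → Matrix (Fin d) (Fin d) ℝ) (ρ : ℝ) (m k : ℕ)
    (G : Config d → E d → E d) : ℝ :=
  ∫ x : Fin k → E d, ∫ μ, coeffIntegrand a₀ ρ m k G x μ ∂poissonLaw d ρ

/-- The integrals in the definition of `c_{k,m}(ρ)` converge absolutely. -/
def CoeffIntegrable {d : ℕ} (a₀ : Config d → Matrix (Fin d) (Fin d) ℝ) (ρ : ℝ) (m k : ℕ)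
    (G : Config d → E d → E d) : Prop :=
  (∀ᵐ x : Fin k → E d, Integrable (coeffIntegrand a₀ ρ m k G x) (poissonLaw d ρ)) ∧
    Integrable fun x : Fin k → E d => ∫ μ, coeffIntegrand a₀ ρ m k G x μ ∂poissonLaw d ρ

end Bulk

end

open Bulk

open MeasureTheory ProbabilityTheory Filter Topology Set
open Function (uncurry)
open ENNReal (ofReal ofReal_mul ofReal_le_ofReal mul_lt_top ofReal_add ofReal_lt_top ofReal_ne_top)
open scoped ENNReal NNReal

set_option linter.unusedSectionVars false

noncomputable section

namespace Bulk

/-! Fix a bounded convex open set `U` and a bounded set `V` containing its 1/2-neighbourhood. By the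
Mecke formula, the expected sum over the particles in `U` is `ρ` times an integral over `z ∈ U` and
over a Poisson configuration `η`, evaluated at `η + δ_z`. A gradient thus becomes a field `g(η, z)`,
and the factor `ρ` cancels the one in the normalisation of `ν_*`. A test function may be multiplied
by any function of the number of particles in `V` without changing its gradient except by that
factor. The Euler-Lagrange equation therefore splits into one equation for each number `n` of
particles, with respect to `λ_n ⊗ dz` (`n` free points in `V`, one in `U`), where the intensity does
not appear. Hence a single corrector `g` (`exists_isCorr`) provides the optimal gradient at every
intensity (`IsCorr.nuStar_eq`, `IsCorr.pull_eq_of_isOptimizer`), and `2 ν_* = |U|⁻¹ E_ρ ∫_U q · g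
dz` depends on `ρ` only through the law: it is `exp(-ρ|V|)` times a power series.

For a field `F` that does not depend on `ρ`, the derivative of `E_ρ[F]` is `E_ρ[I F]`, where `I F(η)
= ∫_V (F(η + δ_y) - F(η)) dy` is `iop` (`Geo.hasDerivAt_expect`). So the `k`-th derivative of `2
ν_*` is `|U|⁻¹ E_ρ ∫_U q · I^k g dz`. The coefficient in the theorem is the same number
(`IsOptimizer.coeff_eq`). Integrating `D_{⟦1,k⟧}((a - a^#) g^#)` over the added points gives `A I^k
g - I^k (A g)`. Since `I^k g` is again a potential field, `A g` may be replaced by `q` in `⟨A g, I^k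
g⟩`; since `I^k (A g - q) = I^k (A g)` is again solenoidal, `⟨g, I^k (A g)⟩ = 0`.

The heart of the matter is a bound on `I^l g` by `C |q|² |U|`, with `C` independent of the domain
and of the intensity (`exists_nn_corr_le`), although `I` integrates over all of `V`. Averaging over
an added particle is adjoint to the removal of a particle, and removal maps smooth functions to
smooth functions. Therefore the potential and the solenoidal fields are stable under averaging,
hence under `I` (`polar_potSet`), and differences of fields of the two kinds remain orthogonal once
integrated over the added point (`Polar.dif`). Thus `I^l g` is potential, `A I^l g + [I^l, A] g`
(minus `q` if `l = 0`) is solenoidal, and the energy estimate controls `I^l g` by the commutator. As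
`A(·, z)` only feels added particles at distance less than 1/2 from `z`, the commutator contains
only powers `I^i g` with `i < l`, at the price of more differences, and its integrals run over balls
of fixed volume (`exists_nn_comm_le`). Energies of iterated differences are estimated in the same
way (`exists_energy_le`), and a double induction closes the argument.

Finally, `ν_*` decreases along the triadic cubes (`nuStar_cube_succ_le`), so `2 ν_*(□_m)` converges
to `q · ā⁻¹ q`. Functions on the half-line that converge pointwise, with derivatives of each order
bounded uniformly, have convergent derivatives of all orders (`Chain.limit`); Taylor's formula for
the limit (`Chain.taylor`) is the expansion. -/

/-- A configuration with a marked point. -/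
abbrev Pt (d : ℕ) := Config d × E d

/-- Vector fields depending on the configuration. -/
abbrev Fld (d : ℕ) := Config d → E d → E d

/-- Coefficient fields depending on the configuration. -/
abbrev Coef (d : ℕ) := Config d → E d → (E d →L[ℝ] E d)

variable {d : ℕ} {ρ Λ : ℝ} {U V : Set (E d)} {q : E d} {ν : Config d} {φ : Config d → ℝ}
  {g : Fld d} {A : Coef d} {a₀ : Config d → Matrix (Fin d) (Fin d) ℝ}

/-! ### Measurable structure of the configuration space -/

theorem Config.ext_apply {μ ν : Config d} (h : ∀ s, MeasurableSet s → μ.1 s = ν.1 s) : μ = ν :=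
  Subtype.ext (Measure.ext h)

@[simp] theorem Config.add_apply {d : ℕ} (μ ν : Config d) (s : Set (E d)) :
    ((μ + ν : Config d) : Measure (E d)) s = μ.1 s + ν.1 s := by
  simp

theorem Config.measurable_of_apply {α : Type*} [MeasurableSpace α]
    {f : α → Config d} (h : ∀ s, MeasurableSet s → Measurable fun a => (f a).1 s) : Measurable f :=
  Measurable.subtype_mk (Measure.measurable_of_measurable_coe _ h)

theorem Config.measurable_apply {s : Set (E d)}
    (hs : MeasurableSet s) : Measurable fun μ : Config d => μ.1 s :=
  (Measure.measurable_coe hs).comp measurable_subtype_coe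

instance : MeasurableAdd₂ (Config d) := by
  refine ⟨Config.measurable_of_apply fun s hs => ?_⟩
  simp only [Config.add_apply]
  exact ((Config.measurable_apply hs).comp measurable_fst).add
    ((Config.measurable_apply hs).comp measurable_snd)

@[fun_prop]
theorem measurable_particle : Measurable (particle : E d → Config d) :=
  Measurable.subtype_mk Measure.measurable_dirac

theorem particle_apply (x : E d) {s : Set (E d)} (hs : MeasurableSet s) :
    (particle x).1 s = s.indicator 1 x := Measure.dirac_apply' _ hs

theorem restr_apply (μ : Config d)
    (U : Set (E d)) {s : Set (E d)} (hs : MeasurableSet s) : (restr μ U).1 s = μ.1 (s ∩ U) :=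
  Measure.restrict_apply hs

theorem measurable_restr (hU : MeasurableSet U) : Measurable fun μ : Config d => restr μ U := by
  refine Config.measurable_of_apply fun s hs => ?_
  simp only [restr_apply _ _ hs]
  exact Config.measurable_apply (hs.inter hU)

theorem restr_add (μ ν : Config d) (U : Set (E d)) : restr (μ + ν) U = restr μ U + restr ν U :=
  Subtype.ext (Measure.restrict_add _ _ _)

theorem restr_zero (U : Set (E d)) : restr (0 : Config d) U = 0 :=
  Subtype.ext (Measure.restrict_zero _)

theorem restr_particle_of_mem {x : E d}
    (hU : MeasurableSet U) (hx : x ∈ U) : restr (particle x) U = particle x := by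
  refine Config.ext_apply fun s hs => ?_
  rw [restr_apply _ _ hs, particle_apply _ (hs.inter hU), particle_apply _ hs]
  by_cases h : x ∈ s <;> simp [h, hx]

theorem restr_particle_of_notMem {x : E d}
    (hU : MeasurableSet U) (hx : x ∉ U) : restr (particle x) U = 0 := by
  refine Config.ext_apply fun s hs => ?_
  rw [restr_apply _ _ hs, particle_apply _ (hs.inter hU)]
  simp [hx]

theorem restr_restr (μ : Config d) (hV : MeasurableSet V) : restr (restr μ U) V = restr μ (V ∩ U) :=
  Subtype.ext (Measure.restrict_restrict hV)

theorem restr_empty (μ : Config d) : restr μ ∅ = 0 :=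
  Subtype.ext (Measure.restrict_empty)

theorem restr_add_restr_compl (μ : Config d) (hU : MeasurableSet U) : restr μ U + restr μ Uᶜ = μ :=
  Subtype.ext (Measure.restrict_add_restrict_compl hU)

theorem restr_sum {ι : Type*} (s : Finset ι)
    (f : ι → Config d) (U : Set (E d)) : restr (∑ i ∈ s, f i) U = ∑ i ∈ s, restr (f i) U := by
  classical
  induction s using Finset.induction_on with
  | empty => simp [restr_zero]
  | insert a s ha ih => rw [Finset.sum_insert ha, Finset.sum_insert ha, restr_add, ih]

theorem Config.sum_apply {ι : Type*} (t : Finset ι) (f : ι → Config d)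
    (s : Set (E d)) : ((∑ i ∈ t, f i : Config d) : Measure (E d)) s = ∑ i ∈ t, (f i).1 s := by
  classical
  induction t using Finset.induction_on with
  | empty => simp
  | insert a t ha ih => rw [Finset.sum_insert ha, Finset.sum_insert ha, Config.add_apply, ih]

theorem add_particle_cancel {μ ν : Config d}
    {x : E d} (h : μ + particle x = ν + particle x) : μ = ν := by
  refine Config.ext_apply fun s hs => ?_
  have := congrArg (fun η : Config d => η.1 s) h
  simp only [Config.add_apply, particle_apply _ hs] at this
  refine (ENNReal.add_left_inj ?_).1 this
  by_cases hx : x ∈ s <;> simp [hx]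

/-- An atom of a sum of Dirac masses sits at one of its points, and that point can be taken out of
the sum. The presence of a particle becomes a condition on masses, which can be checked to be
measurable in `(μ, x)`. -/
theorem exists_eq_add_particle_iff (μ : Config d)
    (x : E d) : (∃ ν : Config d, μ = ν + particle x) ↔ 1 ≤ μ.1 {x} := by
  classical
  constructor
  · rintro ⟨ν, rfl⟩
    rw [Config.add_apply, particle_apply _ (measurableSet_singleton x)]
    simp
  · obtain ⟨_, hσ, ι, _, y, rfl⟩ := μ
    intro h
    have hx : ∃ i, y i = x := by
      by_contra hne
      push Not at hne
      simp only at h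
      rw [Measure.sum_apply _ (measurableSet_singleton x)] at h
      simp [hne] at h
    obtain ⟨i, rfl⟩ := hx
    refine ⟨⟨Measure.sum fun j : {j // j ≠ i} => Measure.dirac (y j), ?_, {j // j ≠ i},
      inferInstance, fun j => y j, rfl⟩, ?_⟩
    · refine SigmaFinite.of_map _ aemeasurable_id ?_
      rw [Measure.map_id]
      have hle : (Measure.sum fun j : {j // j ≠ i} => Measure.dirac (y j))
          ≤ Measure.sum fun i => Measure.dirac (y i) := by
        refine Measure.le_iff.2 fun s hs => ?_
        rw [Measure.sum_apply _ hs, Measure.sum_apply _ hs]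
        exact ENNReal.tsum_comp_le_tsum_of_injective Subtype.val_injective
          (fun j => Measure.dirac (y j) s)
      exact Measure.sigmaFinite_of_le _ hle
    · refine Config.ext_apply fun s hs => ?_
      rw [Config.add_apply]
      change (Measure.sum fun i => Measure.dirac (y i)) s
        = (Measure.sum fun j : {j // j ≠ i} => Measure.dirac (y j)) s + Measure.dirac (y i) s
      rw [Measure.sum_apply _ hs, Measure.sum_apply _ hs, add_comm]
      have h1 := ENNReal.tsum_eq_add_tsum_ite (f := fun j => Measure.dirac (y j) s) i
      rw [h1]
      congr 1
      refine Eq.trans ?_ (tsum_subtype {j | j ≠ i} (fun j => Measure.dirac (y j) s)).symm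
      refine tsum_congr fun j => ?_
      by_cases hj : j = i <;> simp [hj]

/-- All the mass is carried by the countable range of the points. Integrands against `μ` therefore
matter only at particles, where `grad` and `rem` are not given by their default value. -/
theorem ae_exists_eq_add_particle (μ : Config d) :
    ∀ᵐ x ∂μ.1, ∃ ν : Config d, μ = ν + particle x := by
  obtain ⟨_, hσ, ι, _, y, rfl⟩ := μ
  have : ∀ i, ∃ ν : Config d, (⟨Measure.sum fun i => Measure.dirac (y i), hσ, ι, inferInstance,
      y, rfl⟩ : Config d) = ν + particle (y i) := by
    intro i
    rw [exists_eq_add_particle_iff]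
    change 1 ≤ (Measure.sum fun i => Measure.dirac (y i)) {y i}
    rw [Measure.sum_apply _ (measurableSet_singleton _)]
    refine le_trans ?_ (ENNReal.le_tsum i)
    simp
  have hr : (Measure.sum fun i => Measure.dirac (y i)) (Set.range y)ᶜ = 0 := by
    rw [Measure.sum_apply _ (Set.countable_range y).measurableSet.compl]
    simp
  filter_upwards [show Set.range y ∈ ae _ from hr]
  rintro _ ⟨i, rfl⟩
  exact this i

/-- A configuration of finite mass is a finite sum of particles. -/
theorem exists_eq_sum_particle (μ : Config d)
    (h : μ.1 univ < ∞) : ∃ (n : ℕ) (x : Fin n → E d), μ = ∑ i, particle (x i) := by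
  obtain ⟨_, hσ, ι, _, y, rfl⟩ := μ
  have hfin : Finite ι := by
    by_contra hinf
    rw [not_finite_iff_infinite] at hinf
    change (Measure.sum fun i => Measure.dirac (y i)) univ < ∞ at h
    rw [Measure.sum_apply _ MeasurableSet.univ] at h
    simp at h
  obtain ⟨n, ⟨e⟩⟩ := Finite.exists_equiv_fin ι
  refine ⟨n, fun i => y (e.symm i), Config.ext_apply fun s hs => ?_⟩
  rw [Config.sum_apply]
  change (Measure.sum fun i => Measure.dirac (y i)) s = _
  rw [Measure.sum_apply _ hs, ← e.symm.tsum_eq, tsum_fintype]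
  rfl

theorem exists_restr_eq_sum_particle (μ : Config d) (hV : MeasurableSet V) (h : μ.1 V < ∞) :
    ∃ (n : ℕ) (x : Fin n → E d), (∀ i, x i ∈ V) ∧ restr μ V = ∑ i, particle (x i) := by
  obtain ⟨n, x, hx⟩ := exists_eq_sum_particle (restr μ V)
    (by rwa [restr_apply _ _ MeasurableSet.univ, Set.univ_inter])
  refine ⟨n, x, fun i => ?_, hx⟩
  by_contra hi
  have h0 : (restr μ V).1 Vᶜ = 0 := by
    rw [restr_apply _ _ hV.compl]; simp
  rw [hx, Config.sum_apply, Finset.sum_eq_zero_iff] at h0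
  have := h0 i (Finset.mem_univ i)
  rw [particle_apply _ hV.compl] at this
  simp [hi] at this

/-! ### Removing a particle -/

open Classical in
/-- The configuration `μ - δ_x` (and `0` if `μ` has no particle at `x`). -/
def rem (μ : Config d) (x : E d) : Config d :=
  if h : ∃ ν : Config d, μ = ν + particle x then h.choose else 0

theorem rem_add_particle (ν : Config d) (x : E d) : rem (ν + particle x) x = ν := by
  have h : ∃ ν' : Config d, ν + particle x = ν' + particle x := ⟨ν, rfl⟩
  rw [rem, dif_pos h]
  exact (add_particle_cancel h.choose_spec).symm

open Classical in
/-- The restriction to `V` if it is finite, and `0` otherwise. -/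
def clip (V : Set (E d)) (μ : Config d) : Config d :=
  if μ.1 V < ∞ then restr μ V else 0

theorem clip_of_lt {μ : Config d} (h : μ.1 V < ∞) :
    clip V μ = restr μ V := if_pos h

theorem clip_of_not_lt {μ : Config d}
    (h : ¬ μ.1 V < ∞) : clip V μ = 0 := if_neg h

theorem measurable_clip (hV : MeasurableSet V) : Measurable (clip V : Config d → Config d) := by
  classical
  exact Measurable.ite (measurableSet_lt (Config.measurable_apply hV) measurable_const)
    (measurable_restr hV) measurable_const

open Classical in
/-- The points of a configuration in `V`, as a kernel. -/
def clipKernel (V : Set (E d)) : Kernel (Config d) (E d) :=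
  if hV : MeasurableSet V then
    ⟨fun μ => (clip V μ).1, measurable_subtype_coe.comp (measurable_clip hV)⟩
  else 0

theorem clipKernel_apply (hV : MeasurableSet V) (μ : Config d) : clipKernel V μ = (clip V μ).1 := by
  rw [clipKernel, dif_pos hV]; rfl

/-- A finite mass in `V` is an integer, so cutting along `n ≤ μ V < n + 1` writes the kernel as a
countable sum of finite kernels; where the mass is infinite, the default value of `clip` leaves
nothing. S-finiteness is what makes integrals over the particles measurable in the configuration. -/
instance (V : Set (E d)) : IsSFiniteKernel (clipKernel V) := by
  classical
  by_cases hV : MeasurableSet V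
  swap
  · rw [clipKernel, dif_neg hV]; infer_instance
  have hs : ∀ n : ℕ, MeasurableSet {μ : Config d | μ.1 V ∈ Set.Ico (n : ℝ≥0∞) (n + 1)} :=
    fun n => Config.measurable_apply hV measurableSet_Ico
  let κ : ℕ → Kernel (Config d) (E d) := fun n => Kernel.piecewise (hs n) (clipKernel V) 0
  have hκ : ∀ n, IsFiniteKernel (κ n) := by
    intro n
    refine ⟨n + 1, by finiteness, fun μ => ?_⟩
    simp only [κ, Kernel.piecewise_apply]
    split_ifs with h
    · rw [clipKernel_apply hV, clip_of_lt (h.2.trans (by finiteness)),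
        restr_apply _ _ MeasurableSet.univ, Set.univ_inter]
      exact h.2.le
    · simp
  have : clipKernel V = Kernel.sum κ := by
    refine Kernel.ext fun μ => ?_
    rw [Kernel.sum_apply]
    ext s hs'
    rw [Measure.sum_apply _ hs']
    simp only [κ, Kernel.piecewise_apply, Set.mem_ofPred_eq]
    by_cases hμ : μ.1 V < ∞
    · obtain ⟨m, x, -, hx⟩ := exists_restr_eq_sum_particle μ hV hμ
      have hm : μ.1 V = m := by
        have : (restr μ V).1 univ = m := by
          rw [hx, Config.sum_apply]
          simp [particle_apply]
        rwa [restr_apply _ _ MeasurableSet.univ, Set.univ_inter] at this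
      rw [tsum_eq_single m]
      · rw [if_pos]
        rw [hm]
        exact ⟨le_rfl, by exact_mod_cast Nat.lt_succ_self m⟩
      · intro n hn
        rw [if_neg]
        · simp
        · rw [hm]
          rintro ⟨h1, h2⟩
          have h1 : n ≤ m := by exact_mod_cast h1
          have h2 : m < n + 1 := by exact_mod_cast h2
          omega
    · rw [clipKernel_apply hV, clip_of_not_lt hμ]
      simp only [not_lt, top_le_iff] at hμ
      simp [hμ]
  rw [this]
  infer_instance

/-- The translation vector varies together with the configuration. The mass of `s` is what the
kernel gives to a section of a measurable set of triples, hence it is jointly measurable. -/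
theorem measurable_shift_clip (hV : MeasurableSet V) :
    Measurable fun p : Pt d => shift p.2 (clip V p.1) := by
  refine Config.measurable_of_apply fun s hs => ?_
  have h := Kernel.measurable_kernel_prodMk_left
    (κ := (clipKernel V).comap (Prod.fst : Pt d → Config d) measurable_fst)
    (t := {q : (Pt d) × E d | q.2 - q.1.2 ∈ s})
    ((measurable_snd.sub (measurable_snd.comp measurable_fst)) hs)
  convert h using 2 with p
  rw [Kernel.comap_apply, clipKernel_apply hV]
  exact Measure.map_apply (measurable_id.sub_const p.2) hs

/-- The pairs of a configuration that is finite in `V` and of one of its particles in `V`. -/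
def remDom (V : Set (E d)) : Set (Pt d) :=
  {p | p.1.1 V < ∞ ∧ p.2 ∈ V ∧ ∃ ν : Config d, p.1 = ν + particle p.2}

/-- The mass of the moving singleton `{x}` is the mass of a section of the diagonal under the
kernel. -/
theorem measurableSet_remDom (hV : MeasurableSet V) : MeasurableSet (remDom V) := by
  have h1 : MeasurableSet {p : Pt d | p.1.1 V < ∞} :=
    measurableSet_lt ((Config.measurable_apply hV).comp measurable_fst) measurable_const
  have h2 : MeasurableSet {p : Pt d | p.2 ∈ V} := measurable_snd hV
  have h := Kernel.measurable_kernel_prodMk_left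
    (κ := (clipKernel V).comap (Prod.fst : Pt d → Config d) measurable_fst)
    (t := {q : (Pt d) × E d | q.2 = q.1.2})
    (measurableSet_eq_fun measurable_snd (measurable_snd.comp measurable_fst))
  have h3 := measurableSet_le measurable_const (g := _) h (f := fun _ => 1)
  convert (h1.inter h2).inter h3 using 1
  ext ⟨μ, x⟩
  simp only [remDom, Set.mem_ofPred_eq, Set.mem_inter_iff, and_assoc]
  refine and_congr_right fun hμ => and_congr_right fun hx => ?_
  rw [exists_eq_add_particle_iff, Kernel.comap_apply, clipKernel_apply hV, clip_of_lt hμ]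
  have : Prod.mk (μ, x) ⁻¹' {q : (Pt d) × E d | q.2 = q.1.2} = {x} := by
    ext; simp
  rw [this, restr_apply _ _ (measurableSet_singleton x), Set.inter_eq_left.2 (by simpa using hx)]

open Classical in
/-- A measurable version of `rem` on `V`. -/
def remIn (V : Set (E d)) (p : Pt d) : Config d :=
  if p ∈ remDom V then rem p.1 p.2 else 0

theorem remIn_add_particle (hV : MeasurableSet V)
    {x : E d} (hx : x ∈ V) (hν : ν.1 V < ∞) : remIn V (ν + particle x, x) = ν := by
  rw [remIn, if_pos, rem_add_particle]
  refine ⟨?_, hx, ν, rfl⟩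
  rw [Config.add_apply, particle_apply _ hV]
  simp [hx, hν]

theorem measurable_remIn (hV : MeasurableSet V) : Measurable (remIn V : Pt d → Config d) := by
  classical
  refine Config.measurable_of_apply fun s hs => ?_
  have : (fun p : Pt d => (remIn V p).1 s)
      = fun p => if p ∈ remDom V then p.1.1 s - s.indicator 1 p.2 else 0 := by
    funext p
    by_cases hp : p ∈ remDom V
    · obtain ⟨μ, x⟩ := p
      obtain ⟨h1, h2, ν, hν⟩ := id hp
      simp only at hν
      rw [remIn, if_pos hp, if_pos hp]
      simp only
      rw [hν, rem_add_particle, Config.add_apply, particle_apply _ hs,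
        ENNReal.add_sub_cancel_right]
      by_cases hx : x ∈ s <;> simp [hx]
    · rw [remIn, if_neg hp, if_neg hp]; simp
  rw [this]
  refine Measurable.ite (measurableSet_remDom hV) ?_ measurable_const
  exact ((Config.measurable_apply hs).comp measurable_fst).sub
    ((measurable_one.indicator hs).comp measurable_snd)

/-! ### The Mecke formula -/

/-- Isolates one coordinate of an infinite product; it serves both for one cell of the seed and for
one point in the list of a cell. -/
theorem map_update_infinitePi {ι : Type*} [DecidableEq ι] {X : ι → Type*} [∀ i, MeasurableSpace
    (X i)] (τ : ∀ i, Measure (X i)) [∀ i, IsProbabilityMeasure (τ i)] (i : ι) : ((Measure.infinitePi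
    τ).prod (τ i)).map (fun p => Function.update p.1 i p.2) = Measure.infinitePi τ := by
  have hm : Measurable fun p : (∀ i, X i) × X i => Function.update p.1 i p.2 :=
    measurable_update'
  refine Measure.eq_infinitePi τ fun s t ht => ?_
  rw [Measure.map_apply hm (.pi (Finset.countable_toSet s) fun j _ => ht j)]
  by_cases hi : i ∈ s
  · have : (fun p : (∀ i, X i) × X i => Function.update p.1 i p.2) ⁻¹' (Set.pi s t)
        = (Set.pi (s.erase i) t) ×ˢ (t i) := by
      ext ⟨ω, x⟩
      simp only [Set.mem_preimage, Set.mem_pi, Set.mem_prod, Finset.mem_coe, Finset.mem_erase]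
      constructor
      · intro h
        refine ⟨fun j hj => ?_, ?_⟩
        · simpa [Function.update_of_ne hj.1] using h j hj.2
        · simpa using h i hi
      · rintro ⟨h1, h2⟩ j hj
        by_cases hji : j = i
        · subst hji; simpa using h2
        · rw [Function.update_of_ne hji]; exact h1 j ⟨hji, hj⟩
    rw [this, Measure.prod_prod, Measure.infinitePi_pi τ fun j _ => ht j, mul_comm,
      Finset.mul_prod_erase s (fun j => τ j (t j)) hi]
  · have : (fun p : (∀ i, X i) × X i => Function.update p.1 i p.2) ⁻¹' (Set.pi s t)
        = (Set.pi s t) ×ˢ univ := by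
      ext ⟨ω, x⟩
      simp only [Set.mem_preimage, Set.mem_pi, Set.mem_prod, Finset.mem_coe, mem_univ,
        and_true]
      refine forall₂_congr fun j hj => ?_
      rw [Function.update_of_ne (fun h : j = i => hi (h ▸ hj))]
    rw [this, Measure.prod_prod, Measure.infinitePi_pi τ fun j _ => ht j, measure_univ, mul_one]

theorem lintegral_infinitePi_update {ι : Type*} [DecidableEq ι] {X : ι → Type*}
    [∀ i, MeasurableSpace (X i)] (τ : ∀ i, Measure (X i)) [∀ i, IsProbabilityMeasure (τ i)]
    (i : ι) {f : (∀ i, X i) → ℝ≥0∞} (hf : Measurable f) : ∫⁻ ω, f ω ∂Measure.infinitePi τ =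
    ∫⁻ ω, ∫⁻ x, f (Function.update ω i x) ∂τ i ∂Measure.infinitePi τ := by
  conv_lhs => rw [← map_update_infinitePi τ i]
  rw [lintegral_map hf measurable_update', lintegral_prod]
  exact (hf.comp measurable_update').aemeasurable

theorem map_comp_equiv_infinitePi {ι X : Type*}
    [MeasurableSpace X] (τ : Measure X) [IsProbabilityMeasure τ] (e : ι ≃ ι) :
    (Measure.infinitePi fun _ : ι => τ).map (fun ω => ω ∘ e) = Measure.infinitePi fun _ => τ := by
  have h := Measure.infinitePi_map_piCongrLeft (X := fun _ : ι => X) (fun _ : ι => τ) e.symm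
  convert h using 2
  funext ω
  ext j
  conv_rhs => rw [show j = e.symm (e j) by simp]
  exact (Equiv.piCongrLeft_apply_apply (fun _ => X) e.symm ω (e j)).symm

theorem lintegral_poissonMeasure (r : ℝ≥0) (f : ℕ → ℝ≥0∞) :
    ∫⁻ n, f n ∂poissonMeasure r = ∑' n : ℕ, ofReal (Real.exp (-r) * r ^ n / n.factorial) * f n := by
  rw [lintegral_countable']
  refine tsum_congr fun n => ?_
  rw [poissonMeasure_singleton, mul_comm]

/-- The Mecke formula inside one cell. By exchangeability each of the `n + 1` terms equals the one
of the last point, which is independent of the others, and the Poisson weights satisfy `(n + 1)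
p_{n+1} = r p_n`. -/
theorem lintegral_poisson_list {Q M : Type*} [MeasurableSpace Q] [AddCommMonoid M]
    [MeasurableSpace M] [MeasurableAdd₂ M] (τ : Measure Q) [IsProbabilityMeasure τ] {p : Q → M}
    (hp : Measurable p) (r : ℝ≥0) {Ψ : M → Q → ℝ≥0∞} (hΨ : Measurable (uncurry Ψ)) : ∫⁻ s,
    ∑ i ∈ Finset.range s.1, Ψ (∑ j ∈ Finset.range s.1, p (s.2 j)) (s.2 i) ∂(poissonMeasure r).prod
    (Measure.infinitePi fun _ : ℕ => τ) = r * ∫⁻ w, ∫⁻ s, Ψ (∑ j ∈ Finset.range s.1,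
    p (s.2 j) + p w) w ∂(poissonMeasure r).prod (Measure.infinitePi fun _ : ℕ => τ) ∂τ := by
  classical
  have hsum : ∀ n : ℕ, Measurable fun u : ℕ → Q => ∑ j ∈ Finset.range n, p (u j) := fun n =>
    Finset.measurable_fun_sum _ fun j _ => hp.comp (measurable_pi_apply j)
  have hm0 : ∀ n i : ℕ, Measurable fun u : ℕ → Q => Ψ (∑ j ∈ Finset.range n, p (u j)) (u i) :=
    fun n i => hΨ.comp ((hsum n).prodMk (measurable_pi_apply i))
  have hm1 : ∀ n : ℕ, Measurable fun q : Q × (ℕ → Q) =>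
      Ψ (∑ j ∈ Finset.range n, p (q.2 j) + p q.1) q.1 := fun n =>
    hΨ.comp ((((hsum n).comp measurable_snd).add (hp.comp measurable_fst)).prodMk measurable_fst)
  set H : ℕ → ℝ≥0∞ := fun n => ∫⁻ w, ∫⁻ u, Ψ (∑ j ∈ Finset.range n, p (u j) + p w) w
    ∂(Measure.infinitePi fun _ : ℕ => τ) ∂τ with hH
  have key : ∀ n i : ℕ, i < n + 1 →
      ∫⁻ u, Ψ (∑ j ∈ Finset.range (n + 1), p (u j)) (u i) ∂(Measure.infinitePi fun _ : ℕ => τ)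
        = H n := by
    intro n i hi
    -- Exchange the points `i` and `n`; the sum over the first `n + 1` points does not change.
    conv_lhs => rw [← map_comp_equiv_infinitePi τ (Equiv.swap i n)]
    rw [lintegral_map (hm0 _ _) (by fun_prop)]
    have h1 : ∀ u : ℕ → Q, Ψ (∑ j ∈ Finset.range (n + 1), p ((u ∘ Equiv.swap i n) j))
        ((u ∘ Equiv.swap i n) i) = Ψ (∑ j ∈ Finset.range (n + 1), p (u j)) (u n) := by
      intro u
      congr 1
      · refine Finset.sum_equiv (Equiv.swap i n) (fun j => ?_) fun j _ => rfl
        simp only [Finset.mem_range]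
        rw [Equiv.swap_apply_def]
        split_ifs <;> omega
      · simp
    simp only [h1]
    rw [lintegral_infinitePi_update _ n (hm0 _ _)]
    simp only [Finset.sum_range_succ, Function.update_self]
    rw [hH]
    simp only
    have hswap := lintegral_lintegral_swap (μ := τ) (ν := Measure.infinitePi fun _ : ℕ => τ)
      (f := fun w u => Ψ (∑ j ∈ Finset.range n, p (u j) + p w) w) (hm1 n).aemeasurable
    rw [hswap]
    refine lintegral_congr fun u => lintegral_congr fun w => ?_
    congr 2
    refine Finset.sum_congr rfl fun j hj => ?_
    rw [Function.update_of_ne (Finset.mem_range.1 hj).ne]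
  have hml : Measurable fun s : ℕ × (ℕ → Q) =>
      ∑ i ∈ Finset.range s.1, Ψ (∑ j ∈ Finset.range s.1, p (s.2 j)) (s.2 i) :=
    measurable_from_prod_countable_right fun n =>
      Finset.measurable_fun_sum (Finset.range n) fun i _ => hm0 n i
  have hmr : ∀ w, Measurable fun s : ℕ × (ℕ → Q) =>
      Ψ (∑ j ∈ Finset.range s.1, p (s.2 j) + p w) w := fun w =>
    measurable_from_prod_countable_right fun n => (hm1 n).comp measurable_prodMk_left
  rw [lintegral_prod _ hml.aemeasurable, lintegral_poissonMeasure]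
  simp only
  have hr : ∀ w, ∫⁻ s, Ψ (∑ j ∈ Finset.range s.1, p (s.2 j) + p w) w
          ∂(poissonMeasure r).prod (Measure.infinitePi fun _ : ℕ => τ)
      = ∑' n : ℕ, ofReal (Real.exp (-r) * r ^ n / n.factorial) *
        ∫⁻ u, Ψ (∑ j ∈ Finset.range n, p (u j) + p w) w ∂(Measure.infinitePi fun _ : ℕ => τ) := by
    intro w
    rw [lintegral_prod _ (hmr w).aemeasurable, lintegral_poissonMeasure]
  simp only [hr]
  rw [lintegral_tsum]
  swap
  · intro n
    exact ((hm1 n).lintegral_prod_right'.const_mul _).aemeasurable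
  simp_rw [lintegral_finsetSum _ fun i _ => hm0 _ i]
  -- An empty cell contributes nothing, so the left side starts at one point and is matched with the
  -- right side after a shift.
  rw [tsum_eq_zero_add' ENNReal.summable]
  simp only [Finset.range_zero, Finset.sum_empty, mul_zero, zero_add]
  rw [← ENNReal.tsum_mul_left]
  refine tsum_congr fun n => ?_
  rw [Finset.sum_congr rfl fun i hi => key n i (Finset.mem_range.1 hi), Finset.sum_const,
    Finset.card_range, lintegral_const_mul _ (hm1 n).lintegral_prod_right']
  change _ = (r : ℝ≥0∞) * (_ * H n)
  rw [nsmul_eq_mul, ← mul_assoc, ← mul_assoc]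
  congr 1
  rw [← ENNReal.ofReal_natCast, ← ENNReal.ofReal_coe_nnreal, ← ofReal_mul (by positivity),
    ← ofReal_mul (by positivity)]
  congr 1
  rw [Nat.factorial_succ]
  push_cast
  field_simp
  ring

/-- The value `(0, 0)` prescribes no point, so the first summand consists of the points thrown by
the other cells. -/
theorem sample_update (ω : Seed d) (z : Fin d → ℤ) (s : ℕ × (ℕ → Fin d → unitInterval)) :
    sample (Function.update ω z s) = sample (Function.update ω z (0, 0))
    + ∑ i ∈ Finset.range s.1, particle (cellPoint z (s.2 i)) := by
  classical
  refine Config.ext_apply fun t ht => ?_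
  rw [Config.add_apply, Config.sum_apply]
  change sampleMeasure _ t = sampleMeasure _ t + _
  rw [sampleMeasure_apply _ ht, sampleMeasure_apply _ ht,
    ENNReal.tsum_eq_add_tsum_ite z, add_comm]
  congr 1
  · refine tsum_congr fun z' => ?_
    by_cases hz : z' = z
    · subst hz; simp
    · simp [hz]
  · simp [particle_apply _ ht]

/-- The closed cells overlap only on null sets; with half-open intervals instead they form a
partition, the cell of a point being given by the integer parts of its coordinates. -/
theorem cellPoint_volume (d : ℕ) : (volume : Measure (E d)) = Measure.sum fun z :
    Fin d → ℤ => (volume : Measure (Fin d → unitInterval)).map (cellPoint z) := by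
  have h1 : ∀ a : ℤ, (volume : Measure unitInterval).map (fun u : unitInterval => (a : ℝ) + (u : ℝ))
      = volume.restrict (Set.Ico (a : ℝ) (a + 1)) := by
    intro a
    have hc : (volume : Measure unitInterval).map ((↑) : unitInterval → ℝ)
        = volume.restrict (Set.Icc 0 1) := map_comap_subtype_coe measurableSet_Icc volume
    have : (fun u : unitInterval => (a : ℝ) + (u : ℝ)) = (fun t : ℝ => (a : ℝ) + t) ∘ (↑) := rfl
    rw [this, ← Measure.map_map (measurable_const_add _) measurable_subtype_coe, hc,
      ← restrict_Ico_eq_restrict_Icc]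
    have h2 := (measurePreserving_add_left (volume : Measure ℝ) (a : ℝ)).restrict_preimage
      (measurableSet_Ico (a := (a : ℝ)) (b := a + 1))
    have h3 : (fun t : ℝ => (a : ℝ) + t) ⁻¹' Set.Ico (a : ℝ) (a + 1) = Set.Ico 0 1 := by
      ext t; simp
    rw [h3] at h2
    exact h2.map_eq
  have h2 : ∀ z : Fin d → ℤ, (volume : Measure (Fin d → unitInterval)).map
      (fun u j => (z j : ℝ) + (u j : ℝ))
      = volume.restrict (Set.univ.pi fun j => Set.Ico (z j : ℝ) (z j + 1)) := by
    intro z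
    rw [volume_pi, volume_pi, Measure.restrict_pi_pi]
    simp only [← h1]
    exact Measure.pi_map_pi (f := fun j (u : unitInterval) => (z j : ℝ) + (u : ℝ))
      fun j => by fun_prop
  have h3 : (volume : Measure (Fin d → ℝ)) = Measure.sum fun z : Fin d → ℤ =>
      volume.restrict (Set.univ.pi fun j => Set.Ico (z j : ℝ) (z j + 1)) := by
    rw [← Measure.restrict_iUnion, ← Measure.restrict_univ (μ := volume)]
    · congr 1
      · simp
      · symm
        rw [Set.eq_univ_iff_forall]
        intro x
        rw [Set.mem_iUnion]
        refine ⟨fun j => ⌊x j⌋, fun j _ => ⟨Int.floor_le _, Int.lt_floor_add_one _⟩⟩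
    · intro z z' hne
      rw [Function.onFun, Set.disjoint_left]
      intro x hx hx'
      apply hne
      funext j
      have a1 := hx j trivial
      have a2 := hx' j trivial
      rw [← Int.floor_eq_iff.2 ⟨a1.1, a1.2⟩, ← Int.floor_eq_iff.2 ⟨a2.1, a2.2⟩]
    · intro z
      exact .univ_pi fun j => measurableSet_Ico
  have h4 := (PiLp.volume_preserving_toLp (Fin d)).map_eq
  rw [← h4, h3, Measure.map_sum (by fun_prop)]
  congr 1
  funext z
  rw [← h2 z, Measure.map_map (by fun_prop) (by fun_prop)]
  rfl

theorem sample_lt_top (ω : Seed d) (hV : Bornology.IsBounded V) : (sample ω).1 V < ∞ := by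
  obtain ⟨n, hn⟩ := hV.subset_ball_lt 0 0
  obtain ⟨N, hN⟩ := exists_nat_gt n
  refine (measure_mono (hn.2.trans (Metric.ball_subset_ball hN.le))).trans_lt ?_
  change sampleMeasure ω _ < ∞
  rw [sampleMeasure_apply ω Metric.isOpen_ball.measurableSet]
  have hF : (Set.pi univ fun _ : Fin d => Set.Icc (-(N : ℤ) - 1) N).Finite :=
    Set.Finite.pi fun _ => Set.finite_Icc _ _
  rw [tsum_eq_sum (s := hF.toFinset)]
  · refine ENNReal.sum_lt_top.2 fun z _ => ENNReal.sum_lt_top.2 fun i _ => ?_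
    by_cases h : cellPoint z ((ω z).2 i) ∈ Metric.ball (0 : E d) N <;> simp [indicator, h]
  · intro z hz
    refine Finset.sum_eq_zero fun i _ => indicator_of_notMem (fun hmem => hz ?_) _
    rw [Set.Finite.mem_toFinset, Set.mem_univ_pi]
    intro j
    have h1 : ‖cellPoint z ((ω z).2 i)‖ < N := by simpa using hmem
    have h3 : |(z j : ℝ) + ((ω z).2 i j : ℝ)| < N :=
      lt_of_le_of_lt (PiLp.norm_apply_le (cellPoint z ((ω z).2 i)) j) h1
    have h4 := ((ω z).2 i j).2
    rw [abs_lt] at h3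
    constructor
    · have : (-(N : ℝ) - 1) < z j := by linarith [h3.1, h4.2]
      exact_mod_cast this.le
    · have : (z j : ℝ) < N := by linarith [h3.2, h4.1]
      exact_mod_cast this.le

theorem ae_poissonLaw_lt_top (ρ : ℝ) (hV : MeasurableSet V)
    (hb : Bornology.IsBounded V) : ∀ᵐ μ : Config d ∂poissonLaw d ρ, μ.1 V < ∞ := by
  rw [poissonLaw, ae_map_iff (measurable_sample d).aemeasurable
    (measurableSet_lt (Config.measurable_apply hV) measurable_const)]
  exact ae_of_all _ fun ω => sample_lt_top ω hb

theorem measurable_cell_sum (z : Fin d → ℤ)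
    {F : Config d → E d → ℝ≥0∞} (hF : Measurable (uncurry F)) : Measurable fun ω :
    Seed d => ∑ i ∈ Finset.range (ω z).1, F (sample ω) (cellPoint z ((ω z).2 i)) := by
  have hf : ∀ n, Measurable fun ω : Seed d => ∑ i ∈ Finset.range n,
      F (sample ω) (cellPoint z ((ω z).2 i)) := by
    intro n
    refine Finset.measurable_fun_sum (Finset.range n) fun i _ => ?_
    have hpt : Measurable fun ω : Seed d => cellPoint z ((ω z).2 i) :=
      (measurable_cellPoint z).comp
        ((measurable_pi_apply i).comp (measurable_snd.comp (measurable_pi_apply z)))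
    exact hF.comp ((measurable_sample d).prodMk hpt)
  have h1 : Measurable fun ω : Seed d => (ω z).1 := measurable_fst.comp (measurable_pi_apply z)
  refine fun s hs => ?_
  have : (fun ω : Seed d => ∑ i ∈ Finset.range (ω z).1,
      F (sample ω) (cellPoint z ((ω z).2 i))) ⁻¹' s = ⋃ n : ℕ, {ω : Seed d | (ω z).1 = n} ∩
        (fun ω : Seed d => ∑ i ∈ Finset.range n, F (sample ω) (cellPoint z ((ω z).2 i))) ⁻¹' s := by
    ext ω
    simp
  rw [this]
  exact .iUnion fun n => (h1 (measurableSet_singleton n)).inter (hf n hs)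

/-- The Mecke formula. -/
theorem lintegral_mecke (ρ : ℝ) (hV : MeasurableSet V) (hb : Bornology.IsBounded V)
    {F : Config d → E d → ℝ≥0∞} (hF : Measurable (uncurry F)) : ∫⁻ μ, ∫⁻ x, F μ x ∂clipKernel
    V μ ∂poissonLaw d ρ = ofReal ρ * ∫⁻ x in V, ∫⁻ μ, F (μ + particle x) x ∂poissonLaw d ρ := by
  classical
  have hFV : Measurable (uncurry fun μ x => V.indicator (F μ) x) := by
    have : (uncurry fun μ x => V.indicator (F μ) x)
        = (Prod.snd ⁻¹' V).indicator (uncurry F) := by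
      ext ⟨μ, x⟩; rfl
    rw [this]
    exact hF.indicator (measurable_snd hV)
  have hadd : Measurable fun p : E d × Config d => p.2 + particle p.1 := by fun_prop
  have h0 : ∀ ω : Seed d, ∫⁻ x, F (sample ω) x ∂clipKernel V (sample ω)
      = ∑' z, ∑ i ∈ Finset.range (ω z).1,
        V.indicator (F (sample ω)) (cellPoint z ((ω z).2 i)) := by
    intro ω
    rw [clipKernel_apply hV, clip_of_lt (sample_lt_top ω hb)]
    change ∫⁻ x in V, F (sample ω) x ∂sampleMeasure ω = _
    rw [← lintegral_indicator hV, sampleMeasure, lintegral_sum_measure, ENNReal.tsum_sigma']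
    refine tsum_congr fun z => ?_
    rw [tsum_fintype, Finset.sum_range]
    refine Finset.sum_congr rfl fun i _ => ?_
    rw [lintegral_dirac']
    exact hFV.comp measurable_prodMk_left
  have hmz := fun z => measurable_cell_sum z hFV
  have hinner : Measurable fun μ : Config d => ∫⁻ x, F μ x ∂clipKernel V μ :=
    hF.lintegral_kernel_prod_right
  rw [poissonLaw, lintegral_map hinner (measurable_sample d)]
  simp only [h0]
  rw [lintegral_tsum fun z => (hmz z).aemeasurable]
  have hR : ∀ x, ∫⁻ μ, F (μ + particle x) x ∂(seedLaw d ρ).map sample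
      = ∫⁻ ω, F (sample ω + particle x) x ∂seedLaw d ρ := fun x =>
    lintegral_map (hF.comp ((measurable_add_const _).prodMk measurable_const))
      (measurable_sample d)
  simp only [hR]
  have hG : Measurable fun x => V.indicator
      (fun x => ∫⁻ ω, F (sample ω + particle x) x ∂seedLaw d ρ) x := by
    refine Measurable.indicator (Measurable.lintegral_prod_right'
      (f := fun p : E d × Seed d => F (sample p.2 + particle p.1) p.1) ?_) hV
    exact hF.comp ((((measurable_sample d).comp measurable_snd).add
      (measurable_particle.comp measurable_fst)).prodMk measurable_fst)
  rw [← lintegral_indicator hV, cellPoint_volume, lintegral_sum_measure, ← ENNReal.tsum_mul_left]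
  refine tsum_congr fun z => ?_
  rw [lintegral_map hG (measurable_cellPoint z)]
  set τ := (poissonMeasure ρ.toNNReal).prod
      (Measure.infinitePi fun _ : ℕ => (volume : Measure (Fin d → unitInterval))) with hτ
  have hsl : seedLaw d ρ = Measure.infinitePi fun _ : Fin d → ℤ => τ := rfl
  have hrest : Measurable fun ω : Seed d => sample (Function.update ω z (0, 0)) :=
    (measurable_sample d).comp (measurable_update_left)
  -- Both sides are sums over the cells. In the term of `z`, the cell is resampled with the rest of
  -- the seed frozen; the one-cell formula `lintegral_poisson_list` applies, and the resampling is
  -- undone at the end.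
  rw [hsl, lintegral_infinitePi_update _ z (hmz z)]
  have hcell : ∀ ω : Seed d, ∫⁻ s, ∑ i ∈ Finset.range (Function.update ω z s z).1,
        V.indicator (F (sample (Function.update ω z s)))
          (cellPoint z ((Function.update ω z s z).2 i)) ∂τ
      = ofReal ρ * ∫⁻ w, ∫⁻ s, V.indicator (F (sample (Function.update ω z s)
          + particle (cellPoint z w))) (cellPoint z w) ∂τ := by
    intro ω
    simp only [Function.update_self]
    have := lintegral_poisson_list (volume : Measure (Fin d → unitInterval))
      (p := fun u => particle (cellPoint z u))
      (measurable_particle.comp (measurable_cellPoint z)) ρ.toNNReal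
      (Ψ := fun η w => V.indicator (F (sample (Function.update ω z (0, 0)) + η)) (cellPoint z w))
      (hFV.comp ((measurable_const_add _ |>.comp measurable_fst).prodMk
        ((measurable_cellPoint z).comp measurable_snd)))
    refine (lintegral_congr fun s => ?_).trans
      (this.trans (congrArg _ (lintegral_congr fun w => lintegral_congr fun s => ?_)))
    · rw [sample_update ω z s]
    · rw [sample_update ω z s, add_assoc]
  rw [lintegral_congr hcell]
  have hmw : Measurable fun q : Seed d × (Fin d → unitInterval) => V.indicator
      (F (sample q.1 + particle (cellPoint z q.2))) (cellPoint z q.2) :=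
    hFV.comp ((((measurable_sample d).comp measurable_fst).add (measurable_particle.comp
      ((measurable_cellPoint z).comp measurable_snd))).prodMk
      ((measurable_cellPoint z).comp measurable_snd))
  have hmu : Measurable fun q : Seed d × (Fin d → unitInterval) =>
      ∫⁻ s, V.indicator (F (sample (Function.update q.1 z s)
          + particle (cellPoint z q.2))) (cellPoint z q.2) ∂τ := by
    refine Measurable.lintegral_prod_right' (f := fun p : (Seed d × (Fin d → unitInterval)) ×
      (ℕ × (ℕ → Fin d → unitInterval)) => V.indicator (F (sample (Function.update p.1.1 z p.2)
          + particle (cellPoint z p.1.2))) (cellPoint z p.1.2)) ?_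
    have hup : Measurable fun p : (Seed d × (Fin d → unitInterval)) ×
      (ℕ × (ℕ → Fin d → unitInterval)) => (Function.update p.1.1 z p.2, p.1.2) :=
      (measurable_update'.comp ((measurable_fst.comp measurable_fst).prodMk
        measurable_snd)).prodMk (measurable_snd.comp measurable_fst)
    exact hmw.comp hup
  rw [lintegral_const_mul _ hmu.lintegral_prod_right', lintegral_lintegral_swap hmu.aemeasurable]
  congr 1
  refine lintegral_congr fun w => ?_
  rw [← lintegral_infinitePi_update (fun _ : Fin d → ℤ => τ) z
    (f := fun ω => V.indicator (F (sample ω + particle (cellPoint z w))) (cellPoint z w))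
    (hmw.comp measurable_prodMk_right)]
  by_cases hw : cellPoint z w ∈ V
  · simp [indicator_of_mem hw]
  · simp [indicator_of_notMem hw]

/-! ### Independent points in a set of finite volume -/

theorem measurable_sum_particle {ι : Type*}
    (s : Finset ι) : Measurable fun x : ι → E d => ∑ i ∈ s, particle (x i) :=
  Finset.measurable_fun_sum _ fun i _ => measurable_particle.comp (measurable_pi_apply i)

/-- The image of the Lebesgue measure on `V^n` under `x ↦ ∑ δ_{x_i}`. -/
def lam (V : Set (E d)) (n : ℕ) : Measure (Config d) :=
  (Measure.pi fun _ : Fin n => (volume : Measure (E d)).restrict V).map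
    fun x => ∑ i, particle (x i)

instance (V : Set (E d)) (n : ℕ) : SFinite (lam V n) := by
  unfold lam; infer_instance

instance (V : Set (E d)) (n : ℕ)
    [IsFiniteMeasure ((volume : Measure (E d)).restrict V)] : IsFiniteMeasure (lam V n) := by
  unfold lam; infer_instance

theorem lam_zero (V : Set (E d)) : lam V 0 = Measure.dirac 0 := by
  rw [lam, Measure.pi_of_empty, Measure.map_dirac' (measurable_sum_particle _)]
  simp

theorem lintegral_lam_eq_succAbove (V : Set (E d)) (n : ℕ) (i : Fin (n + 1))
    {F : Config d → E d → ℝ≥0∞} (hF : Measurable (uncurry F)) : ∫⁻ x, F (∑ j, particle (x j))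
    (x i) ∂(Measure.pi fun _ : Fin (n + 1) => (volume : Measure (E d)).restrict V)
    = ∫⁻ y in V, ∫⁻ η, F (η + particle y) y ∂lam V n := by
  have hm : Measurable fun q : E d × (Fin n → E d) => (∑ j, particle (q.2 j)) + particle q.1 :=
    ((measurable_sum_particle _).comp measurable_snd).add (measurable_particle.comp measurable_fst)
  have hmp := measurePreserving_piFinSuccAbove
    (fun _ : Fin (n + 1) => (volume : Measure (E d)).restrict V) i
  have hG : Measurable fun q : E d × (Fin n → E d) =>
      F ((∑ j, particle (q.2 j)) + particle q.1) q.1 := hF.comp (hm.prodMk measurable_fst)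
  have h1 : ∀ x : Fin (n + 1) → E d, F (∑ j, particle (x j)) (x i)
      = (fun q : E d × (Fin n → E d) => F ((∑ j, particle (q.2 j)) + particle q.1) q.1)
        (MeasurableEquiv.piFinSuccAbove (fun _ => E d) i x) := by
    intro x
    simp only [MeasurableEquiv.piFinSuccAbove_apply]
    rw [Fin.sum_univ_succAbove _ i, add_comm]
    rfl
  simp only [h1]
  rw [hmp.lintegral_comp hG, lintegral_prod _ hG.aemeasurable]
  refine lintegral_congr fun y => ?_
  have hy : Measurable fun η : Config d => F (η + particle y) y :=
    hF.comp ((measurable_add_const _).prodMk measurable_const)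
  rw [lam, lintegral_map hy (measurable_sum_particle _)]

theorem lintegral_lam_succ (V : Set (E d)) (n : ℕ) {F : Config d → ℝ≥0∞} (hF : Measurable F) :
    ∫⁻ η, F η ∂lam V (n + 1) = ∫⁻ x in V, ∫⁻ η, F (η + particle x) ∂lam V n := by
  rw [lam, lintegral_map hF (measurable_sum_particle _)]
  exact lintegral_lam_eq_succAbove V n 0 (F := fun η _ => F η) (hF.comp measurable_fst)

theorem measurable_add_particle :
    Measurable fun p : Pt d => p.1 + particle p.2 := by fun_prop

theorem lam_succ (V : Set (E d)) (n : ℕ) : lam V (n + 1)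
    = ((lam V n).prod ((volume : Measure (E d)).restrict V)).map fun p => p.1 + particle p.2 := by
  refine Measure.ext_of_lintegral _ fun F hF => ?_
  have hG : Measurable fun p : Pt d => F (p.1 + particle p.2) :=
    hF.comp measurable_add_particle
  rw [lintegral_lam_succ V n hF, lintegral_map hF measurable_add_particle,
    lintegral_prod_symm' _ hG]

theorem lam_univ (V : Set (E d)) (n : ℕ) : lam V n univ = volume V ^ n := by
  rw [lam, Measure.map_apply (measurable_sum_particle _) MeasurableSet.univ]
  simp [Measure.pi_univ]

theorem ae_lam (hV : MeasurableSet V)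
    (n : ℕ) : ∀ᵐ η : Config d ∂lam V n, η.1 Vᶜ = 0 ∧ η.1 V = n := by
  have hm : MeasurableSet
      {η : Config d | η.1 Vᶜ = 0 ∧ η.1 V = n} :=
    (measurableSet_eq_fun (Config.measurable_apply hV.compl) measurable_const).inter
      (measurableSet_eq_fun (Config.measurable_apply hV) measurable_const)
  rw [lam, ae_map_iff (measurable_sum_particle _).aemeasurable hm]
  have : ∀ᵐ x ∂(Measure.pi fun _ : Fin n => (volume : Measure (E d)).restrict V),
      ∀ i, x i ∈ V :=
    ae_all_iff.2 fun i => Measure.tendsto_eval_ae_ae.eventually (ae_restrict_mem hV)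
  filter_upwards [this] with x hx
  rw [Config.sum_apply, Config.sum_apply]
  constructor
  · exact Finset.sum_eq_zero fun i _ => by rw [particle_apply _ hV.compl]; simp [hx i]
  · rw [Finset.sum_congr rfl fun i _ => show _ = (1 : ℝ≥0∞) by
      rw [particle_apply _ hV]; simp [hx i]]
    simp

theorem restr_eq_self {η : Config d} (h : η.1 Vᶜ = 0) : restr η V = η :=
  Subtype.ext (Measure.restrict_eq_self_of_ae_mem (mem_ae_iff.2 h))

theorem restr_compl_eq_zero {η : Config d} (h : η.1 Vᶜ = 0) : restr η Vᶜ = 0 :=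
  Subtype.ext (Measure.restrict_zero_set h)

theorem exists_nat_mass (μ : Config d)
    (hV : MeasurableSet V) (h : μ.1 V < ∞) : ∃ n : ℕ, μ.1 V = n := by
  obtain ⟨n, x, -, hx⟩ := exists_restr_eq_sum_particle μ hV h
  refine ⟨n, ?_⟩
  have : (restr μ V).1 univ = n := by
    rw [hx, Config.sum_apply]
    simp [particle_apply]
  rwa [restr_apply _ _ MeasurableSet.univ, Set.univ_inter] at this

theorem lintegral_eq_sum_particle {ι : Type*}
    (s : Finset ι) (x : ι → E d) {f : E d → ℝ≥0∞} (hf : Measurable f) :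
    ∫⁻ y, f y ∂((∑ i ∈ s, particle (x i) : Config d) : Measure (E d)) = ∑ i ∈ s, f (x i) := by
  have : ((∑ i ∈ s, particle (x i) : Config d) : Measure (E d))
      = ∑ i ∈ s, Measure.dirac (x i) := by
    rw [AddSubmonoid.coe_finsetSum]; rfl
  rw [this, lintegral_finsetSum_measure]
  exact Finset.sum_congr rfl fun i _ => lintegral_dirac' _ hf

theorem clip_eq_self {η : Config d} (h : η.1 Vᶜ = 0) (h' : η.1 V < ∞) : clip V η = η := by
  rw [clip_of_lt h', restr_eq_self h]

theorem measurable_lintegral_clip {F : Config d → E d → ℝ≥0∞}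
    (hF : Measurable (uncurry F)) : Measurable fun μ => ∫⁻ x, F μ x ∂clipKernel V μ :=
  hF.lintegral_kernel_prod_right

/-- The Mecke formula for a given number of particles. -/
theorem lintegral_lam_mecke (hV : MeasurableSet V) (n : ℕ) {F : Config d → E d → ℝ≥0∞}
    (hF : Measurable (uncurry F)) : ∫⁻ μ, ∫⁻ x, F μ x ∂clipKernel V μ ∂lam V (n + 1)
    = (n + 1) * ∫⁻ x in V, ∫⁻ μ, F (μ + particle x) x ∂lam V n := by
  have h1 : ∀ᵐ η : Config d ∂lam V (n + 1), ∫⁻ x, F η x ∂clipKernel V η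
      = ∫⁻ x, F η x ∂η.1 := by
    filter_upwards [ae_lam hV (n + 1)] with η hη
    rw [clipKernel_apply hV, clip_eq_self hη.1 (hη.2 ▸ ENNReal.natCast_lt_top _)]
  have h2 : ∀ᵐ x ∂(Measure.pi fun _ : Fin (n + 1) => (volume : Measure (E d)).restrict V),
      ∫⁻ y, F (∑ i, particle (x i)) y ∂clipKernel V (∑ i, particle (x i))
      = ∑ i, F (∑ j, particle (x j)) (x i) := by
    filter_upwards [ae_of_ae_map (measurable_sum_particle _).aemeasurable h1] with x hx
    rw [hx]
    exact lintegral_eq_sum_particle _ _ (f := F (∑ i, particle (x i)))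
      (hF.comp measurable_prodMk_left)
  rw [lam, lintegral_map (measurable_lintegral_clip hF) (measurable_sum_particle _),
    lintegral_congr_ae h2, lintegral_finsetSum]
  · rw [Finset.sum_congr rfl fun i _ => lintegral_lam_eq_succAbove V n i hF]
    simp [lam]
  · intro i _
    exact hF.comp ((measurable_sum_particle Finset.univ).prodMk (measurable_pi_apply i))

/-- The Mecke formula as an identity of measures, so that it also applies to Bochner integrals of
functions without sign. -/
theorem lam_compProd (hV : MeasurableSet V) (n : ℕ) : lam V (n + 1)
    ⊗ₘ clipKernel V = ((n : ℝ≥0∞) + 1) • ((lam V n).prod ((volume : Measure (E d)).restrict V)).map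
    fun p => (p.1 + particle p.2, p.2) := by
  have hm : Measurable fun p : Pt d => (p.1 + particle p.2, p.2) :=
    measurable_add_particle.prodMk measurable_snd
  refine Measure.ext_of_lintegral _ fun F hF => ?_
  have hG : Measurable fun p : Pt d => F (p.1 + particle p.2, p.2) := hF.comp hm
  rw [Measure.lintegral_compProd hF, lintegral_smul_measure, lintegral_map hF hm,
    lintegral_prod_symm' _ hG, smul_eq_mul]
  exact lintegral_lam_mecke hV n (F := fun μ x => F (μ, x)) hF

theorem poissonLaw_compProd (ρ : ℝ) (hV : MeasurableSet V) (hb : Bornology.IsBounded V) :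
    poissonLaw d ρ ⊗ₘ clipKernel V = ofReal ρ • ((poissonLaw d ρ).prod
    ((volume : Measure (E d)).restrict V)).map fun p => (p.1 + particle p.2, p.2) := by
  have hm : Measurable fun p : Pt d => (p.1 + particle p.2, p.2) :=
    measurable_add_particle.prodMk measurable_snd
  refine Measure.ext_of_lintegral _ fun F hF => ?_
  have hG : Measurable fun p : Pt d => F (p.1 + particle p.2, p.2) := hF.comp hm
  rw [Measure.lintegral_compProd hF, lintegral_smul_measure, lintegral_map hF hm,
    lintegral_prod_symm' _ hG, smul_eq_mul]
  exact lintegral_mecke ρ hV hb (F := fun μ x => F (μ, x)) hF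

/-! ### The Poisson law in a bounded set, and independence from the outside -/

/-- The law of the restriction to `V` of the Poisson point process of intensity `ρ`. -/
def fv (ρ : ℝ) (V : Set (E d)) : Measure (Config d) :=
  Measure.sum fun n : ℕ =>
    ofReal (Real.exp (-(ρ * volume.real V)) * ρ ^ n / n.factorial) • lam V n

instance (ρ : ℝ) (V : Set (E d)) : SFinite (fv ρ V) := by
  unfold fv; infer_instance

theorem lintegral_fv (ρ : ℝ) (V : Set (E d)) (F : Config d → ℝ≥0∞) : ∫⁻ η, F η ∂fv ρ V =
    ∑' n : ℕ, ofReal (Real.exp (-(ρ * volume.real V)) * ρ ^ n / n.factorial) * ∫⁻ η, F η ∂lam V n :=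
    by
  rw [fv, lintegral_sum_measure]
  simp only [lintegral_smul_measure, smul_eq_mul]

/-- Particles are added one at a time. The Mecke formula for `F` on the event of `n + 1` particles
counts `F` once per particle, so it reads `(n + 1) E[F; n + 1] = ρ ∫_V E[F(· + δ_x); n] dx`; the
factors accumulate to `ρ^n / n!`. -/
theorem lintegral_mass_eq (hρ : 0 ≤ ρ) (hV : MeasurableSet V)
    (hb : Bornology.IsBounded V) (n : ℕ) {F : Config d → ℝ≥0∞} (hF : Measurable F) :
    ∫⁻ μ in {μ : Config d | μ.1 V = n}, F μ ∂poissonLaw d ρ = ofReal (ρ ^ n / n.factorial)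
    * ∫⁻ η, ∫⁻ μ in {μ : Config d | μ.1 V = (0 : ℕ)}, F (μ + η) ∂poissonLaw d ρ ∂lam V n := by
  have hs : ∀ n : ℕ, MeasurableSet {μ : Config d | μ.1 V = n} := fun n =>
    measurableSet_eq_fun (Config.measurable_apply hV) measurable_const
  induction n generalizing F with
  | zero =>
    rw [lam_zero, lintegral_dirac']
    · simp
    · exact Measurable.lintegral_prod_right'
        (f := fun p : Config d × Config d => F (p.2 + p.1)) (hF.comp (measurable_snd.add measurable_fst))
  | succ n ih =>
    have h1 := lintegral_mecke ρ hV hb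
      (F := fun μ _ => {μ : Config d | μ.1 V = (n + 1 : ℕ)}.indicator F μ)
      ((hF.indicator (hs _)).comp measurable_fst)
    have h2 : ∫⁻ μ, ∫⁻ _x, {μ : Config d | μ.1 V = (n + 1 : ℕ)}.indicator F μ
        ∂clipKernel V μ ∂poissonLaw d ρ = ((n + 1 : ℕ) : ℝ≥0∞) *
        ∫⁻ μ in {μ : Config d | μ.1 V = (n + 1 : ℕ)}, F μ ∂poissonLaw d ρ := by
      rw [← lintegral_const_mul _ hF, ← lintegral_indicator (hs _)]
      refine lintegral_congr fun μ => ?_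
      by_cases hm : μ ∈ {μ : Config d | μ.1 V = (n + 1 : ℕ)}
      · have hμ : μ.1 V = (n + 1 : ℕ) := hm
        rw [lintegral_const, clipKernel_apply hV,
          clip_of_lt (by rw [hμ]; exact ENNReal.natCast_lt_top _),
          restr_apply _ _ MeasurableSet.univ, Set.univ_inter, hμ, indicator_of_mem hm,
          indicator_of_mem hm, mul_comm]
      · simp only [indicator_of_notMem hm]
        simp
    have h3 : ∀ x ∈ V, ∫⁻ μ, {μ : Config d | μ.1 V = (n + 1 : ℕ)}.indicator F
          (μ + particle x) ∂poissonLaw d ρ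
        = ofReal (ρ ^ n / n.factorial) * ∫⁻ η, ∫⁻ μ in
          {μ : Config d | μ.1 V = (0 : ℕ)}, F (μ + η + particle x)
            ∂poissonLaw d ρ ∂lam V n := by
      intro x hx
      rw [← ih (F := fun μ => F (μ + particle x)) (hF.comp (measurable_add_const _)),
        ← lintegral_indicator (hs _)]
      refine lintegral_congr fun μ => ?_
      have hiff : μ + particle x ∈ {μ : Config d | μ.1 V = (n + 1 : ℕ)}
          ↔ μ ∈ {μ : Config d | μ.1 V = n} := by
        change ((μ + particle x : Config d) : Measure (E d)) V = (n + 1 : ℕ)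
          ↔ μ.1 V = n
        rw [Config.add_apply, particle_apply _ hV, indicator_of_mem hx]
        push_cast
        exact ENNReal.add_left_inj ENNReal.one_ne_top
      by_cases hμ : μ ∈ {μ : Config d | μ.1 V = n}
      · rw [indicator_of_mem (hiff.2 hμ), indicator_of_mem hμ]
      · rw [indicator_of_notMem fun h => hμ (hiff.1 h), indicator_of_notMem hμ]
    have hmm : Measurable fun p : E d × Config d => ∫⁻ μ in
          {μ : Config d | μ.1 V = (0 : ℕ)}, F (μ + (p.2 + particle p.1))
            ∂poissonLaw d ρ := by
      refine Measurable.lintegral_prod_right' (f := fun q : (E d × Config d) × Config d =>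
        F (q.2 + (q.1.2 + particle q.1.1))) (hF.comp ?_)
      fun_prop
    rw [h2, setLIntegral_congr_fun hV h3] at h1
    simp only [add_assoc] at h1
    rw [lintegral_const_mul _ hmm.lintegral_prod_right'] at h1
    rw [lintegral_lam_succ V n]
    swap
    · exact Measurable.lintegral_prod_right' (f := fun q : Config d × Config d =>
        F (q.2 + q.1)) (hF.comp (measurable_snd.add measurable_fst))
    have hn0 : ((n + 1 : ℕ) : ℝ≥0∞) ≠ 0 := by simp
    have hnt : ((n + 1 : ℕ) : ℝ≥0∞) ≠ ∞ := ENNReal.natCast_ne_top _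
    refine (ENNReal.mul_right_inj hn0 hnt).1 ?_
    rw [h1, ← mul_assoc, ← mul_assoc]
    congr 1
    rw [← ENNReal.ofReal_natCast, ← ofReal_mul hρ, ← ofReal_mul (by positivity)]
    congr 1
    rw [Nat.factorial_succ]
    push_cast
    field_simp
    ring

theorem lintegral_eq_tsum_mass (hV : MeasurableSet V)
    (hb : Bornology.IsBounded V) (F : Config d → ℝ≥0∞) : ∫⁻ μ,
    F μ ∂poissonLaw d ρ = ∑' n : ℕ, ∫⁻ μ in {μ : Config d | μ.1 V = n}, F μ ∂poissonLaw d ρ := by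
  have hs : ∀ n : ℕ, MeasurableSet {μ : Config d | μ.1 V = n} := fun n =>
    measurableSet_eq_fun (Config.measurable_apply hV) measurable_const
  rw [← lintegral_iUnion hs]
  · rw [← setLIntegral_univ]
    refine setLIntegral_congr ?_
    filter_upwards [ae_poissonLaw_lt_top ρ hV hb] with μ hμ
    obtain ⟨n, hn⟩ := exists_nat_mass μ hV hμ
    have : μ ∈ ⋃ n : ℕ, {μ : Config d | μ.1 V = n} := Set.mem_iUnion.2 ⟨n, hn⟩
    exact propext ⟨fun _ => this, fun _ => trivial⟩
  · intro i j hij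
    rw [Function.onFun, Set.disjoint_left]
    intro μ h1 h2
    apply hij
    have h1 : μ.1 V = i := h1
    have h2 : μ.1 V = j := h2
    exact_mod_cast h1.symm.trans h2

theorem tsum_ofReal_poisson {t : ℝ}
    (ht : 0 ≤ t) : ∑' n : ℕ, ofReal (t ^ n / n.factorial) = ofReal (Real.exp t) := by
  rw [← ENNReal.ofReal_tsum_of_nonneg (fun n => by positivity) (Real.summable_pow_div_factorial t),
    Real.exp_eq_exp_ℝ, NormedSpace.exp_eq_tsum_div]

/-- The restrictions to `V` and to its complement are independent, and the first one has
law `fv ρ V`. -/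
theorem lintegral_poissonLaw_eq (hρ : 0 ≤ ρ)
    (hV : MeasurableSet V) (hb : Bornology.IsBounded V) {F : Config d → ℝ≥0∞} (hF : Measurable F) :
    ∫⁻ μ, F μ ∂poissonLaw d ρ = ∫⁻ η, ∫⁻ μ, F (restr μ Vᶜ + η) ∂poissonLaw d ρ ∂fv ρ V := by
  have hv : volume V ≠ ∞ := hb.measure_lt_top.ne
  have hs : MeasurableSet {μ : Config d | μ.1 V = (0 : ℕ)} :=
    measurableSet_eq_fun (Config.measurable_apply hV) measurable_const
  -- For a function of the particles outside `V`, the previous formula has the same integral over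
  -- the void event for each number of particles in `V`. Summing over this number gives `E[H(μ ⌞
  -- Vᶜ)] = exp(ρ|V|) E[H; μ V = 0]`, which is the independence.
  have h0 : ∀ H : Config d → ℝ≥0∞, Measurable H →
      ∫⁻ μ in {μ : Config d | μ.1 V = (0 : ℕ)}, H μ ∂poissonLaw d ρ
      = ofReal (Real.exp (-(ρ * volume.real V))) *
        ∫⁻ μ, H (restr μ Vᶜ) ∂poissonLaw d ρ := by
    intro H hH
    rw [lintegral_eq_tsum_mass hV hb]
    have h1 : ∀ n : ℕ, ∫⁻ μ in {μ : Config d | μ.1 V = n}, H (restr μ Vᶜ)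
        ∂poissonLaw d ρ = ofReal ((ρ * volume.real V) ^ n / n.factorial) *
        ∫⁻ μ in {μ : Config d | μ.1 V = (0 : ℕ)}, H μ ∂poissonLaw d ρ := by
      intro n
      have hHr : Measurable fun μ : Config d => H (restr μ Vᶜ) :=
        hH.comp (measurable_restr hV.compl)
      rw [lintegral_mass_eq hρ hV hb n hHr]
      have h2 : ∀ᵐ η ∂lam V n, ∫⁻ μ in {μ : Config d | μ.1 V = (0 : ℕ)},
          H (restr (μ + η) Vᶜ) ∂poissonLaw d ρ
          = ∫⁻ μ in {μ : Config d | μ.1 V = (0 : ℕ)}, H μ ∂poissonLaw d ρ := by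
        filter_upwards [ae_lam hV n] with η hη
        refine setLIntegral_congr_fun hs fun μ hμ => ?_
        have hμ : μ.1 V = (0 : ℕ) := hμ
        simp only [restr_add]
        rw [restr_compl_eq_zero hη.1, add_zero,
          restr_eq_self (V := Vᶜ) (by rw [compl_compl, hμ]; simp)]
      rw [lintegral_congr_ae h2, lintegral_const, lam_univ, mul_comm _ (volume V ^ n), ← mul_assoc]
      congr 1
      rw [mul_pow, mul_div_right_comm, ofReal_mul (by positivity)]
      congr 1
      rw [ENNReal.ofReal_pow (by positivity), ofReal_measureReal hv]
    simp only [h1]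
    rw [ENNReal.tsum_mul_right, tsum_ofReal_poisson (by positivity), ← mul_assoc,
      ← ofReal_mul (by positivity), ← Real.exp_add]
    simp
  rw [lintegral_eq_tsum_mass hV hb, lintegral_fv]
  refine tsum_congr fun n => ?_
  rw [lintegral_mass_eq hρ hV hb n hF]
  simp only [fun η => h0 (fun μ => F (μ + η)) (hF.comp (measurable_add_const _))]
  rw [lintegral_const_mul, ← mul_assoc]
  · congr 1
    rw [← ofReal_mul (by positivity)]
    congr 1
    ring
  · refine Measurable.lintegral_prod_right' (f := fun q : Config d × Config d =>
        F (restr q.2 Vᶜ + q.1)) (hF.comp ?_)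
    exact ((measurable_restr hV.compl).comp measurable_snd).add measurable_fst

/-! ### Smooth functions of the configuration and their gradients -/

/-- `g` is the gradient of `y ↦ φ(ν + δ_y)` at `z`, coordinate by coordinate. -/
def HasPG (φ : Config d → ℝ) (ν : Config d) (z g : E d) : Prop :=
  ∀ k, HasLineDerivAt ℝ (fun y => φ (ν + particle y)) (g k) z (EuclideanSpace.single k 1)

/-- The gradient of `y ↦ φ(ν + δ_y)` at `z`, as a measurable function of `(ν, z)`. -/
def pgrad (φ : Config d → ℝ) (ν : Config d) (z : E d) : E d :=
  WithLp.toLp 2 fun k => limsup (fun n : ℕ => ((n : ℝ) + 1) *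
    (φ (ν + particle (z + ((n : ℝ) + 1)⁻¹ • EuclideanSpace.single k 1)) - φ (ν + particle z))) atTop

theorem measurable_pgrad (hφ : Measurable φ) : Measurable (uncurry (pgrad φ)) := by
  refine (WithLp.measurable_toLp 2 (Fin d → ℝ)).comp (measurable_pi_lambda _ fun k => ?_)
  refine Measurable.limsup fun n => ?_
  refine Measurable.const_mul ?_ _
  refine Measurable.sub (hφ.comp ?_) (hφ.comp ?_)
  · exact measurable_fst.add (measurable_particle.comp (measurable_snd.add_const _))
  · exact measurable_fst.add (measurable_particle.comp measurable_snd)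

theorem HasPG.pgrad_eq {z g : E d} (h : HasPG φ ν z g) : pgrad φ ν z = g := by
  ext k
  refine Tendsto.limsup_eq ?_
  have h1 := (hasDerivAt_iff_tendsto_slope_zero.1 (h k))
  have h2 : Tendsto (fun n : ℕ => ((n : ℝ) + 1)⁻¹) atTop (𝓝[≠] 0) := by
    refine tendsto_nhdsWithin_iff.2 ⟨?_, Eventually.of_forall fun n => ?_⟩
    · simpa using tendsto_one_div_add_atTop_nhds_zero_nat (𝕜 := ℝ)
    · have : (0 : ℝ) < (n : ℝ) + 1 := by positivity
      exact (inv_pos.2 this).ne'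
  refine (h1.comp h2).congr fun n => ?_
  simp

theorem HasPG.grad_eq {z g : E d} (h : HasPG φ ν z g) : grad φ (ν + particle z) z = g := by
  have hex : ∃ ν' : Config d, ν + particle z = ν' + particle z := ⟨ν, rfl⟩
  rw [grad, dif_pos hex, ← add_particle_cancel hex.choose_spec]
  ext k
  exact (h k).lineDeriv

theorem HasPG.congr {φ φ' : Config d → ℝ} {ν ν' : Config d} {z g : E d}
    (h : HasPG φ ν z g) (he : ∀ᶠ y in 𝓝 z, φ' (ν' + particle y) = φ (ν + particle y)) :
    HasPG φ' ν' z g := fun k => (h k).congr_of_eventuallyEq he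

theorem HasPG.add {φ φ' : Config d → ℝ} {z g g' : E d}
    (h : HasPG φ ν z g) (h' : HasPG φ' ν z g') :
    HasPG (fun μ => φ μ + φ' μ) ν z (g + g') := fun k => HasDerivAt.add (h k) (h' k)

theorem HasPG.sub {φ φ' : Config d → ℝ} {z g g' : E d}
    (h : HasPG φ ν z g) (h' : HasPG φ' ν z g') :
    HasPG (fun μ => φ μ - φ' μ) ν z (g - g') := fun k => HasDerivAt.sub (h k) (h' k)

theorem HasPG.const_mul {z g : E d}
    (c : ℝ) (h : HasPG φ ν z g) : HasPG (fun μ => c * φ μ) ν z (c • g) :=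
  fun k => HasDerivAt.const_mul c (h k)

theorem hasPG_const {z : E d}
    (c : ℝ) (h : ∀ᶠ y in 𝓝 z, φ (ν + particle y) = c) : HasPG φ ν z 0 := by
  intro k
  have : HasLineDerivAt ℝ (fun _ : E d => c) 0 z (EuclideanSpace.single k 1) :=
    hasDerivAt_const _ _
  exact this.congr_of_eventuallyEq h

theorem HasPG.sum {ι : Type*} (s : Finset ι) {ν : ι → Config d}
    {z : E d} {g : ι → E d} (h : ∀ i ∈ s, HasPG φ (ν i) z (g i)) (k : Fin d) : HasLineDerivAt ℝ
    (fun y => ∑ i ∈ s, φ (ν i + particle y)) ((∑ i ∈ s, g i) k) z (EuclideanSpace.single k 1) := by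
  have h1 : (∑ i ∈ s, g i) k = ∑ i ∈ s, g i k := by simp
  rw [h1]
  exact HasDerivAt.fun_sum fun i hi => h i hi k

theorem mass_sum_particle (hU : MeasurableSet U) {n : ℕ} {x : Fin n → E d}
    (hx : ∀ i, x i ∈ U) : ((∑ i, particle (x i) : Config d) : Measure (E d)) U = n := by
  rw [Config.sum_apply, Finset.sum_congr rfl fun i _ => show _ = (1 : ℝ≥0∞) by
      rw [particle_apply _ hU]; simp [hx i]]
  simp

theorem restr_sum_particle (hU : MeasurableSet U) {n : ℕ} {x : Fin n → E d}
    (hx : ∀ i, x i ∈ U) : restr (∑ i, particle (x i)) U = ∑ i, particle (x i) := by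
  rw [restr_sum]
  exact Finset.sum_congr rfl fun i _ => restr_particle_of_mem hU (hx i)

theorem restr_compl_sum_particle (hU : MeasurableSet U)
    {n : ℕ} {x : Fin n → E d} (hx : ∀ i, x i ∈ U) : restr (∑ i, particle (x i)) Uᶜ = 0 := by
  rw [restr_sum]
  exact Finset.sum_eq_zero fun i _ => restr_particle_of_notMem hU.compl (by simp [hx i])

theorem restr_compl_mass (hU : MeasurableSet U) (μ : Config d) : (restr μ Uᶜ).1 U = 0 := by
  rw [restr_apply _ _ hU]; simp

theorem restr_compl_idem (hU : MeasurableSet U)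
    (μ : Config d) : restr (restr μ Uᶜ) Uᶜ = restr μ Uᶜ := by
  rw [restr_restr _ hU.compl, Set.inter_self]

/-- The definition of smoothness only freezes particles outside `U`. The finitely many particles of
`ν` inside `U` are treated as additional variables, and the smooth function of `n + m` points is
restricted to a slice. -/
theorem SmoothIn.contDiffOn_add (hU : MeasurableSet U)
    (hφ : SmoothIn U φ) (hν : ν.1 U < ∞) (n : ℕ) : ContDiffOn ℝ ((⊤ : ℕ∞) : WithTop ℕ∞)
    (fun x : Fin n → E d => φ (∑ i, particle (x i) + ν)) {x | ∀ i, x i ∈ U} := by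
  obtain ⟨m, y, hy, hyν⟩ := exists_restr_eq_sum_particle ν hU hν
  have h1 := hφ.2 ν (n + m)
  have h2 : ContDiff ℝ ((⊤ : ℕ∞) : WithTop ℕ∞)
      (fun x : Fin n → E d => (Fin.append x y : Fin (n + m) → E d)) := by
    rw [contDiff_pi]
    intro i
    refine Fin.addCases (fun j => ?_) (fun j => ?_) i
    · simp only [Fin.append_left]; fun_prop
    · simp only [Fin.append_right]; fun_prop
  refine (h1.comp h2.contDiffOn (fun x hx => ?_)).congr fun x hx => ?_
  · intro i
    refine Fin.addCases (fun j => ?_) (fun j => ?_) i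
    · rw [Fin.append_left]; exact hx j
    · rw [Fin.append_right]; exact hy j
  · simp only [Function.comp]
    congr 1
    rw [Fin.sum_univ_add]
    simp only [Fin.append_left, Fin.append_right]
    rw [add_assoc, ← hyν, restr_add_restr_compl _ hU]

theorem SmoothIn.hasPG (hU : IsOpen U)
    (hφ : SmoothIn U φ) (hν : ν.1 U < ∞) {z : E d} (hz : z ∈ U) : HasPG φ ν z (pgrad φ ν z) := by
  have h1 := hφ.contDiffOn_add hU.measurableSet hν 1
  have h2 : ContDiffOn ℝ ((⊤ : ℕ∞) : WithTop ℕ∞) (fun y : E d => φ (ν + particle y)) U := by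
    have h3 : ContDiff ℝ ((⊤ : ℕ∞) : WithTop ℕ∞) (fun y : E d => (fun _ : Fin 1 => y)) := by
      fun_prop
    refine (h1.comp h3.contDiffOn (fun y hy _ => hy)).congr fun y hy => ?_
    simp [add_comm]
  have h4 : DifferentiableAt ℝ (fun y : E d => φ (ν + particle y)) z :=
    (h2.differentiableOn (by simp)).differentiableAt (hU.mem_nhds hz)
  have h5 : HasPG φ ν z (WithLp.toLp 2 fun k =>
      fderiv ℝ (fun y : E d => φ (ν + particle y)) z (EuclideanSpace.single k 1)) :=
    fun k => h4.hasFDerivAt.hasLineDerivAt _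
  rwa [h5.pgrad_eq]

theorem SmoothIn.grad_eq (hU : IsOpen U) (hφ : SmoothIn U φ)
    (hν : ν.1 U < ∞) {z : E d} (hz : z ∈ U) : grad φ (ν + particle z) z = pgrad φ ν z :=
  (hφ.hasPG hU hν hz).grad_eq

theorem SmoothIn.add {φ φ' : Config d → ℝ}
    (h : SmoothIn U φ) (h' : SmoothIn U φ') : SmoothIn U fun μ => φ μ + φ' μ :=
  ⟨h.1.add h'.1, fun μ n => (h.2 μ n).add (h'.2 μ n)⟩

theorem SmoothIn.sub {φ φ' : Config d → ℝ}
    (h : SmoothIn U φ) (h' : SmoothIn U φ') : SmoothIn U fun μ => φ μ - φ' μ :=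
  ⟨h.1.sub h'.1, fun μ n => (h.2 μ n).sub (h'.2 μ n)⟩

/-- `c(μ)` depends only on the number of particles in `U` and on the particles outside `U`. -/
def IsExterior (U : Set (E d)) (c : Config d → ℝ) : Prop :=
  ∀ μ ν : Config d, μ.1 U = ν.1 U → restr μ Uᶜ = restr ν Uᶜ →
    c μ = c ν

theorem IsExterior.add_particle (hU : MeasurableSet U) {c : Config d → ℝ} (hc : IsExterior U c) (ν :
    Config d) {y z : E d} (hy : y ∈ U) (hz : z ∈ U) : c (ν + particle y) = c (ν + particle z) := by
  refine hc _ _ ?_ ?_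
  · rw [Config.add_apply, Config.add_apply, particle_apply _ hU, particle_apply _ hU]
    simp [hy, hz]
  · rw [restr_add, restr_add, restr_particle_of_notMem hU.compl (by simp [hy]),
      restr_particle_of_notMem hU.compl (by simp [hz])]

theorem IsExterior.sum_particle (hU : MeasurableSet U) {c : Config d → ℝ}
    (hc : IsExterior U c) (ν : Config d) {n : ℕ} {x y : Fin n → E d} (hx : ∀ i, x i ∈ U)
    (hy : ∀ i, y i ∈ U) : c (∑ i, particle (x i) + ν) = c (∑ i, particle (y i) + ν) := by
  refine hc _ _ ?_ ?_
  · rw [Config.add_apply, Config.add_apply, mass_sum_particle hU hx, mass_sum_particle hU hy]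
  · rw [restr_add, restr_add, restr_compl_sum_particle hU hx, restr_compl_sum_particle hU hy]

/-- An exterior function is constant while the particles move inside `U`, so it acts as a scalar.
This allows test functions to be localised to a given number of particles. -/
theorem SmoothIn.exterior_mul (hU : MeasurableSet U) {φ c : Config d → ℝ} (h : SmoothIn U φ)
    (hc : Measurable c) (hce : IsExterior U c) : SmoothIn U fun μ => c μ * φ μ := by
  refine ⟨hc.mul h.1, fun μ n => ?_⟩
  by_cases hne : ∃ x : Fin n → E d, ∀ i, x i ∈ U
  · obtain ⟨x₀, hx₀⟩ := hne
    refine ((h.2 μ n).const_smul (c (∑ i, particle (x₀ i) + restr μ Uᶜ))).congr fun x hx => ?_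
    beta_reduce
    rw [hce.sum_particle hU _ hx hx₀]; rfl
  · push Not at hne
    intro x hx
    obtain ⟨i, hi⟩ := hne x
    exact absurd (hx i) hi

theorem smoothIn_const (U : Set (E d)) (a : ℝ) : SmoothIn U fun _ : Config d => a :=
  ⟨measurable_const, fun _ _ => contDiffOn_const⟩

theorem IsExterior.smoothIn (hU : MeasurableSet U)
    {c : Config d → ℝ} (hc : Measurable c) (hce : IsExterior U c) : SmoothIn U c := by
  simpa using (smoothIn_const U 1).exterior_mul hU hc hce

theorem HasPG.exterior_mul (hU : IsOpen U) {φ c : Config d → ℝ} {z g : E d} (h : HasPG φ ν z g)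
    (hce : IsExterior U c) (hz : z ∈ U) :
    HasPG (fun μ => c μ * φ μ) ν z (c (ν + particle z) • g) := by
  refine (h.const_mul (c (ν + particle z))).congr ?_
  filter_upwards [hU.mem_nhds hz] with y hy
  rw [hce.add_particle hU.measurableSet ν hy hz]

theorem IsExterior.hasPG (hU : IsOpen U) {c : Config d → ℝ}
    (hce : IsExterior U c) (ν : Config d) {z : E d} (hz : z ∈ U) : HasPG c ν z 0 := by
  refine hasPG_const (c (ν + particle z)) ?_
  filter_upwards [hU.mem_nhds hz] with y hy
  rw [hce.add_particle hU.measurableSet ν hy hz]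

theorem isExterior_mass (hU : MeasurableSet U) (hV : MeasurableSet V)
    (hUV : U ⊆ V) (f : ℝ≥0∞ → ℝ) : IsExterior U fun μ : Config d => f (μ.1 V) := by
  intro μ ν h1 h2
  have h3 : ∀ η : Config d, η.1 V
      = η.1 U + (restr η Uᶜ).1 V := by
    intro η
    rw [restr_apply _ _ hV, ← measure_inter_add_sdiff V hU, Set.inter_eq_right.2 hUV]; rfl
  beta_reduce
  rw [h3 μ, h3 ν, h1, h2]

theorem SmoothIn.add_particle (hU : MeasurableSet U)
    (h : SmoothIn U φ) (y : E d) : SmoothIn U fun μ => φ (μ + particle y) := by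
  refine ⟨h.1.comp (measurable_add_const _), fun μ n => ?_⟩
  refine (h.contDiffOn_add hU (ν := restr μ Uᶜ + particle y) ?_ n).congr fun x hx => ?_
  · rw [Config.add_apply, restr_compl_mass hU, zero_add, particle_apply _ hU]
    by_cases hy : y ∈ U <;> simp [hy]
  · beta_reduce
    rw [add_assoc]

theorem pgrad_add_particle (φ : Config d → ℝ) (y : E d) (ν : Config d)
    (z : E d) : pgrad (fun μ => φ (μ + particle y)) ν z = pgrad φ (ν + particle y) z := by
  simp only [pgrad, add_right_comm ν _ (particle y)]

/-- Freezing the particles outside a larger set. -/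
theorem SmoothIn.freeze (hU : MeasurableSet U) (hV : MeasurableSet V) (hUV : U ⊆ V)
    (h : SmoothIn U φ) (ζ : Config d) : SmoothIn U fun μ => φ (restr ζ Vᶜ + restr μ V) := by
  refine ⟨h.1.comp ((measurable_restr hV).const_add _), fun μ n => ?_⟩
  refine (h.contDiffOn_add hU (ν := restr ζ Vᶜ + restr (restr μ Uᶜ) V) ?_ n).congr fun x hx => ?_
  · rw [Config.add_apply, restr_apply _ _ hU, restr_apply _ _ hU, restr_apply _ _ (hU.inter hV)]
    have h1 : U ∩ Vᶜ = ∅ := by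
      rw [← Set.disjoint_iff_inter_eq_empty]
      exact Set.disjoint_compl_right_iff_subset.2 hUV
    have h2 : U ∩ V ∩ Uᶜ = ∅ := by
      ext a; simp only [Set.mem_inter_iff, Set.mem_compl_iff, Set.mem_empty_iff_false]; tauto
    simp [h1, h2]
  · have : restr (∑ i, particle (x i)) V = ∑ i, particle (x i) :=
      restr_sum_particle hV fun i => hUV (hx i)
    simp only [restr_add, this]
    congr 1
    abel

theorem HasPG.freeze (hU : IsOpen U) (hV : MeasurableSet V) (hUV : U ⊆ V)
    {ζ ν : Config d} {z g : E d} (hz : z ∈ U) (h : HasPG φ (restr ζ Vᶜ + restr ν V) z g) :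
    HasPG (fun μ => φ (restr ζ Vᶜ + restr μ V)) ν z g := by
  refine h.congr ?_
  filter_upwards [hU.mem_nhds hz] with y hy
  rw [restr_add, restr_particle_of_mem hV (hUV hy), add_assoc]

-- When `U` shrinks to `U'`, the particles of `U \ U'` become frozen. Smoothness on `U` says
-- something only if they are finite in number, so the factor discards the other configurations; the
-- condition itself is not affected by motions inside `U'`.
open Classical in
theorem SmoothIn.mono {U U' : Set (E d)} (hU : MeasurableSet U) (hU' : MeasurableSet U') (hUU : U'
    ⊆ U) (h : SmoothIn U φ) : SmoothIn U' fun μ => (if μ.1 (U \ U') < ∞ then 1 else 0) * φ μ := by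
  have hm : Measurable fun μ : Config d =>
      if μ.1 (U \ U') < ∞ then (1 : ℝ) else 0 :=
    Measurable.ite (measurableSet_lt (Config.measurable_apply (hU.diff hU')) measurable_const)
      measurable_const measurable_const
  refine ⟨hm.mul h.1, fun μ n => ?_⟩
  have hmass : ∀ x : Fin n → E d, (∀ i, x i ∈ U') →
      ((∑ i, particle (x i) + restr μ U'ᶜ : Config d) : Measure (E d)) (U \ U')
        = μ.1 (U \ U') := by
    intro x hx
    rw [Config.add_apply, Config.sum_apply, Finset.sum_eq_zero, zero_add,
      restr_apply _ _ (hU.diff hU')]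
    · congr 1
      ext a; simp only [Set.mem_inter_iff, Set.mem_compl_iff, Set.mem_sdiff]; tauto
    · intro i _
      rw [particle_apply _ (hU.diff hU')]
      simp [hx i]
  by_cases hμ : μ.1 (U \ U') < ∞
  · have hsub : {x : Fin n → E d | ∀ i, x i ∈ U'} ⊆ {x | ∀ i, x i ∈ U} :=
      fun x hx i => hUU (hx i)
    refine ((h.contDiffOn_add hU (ν := restr μ U'ᶜ) ?_ n).mono hsub).congr fun x hx => ?_
    · rw [restr_apply _ _ hU]; exact hμ
    · beta_reduce
      rw [hmass x hx, if_pos hμ, one_mul]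
  · refine (contDiffOn_const (c := (0 : ℝ))).congr fun x hx => ?_
    beta_reduce
    rw [hmass x hx, if_neg hμ, zero_mul]

/-! ### Removal of one particle from the argument of a function -/

theorem integral_eq_sum_particle {ι W : Type*} [NormedAddCommGroup W]
    [NormedSpace ℝ W] [CompleteSpace W] (s : Finset ι) (x : ι → E d) (f : E d → W) :
    ∫ y, f y ∂((∑ i ∈ s, particle (x i) : Config d) : Measure (E d)) = ∑ i ∈ s, f (x i) := by
  have : ((∑ i ∈ s, particle (x i) : Config d) : Measure (E d))
      = ∑ i ∈ s, Measure.dirac (x i) := by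
    rw [AddSubmonoid.coe_finsetSum]; rfl
  rw [this, integral_finsetSum_measure]
  · exact Finset.sum_congr rfl fun i _ => integral_dirac _ _
  · exact fun i _ => integrable_dirac (by simp [enorm_lt_top])

/-- `μ ↦ ∫_V f(μ - δ_x) dμ(x)`. -/
def removal {W : Type*} [NormedAddCommGroup W]
    [NormedSpace ℝ W] (V : Set (E d)) (f : Config d → W) (μ : Config d) : W :=
  ∫ x, f (remIn V (μ, x)) ∂clipKernel V μ

theorem rem_add {n : ℕ} {x : Fin n → E d} (hx : restr ν V = ∑ i, particle (x i))
    (hV : MeasurableSet V) (i : Fin n) : rem ν (x i) + particle (x i) = ν := by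
  have : ∃ ν' : Config d, ν = ν' + particle (x i) := by
    refine ⟨∑ j ∈ Finset.univ.erase i, particle (x j) + restr ν Vᶜ, ?_⟩
    conv_lhs => rw [← restr_add_restr_compl ν hV, hx, ← Finset.sum_erase_add _ _ (Finset.mem_univ i)]
    abel
  obtain ⟨ν', h⟩ := this
  rw [h, rem_add_particle]

theorem removal_eq {W : Type*} [NormedAddCommGroup W] [NormedSpace ℝ W] [CompleteSpace W]
    (hV : MeasurableSet V) (f : Config d → W) (hν : ν.1 V < ∞) {n : ℕ} {x : Fin n → E d} (hxV : ∀ i,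
    x i ∈ V) (hx : restr ν V = ∑ i, particle (x i)) : removal V f ν = ∑ i, f (rem ν (x i)) := by
  rw [removal, clipKernel_apply hV, clip_of_lt hν, hx, integral_eq_sum_particle]
  refine Finset.sum_congr rfl fun i _ => ?_
  rw [remIn, if_pos]
  exact ⟨hν, hxV i, _, (rem_add hx hV i).symm⟩

theorem removal_of_not_lt {W : Type*} [NormedAddCommGroup W] [NormedSpace ℝ W]
    (hV : MeasurableSet V) (f : Config d → W) (hν : ¬ ν.1 V < ∞) : removal V f ν = 0 := by
  rw [removal, clipKernel_apply hV, clip_of_not_lt hν]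
  simp

theorem measurable_removal (hV : MeasurableSet V)
    {f : Config d → ℝ} (hf : Measurable f) : Measurable (removal V f) := by
  have : StronglyMeasurable (uncurry fun (μ : Config d) (x : E d) => f (remIn V (μ, x))) :=
    (hf.comp (measurable_remIn hV)).stronglyMeasurable
  exact this.integral_kernel_prod_right.measurable

theorem mass_add_particle_lt (hV : MeasurableSet V)
    {y : E d} : ((ν + particle y : Config d) : Measure (E d)) V < ∞ ↔ ν.1 V < ∞ := by
  rw [Config.add_apply, particle_apply _ hV, ENNReal.add_lt_top]
  by_cases hy : y ∈ V <;> simp [hy]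

/-- The sum over the particles of `V` splits into the moving ones and the finitely many frozen ones.
Removing a moving particle leaves a smooth function of the other variables; removing a frozen one
changes the frozen configuration. This keeps the class of test functions stable under the adjoint of
averaging. -/
theorem SmoothIn.removal (hU : MeasurableSet U)
    (hV : MeasurableSet V) (hUV : U ⊆ V) (h : SmoothIn U φ) : SmoothIn U (removal V φ) := by
  refine ⟨measurable_removal hV h.1, fun μ n => ?_⟩
  have hmass : ∀ x : Fin n → E d, (∀ i, x i ∈ U) →
      (((∑ i, particle (x i) + restr μ Uᶜ : Config d) : Measure (E d)) V < ∞
        ↔ (restr μ Uᶜ).1 V < ∞) := by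
    intro x hx
    rw [Config.add_apply, mass_sum_particle hV fun i => hUV (hx i), ENNReal.add_lt_top]
    simp
  by_cases hμ : (restr μ Uᶜ).1 V < ∞
  swap
  · refine (contDiffOn_const (c := (0 : ℝ))).congr fun x hx => ?_
    exact removal_of_not_lt hV _ fun h => hμ ((hmass x hx).1 h)
  obtain ⟨m, y, hyV, hy⟩ := exists_restr_eq_sum_particle (restr μ Uᶜ) hV hμ
  have hform : ∀ x : Fin n → E d, (∀ i, x i ∈ U) →
      Bulk.removal V φ (∑ i, particle (x i) + restr μ Uᶜ)
        = ∑ i, φ (∑ j ∈ Finset.univ.erase i, particle (x j) + restr μ Uᶜ)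
          + ∑ j, φ (∑ i, particle (x i) + rem (restr μ Uᶜ) (y j)) := by
    intro x hx
    have hr : restr (∑ i, particle (x i) + restr μ Uᶜ) V
        = ∑ i : Fin (n + m), particle ((Fin.append x y : Fin (n + m) → E d) i) := by
      rw [restr_add, restr_sum_particle hV fun i => hUV (hx i), hy, Fin.sum_univ_add]
      simp
    rw [removal_eq hV φ ((hmass x hx).2 hμ) (x := Fin.append x y) ?_ hr, Fin.sum_univ_add]
    · congr 1
      · refine Finset.sum_congr rfl fun i _ => ?_
        rw [Fin.append_left]
        congr 1
        rw [← Finset.sum_erase_add _ _ (Finset.mem_univ i), add_right_comm, rem_add_particle]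
      · refine Finset.sum_congr rfl fun i _ => ?_
        rw [Fin.append_right]
        congr 1
        conv_lhs => rw [← rem_add hy hV i, ← add_assoc]
        rw [rem_add_particle]
    · intro i
      refine Fin.addCases (fun j => ?_) (fun j => ?_) i
      · rw [Fin.append_left]; exact hUV (hx j)
      · rw [Fin.append_right]; exact hyV j
  refine ContDiffOn.congr (ContDiffOn.add ?_ ?_) hform
  · refine ContDiffOn.sum fun i _ => ?_
    obtain _ | n := n
    · exact i.elim0
    have h1 := h.2 μ n
    have h2 : ContDiff ℝ ((⊤ : ℕ∞) : WithTop ℕ∞)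
      (fun x : Fin (n + 1) → E d => fun j => x (i.succAbove j)) := by fun_prop
    have hmt : MapsTo (fun x : Fin (n + 1) → E d => fun j => x (i.succAbove j))
      {x | ∀ i, x i ∈ U} {x | ∀ i, x i ∈ U} := fun x hx j => hx _
    refine (h1.comp h2.contDiffOn hmt).congr fun x _ => ?_
    simp only [Function.comp]
    congr 2
    rw [← Finset.compl_singleton, ← Fin.image_succAbove_univ,
      Finset.sum_image fun a _ b _ hab => Fin.succAbove_right_injective hab]
  · refine ContDiffOn.sum fun j _ => ?_
    refine h.contDiffOn_add hU ?_ n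
    refine lt_of_le_of_lt ?_ (show (restr μ Uᶜ).1 U < ∞ by
      rw [restr_compl_mass hU]; simp)
    conv_rhs => rw [← rem_add hy hV j, Config.add_apply]
    exact le_self_add

theorem HasPG.removal (hU : IsOpen U)
    (hV : MeasurableSet V) (hUV : U ⊆ V) (h : SmoothIn U φ) (hν : ν.1 V < ∞) {z : E d}
    (hz : z ∈ U) : HasPG (Bulk.removal V φ) ν z (Bulk.removal V (fun μ => pgrad φ μ z) ν) := by
  obtain ⟨m, x, hxV, hx⟩ := exists_restr_eq_sum_particle ν hV hν
  rw [removal_eq hV _ hν hxV hx]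
  have hle : ∀ i, (rem ν (x i)).1 V < ∞ := fun i =>
    (mass_add_particle_lt hV).1 (by rw [rem_add hx hV i]; exact hν)
  have hU' : ∀ i, (rem ν (x i)).1 U < ∞ := fun i =>
    (measure_mono hUV).trans_lt (hle i)
  intro k
  have h1 := HasPG.sum Finset.univ (fun i _ => h.hasPG hU (hU' i) hz) k
  -- The term in which the moving particle itself is removed is `φ ν`, which does not depend on `y`.
  have h2 : HasLineDerivAt ℝ (fun y => ∑ i, φ (rem ν (x i) + particle y) + φ ν)
      ((∑ i, pgrad φ (rem ν (x i)) z) k) z (EuclideanSpace.single k 1) :=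
    HasDerivAt.add_const _ h1
  refine h2.congr_of_eventuallyEq ?_
  filter_upwards [hU.mem_nhds hz] with y hy
  have hr : restr (ν + particle y) V
      = ∑ i : Fin (m + 1), particle ((Fin.snoc x y : Fin (m + 1) → E d) i) := by
    rw [restr_add, restr_particle_of_mem hV (hUV hy), hx, Fin.sum_univ_castSucc]
    simp
  rw [removal_eq hV φ ((mass_add_particle_lt hV).2 hν) (x := Fin.snoc x y) ?_ hr,
    Fin.sum_univ_castSucc]
  · simp only [Fin.snoc_castSucc, Fin.snoc_last]
    congr 1
    · refine Finset.sum_congr rfl fun i _ => ?_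
      congr 1
      conv_lhs => rw [← rem_add hx hV i, add_right_comm]
      rw [rem_add_particle]
    · rw [rem_add_particle]
  · intro i
    refine Fin.lastCases ?_ (fun j => ?_) i
    · rw [Fin.snoc_last]; exact hUV hy
    · rw [Fin.snoc_castSucc]; exact hxV j

/-! ### Linear functions -/

/-- `μ ↦ ∫_U p · x dμ(x)`. -/
def linFun (U : Set (E d)) (p : E d) (μ : Config d) : ℝ :=
  ∫ x, inner ℝ p x ∂clipKernel U μ

theorem linFun_eq (hU : MeasurableSet U) (p : E d) (hν : ν.1 U < ∞) {n : ℕ} {x : Fin n → E d}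
    (hx : restr ν U = ∑ i, particle (x i)) : linFun U p ν = ∑ i, inner ℝ p (x i) := by
  rw [linFun, clipKernel_apply hU, clip_of_lt hν, hx, integral_eq_sum_particle]

theorem smoothIn_linFun (hU : MeasurableSet U) (p : E d) : SmoothIn U (linFun U p) := by
  constructor
  · have : StronglyMeasurable (uncurry fun (_ : Config d) (x : E d) => inner ℝ p x) :=
      (Measurable.inner measurable_const measurable_snd).stronglyMeasurable
    exact this.integral_kernel_prod_right.measurable
  · intro μ n
    have h1 : ContDiff ℝ ((⊤ : ℕ∞) : WithTop ℕ∞)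
        (fun x : Fin n → E d => ∑ i, inner ℝ p (x i)) :=
      ContDiff.sum fun i _ => contDiff_const.inner ℝ (by fun_prop)
    refine h1.contDiffOn.congr fun x hx => ?_
    refine linFun_eq hU p ?_ ?_
    · rw [Config.add_apply, mass_sum_particle hU hx, restr_compl_mass hU]; simp
    · rw [restr_add, restr_sum_particle hU hx, restr_restr _ hU]; simp [restr_empty]

/-- Constant fields are gradients; as test fields they yield the lower bound on `ν_*`. -/
theorem hasPG_linFun (hU : IsOpen U)
    (p : E d) (hν : ν.1 U < ∞) {z : E d} (hz : z ∈ U) : HasPG (linFun U p) ν z p := by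
  obtain ⟨m, x, hxV, hx⟩ := exists_restr_eq_sum_particle ν hU.measurableSet hν
  intro k
  have h0 : HasFDerivAt (fun y : E d => ∑ i, inner ℝ p (x i) + inner ℝ p y)
      (innerSL ℝ p : E d →L[ℝ] ℝ) z :=
    ((innerSL ℝ p : E d →L[ℝ] ℝ).hasFDerivAt).const_add _
  have h1 := h0.hasLineDerivAt (EuclideanSpace.single k 1)
  have h2 : (innerSL ℝ p : E d →L[ℝ] ℝ) (EuclideanSpace.single k 1) = p k := by
    simp [EuclideanSpace.inner_single_right]
  rw [h2] at h1
  refine h1.congr_of_eventuallyEq ?_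
  filter_upwards [hU.mem_nhds hz] with y hy
  have hr : restr (ν + particle y) U
      = ∑ i : Fin (m + 1), particle ((Fin.snoc x y : Fin (m + 1) → E d) i) := by
    rw [restr_add, restr_particle_of_mem hU.measurableSet hy, hx, Fin.sum_univ_castSucc]
    simp
  rw [linFun_eq hU.measurableSet p ((mass_add_particle_lt hU.measurableSet).2 hν) hr,
    Fin.sum_univ_castSucc]
  simp

attribute [irreducible] pgrad

/-! ### The Poincaré inequality -/

theorem sq_lintegral_le {α : Type*} [MeasurableSpace α] (ν : Measure α)
    {f : α → ℝ≥0∞} (hf : AEMeasurable f ν) : (∫⁻ x, f x ∂ν) ^ 2 ≤ ν univ * ∫⁻ x, f x ^ 2 ∂ν := by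
  have h := ENNReal.lintegral_mul_le_Lp_mul_Lq ν Real.HolderConjugate.two_two hf
    (aemeasurable_const (b := (1 : ℝ≥0∞)))
  simp only [Pi.mul_apply, mul_one, ENNReal.one_rpow, lintegral_const, one_mul] at h
  calc (∫⁻ x, f x ∂ν) ^ 2 ≤ ((∫⁻ x, f x ^ (2 : ℝ) ∂ν) ^ (1 / 2 : ℝ) * ν univ ^ (1 / 2 : ℝ)) ^ 2 := by
        gcongr
    _ = _ := by
        rw [mul_pow, ← ENNReal.rpow_natCast, ← ENNReal.rpow_mul, ← ENNReal.rpow_natCast,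
          ← ENNReal.rpow_mul, mul_comm]
        norm_num

theorem enorm_sq_eq {x : ℝ} : ‖x‖ₑ ^ 2 = ofReal (x ^ 2) := by
  rw [← sq_abs, ENNReal.ofReal_pow (abs_nonneg x), Real.enorm_eq_ofReal_abs]

/-- The diagonals of a quadrilateral against its sides: the difference of the two members is `(a - b
+ e - c)²`. -/
theorem enorm_quadrilateral (a b c e : ℝ) : ‖a
    - e‖ₑ ^ 2 + ‖b - c‖ₑ ^ 2 ≤ (‖a - b‖ₑ ^ 2 + ‖e - c‖ₑ ^ 2) + (‖b - e‖ₑ ^ 2 + ‖c - a‖ₑ ^ 2) := by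
  simp only [enorm_sq_eq]
  rw [← ofReal_add (by positivity) (by positivity),
    ← ofReal_add (by positivity) (by positivity),
    ← ofReal_add (by positivity) (by positivity),
    ← ofReal_add (by positivity) (by positivity)]
  refine ofReal_le_ofReal ?_
  nlinarith [sq_nonneg (a - b + e - c)]

/-- The mean square difference between two samples with `n` points. -/
def msDiff (U : Set (E d)) (n : ℕ) (φ : Config d → ℝ) : ℝ≥0∞ :=
  ∫⁻ η, ∫⁻ η', ‖φ η - φ η'‖ₑ ^ 2 ∂lam U n ∂lam U n

/-- The mean square difference when one point is resampled. -/
def msDiffOne (U : Set (E d)) (n : ℕ) (φ : Config d → ℝ) : ℝ≥0∞ :=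
  ∫⁻ x in U, ∫⁻ y in U, ∫⁻ η, ‖φ (η + particle x) - φ (η + particle y)‖ₑ ^ 2 ∂lam U n

theorem measurable_enorm_sub_sq {α : Type*} [MeasurableSpace α]
    {f g : α → ℝ} (hf : Measurable f) (hg : Measurable g) : Measurable fun a => ‖f a - g a‖ₑ ^ 2 :=
  (hf.sub hg).enorm.pow_const 2

/-- The quadrilateral inequality is applied to the four values `φ(η + δ_x)`, `φ(η + δ_y)`, `φ(η' +
δ_x)`, `φ(η' + δ_y)`. The diagonals compare two full samples; one pair of sides changes only the
last point, the other only the remaining ones. After integration both members of each pair are equal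
by symmetry. -/
theorem msDiff_succ_le (U : Set (E d)) (n : ℕ) (hφ : Measurable φ) : msDiff U (n + 1) φ ≤ volume
    U ^ n * msDiffOne U n φ + volume U * ∫⁻ x in U, msDiff U n fun μ => φ (μ + particle x) := by
  set V := (volume : Measure (E d)).restrict U with hV
  set T : E d → E d → Config d → Config d → ℝ≥0∞ := fun x y η η' =>
    ‖φ (η + particle x) - φ (η' + particle y)‖ₑ ^ 2 with hT
  have e1 : msDiff U (n + 1) φ
      = ∫⁻ x, ∫⁻ y, ∫⁻ η, ∫⁻ η', T x y η η' ∂lam U n ∂lam U n ∂V ∂V := by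
    have h1 : ∀ η : Config d, ∫⁻ η', ‖φ η - φ η'‖ₑ ^ 2 ∂lam U (n + 1)
        = ∫⁻ y, ∫⁻ η', ‖φ η - φ (η' + particle y)‖ₑ ^ 2 ∂lam U n ∂V := fun η =>
      lintegral_lam_succ U n (measurable_enorm_sub_sq measurable_const hφ)
    rw [msDiff]
    simp only [h1]
    have hm3 : Measurable fun q : (Pt d) × Config d =>
        ‖φ q.1.1 - φ (q.2 + particle q.1.2)‖ₑ ^ 2 :=
      measurable_enorm_sub_sq (by fun_prop) (by fun_prop)
    rw [lintegral_lam_succ U n]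
    · refine lintegral_congr fun x => ?_
      refine lintegral_lintegral_swap ?_
      exact (hm3.lintegral_prod_right'.comp (((measurable_add_const (particle x)).comp
        measurable_fst).prodMk measurable_snd)).aemeasurable
    · exact hm3.lintegral_prod_right'.lintegral_prod_right'
  have hTm : Measurable fun q : ((E d × E d) × Config d) × Config d =>
      T q.1.1.1 q.1.1.2 q.1.2 q.2 := measurable_enorm_sub_sq (by fun_prop) (by fun_prop)
  set J : (E d → E d → Config d → Config d → ℝ≥0∞) → ℝ≥0∞ := fun S =>
    ∫⁻ x, ∫⁻ y, ∫⁻ η, ∫⁻ η', S x y η η' ∂lam U n ∂lam U n ∂V ∂V with hJ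
  have Jadd : ∀ S S' : E d → E d → Config d → Config d → ℝ≥0∞,
      Measurable (fun q : ((E d × E d) × Config d) × Config d => S q.1.1.1 q.1.1.2 q.1.2 q.2) →
      J (fun x y η η' => S x y η η' + S' x y η η') = J S + J S' := by
    intro S S' hS
    have m1 := hS.lintegral_prod_right' (ν := lam U n)
    have m2 := m1.lintegral_prod_right' (ν := lam U n)
    have m3 := m2.lintegral_prod_right' (ν := V)
    simp only [hJ]
    rw [← lintegral_add_left m3]
    refine lintegral_congr fun x => ?_
    have mx : Measurable fun y => ∫⁻ η, ∫⁻ η', S x y η η' ∂lam U n ∂lam U n :=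
      m2.comp (measurable_prodMk_left (x := x))
    rw [← lintegral_add_left mx]
    refine lintegral_congr fun y => ?_
    have my : Measurable fun η => ∫⁻ η', S x y η η' ∂lam U n :=
      m1.comp (measurable_prodMk_left (x := (x, y)))
    rw [← lintegral_add_left my]
    refine lintegral_congr fun η => ?_
    have mη : Measurable fun η' => S x y η η' :=
      hS.comp (measurable_prodMk_left (x := ((x, y), η)))
    rw [← lintegral_add_left mη]
  have Jmono : ∀ S S' : E d → E d → Config d → Config d → ℝ≥0∞,
      (∀ x y η η', S x y η η' ≤ S' x y η η') → J S ≤ J S' := fun S S' h =>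
    lintegral_mono fun x => lintegral_mono fun y => lintegral_mono fun η =>
      lintegral_mono fun η' => h x y η η'
  have swapxy : ∀ S : E d → E d → Config d → Config d → ℝ≥0∞,
      Measurable (fun q : ((E d × E d) × Config d) × Config d => S q.1.1.1 q.1.1.2 q.1.2 q.2) →
      J (fun x y η η' => S y x η η') = J S := by
    intro S hS
    have m1 := hS.lintegral_prod_right' (ν := lam U n)
    have m2 := m1.lintegral_prod_right' (ν := lam U n)
    simp only [hJ]
    exact (lintegral_lintegral_swap m2.aemeasurable).symm
  have swapη : ∀ S : E d → E d → Config d → Config d → ℝ≥0∞,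
      Measurable (fun q : ((E d × E d) × Config d) × Config d => S q.1.1.1 q.1.1.2 q.1.2 q.2) →
      J (fun x y η η' => S x y η' η) = J S := by
    intro S hS
    simp only [hJ]
    refine lintegral_congr fun x => lintegral_congr fun y => ?_
    have : Measurable fun p : Config d × Config d => S x y p.1 p.2 :=
      hS.comp (((measurable_const (a := (x, y))).prodMk measurable_fst).prodMk measurable_snd)
    exact (lintegral_lintegral_swap this.aemeasurable).symm
  set A : E d → E d → Config d → Config d → ℝ≥0∞ := fun x y η _ =>
    ‖φ (η + particle x) - φ (η + particle y)‖ₑ ^ 2 with hA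
  set B : E d → E d → Config d → Config d → ℝ≥0∞ := fun x _ η η' =>
    ‖φ (η + particle x) - φ (η' + particle x)‖ₑ ^ 2 with hB
  have hAm : Measurable fun q : ((E d × E d) × Config d) × Config d =>
      A q.1.1.1 q.1.1.2 q.1.2 q.2 := measurable_enorm_sub_sq (by fun_prop) (by fun_prop)
  have hBm : Measurable fun q : ((E d × E d) × Config d) × Config d =>
      B q.1.1.1 q.1.1.2 q.1.2 q.2 := measurable_enorm_sub_sq (by fun_prop) (by fun_prop)
  have hBm' : Measurable fun q : ((E d × E d) × Config d) × Config d =>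
      B q.1.1.2 q.1.1.1 q.1.2 q.2 := measurable_enorm_sub_sq (by fun_prop) (by fun_prop)
  have hAm' : Measurable fun q : ((E d × E d) × Config d) × Config d =>
      A q.1.1.1 q.1.1.2 q.2 q.1.2 := measurable_enorm_sub_sq (by fun_prop) (by fun_prop)
  have hTm' : Measurable fun q : ((E d × E d) × Config d) × Config d =>
      T q.1.1.2 q.1.1.1 q.1.2 q.2 := measurable_enorm_sub_sq (by fun_prop) (by fun_prop)
  have key : J T + J T ≤ (J A + J A) + (J B + J B) := by
    calc J T + J T = J T + J (fun x y η η' => T y x η η') := by rw [swapxy T hTm]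
      _ = J (fun x y η η' => T x y η η' + T y x η η') := (Jadd T _ hTm).symm
      _ ≤ J (fun x y η η' => (A x y η η' + A x y η' η) + (B y x η η' + B x y η η')) := by
          refine Jmono _ _ fun x y η η' => ?_
          have := enorm_quadrilateral (φ (η + particle x)) (φ (η + particle y))
            (φ (η' + particle x)) (φ (η' + particle y))
          simp only [hT, hA, hB]
          rw [enorm_sub_rev (φ (η' + particle x)) (φ (η' + particle y)),
            enorm_sub_rev (φ (η + particle x)) (φ (η' + particle x))]
          convert this using 3
      _ = (J A + J A) + (J B + J B) := by
          rw [Jadd _ _ (hAm.add hAm'), Jadd A _ hAm, Jadd _ _ hBm', swapη A hAm, swapxy B hBm]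
  have hTle : J T ≤ J A + J B := by
    rcases eq_or_ne (J A + J B) ∞ with h | h
    · rw [h]; exact le_top
    have h2 : 2 * J T ≤ 2 * (J A + J B) := by
      rw [two_mul, two_mul]; exact key.trans (le_of_eq (by ring))
    exact (ENNReal.mul_le_mul_iff_right (by simp) (by simp)).1 h2
  -- `A` does not depend on `η'`, whence the factor `|U|^n`; `B` does not depend on `y`, whence the
  -- factor `|U|`.
  refine (e1.trans_le hTle).trans (add_le_add (le_of_eq ?_) (le_of_eq ?_))
  · simp only [hJ, hA, lintegral_const, lam_univ]
    rw [msDiffOne, ← lintegral_const_mul]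
    · refine lintegral_congr fun x => ?_
      rw [← lintegral_const_mul]
      · refine lintegral_congr fun y => ?_
        rw [lintegral_mul_const, mul_comm]
        exact measurable_enorm_sub_sq (by fun_prop) (by fun_prop)
      · exact (measurable_enorm_sub_sq (f := fun q : E d × Config d => φ (q.2 + particle x))
          (g := fun q => φ (q.2 + particle q.1)) (by fun_prop) (by fun_prop)).lintegral_prod_right'
    · exact (measurable_enorm_sub_sq
        (f := fun q : (E d × E d) × Config d => φ (q.2 + particle q.1.1))
        (g := fun q => φ (q.2 + particle q.1.2)) (by fun_prop)
        (by fun_prop)).lintegral_prod_right'.lintegral_prod_right'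
  · simp only [hJ, hB, lintegral_const, msDiff]
    rw [← lintegral_const_mul]
    · refine lintegral_congr fun x => ?_
      rw [hV, Measure.restrict_apply_univ, mul_comm]
    · exact (measurable_enorm_sub_sq
        (f := fun q : (E d × Config d) × Config d => φ (q.1.2 + particle q.1.1))
        (g := fun q => φ (q.2 + particle q.1.1)) (by fun_prop)
        (by fun_prop)).lintegral_prod_right'.lintegral_prod_right'

theorem lintegral_rotate {α : Type*} [MeasurableSpace α] (ν : Measure α)
    [SFinite ν] {f : α → α → α → ℝ≥0∞} (hf : Measurable fun q : (α × α) × α => f q.1.1 q.1.2 q.2) :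
    ∫⁻ w, ∫⁻ x, ∫⁻ y, f w x y ∂ν ∂ν ∂ν = ∫⁻ x, ∫⁻ y, ∫⁻ w, f w x y ∂ν ∂ν ∂ν := by
  have h1 : Measurable fun p : α × α => ∫⁻ y, f p.1 p.2 y ∂ν := hf.lintegral_prod_right'
  rw [lintegral_lintegral_swap h1.aemeasurable]
  refine lintegral_congr fun x => ?_
  have h2 : Measurable fun p : α × α => f p.1 x p.2 :=
    hf.comp ((measurable_fst.prodMk (measurable_const (a := x))).prodMk measurable_snd)
  exact lintegral_lintegral_swap h2.aemeasurable

theorem msDiffOne_succ (U : Set (E d)) (n : ℕ) (hφ : Measurable φ) :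
    ∫⁻ w in U, msDiffOne U n (fun μ => φ (μ + particle w)) = msDiffOne U (n + 1) φ := by
  have hm : Measurable fun q : ((E d × E d) × E d) × Config d =>
      ‖φ (q.2 + particle q.1.1.1 + particle q.1.1.2) - φ (q.2 + particle q.1.1.1 + particle q.1.2)‖ₑ ^ 2 :=
    measurable_enorm_sub_sq (by fun_prop) (by fun_prop)
  have h1 : ∀ x y : E d, ∫⁻ η, ‖φ (η + particle x) - φ (η + particle y)‖ₑ ^ 2 ∂lam U (n + 1)
      = ∫⁻ w in U, ∫⁻ η, ‖φ (η + particle w + particle x) - φ (η + particle w + particle y)‖ₑ ^ 2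
        ∂lam U n := fun x y =>
    lintegral_lam_succ U n (F := fun η => ‖φ (η + particle x) - φ (η + particle y)‖ₑ ^ 2)
      (measurable_enorm_sub_sq (by fun_prop) (by fun_prop))
  have h2 := lintegral_rotate ((volume : Measure (E d)).restrict U)
    (f := fun w x y => ∫⁻ η, ‖φ (η + particle w + particle x) - φ (η + particle w + particle y)‖ₑ ^ 2
        ∂lam U n) (hm.lintegral_prod_right' (ν := lam U n))
  simp only [msDiffOne]
  refine Eq.trans ?_ (h2.trans ?_)
  · refine lintegral_congr fun w => lintegral_congr fun x => lintegral_congr fun y =>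
      lintegral_congr fun η => ?_
    rw [add_right_comm η (particle x), add_right_comm η (particle y)]
  · exact lintegral_congr fun x => lintegral_congr fun y => (h1 x y).symm

theorem measurable_msDiffOne (U : Set (E d)) (n : ℕ)
    (hφ : Measurable φ) : Measurable fun w => msDiffOne U n fun μ => φ (μ + particle w) := by
  have hm : Measurable fun q : ((E d × E d) × E d) × Config d =>
      ‖φ (q.2 + particle q.1.1.2 + particle q.1.1.1) - φ (q.2 + particle q.1.2 + particle q.1.1.1)‖ₑ ^ 2 :=
    measurable_enorm_sub_sq (by fun_prop) (by fun_prop)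
  exact hm.lintegral_prod_right'.lintegral_prod_right'.lintegral_prod_right'

theorem msDiff_zero (U : Set (E d)) (hφ : Measurable φ) : msDiff U 0 φ = 0 := by
  have hm : Measurable fun p : Config d × Config d => ‖φ p.1 - φ p.2‖ₑ ^ 2 :=
    measurable_enorm_sub_sq (by fun_prop) (by fun_prop)
  rw [msDiff, lam_zero, lintegral_dirac' _ hm.lintegral_prod_right']
  change ∫⁻ y, ‖φ 0 - φ y‖ₑ ^ 2 ∂Measure.dirac (0 : Config d) = 0
  rw [lintegral_dirac' _ (measurable_enorm_sub_sq measurable_const hφ)]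
  simp

/-- Efron-Stein: each step of the induction contributes the same resampling term, because
integrating `msDiffOne` over one frozen point gives `msDiffOne` with one more point. -/
theorem msDiff_le (U : Set (E d)) (n : ℕ)
    (hφ : Measurable φ) : msDiff U (n + 1) φ ≤ (n + 1) * volume U ^ n * msDiffOne U n φ := by
  induction n generalizing φ with
  | zero =>
    refine (msDiff_succ_le U 0 hφ).trans (le_of_eq ?_)
    have h0 : ∀ w : E d, msDiff U 0 (fun μ => φ (μ + particle w)) = 0 := fun w =>
      msDiff_zero U (by fun_prop)
    simp [h0]
  | succ n ih =>
    refine (msDiff_succ_le U (n + 1) hφ).trans ?_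
    calc _ ≤ volume U ^ (n + 1) * msDiffOne U (n + 1) φ + volume U * ∫⁻ w in U,
          (n + 1) * volume U ^ n * msDiffOne U n (fun μ => φ (μ + particle w)) := by
          gcongr with w
          exact ih (by fun_prop)
      _ = _ := by
          rw [lintegral_const_mul, msDiffOne_succ U n hφ]
          · push_cast; ring
          · exact measurable_msDiffOne U n hφ

theorem lintegral_comp_add_smul_le {F : E d → ℝ≥0∞} (hF : Measurable F)
    (c : E d) {s : ℝ} (hs : 1 / 2 ≤ s) : ∫⁻ y, F (c + s • y) ≤ 2 ^ d * ∫⁻ y, F y := by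
  have hs0 : s ≠ 0 := by linarith
  have hm : Measurable fun y : E d => F (c + y) := hF.comp (measurable_const_add c)
  have h1 : ∫⁻ y, F (c + s • y) = ofReal |(s ^ d)⁻¹| * ∫⁻ y, F y := by
    rw [← lintegral_map (g := fun y : E d => s • y) hm (measurable_const_smul s),
      Measure.map_addHaar_smul _ hs0, lintegral_smul_measure, lintegral_add_left_eq_self]
    simp
  rw [h1]
  gcongr
  rw [abs_of_pos (by positivity), ← inv_pow]
  have : (s⁻¹) ^ d ≤ 2 ^ d := by
    gcongr
    rw [inv_le_comm₀ (by linarith) (by norm_num)]; linarith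
  calc ofReal (s⁻¹ ^ d) ≤ ofReal (2 ^ d) := ofReal_le_ofReal this
    _ = 2 ^ d := by rw [ENNReal.ofReal_pow (by norm_num)]; simp

theorem enorm_sub_sq_le_segment (hc : Convex ℝ U) {h : E d → ℝ} {g : E d → E d} (hg : Measurable g)
    (hh : ∀ z ∈ U, HasFDerivAt h (innerSL ℝ (g z)) z) {x y : E d} (hx : x ∈ U) (hy : y ∈ U) :
    ‖h x - h y‖ₑ ^ 2 ≤ ‖y - x‖ₑ ^ 2 * ∫⁻ s in Icc (0 : ℝ) 1, ‖g ((1 - s) • x + s • y)‖ₑ ^ 2 := by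
  set f' : ℝ → ℝ := fun s => inner ℝ (g ((1 - s) • x + s • y)) (y - x) with hf'
  have hgm : Measurable fun s : ℝ => g ((1 - s) • x + s • y) := hg.comp (by fun_prop)
  have hf'm : Measurable f' := hgm.inner measurable_const
  have hder : ∀ s ∈ Set.uIcc (0 : ℝ) 1,
      HasDerivAt (fun s : ℝ => h ((1 - s) • x + s • y)) (f' s) s := by
    intro s hs
    rw [Set.uIcc_of_le zero_le_one] at hs
    have hmem : (1 - s) • x + s • y ∈ U :=
      hc hx hy (by linarith [hs.2]) hs.1 (by ring)
    have h1 : HasDerivAt (fun s : ℝ => (1 - s) • x + s • y) (y - x) s := by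
      have h2 := (((hasDerivAt_id' s).const_sub 1).smul_const x).fun_add
        ((hasDerivAt_id' s).smul_const y)
      simpa [sub_eq_neg_add] using h2
    have h3 := (hh _ hmem).comp_hasDerivAt s h1
    simpa [hf', Function.comp_def] using h3
  have key : ‖h x - h y‖ₑ ≤ ∫⁻ s in Icc (0 : ℝ) 1, ‖f' s‖ₑ := by
    by_cases hi : IntervalIntegrable f' volume 0 1
    · have := intervalIntegral.integral_eq_sub_of_hasDerivAt hder hi
      simp only [sub_zero, one_smul, sub_self, zero_smul, zero_add, add_zero] at this
      rw [enorm_sub_rev, ← this, intervalIntegral.integral_of_le zero_le_one,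
        setLIntegral_congr (Ioc_ae_eq_Icc (μ := volume) (a := (0 : ℝ)) (b := 1)).symm]
      exact enorm_integral_le_lintegral_enorm _
    -- If the derivative is not integrable along the segment, the right side is infinite and nothing
    -- has to be shown; no integrability of `g` is assumed.
    · have : ∫⁻ s in Icc (0 : ℝ) 1, ‖f' s‖ₑ = ∞ := by
        by_contra hne
        apply hi
        rw [intervalIntegrable_iff_integrableOn_Icc_of_le zero_le_one]
        exact ⟨hf'm.aestronglyMeasurable, lt_top_iff_ne_top.2 hne⟩
      rw [this]; exact le_top
  calc ‖h x - h y‖ₑ ^ 2 ≤ (∫⁻ s in Icc (0 : ℝ) 1, ‖f' s‖ₑ) ^ 2 := by gcongr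
    _ ≤ _ := sq_lintegral_le _ hf'm.enorm.aemeasurable
    _ = ∫⁻ s in Icc (0 : ℝ) 1, ‖f' s‖ₑ ^ 2 := by simp
    _ ≤ ∫⁻ s in Icc (0 : ℝ) 1, ‖y - x‖ₑ ^ 2 * ‖g ((1 - s) • x + s • y)‖ₑ ^ 2 := by
        refine lintegral_mono fun s => ?_
        rw [← mul_pow]
        gcongr
        rw [mul_comm, ← ofReal_norm, ← ofReal_norm, ← ofReal_norm,
          ← ofReal_mul (norm_nonneg _)]
        exact ofReal_le_ofReal (norm_inner_le_norm _ _)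
    _ = _ := lintegral_const_mul _ (hgm.enorm.pow_const 2)

/-- Differences are integrated along segments. For `s ≥ 1/2` the change of variables is made in the
endpoint `y`, for `s < 1/2` in the endpoint `x`, so that the Jacobian never exceeds `2^d`. -/
theorem poincare_convex (hU : MeasurableSet U)
    (hc : Convex ℝ U) {D : ℝ≥0∞} (hD : ∀ x ∈ U, ∀ y ∈ U, ‖y - x‖ₑ ≤ D) {h : E d → ℝ} {g : E d → E d}
    (hg : Measurable g) (hh : ∀ z ∈ U, HasFDerivAt h (innerSL ℝ (g z)) z) : ∫⁻ x in U,
    ∫⁻ y in U, ‖h x - h y‖ₑ ^ 2 ≤ D ^ 2 * (2 ^ d * volume U) * ∫⁻ z in U, ‖g z‖ₑ ^ 2 := by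
  set F : E d → ℝ≥0∞ := U.indicator fun z => ‖g z‖ₑ ^ 2 with hF
  have hFm : Measurable F := (hg.enorm.pow_const 2).indicator hU
  have hmul : Measurable fun q : (E d × E d) × ℝ => F ((1 - q.2) • q.1.1 + q.2 • q.1.2) :=
    hFm.comp (by fun_prop)
  have hmul2 : Measurable fun q : (E d × ℝ) × E d => F ((1 - q.1.2) • q.1.1 + q.1.2 • q.2) :=
    hFm.comp (by fun_prop)
  have hs : ∀ s ∈ Icc (0 : ℝ) 1, ∫⁻ x in U, ∫⁻ y in U, F ((1 - s) • x + s • y)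
      ≤ 2 ^ d * volume U * ∫⁻ z, F z := by
    intro s hs
    have hone : ∀ s : ℝ, 1 / 2 ≤ s → ∫⁻ x in U, ∫⁻ y in U, F ((1 - s) • x + s • y)
        ≤ 2 ^ d * volume U * ∫⁻ z, F z := by
      intro s hs
      calc _ ≤ ∫⁻ x in U, 2 ^ d * ∫⁻ z, F z := lintegral_mono fun x =>
            (setLIntegral_le_lintegral U _).trans (lintegral_comp_add_smul_le hFm _ hs)
        _ = _ := by rw [lintegral_const, Measure.restrict_apply_univ]; ring
    by_cases h2 : 1 / 2 ≤ s
    · exact hone s h2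
    · have h3 := hone (1 - s) (by linarith)
      rw [lintegral_lintegral_swap]
      · convert h3 using 6
        rw [add_comm]; simp
      · exact (hFm.comp (by fun_prop)).aemeasurable
  calc ∫⁻ x in U, ∫⁻ y in U, ‖h x - h y‖ₑ ^ 2
      ≤ ∫⁻ x in U, ∫⁻ y in U, D ^ 2 * ∫⁻ s in Icc (0 : ℝ) 1, F ((1 - s) • x + s • y) := by
        refine setLIntegral_mono' hU fun x hx => setLIntegral_mono' hU fun y hy => ?_
        refine (enorm_sub_sq_le_segment hc hg hh hx hy).trans ?_
        refine mul_le_mul' (pow_le_pow_left' (hD x hx y hy) 2)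
          (setLIntegral_mono' measurableSet_Icc fun s hs => ?_)
        rw [hF, indicator_of_mem (hc hx hy (by linarith [hs.2]) hs.1 (by ring))]
    _ = D ^ 2 * ∫⁻ x in U, ∫⁻ y in U, ∫⁻ s in Icc (0 : ℝ) 1, F ((1 - s) • x + s • y) := by
        have m1 : Measurable fun p : E d × E d =>
            ∫⁻ s in Icc (0 : ℝ) 1, F ((1 - s) • p.1 + s • p.2) := hmul.lintegral_prod_right'
        rw [← lintegral_const_mul _ m1.lintegral_prod_right']
        refine lintegral_congr fun x => ?_
        have m2 : Measurable fun y : E d => ∫⁻ s in Icc (0 : ℝ) 1, F ((1 - s) • x + s • y) :=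
          m1.comp (measurable_prodMk_left (x := x))
        exact lintegral_const_mul _ m2
    _ = D ^ 2 * ∫⁻ s in Icc (0 : ℝ) 1, ∫⁻ x in U, ∫⁻ y in U, F ((1 - s) • x + s • y) := by
        congr 1
        have e1 : ∀ x : E d, ∫⁻ y in U, ∫⁻ s in Icc (0 : ℝ) 1, F ((1 - s) • x + s • y)
            = ∫⁻ s in Icc (0 : ℝ) 1, ∫⁻ y in U, F ((1 - s) • x + s • y) := fun x =>
          lintegral_lintegral_swap (hFm.comp (by fun_prop)).aemeasurable
        simp only [e1]
        exact lintegral_lintegral_swap hmul2.lintegral_prod_right'.aemeasurable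
    _ ≤ D ^ 2 * ∫⁻ s in Icc (0 : ℝ) 1, 2 ^ d * volume U * ∫⁻ z, F z := by
        have := setLIntegral_mono' (μ := volume) (measurableSet_Icc (a := (0 : ℝ)) (b := 1)) hs
        exact mul_le_mul_right this _
    _ = _ := by
        rw [lintegral_const, Measure.restrict_apply_univ, Real.volume_Icc, hF,
          lintegral_indicator hU]
        simp [mul_assoc]

theorem SmoothIn.hasFDerivAt (hU : IsOpen U) (hφ : SmoothIn U φ) (hν : ν.1 U < ∞) {z : E d}
    (hz : z ∈ U) : HasFDerivAt (fun y => φ (ν + particle y)) (innerSL ℝ (pgrad φ ν z)) z := by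
  have h1 := hφ.contDiffOn_add hU.measurableSet hν 1
  have h2 : ContDiffOn ℝ ((⊤ : ℕ∞) : WithTop ℕ∞) (fun y : E d => φ (ν + particle y)) U := by
    have h3 : ContDiff ℝ ((⊤ : ℕ∞) : WithTop ℕ∞) (fun y : E d => (fun _ : Fin 1 => y)) := by
      fun_prop
    refine (h1.comp h3.contDiffOn (fun y hy _ => hy)).congr fun y hy => ?_
    simp [add_comm]
  have h4 : DifferentiableAt ℝ (fun y : E d => φ (ν + particle y)) z :=
    (h2.differentiableOn (by simp)).differentiableAt (hU.mem_nhds hz)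
  have h5 : HasPG φ ν z (WithLp.toLp 2 fun k =>
      fderiv ℝ (fun y : E d => φ (ν + particle y)) z (EuclideanSpace.single k 1)) :=
    fun k => h4.hasFDerivAt.hasLineDerivAt _
  have h6 : innerSL ℝ (pgrad φ ν z) = fderiv ℝ (fun y : E d => φ (ν + particle y)) z := by
    rw [h5.pgrad_eq]
    apply ContinuousLinearMap.coe_injective
    refine (EuclideanSpace.basisFun (Fin d) ℝ).toBasis.ext fun k => ?_
    simp [EuclideanSpace.inner_single_right]
  rw [h6]
  exact h4.hasFDerivAt

theorem msDiffOne_le (hU : IsOpen U)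
    (hc : Convex ℝ U) {D : ℝ≥0∞} (hD : ∀ x ∈ U, ∀ y ∈ U, ‖y - x‖ₑ ≤ D) (hφ : SmoothIn U φ)
    {ζ : Config d} (hζ : (ζ : Measure (E d)) U < ∞) (n : ℕ) : msDiffOne U n (fun η => φ (ζ + η))
    ≤ D ^ 2 * (2 ^ d * volume U) * ∫⁻ η, (∫⁻ z in U, ‖pgrad φ (ζ + η) z‖ₑ ^ 2) ∂lam U n := by
  have hφm := hφ.1
  have m0 : Measurable fun q : (E d × E d) × Config d =>
      ‖φ (ζ + (q.2 + particle q.1.1)) - φ (ζ + (q.2 + particle q.1.2))‖ₑ ^ 2 :=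
    measurable_enorm_sub_sq (by fun_prop) (by fun_prop)
  have m1 : Measurable fun q : (E d × Config d) × E d =>
      ‖φ (ζ + (q.1.2 + particle q.1.1)) - φ (ζ + (q.1.2 + particle q.2))‖ₑ ^ 2 :=
    measurable_enorm_sub_sq (by fun_prop) (by fun_prop)
  have e1 : ∀ x : E d, ∫⁻ y in U, ∫⁻ η, ‖φ (ζ + (η + particle x)) - φ (ζ + (η + particle y))‖ₑ ^ 2 ∂lam U n
      = ∫⁻ η, (∫⁻ y in U, ‖φ (ζ + (η + particle x)) - φ (ζ + (η + particle y))‖ₑ ^ 2) ∂lam U n := by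
    intro x
    refine lintegral_lintegral_swap ?_
    exact (measurable_enorm_sub_sq (by fun_prop) (by fun_prop)).aemeasurable
  have mg : Measurable fun p : Pt d => ‖pgrad φ (ζ + p.1) p.2‖ₑ ^ 2 :=
    ((measurable_pgrad hφm).comp (by fun_prop : Measurable fun p : Pt d =>
      (ζ + p.1, p.2))).enorm.pow_const 2
  rw [msDiffOne]
  simp only [e1]
  rw [lintegral_lintegral_swap m1.lintegral_prod_right'.aemeasurable,
    ← lintegral_const_mul _ mg.lintegral_prod_right']
  refine lintegral_mono_ae ?_
  filter_upwards [ae_lam hU.measurableSet n] with η hη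
  have hfin : ((ζ + η : Config d) : Measure (E d)) U < ∞ := by
    rw [Config.add_apply, hη.2]; exact ENNReal.add_lt_top.2 ⟨hζ, by simp⟩
  have := poincare_convex (h := fun y => φ (ζ + η + particle y)) (g := pgrad φ (ζ + η))
    hU.measurableSet hc hD (Measurable.of_uncurry_left (measurable_pgrad hφm))
    fun z hz => hφ.hasFDerivAt hU hfin hz
  simpa only [add_assoc] using this

/-- Jensen's inequality in the second variable. Integrability of `f` is not assumed: when the right
side is finite, one section `y ↦ f x - f y` is square integrable, and this is enough. -/
theorem variance_le_msDiff {α : Type*}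
    [MeasurableSpace α] (ν : Measure α) [IsFiniteMeasure ν] {f : α → ℝ} (hf : Measurable f) :
    ∫⁻ x, ‖f x - ⨍ y, f y ∂ν‖ₑ ^ 2 ∂ν ≤ (ν univ)⁻¹ * ∫⁻ x, ∫⁻ y, ‖f x - f y‖ₑ ^ 2 ∂ν ∂ν := by
  rcases eq_or_ne ν 0 with h0 | h0
  · subst h0; simp
  have hu0 : ν univ ≠ 0 := by simp [h0]
  have hut : ν univ ≠ ∞ := measure_ne_top _ _
  set W := ∫⁻ x, ∫⁻ y, ‖f x - f y‖ₑ ^ 2 ∂ν ∂ν with hW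
  rcases eq_or_ne W ∞ with hWt | hWt
  · rw [hWt, ENNReal.mul_top (by simp)]; exact le_top
  have hm : Measurable fun p : α × α => ‖f p.1 - f p.2‖ₑ ^ 2 :=
    measurable_enorm_sub_sq (by fun_prop) (by fun_prop)
  have hitg : Integrable f ν := by
    have hae := ae_lt_top hm.lintegral_prod_right' hWt
    have hne : NeBot (ae ν) := ae_neBot.2 h0
    obtain ⟨x, hx⟩ := hae.exists
    have h2 : MemLp (fun y => f x - f y) 2 ν := by
      refine ⟨(measurable_const.sub hf).aestronglyMeasurable, ?_⟩
      rw [eLpNorm_lt_top_iff_lintegral_rpow_enorm_lt_top (by simp) (by simp)]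
      simpa using hx
    have h3 := (integrable_const (f x)).sub (h2.integrable (by norm_num))
    exact h3.congr (Eventually.of_forall fun y => by simp)
  rw [hW, ← lintegral_const_mul _ hm.lintegral_prod_right']
  refine lintegral_mono fun x => ?_
  have h1 : f x - ⨍ y, f y ∂ν = ⨍ y, (f x - f y) ∂ν := by
    rw [average_eq, average_eq, integral_sub (integrable_const _) hitg, smul_sub, integral_const,
      smul_smul, inv_mul_cancel₀ (by simpa [Measure.real, ENNReal.toReal_eq_zero_iff, hut] using hu0),
      one_smul]
  rw [h1, average]
  refine (pow_le_pow_left' (enorm_integral_le_lintegral_enorm _) 2).trans ?_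
  refine (sq_lintegral_le _ (measurable_const.sub hf).enorm.aemeasurable).trans (le_of_eq ?_)
  rw [lintegral_smul_measure, Measure.smul_apply, smul_eq_mul, ENNReal.inv_mul_cancel hu0 hut,
    one_mul, smul_eq_mul]
  rfl

/-- The average over the positions of the particles in `U`, their number being fixed. -/
def fibreAvg (U : Set (E d)) (φ : Config d → ℝ) (μ : Config d) : ℝ :=
  ⨍ η, φ (restr μ Uᶜ + η) ∂lam U ⌊(μ.1 U).toReal⌋₊

theorem isExterior_fibreAvg (U : Set (E d)) (φ : Config d → ℝ) :
    IsExterior U (fibreAvg U φ) := fun μ ν h h' => by rw [fibreAvg, fibreAvg, h, h']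

theorem measurable_fibreAvg (hU : MeasurableSet U)
    (hφ : Measurable φ) : Measurable (fibreAvg U φ) := by
  have h1 : ∀ n : ℕ, Measurable fun ζ : Config d => ⨍ η, φ (ζ + η) ∂lam U n := by
    intro n
    have h2 : StronglyMeasurable fun p : Config d × Config d => φ (p.1 + p.2) :=
      Measurable.stronglyMeasurable (by fun_prop)
    simp only [average_eq]
    have h3 : Measurable fun ζ : Config d => ∫ η, φ (ζ + η) ∂lam U n :=
      (h2.integral_prod_right' (ν := lam U n)).measurable
    exact h3.const_smul ((lam U n).real univ)⁻¹
  have h2 : Measurable fun p : ℕ × Config d => ⨍ η, φ (p.2 + η) ∂lam U p.1 :=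
    measurable_from_prod_countable_right h1
  have h3 : Measurable fun μ : Config d =>
      (⌊(μ.1 U).toReal⌋₊, restr μ Uᶜ) :=
    (Nat.measurable_floor.comp (Config.measurable_apply hU).ennreal_toReal).prodMk
      (measurable_restr hU.compl)
  have h4 := h2.comp h3
  have h5 : fibreAvg U φ = (fun p : ℕ × Config d => ⨍ η, φ (p.2 + η) ∂lam U p.1) ∘
      fun μ : Config d => (⌊(μ.1 U).toReal⌋₊, restr μ Uᶜ) := by
    funext μ
    simp only [fibreAvg, Function.comp_apply]
  rw [h5]
  exact h4

/-- Poincaré inequality for functions of the particles in a bounded convex open set. -/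
theorem exists_poincare (hρ : 0 ≤ ρ) (hU : IsOpen U)
    (hc : Convex ℝ U) (hb : Bornology.IsBounded U) (h0 : volume U ≠ 0) : ∃ K : ℝ≥0∞, K ≠ ∞ ∧
    ∀ φ : Config d → ℝ, SmoothIn U φ → ∫⁻ μ, ‖φ μ - fibreAvg U φ μ‖ₑ ^ 2 ∂poissonLaw d ρ ≤ K * ∫⁻ μ,
    (∫⁻ z in U, ‖pgrad φ μ z‖ₑ ^ 2) ∂poissonLaw d ρ := by
  have hUm := hU.measurableSet
  have ht : volume U ≠ ∞ := hb.measure_lt_top.ne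
  have : IsFiniteMeasure ((volume : Measure (E d)).restrict U) := ⟨by simp [hb.measure_lt_top]⟩
  obtain ⟨D, hD⟩ : ∃ D : ℝ, ∀ x ∈ U, ∀ y ∈ U, ‖y - x‖ ≤ D := by
    obtain ⟨C, hC⟩ := hb.exists_norm_le
    exact ⟨C + C, fun x hx y hy => (norm_sub_le _ _).trans (add_le_add (hC y hy) (hC x hx))⟩
  have hD' : ∀ x ∈ U, ∀ y ∈ U, ‖y - x‖ₑ ≤ ofReal D := fun x hx y hy => by
    rw [← ofReal_norm]; exact ofReal_le_ofReal (hD x hx y hy)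
  set c : ℝ≥0∞ := ofReal D ^ 2 * (2 ^ d * volume U) with hcdef
  set K : ℝ≥0∞ := ofReal ρ * (volume U)⁻¹ * c with hK
  refine ⟨K, ?_, fun φ hφ => ?_⟩
  · refine ENNReal.mul_ne_top (ENNReal.mul_ne_top ofReal_ne_top (by simpa using h0)) ?_
    exact ENNReal.mul_ne_top (by simp) (ENNReal.mul_ne_top (by simp) ht)
  have hφm := hφ.1
  have hm1 : Measurable fun μ : Config d => ‖φ μ - fibreAvg U φ μ‖ₑ ^ 2 :=
    measurable_enorm_sub_sq hφm (measurable_fibreAvg hUm hφm)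
  have hm2 : Measurable fun μ : Config d => ∫⁻ z in U, ‖pgrad φ μ z‖ₑ ^ 2 :=
    ((measurable_pgrad hφm).enorm.pow_const 2).lintegral_prod_right'
  have hm1' : Measurable fun p : Config d × Config d =>
      ‖φ (restr p.2 Uᶜ + p.1) - fibreAvg U φ (restr p.2 Uᶜ + p.1)‖ₑ ^ 2 :=
    hm1.comp (((measurable_restr hUm.compl).comp measurable_snd).add measurable_fst)
  have hm2' : Measurable fun p : Config d × Config d =>
      ∫⁻ z in U, ‖pgrad φ (restr p.2 Uᶜ + p.1) z‖ₑ ^ 2 :=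
    hm2.comp (((measurable_restr hUm.compl).comp measurable_snd).add measurable_fst)
  have hm3 : Measurable fun μ : Config d =>
      ∫⁻ η, (∫⁻ z in U, ‖pgrad φ (restr μ Uᶜ + η) z‖ₑ ^ 2) ∂fv ρ U :=
    (hm2'.comp measurable_swap).lintegral_prod_right'
  rw [lintegral_poissonLaw_eq hρ hUm hb hm1, lintegral_poissonLaw_eq hρ hUm hb hm2,
    lintegral_lintegral_swap hm1'.aemeasurable,
    lintegral_lintegral_swap (μ := fv ρ U) (ν := poissonLaw d ρ)
      (f := fun η μ => ∫⁻ z in U, ‖pgrad φ (restr μ Uᶜ + η) z‖ₑ ^ 2) hm2'.aemeasurable,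
    ← lintegral_const_mul _ hm3]
  refine lintegral_mono fun μ => ?_
  set ζ := restr μ Uᶜ with hζdef
  have hζ : (ζ : Measure (E d)) U = 0 := restr_compl_mass hUm μ
  have hlevel : ∀ n : ℕ, ∫⁻ η, ‖φ (ζ + η) - fibreAvg U φ (ζ + η)‖ₑ ^ 2 ∂lam U n
      ≤ (volume U ^ n)⁻¹ * msDiff U n fun η => φ (ζ + η) := by
    intro n
    have h1 := variance_le_msDiff (lam U n) (f := fun η => φ (ζ + η)) (by fun_prop)
    rw [lam_univ] at h1
    refine (le_of_eq (lintegral_congr_ae ?_)).trans h1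
    filter_upwards [ae_lam hUm n] with η hη
    have h2 : fibreAvg U φ (ζ + η) = ⨍ η, φ (ζ + η) ∂lam U n := by
      rw [fibreAvg, Config.add_apply, hζ, hη.2, zero_add, restr_add, restr_compl_eq_zero hη.1,
        add_zero, hζdef, restr_compl_idem hUm]
      simp
    rw [h2]
  rw [lintegral_fv, lintegral_fv, tsum_eq_zero_add' ENNReal.summable, ← ENNReal.tsum_mul_left]
  have hz : ∫⁻ η, ‖φ (ζ + η) - fibreAvg U φ (ζ + η)‖ₑ ^ 2 ∂lam U 0 = 0 := by
    have := hlevel 0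
    rw [msDiff_zero U (by fun_prop), mul_zero] at this
    exact le_antisymm this bot_le
  rw [hz, mul_zero, zero_add]
  refine ENNReal.tsum_le_tsum fun n => ?_
  set G := ∫⁻ η, (∫⁻ z in U, ‖pgrad φ (ζ + η) z‖ₑ ^ 2) ∂lam U n with hG
  set w := Real.exp (-(ρ * volume.real U)) * ρ ^ n / n.factorial with hw
  have hw0 : 0 ≤ w := by positivity
  -- The variance with `n + 1` particles is paid by gradients with `n` other particles. The weight
  -- of level `n + 1` is `ρ / (n + 1)` times that of level `n`, and this `n + 1` cancels the one of
  -- `msDiff_le`.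
  have hwn : Real.exp (-(ρ * volume.real U)) * ρ ^ (n + 1) / (n + 1).factorial
      = ρ * w * ((n : ℝ) + 1)⁻¹ := by
    rw [hw, Nat.factorial_succ]; push_cast; field_simp; ring
  rw [hwn, ofReal_mul (by positivity), ofReal_mul hρ,
    ENNReal.ofReal_inv_of_pos (by positivity)]
  have hn1 : ofReal ((n : ℝ) + 1) = (n : ℝ≥0∞) + 1 := by
    rw [ofReal_add (by positivity) (by norm_num)]; simp
  rw [hn1]
  calc _ ≤ ofReal ρ * ofReal w * ((n : ℝ≥0∞) + 1)⁻¹ *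
        ((volume U ^ (n + 1))⁻¹ * ((n + 1) * volume U ^ n * (c * G))) := by
        gcongr
        refine (hlevel (n + 1)).trans ?_
        gcongr
        refine (msDiff_le U n (by fun_prop)).trans ?_
        gcongr
        exact msDiffOne_le hU hc hD' hφ (by simp [hζ]) n
    _ = (((n : ℝ≥0∞) + 1)⁻¹ * ((n : ℝ≥0∞) + 1)) * ((volume U ^ n)⁻¹ * volume U ^ n) *
        (K * (ofReal w * G)) := by
        rw [pow_succ, ENNReal.mul_inv (Or.inr ht) (Or.inr h0), hK]
        ring
    _ = _ := by
        rw [ENNReal.inv_mul_cancel (by simp) (by finiteness),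
          ENNReal.inv_mul_cancel (pow_ne_zero _ h0) (ENNReal.pow_ne_top ht)]
        simp

/-! ### Square-integrable vector functions -/

/-- The squared `L²` norm. -/
def msq {α W : Type*}
    [MeasurableSpace α] [NormedAddCommGroup W] (m : Measure α) (f : α → W) : ℝ≥0∞ :=
  ∫⁻ p, ‖f p‖ₑ ^ 2 ∂m

section L2

variable {α W : Type*} [MeasurableSpace α] [NormedAddCommGroup W] {m : Measure α}

theorem eLpNorm_two_sq (m : Measure α) (f : α → W) : eLpNorm f 2 m ^ 2 = msq m f := by
  rw [eLpNorm_eq_lintegral_rpow_enorm_toReal (by simp) (by simp), msq, ← ENNReal.rpow_natCast,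
    ← ENNReal.rpow_mul]
  norm_num

theorem memLp_two_iff_msq {f : α → W}
    (hf : AEStronglyMeasurable f m) : MemLp f 2 m ↔ msq m f < ∞ := by
  rw [← eLpNorm_two_sq, ENNReal.pow_lt_top_iff]
  simp [MemLp, hf]

theorem msq_congr {f h : α → W} (hfh : f =ᵐ[m] h) : msq m f = msq m h :=
  lintegral_congr_ae (hfh.mono fun p hp => by simp only [hp])

theorem enorm_add_sq_le (a b : W) : ‖a + b‖ₑ ^ 2 ≤ 2 * ‖a‖ₑ ^ 2 + 2 * ‖b‖ₑ ^ 2 := by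
  have h1 : ‖a + b‖ ^ 2 ≤ 2 * ‖a‖ ^ 2 + 2 * ‖b‖ ^ 2 := by
    have := norm_add_le a b
    nlinarith [sq_nonneg (‖a‖ - ‖b‖), norm_nonneg (a + b)]
  have h2 : ∀ c : W, ‖c‖ₑ ^ 2 = ofReal (‖c‖ ^ 2) := fun c => by
    rw [ENNReal.ofReal_pow (norm_nonneg c), ofReal_norm]
  rw [h2, h2, h2, ← ENNReal.ofReal_ofNat 2, ← ofReal_mul (by norm_num),
    ← ofReal_mul (by norm_num), ← ofReal_add (by positivity) (by positivity)]
  exact ofReal_le_ofReal h1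

theorem enorm_sub_sq_le (a b : W) : ‖a - b‖ₑ ^ 2 ≤ 2 * ‖a‖ₑ ^ 2 + 2 * ‖b‖ₑ ^ 2 := by
  have := enorm_add_sq_le a (-b)
  rwa [enorm_neg, ← sub_eq_add_neg] at this

variable [MeasurableSpace W] [BorelSpace W]

theorem msq_add_le {f h : α → W}
    (hf : Measurable f) : msq m (fun p => f p + h p) ≤ 2 * msq m f + 2 * msq m h := by
  calc _ ≤ ∫⁻ p, (2 * ‖f p‖ₑ ^ 2 + 2 * ‖h p‖ₑ ^ 2) ∂m := lintegral_mono fun p => enorm_add_sq_le _ _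
    _ = _ := by
      rw [lintegral_add_left ((hf.enorm.pow_const 2).const_mul 2),
        lintegral_const_mul' _ _ (by simp), lintegral_const_mul' _ _ (by simp)]
      rfl

theorem msq_sub_le {f h : α → W}
    (hf : Measurable f) : msq m (fun p => f p - h p) ≤ 2 * msq m f + 2 * msq m h := by
  calc _ ≤ ∫⁻ p, (2 * ‖f p‖ₑ ^ 2 + 2 * ‖h p‖ₑ ^ 2) ∂m := lintegral_mono fun p => enorm_sub_sq_le _ _
    _ = _ := by
      rw [lintegral_add_left ((hf.enorm.pow_const 2).const_mul 2),
        lintegral_const_mul' _ _ (by simp), lintegral_const_mul' _ _ (by simp)]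
      rfl

end L2

section L2inner

variable {α W : Type*} [MeasurableSpace α] [NormedAddCommGroup W] [InnerProductSpace ℝ W]
  [MeasurableSpace W] [BorelSpace W] [SecondCountableTopology W] {m : Measure α}

theorem integrable_inner_of_msq {f h : α → W} (hf : Measurable f) (hh : Measurable h)
    (hf2 : msq m f < ∞) (hh2 : msq m h < ∞) : Integrable (fun p => inner ℝ (f p) (h p)) m := by
  have h1 := (memLp_two_iff_msq hf.aestronglyMeasurable).2 hf2
  have h2 := (memLp_two_iff_msq hh.aestronglyMeasurable).2 hh2
  refine (h1.norm.integrable_mul h2.norm).mono' (hf.inner hh).aestronglyMeasurable ?_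
  exact Eventually.of_forall fun p => norm_inner_le_norm _ _

theorem enorm_integral_inner_sq_le {f h : α → W} (hf : Measurable f)
    (hh : Measurable h) : ‖∫ p, inner ℝ (f p) (h p) ∂m‖ₑ ^ 2 ≤ msq m f * msq m h := by
  have h1 : ‖∫ p, inner ℝ (f p) (h p) ∂m‖ₑ ≤ ∫⁻ p, ‖f p‖ₑ * ‖h p‖ₑ ∂m := by
    refine (enorm_integral_le_lintegral_enorm _).trans (lintegral_mono fun p => ?_)
    rw [← ofReal_norm, ← ofReal_norm, ← ofReal_norm, ← ofReal_mul (norm_nonneg _)]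
    exact ofReal_le_ofReal (norm_inner_le_norm _ _)
  have h2 := ENNReal.lintegral_mul_le_Lp_mul_Lq m Real.HolderConjugate.two_two
    hf.enorm.aemeasurable hh.enorm.aemeasurable
  simp only [Pi.mul_apply] at h2
  calc _ ≤ ((∫⁻ x, ‖f x‖ₑ ^ (2 : ℝ) ∂m) ^ (1 / 2 : ℝ) * (∫⁻ x, ‖h x‖ₑ ^ (2 : ℝ) ∂m) ^ (1 / 2 : ℝ)) ^ 2 :=
        pow_le_pow_left' (h1.trans h2) 2
    _ = _ := by
        rw [mul_pow, ← ENNReal.rpow_natCast, ← ENNReal.rpow_mul, ← ENNReal.rpow_natCast,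
          ← ENNReal.rpow_mul]
        simp [msq]

/-- If `f j → f` in `L²`, then `∫ f j · h → ∫ f · h`; in particular orthogonality persists. -/
theorem integral_inner_eq_zero_of_tendsto {f : ℕ → α → W} {g h : α → W} (hf : ∀ j, Measurable (f j))
    (hg : Measurable g) (hh : Measurable h) (hf2 : ∀ j, msq m (f j) < ∞) (hg2 : msq m g < ∞)
    (hh2 : msq m h < ∞) (hlim : Tendsto (fun j => msq m fun p => f j p - g p) atTop (𝓝 0))
    (h0 : ∀ j, ∫ p, inner ℝ (f j p) (h p) ∂m = 0) : ∫ p, inner ℝ (g p) (h p) ∂m = 0 := by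
  have h1 : ∀ j, ‖∫ p, inner ℝ (g p) (h p) ∂m‖ₑ ^ 2 ≤ msq m (fun p => f j p - g p) * msq m h := by
    intro j
    refine le_trans (le_of_eq ?_) (enorm_integral_inner_sq_le ((hf j).sub hg) hh)
    simp only [inner_sub_left]
    rw [integral_sub (integrable_inner_of_msq (hf j) hh (hf2 j) hh2)
      (integrable_inner_of_msq hg hh hg2 hh2), h0, zero_sub, enorm_neg]
  have h2 : Tendsto (fun j => msq m (fun p => f j p - g p) * msq m h) atTop (𝓝 0) := by
    have := ENNReal.Tendsto.mul_const hlim (Or.inr hh2.ne)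
    rwa [zero_mul] at this
  have h3 := le_antisymm (ge_of_tendsto' h2 h1) bot_le
  simpa using h3

end L2inner

/-! ### The setting -/

/-- A bounded open convex set `U`, and a bounded set `V` that contains its `1/2`-neighbourhood. -/
structure Dom (U V : Set (E d)) : Prop where
  isOpen : IsOpen U
  convex : Convex ℝ U
  pos : volume U ≠ 0
  meas : MeasurableSet V
  bdd : Bornology.IsBounded V
  thick : ∀ z ∈ U, Metric.ball z (1 / 2) ⊆ V

namespace Dom

theorem subset (h : Dom U V) : U ⊆ V := fun z hz => h.thick z hz (Metric.mem_ball_self (by norm_num))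

theorem measU (h : Dom U V) : MeasurableSet U := h.isOpen.measurableSet

theorem bddU (h : Dom U V) : Bornology.IsBounded U := h.bdd.subset h.subset

theorem finV (h : Dom U V) : IsFiniteMeasure ((volume : Measure (E d)).restrict V) :=
  ⟨by simp [h.bdd.measure_lt_top]⟩

end Dom

/-- The measure `λ_n ⊗ dz` on `{configurations in V with n particles} × U`. -/
def levU (U V : Set (E d)) (n : ℕ) : Measure (Pt d) :=
  (lam V n).prod ((volume : Measure (E d)).restrict U)

/-- A measurable, symmetric, uniformly elliptic coefficient field with range of dependence `1/2`. -/
structure IsField (Λ : ℝ) (A : Coef d) : Prop where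
  meas : Measurable (uncurry A)
  symm : ∀ μ z x y, inner ℝ (A μ z x) y = inner ℝ x (A μ z y)
  lower : ∀ μ z x, ‖x‖ ^ 2 ≤ inner ℝ x (A μ z x)
  upper : ∀ μ z, ‖A μ z‖ ≤ Λ
  local_ : ∀ μ z y, y ∉ Metric.ball z (1 / 2) → A (μ + particle y) z = A μ z

/-- The squared norm on `λ_n ⊗ dz` is finite for every `n`. -/
def LevL2 (U V : Set (E d)) (F : Fld d) : Prop :=
  Measurable (uncurry F) ∧ ∀ n, msq (levU U V n) (uncurry F) < ∞

theorem measurable_clm_apply {α : Type*} [MeasurableSpace α] {A : α → (E d →L[ℝ] E d)}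
    {F : α → E d} (hA : Measurable A) (hF : Measurable F) : Measurable fun p => A p (F p) := by
  have h : Continuous fun q : (E d →L[ℝ] E d) × E d => q.1 q.2 :=
    isBoundedBilinearMap_apply.continuous
  exact h.measurable.comp (hA.prodMk hF)

theorem msq_clm_apply_le {α : Type*}
    [MeasurableSpace α] (m : Measure α) {A : α → (E d →L[ℝ] E d)} (F : α → E d)
    {M : ℝ} (hA : ∀ p, ‖A p‖ ≤ M) : msq m (fun p => A p (F p)) ≤ ofReal M ^ 2 * msq m F := by
  rw [msq, msq, ← lintegral_const_mul' _ _ (by finiteness)]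
  refine lintegral_mono fun p => ?_
  rw [← mul_pow]
  gcongr
  rw [← ofReal_norm, ← ofReal_norm, ← ENNReal.ofReal_mul' (norm_nonneg _)]
  exact ofReal_le_ofReal (((A p).le_opNorm _).trans (by gcongr; exact hA p))

/-- The function `A g - q`. -/
def resid (A : Coef d) (q : E d) (g : Fld d)
    (μ : Config d) (z : E d) : E d := A μ z (g μ z) - q

/-- `g` is the gradient of the corrector: a limit of smooth gradients which satisfies the
Euler-Lagrange equation, on each level. -/
structure IsCorr (U V : Set (E d)) (A : Coef d) (q : E d)
    (g : Fld d) : Prop where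
  meas : Measurable (uncurry g)
  approx : ∃ φ : ℕ → Config d → ℝ, (∀ j, SmoothIn U (φ j) ∧ LevL2 U V (pgrad (φ j))) ∧
    ∀ n, Tendsto (fun j => msq (levU U V n) fun p => pgrad (φ j) p.1 p.2 - g p.1 p.2) atTop (𝓝 0)
  el : ∀ φ : Config d → ℝ, SmoothIn U φ → ∀ n,
    msq (levU U V n) (uncurry (pgrad φ)) < ∞ →
      ∫ p, inner ℝ (pgrad φ p.1 p.2) (resid A q g p.1 p.2) ∂levU U V n = 0

theorem levU_univ (U V : Set (E d)) (n : ℕ) : levU U V n univ = volume V ^ n * volume U := by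
  rw [levU, ← Set.univ_prod_univ, Measure.prod_prod, lam_univ, Measure.restrict_apply_univ]

theorem Dom.levU_finite (h : Dom U V) (n : ℕ) : IsFiniteMeasure (levU U V n) :=
  ⟨by rw [levU_univ]; exact mul_lt_top (ENNReal.pow_lt_top h.bdd.measure_lt_top)
        h.bddU.measure_lt_top⟩

theorem measurable_resid (hA : Measurable (uncurry A))
    (hg : Measurable (uncurry g)) : Measurable (uncurry (resid A q g)) :=
  (measurable_clm_apply hA hg).sub_const q

theorem msq_const {α W : Type*} [MeasurableSpace α] [NormedAddCommGroup W]
    (m : Measure α) (q : W) : msq m (fun _ : α => q) = ‖q‖ₑ ^ 2 * m univ := by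
  rw [msq, lintegral_const]

theorem IsCorr.levL2 (h : IsCorr U V A q g) : LevL2 U V g := by
  refine ⟨h.meas, fun n => ?_⟩
  obtain ⟨φ, hφ, hlim⟩ := h.approx
  obtain ⟨j, hj⟩ := ((hlim n).eventually (gt_mem_nhds (zero_lt_one' ℝ≥0∞))).exists
  have hmj : Measurable fun p : Pt d => pgrad (φ j) p.1 p.2 := (hφ j).2.1
  have h1 := msq_sub_le (m := levU U V n) (f := fun p => pgrad (φ j) p.1 p.2)
    (h := fun p => pgrad (φ j) p.1 p.2 - g p.1 p.2) hmj
  simp only [sub_sub_cancel] at h1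
  refine lt_of_le_of_lt h1 (ENNReal.add_lt_top.2 ⟨mul_lt_top (by simp) ((hφ j).2.2 n),
    mul_lt_top (by simp) (hj.trans (by simp))⟩)

theorem LevL2.resid (hD : Dom U V)
    (hA : IsField Λ A) (q : E d) (hg : LevL2 U V g) : LevL2 U V (resid A q g) := by
  refine ⟨measurable_resid hA.meas hg.1, fun n => ?_⟩
  have := hD.levU_finite n
  have h1 := msq_sub_le (m := levU U V n) (f := fun p => uncurry A p (uncurry g p))
    (h := fun _ => q) (measurable_clm_apply hA.meas hg.1)
  refine lt_of_le_of_lt h1 (ENNReal.add_lt_top.2 ⟨mul_lt_top (by simp) ?_,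
    mul_lt_top (by simp) ?_⟩)
  · exact lt_of_le_of_lt (msq_clm_apply_le _ _ fun p => hA.upper p.1 p.2)
      (mul_lt_top (by finiteness) (hg.2 n))
  · rw [msq_const]; exact mul_lt_top (by simp) (measure_lt_top _ _)

/-- The Euler-Lagrange equation, tested with the gradient of a corrector. -/
theorem IsCorr.el_corr (hD : Dom U V)
    (hA : IsField Λ A) {q q' : E d} {g g' : Fld d} (h : IsCorr U V A q g) (h' : IsCorr U V A q' g')
    (n : ℕ) : ∫ p, inner ℝ (g' p.1 p.2) (resid A q g p.1 p.2) ∂levU U V n = 0 := by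
  obtain ⟨φ, hφ, hlim⟩ := h'.approx
  have hr := h.levL2.resid hD hA q
  exact integral_inner_eq_zero_of_tendsto (m := levU U V n)
    (f := fun j (p : Pt d) => pgrad (φ j) p.1 p.2)
    (g := fun p : Pt d => g' p.1 p.2)
    (h := fun p : Pt d => resid A q g p.1 p.2)
    (fun j => (hφ j).2.1) h'.meas hr.1 (fun j => (hφ j).2.2 n)
    (h'.levL2.2 n) (hr.2 n) (hlim n) fun j => h.el _ (hφ j).1 n ((hφ j).2.2 n)

/-! ### Existence of the corrector -/

theorem fv_weight_pos (hρ : 0 < ρ) (V : Set (E d)) (n : ℕ) :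
    0 < Real.exp (-(ρ * volume.real V)) * ρ ^ n / n.factorial := by positivity

/-- The weights of the levels in `fv`. -/
def fvW (ρ : ℝ) (V : Set (E d)) (n : ℕ) : ℝ≥0∞ :=
  ofReal (Real.exp (-(ρ * volume.real V)) * ρ ^ n / n.factorial)

theorem fvW_ne_zero (hρ : 0 < ρ) (V : Set (E d)) (n : ℕ) : fvW ρ V n ≠ 0 := by
  simpa [fvW] using fv_weight_pos hρ V n

theorem fvW_ne_top (ρ : ℝ) (V : Set (E d)) (n : ℕ) : fvW ρ V n ≠ ∞ :=
  ofReal_ne_top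

/-- The measure `fv ⊗ dz`. -/
def fvU (ρ : ℝ) (U V : Set (E d)) : Measure (Pt d) :=
  (fv ρ V).prod ((volume : Measure (E d)).restrict U)

theorem fvU_eq_sum (ρ : ℝ)
    (U V : Set (E d)) : fvU ρ U V = Measure.sum fun n => fvW ρ V n • levU U V n := by
  rw [fvU, fv, Measure.prod_sum_left]
  simp only [Measure.prod_smul_left, levU, fvW]

theorem lintegral_fvU (ρ : ℝ) (U V : Set (E d))
    (F : Pt d → ℝ≥0∞) : ∫⁻ p, F p ∂fvU ρ U V = ∑' n, fvW ρ V n * ∫⁻ p, F p ∂levU U V n := by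
  simp only [fvU_eq_sum, lintegral_sum_measure, lintegral_smul_measure, smul_eq_mul]

theorem msq_fvU (ρ : ℝ) (U V : Set (E d)) (F : Pt d → E d) :
    msq (fvU ρ U V) F = ∑' n, fvW ρ V n * msq (levU U V n) F := lintegral_fvU ρ U V _

theorem tsum_fvW (hρ : 0 ≤ ρ)
    (hb : Bornology.IsBounded V) : ∑' n, fvW ρ V n * volume V ^ n = 1 := by
  have hv : volume V = ofReal (volume.real V) :=
    (ENNReal.ofReal_toReal hb.measure_lt_top.ne).symm
  have h1 : ∀ n : ℕ, fvW ρ V n * volume V ^ n = ofReal (Real.exp (-(ρ * volume.real V))) *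
      ofReal ((ρ * volume.real V) ^ n / n.factorial) := by
    intro n
    rw [hv, ← ENNReal.ofReal_pow measureReal_nonneg, fvW, ← ofReal_mul (by positivity),
      ← ofReal_mul (by positivity)]
    congr 1
    rw [mul_pow]; ring
  simp only [h1]
  rw [ENNReal.tsum_mul_left, tsum_ofReal_poisson (by positivity), ← ofReal_mul (by positivity),
    ← Real.exp_add]
  simp

theorem fvU_univ (hρ : 0 ≤ ρ)
    (U : Set (E d)) (hb : Bornology.IsBounded V) : fvU ρ U V univ = volume U := by
  have h1 := lintegral_fvU ρ U V (fun _ => 1)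
  simp only [lintegral_const, one_mul] at h1
  rw [h1]
  simp only [levU_univ, ← mul_assoc]
  rw [ENNReal.tsum_mul_right, tsum_fvW hρ hb, one_mul]

theorem ae_fvU {P : Pt d → Prop} (h : ∀ n, ∀ᵐ p ∂levU U V n, P p) : ∀ᵐ p ∂fvU ρ U V, P p := by
  rw [fvU_eq_sum, Measure.ae_sum_iff]
  intro n
  exact Measure.ae_smul_measure (h n) _

theorem ae_levU_mem (hD : Dom U V)
    (n : ℕ) : ∀ᵐ p : Pt d ∂levU U V n, p.1.1 Vᶜ = 0 ∧ p.1.1 V = n ∧ p.2 ∈ U := by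
  have := hD.finV
  have h1 : ∀ᵐ p : Pt d ∂levU U V n, p.1.1 Vᶜ = 0 ∧
      p.1.1 V = n :=
    Measure.quasiMeasurePreserving_fst.ae (ae_lam hD.meas n)
  have h2 : ∀ᵐ p : Pt d ∂levU U V n, p.2 ∈ U :=
    Measure.quasiMeasurePreserving_snd.ae (ae_restrict_mem hD.measU)
  filter_upwards [h1, h2] with p hp hp'
  exact ⟨hp.1, hp.2, hp'⟩

theorem mass_lt_top_of (hUV : U ⊆ V) {μ : Config d} {n : ℕ} (h : μ.1 V = n) : μ.1 U < ∞ :=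
  lt_of_le_of_lt (measure_mono hUV) (by rw [h]; simp)

theorem pgrad_add_ae (hD : Dom U V)
    {φ φ' : Config d → ℝ} (h : SmoothIn U φ) (h' : SmoothIn U φ') (n : ℕ) : ∀ᵐ p :
    Pt d ∂levU U V n, pgrad (fun μ => φ μ + φ' μ) p.1 p.2 = pgrad φ p.1 p.2 + pgrad φ' p.1 p.2 := by
  filter_upwards [ae_levU_mem hD n] with p hp
  have hf := mass_lt_top_of hD.subset hp.2.1
  exact ((h.hasPG hD.isOpen hf hp.2.2).add (h'.hasPG hD.isOpen hf hp.2.2)).pgrad_eq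

theorem pgrad_exterior_mul_ae (hD : Dom U V)
    {φ c : Config d → ℝ} (h : SmoothIn U φ) (hc : IsExterior U c) (n : ℕ) : ∀ᵐ p : Pt d ∂levU U V n,
    pgrad (fun μ => c μ * φ μ) p.1 p.2 = c (p.1 + particle p.2) • pgrad φ p.1 p.2 := by
  filter_upwards [ae_levU_mem hD n] with p hp
  have hf := mass_lt_top_of hD.subset hp.2.1
  exact ((h.hasPG hD.isOpen hf hp.2.2).exterior_mul hD.isOpen hc hp.2.2).pgrad_eq

/-- The subspace of smooth gradients in `L²`. -/
def gradSpace (hD : Dom U V) (ρ : ℝ) :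
    Submodule ℝ (Lp (E d) 2 (fvU ρ U V)) where
  carrier := {F | ∃ φ, SmoothIn U φ ∧ (fun p => pgrad φ p.1 p.2) =ᵐ[fvU ρ U V] F}
  zero_mem' := ⟨fun _ => 0, smoothIn_const U 0, by
    have h1 : ∀ p : Pt d, pgrad (fun _ => (0 : ℝ)) p.1 p.2 = 0 := fun p =>
      (hasPG_const 0 (Eventually.of_forall fun _ => rfl)).pgrad_eq
    filter_upwards [Lp.coeFn_zero (E d) 2 (fvU ρ U V)] with p hp
    rw [hp, h1]; rfl⟩
  add_mem' := by
    rintro F F' ⟨φ, hφ, hF⟩ ⟨φ', hφ', hF'⟩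
    refine ⟨fun μ => φ μ + φ' μ, hφ.add hφ', ?_⟩
    filter_upwards [hF, hF', Lp.coeFn_add F F', ae_fvU (pgrad_add_ae hD hφ hφ')] with p h1 h2 h3 h4
    rw [h4, h3, Pi.add_apply, h1, h2]
  smul_mem' := by
    rintro c F ⟨φ, hφ, hF⟩
    have hc : IsExterior U fun _ : Config d => c := fun _ _ _ _ => rfl
    refine ⟨fun μ => c * φ μ, hφ.exterior_mul hD.measU measurable_const hc, ?_⟩
    filter_upwards [hF, Lp.coeFn_smul c F, ae_fvU (pgrad_exterior_mul_ae hD hφ hc)] with p h1 h3 h4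
    rw [h4, h3, Pi.smul_apply, h1]

/-- The Lax-Milgram lemma on a subspace, for a multiplication operator. -/
theorem exists_mem_closure_inner_eq {H : Type*} [NormedAddCommGroup H] [InnerProductSpace ℝ H]
    [CompleteSpace H] (S : Submodule ℝ H) (M : H →L[ℝ] H) (hM : ∀ x, ‖x‖ ^ 2 ≤ inner ℝ (M x) x)
    (q : H) : ∃ g ∈ S.topologicalClosure, ∀ w ∈ S, inner ℝ (M g) w = inner ℝ q w := by
  set T := S.topologicalClosure
  have : CompleteSpace T := S.isClosed_topologicalClosure.completeSpace_coe
  set B : T →L[ℝ] T →L[ℝ] ℝ :=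
    ((innerSL ℝ : H →L[ℝ] H →L[ℝ] ℝ).comp (M.comp T.subtypeL)).flip.comp T.subtypeL |>.flip with hB
  have hBa : ∀ v w : T, B v w = inner ℝ (M v) (w : H) := fun v w => rfl
  have hco : IsCoercive B := ⟨1, one_pos, fun v => by
    rw [hBa, one_mul, ← sq]; exact hM v⟩
  set e := hco.continuousLinearEquivOfBilin
  refine ⟨(e.symm (T.orthogonalProjectionOnto q) : T), Subtype.prop _, fun w hw => ?_⟩
  have h1 := hco.continuousLinearEquivOfBilin_apply (e.symm (T.orthogonalProjectionOnto q))
    ⟨w, S.le_topologicalClosure hw⟩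
  rw [hBa] at h1
  rw [← h1]
  change inner ℝ (e (e.symm (T.orthogonalProjectionOnto q))) _ = _
  rw [e.apply_symm_apply]
  exact Submodule.inner_orthogonalProjectionOnto_eq_of_mem_right ⟨w, S.le_topologicalClosure hw⟩ q

theorem tendsto_zero_of_const_mul {c : ℝ≥0∞} (hc : c ≠ 0) (hc' : c ≠ ∞) {u w : ℕ → ℝ≥0∞}
    (h : ∀ j, c * u j ≤ w j) (hw : Tendsto w atTop (𝓝 0)) : Tendsto u atTop (𝓝 0) := by
  have h1 : Tendsto (fun j => c⁻¹ * w j) atTop (𝓝 0) := by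
    have := ENNReal.Tendsto.const_mul (a := c⁻¹) hw (Or.inr (by simpa using hc))
    rwa [mul_zero] at this
  refine tendsto_of_tendsto_of_tendsto_of_le_of_le tendsto_const_nhds h1 (fun j => bot_le) fun j => ?_
  calc u j = c⁻¹ * (c * u j) := by rw [← mul_assoc, ENNReal.inv_mul_cancel hc hc', one_mul]
    _ ≤ _ := by gcongr; exact h j

theorem fvW_mul_msq_le (ρ : ℝ) (U V : Set (E d))
    (n : ℕ) (F : Pt d → E d) : fvW ρ V n * msq (levU U V n) F ≤ msq (fvU ρ U V) F := by
  rw [msq_fvU]; exact ENNReal.le_tsum n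

/-- The indicator of a given number of particles in `V` is an exterior function, so multiplying a
test function by it multiplies the gradient by an indicator. The weighted equation on all levels
thus splits into separate equations, from which the weight, hence the intensity, drops out. -/
theorem el_level_of_el (hD : Dom U V) {R : Fld d} (hRm : Measurable (uncurry R))
    (hR2 : msq (fvU 1 U V) (uncurry R) < ∞) (hEL : ∀ ψ : Config d → ℝ, SmoothIn U ψ →
    msq (fvU 1 U V) (uncurry (pgrad ψ)) < ∞ → ∫ p, inner ℝ (uncurry (pgrad ψ) p) (uncurry R p)
    ∂fvU 1 U V = 0) (hφ : SmoothIn U φ) (n : ℕ) (hfinφ : msq (levU U V n) (uncurry (pgrad φ)) < ∞) :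
    ∫ p, inner ℝ (pgrad φ p.1 p.2) (R p.1 p.2) ∂levU U V n = 0 := by
  -- The gradient at `(η, z)` refers to the configuration `η + δ_z`: level `n` of `η` corresponds to
  -- `n + 1` particles in `V`.
  set f : ℝ≥0∞ → ℝ := fun t => if t = ((n + 1 : ℕ) : ℝ≥0∞) then 1 else 0 with hf
  have hfm : Measurable f := Measurable.ite (measurableSet_singleton _) measurable_const
    measurable_const
  set c : Config d → ℝ := fun μ => f (μ.1 V) with hc
  have hcm : Measurable c := hfm.comp (Config.measurable_apply hD.meas)
  have hce : IsExterior U c := isExterior_mass hD.measU hD.meas hD.subset f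
  obtain ⟨ψ, hψdef⟩ : ∃ ψ : Config d → ℝ, ψ = fun μ => c μ * φ μ := ⟨_, rfl⟩
  have hψ : SmoothIn U ψ := hψdef ▸ hφ.exterior_mul hD.measU hcm hce
  have hlev : ∀ k, ∀ᵐ p : Pt d ∂levU U V k, pgrad ψ p.1 p.2 =
      (if k = n then (1 : ℝ) else 0) • pgrad φ p.1 p.2 := by
    intro k
    filter_upwards [pgrad_exterior_mul_ae hD hφ hce k, ae_levU_mem hD k] with p h1 h2
    rw [hψdef, h1]
    congr 1
    simp only [hc, hf, Config.add_apply, h2.2.1, particle_apply _ hD.meas,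
      indicator_of_mem (hD.subset h2.2.2), Pi.one_apply]
    norm_cast
    simp
  have hmsq : msq (fvU 1 U V) (uncurry (pgrad ψ)) < ∞ := by
    rw [msq_fvU, tsum_eq_single n]
    · refine mul_lt_top (fvW_ne_top 1 V n).lt_top ?_
      rwa [msq_congr (h := uncurry (pgrad φ))
        ((hlev n).mono fun p hp => by simpa [uncurry] using hp)]
    · intro k hk
      rw [msq_congr (h := fun _ => 0)
        ((hlev k).mono fun p hp => by simpa [uncurry, hk] using hp)]
      simp [msq]
  have hψm : Measurable (uncurry (pgrad ψ)) := measurable_pgrad hψ.1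
  have h1 := hEL ψ hψ hmsq
  have hitg := integrable_inner_of_msq hψm hRm hmsq hR2
  have h2 : HasSum (fun k => ∫ p, inner ℝ (uncurry (pgrad ψ) p)
      (uncurry R p) ∂(fvW 1 V k • levU U V k)) 0 := by
    rw [fvU_eq_sum] at hitg h1
    rw [← h1]
    exact hasSum_integral_measure hitg
  have h3 : ∀ k, k ≠ n → ∫ p, inner ℝ (uncurry (pgrad ψ) p)
      (uncurry R p) ∂(fvW 1 V k • levU U V k) = 0 := by
    intro k hk
    rw [integral_smul_measure]
    refine smul_eq_zero_of_right _ ?_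
    refine (integral_congr_ae (g := fun _ => (0 : ℝ)) ((hlev k).mono fun p hp => ?_)).trans (by simp)
    simp only [uncurry]
    rw [hp, if_neg hk, zero_smul, inner_zero_left]
  have h4 := (hasSum_single n h3).unique h2
  rw [integral_smul_measure, smul_eq_zero] at h4
  have h5 : (fvW 1 V n).toReal ≠ 0 :=
    ENNReal.toReal_ne_zero.2 ⟨fvW_ne_zero one_pos V n, fvW_ne_top 1 V n⟩
  rw [← h4.resolve_left h5]
  refine integral_congr_ae ((hlev n).mono fun p hp => ?_)
  simp only [uncurry]
  rw [hp, if_pos rfl, one_smul]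

/-- Lax-Milgram in the closure of the smooth gradients, at intensity 1. The choice of intensity is
immaterial: all weights are positive, so both the approximation and the equation pass to every
single level. -/
theorem exists_isCorr (hD : Dom U V) (hA : IsField Λ A) (q : E d) : ∃ g, IsCorr U V A q g := by
  set m := fvU 1 U V with hm
  have hfin : IsFiniteMeasure m := ⟨by
    rw [hm, fvU_univ zero_le_one U hD.bdd]; exact hD.bddU.measure_lt_top⟩
  have hAmem : MemLp (uncurry A) ∞ m :=
    memLp_top_of_bound hA.meas.aestronglyMeasurable Λ
      (Eventually.of_forall fun p => hA.upper p.1 p.2)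
  set Ā := hAmem.toLp with hĀ
  set M : Lp (E d) 2 m →L[ℝ] Lp (E d) 2 m :=
    (ContinuousLinearMap.id ℝ (E d →L[ℝ] E d)).holderL m ∞ 2 2 Ā with hMdef
  have hMae : ∀ x : Lp (E d) 2 m, M x =ᵐ[m] fun p => A p.1 p.2 (x p) := by
    intro x
    have h1 : M x =ᵐ[m] _ :=
      ContinuousLinearMap.coeFn_holder (r := 2) (ContinuousLinearMap.id ℝ (E d →L[ℝ] E d)) Ā x
    filter_upwards [h1, hAmem.coeFn_toLp] with p h1 h2
    rw [h1, hĀ, h2]; rfl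
  set Q : Lp (E d) 2 m := (memLp_const q).toLp (fun _ => q) with hQ
  have hQae : Q =ᵐ[m] fun _ => q := MemLp.coeFn_toLp _
  obtain ⟨g₀, hg₀, hEL⟩ := exists_mem_closure_inner_eq (gradSpace hD 1) M (fun x => by
    rw [← real_inner_self_eq_norm_sq, L2.inner_def, L2.inner_def]
    refine integral_mono_ae (L2.integrable_inner x x) (L2.integrable_inner (M x) x) ?_
    filter_upwards [hMae x] with p hp
    rw [hp, real_inner_self_eq_norm_sq, real_inner_comm]
    exact hA.lower _ _ _) Q
  have hsm := Lp.aestronglyMeasurable g₀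
  set gm := hsm.mk g₀ with hgm
  have hgmm : Measurable gm := hsm.stronglyMeasurable_mk.measurable
  have hgae : g₀ =ᵐ[m] gm := hsm.ae_eq_mk
  refine ⟨fun μ z => gm (μ, z), hgmm, ?_, ?_⟩
  · have hcl : g₀ ∈ closure (gradSpace hD 1 : Set (Lp (E d) 2 m)) := hg₀
    obtain ⟨F, hF, hlim⟩ := mem_closure_iff_seq_limit.1 hcl
    choose φ hφ hφF using hF
    have hmj : ∀ j, msq m (fun p => pgrad (φ j) p.1 p.2) < ∞ := fun j => by
      rw [msq_congr (hφF j)]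
      exact (memLp_two_iff_msq (Lp.aestronglyMeasurable _)).1 (Lp.memLp _)
    refine ⟨φ, fun j => ⟨hφ j, measurable_pgrad (hφ j).1, fun n => ?_⟩, fun n => ?_⟩
    · have h1 := (fvW_mul_msq_le 1 U V n _).trans_lt (hmj j)
      exact lt_of_mul_lt_mul_left' (lt_of_lt_of_eq h1
        (ENNReal.mul_top (fvW_ne_zero one_pos V n)).symm)
    · have h1 := (Lp.tendsto_Lp_iff_tendsto_eLpNorm' F g₀).1 hlim
      have h2 := ENNReal.Tendsto.pow (n := 2) h1
      rw [zero_pow two_ne_zero] at h2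
      refine tendsto_zero_of_const_mul (fvW_ne_zero one_pos V n) (fvW_ne_top 1 V n)
        (fun j => fvW_mul_msq_le 1 U V n _) ?_
      refine h2.congr fun j => ?_
      rw [eLpNorm_two_sq]
      refine msq_congr ?_
      filter_upwards [hφF j, hgae] with p h3 h4
      rw [Pi.sub_apply, ← h3, h4]
  · refine fun φ hφ n => el_level_of_el hD ?_ ?_ (fun ψ hψ hmsq => ?_) hφ n
    · exact measurable_resid hA.meas hgmm
    · have hgm2 : msq m gm < ∞ := by
        rw [← msq_congr hgae]
        exact (memLp_two_iff_msq (Lp.aestronglyMeasurable _)).1 (Lp.memLp _)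
      refine lt_of_le_of_lt (msq_sub_le (m := m) (f := fun p => uncurry A p (gm p))
        (h := fun _ => q) (measurable_clm_apply hA.meas hgmm)) (ENNReal.add_lt_top.2
          ⟨mul_lt_top (by simp) ?_, mul_lt_top (by simp) ?_⟩)
      · exact lt_of_le_of_lt (msq_clm_apply_le _ _ fun p => hA.upper p.1 p.2)
          (mul_lt_top (by finiteness) hgm2)
      · rw [msq_const]; exact mul_lt_top (by simp) (measure_lt_top _ _)
    · have hψm : Measurable (uncurry (pgrad ψ)) := measurable_pgrad hψ.1
      have hmem : MemLp (uncurry (pgrad ψ)) 2 m :=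
        (memLp_two_iff_msq hψm.aestronglyMeasurable).2 hmsq
      have h0 := hEL hmem.toLp ⟨ψ, hψ, hmem.coeFn_toLp.symm⟩
      rw [← sub_eq_zero, ← inner_sub_left, L2.inner_def] at h0
      rw [← h0]
      refine integral_congr_ae ?_
      filter_upwards [hmem.coeFn_toLp, hMae g₀, hgae, hQae, Lp.coeFn_sub (M g₀) Q]
        with p a1 a2 a3 a4 a5
      rw [a5, Pi.sub_apply, a2, a4, a1, a3, real_inner_comm]
      rfl

/-! ### Energy estimate and symmetry for the corrector -/

/-- The energy estimate `‖a‖² ≤ ⟨a, b⟩ = -⟨a, e⟩ ≤ ‖a‖ ‖e‖`. In the applications `a` is potential,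
`b = A a`, and `b + e` is solenoidal. Dividing by `‖a‖` requires that it be known to be finite
beforehand. -/
theorem msq_le_of_integral_inner_eq_zero {α W : Type*} [MeasurableSpace α] [NormedAddCommGroup W]
    [InnerProductSpace ℝ W] [MeasurableSpace W] [BorelSpace W] [SecondCountableTopology W]
    {m : Measure α} {a b e : α → W} (ha : Measurable a) (hb : Measurable b) (he : Measurable e)
    (ha2 : msq m a < ∞) (hb2 : msq m b < ∞) (he2 : msq m e < ∞) (hlow : ∀ᵐ p ∂m, ‖a p‖ ^
    2 ≤ inner ℝ (a p) (b p)) (h0 : ∫ p, inner ℝ (a p) (b p + e p) ∂m = 0) : msq m a ≤ msq m e := by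
  have i1 := integrable_inner_of_msq ha hb ha2 hb2
  have i2 := integrable_inner_of_msq ha he ha2 he2
  have i3 : Integrable (fun p => ‖a p‖ ^ 2) m := by
    simpa only [real_inner_self_eq_norm_sq] using integrable_inner_of_msq ha ha ha2 ha2
  simp only [inner_add_right] at h0
  rw [integral_add i1 i2] at h0
  have h1 : ∫ p, ‖a p‖ ^ 2 ∂m ≤ ‖∫ p, inner ℝ (a p) (e p) ∂m‖ := by
    calc _ ≤ ∫ p, inner ℝ (a p) (b p) ∂m := integral_mono_ae i3 i1 hlow
      _ = - ∫ p, inner ℝ (a p) (e p) ∂m := by linarith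
      _ ≤ _ := neg_le_abs _
  have h2 : msq m a = ofReal (∫ p, ‖a p‖ ^ 2 ∂m) := by
    rw [ofReal_integral_eq_lintegral_ofReal i3 (Eventually.of_forall fun p => by positivity), msq]
    refine lintegral_congr fun p => ?_
    rw [ENNReal.ofReal_pow (norm_nonneg _), ofReal_norm]
  have h3 : msq m a ≤ ‖∫ p, inner ℝ (a p) (e p) ∂m‖ₑ := by
    rw [h2, ← ofReal_norm]; exact ofReal_le_ofReal h1
  have h4 : msq m a * msq m a ≤ msq m a * msq m e := by
    rw [← sq]
    exact (pow_le_pow_left' h3 2).trans (enorm_integral_inner_sq_le ha he)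
  rcases eq_or_ne (msq m a) 0 with h | h
  · rw [h]; exact bot_le
  · exact (ENNReal.mul_le_mul_iff_right h ha2.ne).1 h4

namespace IsField

theorem measurable_apply (hA : IsField Λ A) {F : Pt d → E d} (hF : Measurable F) :
    Measurable fun p : Pt d => A p.1 p.2 (F p) := measurable_clm_apply hA.meas hF

theorem msq_apply_lt_top (hA : IsField Λ A) {m : Measure (Pt d)}
    {F : Pt d → E d} (hF : msq m F < ∞) : msq m (fun p => A p.1 p.2 (F p)) < ∞ :=
  (msq_clm_apply_le m (A := fun p : Pt d => A p.1 p.2) F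
    fun p => hA.upper p.1 p.2).trans_lt (mul_lt_top (by finiteness) hF)

end IsField

theorem msq_const_lt_top {α W : Type*} [MeasurableSpace α] [NormedAddCommGroup W]
    (m : Measure α) [IsFiniteMeasure m] (q : W) : msq m (fun _ : α => q) < ∞ := by
  rw [msq_const]; exact mul_lt_top (by simp) (measure_lt_top _ _)

namespace IsCorr

variable {q q' : E d}
  {g g' : Fld d}

theorem msq_le (hD : Dom U V) (hA : IsField Λ A) (h : IsCorr U V A q g)
    (n : ℕ) : msq (levU U V n) (uncurry g) ≤ ‖q‖ₑ ^ 2 * volume U * volume V ^ n := by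
  have := hD.levU_finite n
  have hg := h.levL2
  have h0 : ∫ p, inner ℝ (uncurry g p) (A p.1 p.2 (uncurry g p) + -q)
      ∂levU U V n = 0 := by
    simp only [← sub_eq_add_neg]
    exact h.el_corr hD hA h n
  have h1 := msq_le_of_integral_inner_eq_zero (m := levU U V n) (a := uncurry g)
    (b := fun p => A p.1 p.2 (uncurry g p)) (e := fun _ => -q) hg.1
    (hA.measurable_apply hg.1) measurable_const (hg.2 n) (hA.msq_apply_lt_top (hg.2 n))
    (msq_const_lt_top _ _) (Eventually.of_forall fun p => hA.lower _ _ _) h0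
  refine h1.trans (le_of_eq ?_)
  rw [msq_const, levU_univ, enorm_neg]; ring

end IsCorr

/-! ### From the box `V` to the Poisson process on the whole space -/

/-- The measure `P_ρ ⊗ dz`. -/
def poisU (ρ : ℝ) (U : Set (E d)) : Measure (Pt d) :=
  (poissonLaw d ρ).prod ((volume : Measure (E d)).restrict U)

instance (ρ : ℝ) (U : Set (E d)) : SFinite (poisU ρ U) := by
  unfold poisU; infer_instance

instance (ρ : ℝ) (U V : Set (E d)) : SFinite (fvU ρ U V) := by
  unfold fvU; infer_instance

theorem lintegral_poisU_eq (hρ : 0 ≤ ρ) (hD : Dom U V) {F : Pt d → ℝ≥0∞} (hF : Measurable F) :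
    ∫⁻ p, F p ∂poisU ρ U = ∫⁻ ζ, ∫⁻ p, F (restr ζ Vᶜ + p.1, p.2) ∂fvU ρ U V ∂poissonLaw d ρ := by
  have hr := measurable_restr (d := d) hD.meas.compl
  have m1 : Measurable fun r : (E d × Config d) × Config d => F (restr r.2 Vᶜ + r.1.2, r.1.1) :=
    hF.comp (((hr.comp measurable_snd).add (measurable_snd.comp measurable_fst)).prodMk
      (measurable_fst.comp measurable_fst))
  have m2 : Measurable fun r : Config d × (Pt d) => F (restr r.1 Vᶜ + r.2.1, r.2.2) :=
    hF.comp (((hr.comp measurable_fst).add (measurable_fst.comp measurable_snd)).prodMk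
      (measurable_snd.comp measurable_snd))
  calc ∫⁻ p, F p ∂poisU ρ U = ∫⁻ z in U, ∫⁻ μ, F (μ, z) ∂poissonLaw d ρ :=
        lintegral_prod_symm' F hF
    _ = ∫⁻ z in U, ∫⁻ η, ∫⁻ ζ, F (restr ζ Vᶜ + η, z) ∂poissonLaw d ρ ∂fv ρ V := by
        refine lintegral_congr fun z => ?_
        exact lintegral_poissonLaw_eq (F := fun μ => F (μ, z)) hρ hD.meas hD.bdd
          (hF.comp measurable_prodMk_right)
    _ = ∫⁻ p, ∫⁻ ζ, F (restr ζ Vᶜ + p.1, p.2) ∂poissonLaw d ρ ∂fvU ρ U V := by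
        rw [fvU, lintegral_prod_symm']
        have m3 : Measurable fun r : (Pt d) × Config d =>
            F (restr r.2 Vᶜ + r.1.1, r.1.2) := m2.comp measurable_swap
        exact m3.lintegral_prod_right'
    _ = _ := lintegral_lintegral_swap (m2.comp measurable_swap).aemeasurable

theorem poisU_eq_map (hρ : 0 ≤ ρ) (hD : Dom U V) :
    poisU ρ U = ((poissonLaw d ρ).prod (fvU ρ U V)).map fun r => (restr r.1 Vᶜ + r.2.1, r.2.2) := by
  have hr := measurable_restr (d := d) hD.meas.compl
  have hT : Measurable fun r : Config d × (Pt d) =>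
      ((restr r.1 Vᶜ + r.2.1, r.2.2) : Pt d) :=
    ((hr.comp measurable_fst).add (measurable_fst.comp measurable_snd)).prodMk
      (measurable_snd.comp measurable_snd)
  refine Measure.ext_of_lintegral _ fun F hF => ?_
  have hFT : Measurable fun r : Config d × (Pt d) => F (restr r.1 Vᶜ + r.2.1, r.2.2) :=
    hF.comp hT
  rw [lintegral_poisU_eq hρ hD hF, lintegral_map hF hT, lintegral_prod _ hFT.aemeasurable]

theorem clip_restr_compl_add (hV : MeasurableSet V) (ζ : Config d)
    {η : Config d} (h : η.1 Vᶜ = 0) (h' : η.1 V < ∞) : clip V (restr ζ Vᶜ + η) = η := by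
  rw [clip_of_lt, restr_add, restr_restr _ hV, Set.inter_compl_self, restr_empty, zero_add,
    restr_eq_self h]
  rw [Config.add_apply, restr_compl_mass hV, zero_add]
  exact h'

theorem lintegral_clip_poisU (hρ : 0 ≤ ρ) (hD : Dom U V) {F : Pt d → ℝ≥0∞}
    (hF : Measurable F) : ∫⁻ p, F (clip V p.1, p.2) ∂poisU ρ U = ∫⁻ p, F p ∂fvU ρ U V := by
  have hc : Measurable fun p : Pt d => (clip V p.1, p.2) :=
    ((measurable_clip hD.meas).comp measurable_fst).prodMk measurable_snd
  have hm : Measurable fun p : Pt d => F (clip V p.1, p.2) := hF.comp hc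
  rw [lintegral_poisU_eq hρ hD hm]
  have h1 : ∀ ζ : Config d, ∫⁻ p, F (clip V (restr ζ Vᶜ + p.1), p.2) ∂fvU ρ U V
      = ∫⁻ p, F p ∂fvU ρ U V := fun ζ => by
    refine lintegral_congr_ae (ae_fvU fun n => ?_)
    filter_upwards [ae_levU_mem hD n] with p hp
    rw [clip_restr_compl_add hD.meas ζ hp.1 (by rw [hp.2.1]; simp)]
  simp only [h1, lintegral_const, measure_univ, mul_one]

theorem map_clip_poisU (hρ : 0 ≤ ρ)
    (hD : Dom U V) : (poisU ρ U).map (fun p => (clip V p.1, p.2)) = fvU ρ U V := by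
  have hc : Measurable fun p : Pt d => (clip V p.1, p.2) :=
    ((measurable_clip hD.meas).comp measurable_fst).prodMk measurable_snd
  refine Measure.ext_of_lintegral _ fun F hF => ?_
  rw [lintegral_map hF hc, lintegral_clip_poisU hρ hD hF]

theorem ae_poisU_mem (ρ : ℝ) (hD : Dom U V) : ∀ᵐ p : Pt d ∂poisU ρ U, p.1.1 V < ∞ ∧ p.2 ∈ U := by
  have h1 : ∀ᵐ p : Pt d ∂poisU ρ U, p.1.1 V < ∞ :=
    Measure.quasiMeasurePreserving_fst.ae (ae_poissonLaw_lt_top ρ hD.meas hD.bdd)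
  have h2 : ∀ᵐ p : Pt d ∂poisU ρ U, p.2 ∈ U :=
    Measure.quasiMeasurePreserving_snd.ae (ae_restrict_mem hD.measU)
  filter_upwards [h1, h2] with p hp hp'
  exact ⟨hp, hp'⟩

theorem poisU_univ (ρ : ℝ) (U : Set (E d)) : poisU ρ U univ = volume U := by
  rw [poisU, ← Set.univ_prod_univ, Measure.prod_prod, measure_univ, one_mul,
    Measure.restrict_apply_univ]

theorem msq_fvU_lt_top_of_le (hρ : 0 ≤ ρ) (hD : Dom U V) {F : Pt d → E d}
    {K : ℝ≥0∞} (h : ∀ n, msq (levU U V n) F ≤ K * volume V ^ n) : msq (fvU ρ U V) F ≤ K := by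
  rw [msq_fvU]
  calc _ ≤ ∑' n, K * (fvW ρ V n * volume V ^ n) := by
        refine ENNReal.tsum_le_tsum fun n => ?_
        rw [mul_left_comm]
        gcongr
        exact h n
    _ = K := by rw [ENNReal.tsum_mul_left, tsum_fvW hρ hD.bdd, mul_one]

/-- A function of the configuration in `V`, as a function of the whole configuration. -/
def lift (V : Set (E d)) (g : Fld d) (p : Pt d) : E d :=
  g (clip V p.1) p.2

theorem measurable_lift (hV : MeasurableSet V)
    (hg : Measurable (uncurry g)) : Measurable (lift V g) :=
  hg.comp (((measurable_clip hV).comp measurable_fst).prodMk measurable_snd)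

theorem msq_lift (hρ : 0 ≤ ρ) (hD : Dom U V)
    (hg : Measurable (uncurry g)) : msq (poisU ρ U) (lift V g) = msq (fvU ρ U V) (uncurry g) :=
  lintegral_clip_poisU hρ hD (hg.enorm.pow_const 2)

theorem pgrad_freeze_ae (hD : Dom U V)
    (hφ : SmoothIn U φ) (ζ : Config d) (n : ℕ) : ∀ᵐ p : Pt d ∂levU U V n,
    pgrad (fun μ => φ (restr ζ Vᶜ + restr μ V)) p.1 p.2 = pgrad φ (restr ζ Vᶜ + p.1) p.2 := by
  filter_upwards [ae_levU_mem hD n] with p hp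
  have h1 : restr p.1 V = p.1 := restr_eq_self hp.1
  have hf : ((restr ζ Vᶜ + p.1 : Config d) : Measure (E d)) U < ∞ := by
    refine lt_of_le_of_lt (measure_mono hD.subset) ?_
    rw [Config.add_apply, restr_compl_mass hD.meas, hp.2.1]; simp
  refine (HasPG.freeze hD.isOpen hD.meas hD.subset hp.2.2 ?_).pgrad_eq
  rw [h1]
  exact hφ.hasPG hD.isOpen hf hp.2.2

/-- The Euler-Lagrange equation for the Poisson process on the whole space. -/
theorem IsCorr.el_poisU (hρ : 0 < ρ) (hD : Dom U V) (hA : IsField Λ A)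
    (h : IsCorr U V A q g) (hφ : SmoothIn U φ) (h2 : msq (poisU ρ U) (uncurry (pgrad φ)) < ∞) :
    ∫ p, inner ℝ (pgrad φ p.1 p.2) (lift V (resid A q g) p) ∂poisU ρ U = 0 := by
  have hr := measurable_restr (d := d) hD.meas.compl
  have hT : Measurable fun r : Config d × (Pt d) =>
      ((restr r.1 Vᶜ + r.2.1, r.2.2) : Pt d) :=
    ((hr.comp measurable_fst).add (measurable_fst.comp measurable_snd)).prodMk
      (measurable_snd.comp measurable_snd)
  have hRl := h.levL2.resid hD hA q
  have hφm : Measurable (uncurry (pgrad φ)) := measurable_pgrad hφ.1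
  have hLm := measurable_lift hD.meas hRl.1
  have hfvfin : IsFiniteMeasure (fvU ρ U V) :=
    ⟨by rw [fvU_univ hρ.le U hD.bdd]; exact hD.bddU.measure_lt_top⟩
  have hR2 : msq (fvU ρ U V) (uncurry (resid A q g)) < ∞ := by
    have hg2 : msq (fvU ρ U V) (uncurry g) < ∞ :=
      (msq_fvU_lt_top_of_le hρ.le hD fun n => h.msq_le hD hA n).trans_lt
        (mul_lt_top (by finiteness) hD.bddU.measure_lt_top)
    exact lt_of_le_of_lt (msq_sub_le (m := fvU ρ U V)
      (f := fun p => A p.1 p.2 (uncurry g p))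
      (h := fun _ => q) (hA.measurable_apply h.meas)) (ENNReal.add_lt_top.2
        ⟨mul_lt_top (by simp) (hA.msq_apply_lt_top hg2),
          mul_lt_top (by simp) (msq_const_lt_top _ _)⟩)
  have hL2 : msq (poisU ρ U) (lift V (resid A q g)) < ∞ := by rwa [msq_lift hρ.le hD hRl.1]
  have hitg := integrable_inner_of_msq (m := poisU ρ U) hφm hLm h2 hL2
  have hfm : Measurable fun p : Pt d =>
      (inner ℝ (uncurry (pgrad φ) p) (lift V (resid A q g) p) : ℝ) := hφm.inner hLm
  change ∫ p, inner ℝ (uncurry (pgrad φ) p) (lift V (resid A q g) p) ∂poisU ρ U = 0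
  have e1 : ∀ᵐ ζ ∂poissonLaw d ρ,
      msq (fvU ρ U V) (fun p => pgrad φ (restr ζ Vᶜ + p.1) p.2) < ∞ := by
    rw [msq, lintegral_poisU_eq hρ.le hD (hφm.enorm.pow_const 2)] at h2
    have m2 : Measurable fun r : Config d × (Pt d) =>
        ‖uncurry (pgrad φ) (restr r.1 Vᶜ + r.2.1, r.2.2)‖ₑ ^ 2 :=
      (hφm.comp hT).enorm.pow_const 2
    exact ae_lt_top m2.lintegral_prod_right' h2.ne
  rw [poisU_eq_map hρ.le hD] at hitg ⊢
  rw [integrable_map_measure hfm.aestronglyMeasurable hT.aemeasurable] at hitg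
  rw [integral_map hT.aemeasurable hfm.aestronglyMeasurable]
  refine (integral_prod _ hitg).trans ?_
  refine (integral_congr_ae (g := fun _ => (0 : ℝ)) ?_).trans (by simp)
  -- With the configuration outside `V` frozen at `ζ`, the function `φ(ζ ⌞ Vᶜ + ·)` is a test
  -- function for the problem in the box, and the equation holds on each level.
  filter_upwards [e1, hitg.prod_right_ae] with ζ hζ hiζ
  have hps := hφ.freeze hD.measU hD.meas hD.subset ζ
  rw [fvU_eq_sum] at hiζ ⊢
  have h3 := hasSum_integral_measure hiζ
  refine h3.unique ?_
  convert hasSum_zero with n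
  rw [integral_smul_measure]
  refine smul_eq_zero_of_right _ ?_
  have hpg := pgrad_freeze_ae hD hφ ζ n
  have hfn : msq (levU U V n)
      (uncurry (pgrad fun μ => φ (restr ζ Vᶜ + restr μ V))) < ∞ := by
    refine (msq_congr (h := fun p : Pt d => pgrad φ (restr ζ Vᶜ + p.1) p.2) hpg).trans_lt ?_
    have h4 := (fvW_mul_msq_le ρ U V n _).trans_lt hζ
    exact lt_of_mul_lt_mul_left' (lt_of_lt_of_eq h4
      (ENNReal.mul_top (fvW_ne_zero hρ V n)).symm)
  rw [← h.el _ hps n hfn]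
  refine integral_congr_ae ?_
  filter_upwards [hpg, ae_levU_mem hD n] with p h5 h6
  rw [h5]
  simp only [Function.comp_apply, uncurry, lift]
  rw [clip_restr_compl_add hD.meas ζ h6.1 (by rw [h6.2.1]; simp)]

/-! ### The corrector belongs to `H¹` -/

theorem IsCorr.msq_fvU_lt_top (hρ : 0 ≤ ρ)
    (hD : Dom U V) (hA : IsField Λ A) (h : IsCorr U V A q g) : msq (fvU ρ U V) (uncurry g) < ∞ :=
  (msq_fvU_lt_top_of_le hρ hD fun n => h.msq_le hD hA n).trans_lt
    (mul_lt_top (by finiteness) hD.bddU.measure_lt_top)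

/-- The approximations converge only level by level. Cutting off configurations with too many
particles in `V` leaves finitely many levels, and the tail of the corrector is small because its
energy is summable. Emptying the outside of `V` makes the function depend on the box only. -/
theorem IsCorr.exists_smooth_approx (hρ : 0 ≤ ρ)
    (hD : Dom U V) (hA : IsField Λ A) (h : IsCorr U V A q g) {ε : ℝ≥0∞} (hε : ε ≠ 0) : ∃ Φ :
    Config d → ℝ, SmoothIn U Φ ∧ msq (poisU ρ U) (fun p => pgrad Φ p.1 p.2 - lift V g p) ≤ ε := by
  have hfin : ∑' n, fvW ρ V n * msq (levU U V n) (uncurry g) ≠ ∞ := by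
    rw [← msq_fvU]; exact (h.msq_fvU_lt_top hρ hD hA).ne
  have hε2 : 0 < ε / 2 := ENNReal.div_pos hε (by simp)
  obtain ⟨K, hK⟩ := ((ENNReal.tendsto_sum_nat_add _ hfin).eventually (gt_mem_nhds hε2)).exists
  obtain ⟨φ, hφ, hlim⟩ := h.approx
  have hsum : Tendsto (fun j => ∑ n ∈ Finset.range K, fvW ρ V n *
      msq (levU U V n) fun p => pgrad (φ j) p.1 p.2 - g p.1 p.2) atTop (𝓝 0) := by
    have := tendsto_finsetSum (Finset.range K) fun n _ =>
      ENNReal.Tendsto.const_mul (a := fvW ρ V n) (hlim n) (Or.inr (fvW_ne_top ρ V n))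
    simpa using this
  obtain ⟨j, hj⟩ := (hsum.eventually (gt_mem_nhds hε2)).exists
  -- The cutoff is `K + 1` because it is evaluated at `η + δ_z`; it keeps the levels `n < K` of `η`.
  set f : ℝ≥0∞ → ℝ := fun t => if t < ((K + 1 : ℕ) : ℝ≥0∞) then 1 else 0 with hf
  have hfm : Measurable f := Measurable.ite measurableSet_Iio measurable_const measurable_const
  have hce : IsExterior U fun μ : Config d => f (μ.1 V) :=
    isExterior_mass hD.measU hD.meas hD.subset f
  have hcm : Measurable fun μ : Config d => f (μ.1 V) :=
    hfm.comp (Config.measurable_apply hD.meas)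
  have hfr := (hφ j).1.freeze hD.measU hD.meas hD.subset 0
  refine ⟨fun μ => f (μ.1 V) * φ j (restr 0 Vᶜ + restr μ V),
    hfr.exterior_mul hD.measU hcm hce, ?_⟩
  set G : Fld d := fun η z =>
    (if η.1 V < (K : ℝ≥0∞) then (1 : ℝ) else 0) • pgrad (φ j) η z - g η z with hG
  have hGm : Measurable (uncurry G) := by
    have h1 : Measurable fun p : Pt d =>
        (if p.1.1 V < (K : ℝ≥0∞) then (1 : ℝ) else 0) :=
      Measurable.ite (((Config.measurable_apply hD.meas).comp measurable_fst) measurableSet_Iio)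
        measurable_const measurable_const
    exact (h1.smul (hφ j).2.1).sub h.meas
  have hae : (fun p : Pt d =>
      pgrad (fun μ : Config d => f (μ.1 V) * φ j (restr 0 Vᶜ + restr μ V)) p.1 p.2
        - lift V g p) =ᵐ[poisU ρ U] lift V G := by
    filter_upwards [ae_poisU_mem ρ hD] with p hp
    have hres : restr (0 : Config d) Vᶜ + restr p.1 V = restr p.1 V := by rw [restr_zero, zero_add]
    have hU : (restr p.1 V).1 U < ∞ := by
      rw [restr_apply _ _ hD.measU]
      exact lt_of_le_of_lt (measure_mono Set.inter_subset_right) hp.1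
    have hpg : HasPG (φ j) (restr (0 : Config d) Vᶜ + restr p.1 V) p.2
        (pgrad (φ j) (restr p.1 V) p.2) := by
      rw [hres]; exact (hφ j).1.hasPG hD.isOpen hU hp.2
    have h2 := ((HasPG.freeze hD.isOpen hD.meas hD.subset hp.2 hpg).exterior_mul hD.isOpen hce
      hp.2).pgrad_eq
    rw [h2]
    simp only [lift, hG, clip_of_lt hp.1]
    congr 2
    obtain ⟨k, hk⟩ := exists_nat_mass p.1 hD.meas hp.1
    simp only [hf, Config.add_apply, particle_apply _ hD.meas,
        indicator_of_mem (hD.subset hp.2), Pi.one_apply, restr_apply _ _ hD.meas,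
        Set.inter_self, hk]
    norm_cast
    simp
  rw [msq_congr hae, msq_lift hρ hD hGm, msq_fvU,
    ← Summable.sum_add_tsum_nat_add' (k := K) ENNReal.summable]
  refine le_trans (add_le_add ?_ ?_) (ENNReal.add_halves ε).le
  · refine le_trans (Finset.sum_le_sum fun n hn => le_of_eq ?_) hj.le
    congr 1
    refine msq_congr ?_
    filter_upwards [ae_levU_mem hD n] with p hp
    simp only [uncurry, hG, hp.2.1]
    rw [if_pos (by exact_mod_cast Finset.mem_range.1 hn), one_smul]
  · refine le_trans (ENNReal.tsum_le_tsum fun n => le_of_eq ?_) hK.le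
    congr 1
    rw [msq, msq]
    refine lintegral_congr_ae ?_
    filter_upwards [ae_levU_mem hD (n + K)] with p hp
    simp only [uncurry, hG, hp.2.1]
    rw [if_neg (by rw [not_lt]; exact_mod_cast Nat.le_add_left K n), zero_smul, zero_sub,
      enorm_neg]

theorem pgrad_add_poisU (ρ : ℝ)
    (hD : Dom U V) {φ φ' : Config d → ℝ} (h : SmoothIn U φ) (h' : SmoothIn U φ') : ∀ᵐ p :
    Pt d ∂poisU ρ U, pgrad (fun μ => φ μ + φ' μ) p.1 p.2 = pgrad φ p.1 p.2 + pgrad φ' p.1 p.2 := by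
  filter_upwards [ae_poisU_mem ρ hD] with p hp
  have hf := lt_of_le_of_lt (measure_mono hD.subset) hp.1
  exact ((h.hasPG hD.isOpen hf hp.2).add (h'.hasPG hD.isOpen hf hp.2)).pgrad_eq

theorem pgrad_sub_poisU (ρ : ℝ)
    (hD : Dom U V) {φ φ' : Config d → ℝ} (h : SmoothIn U φ) (h' : SmoothIn U φ') : ∀ᵐ p :
    Pt d ∂poisU ρ U, pgrad (fun μ => φ μ - φ' μ) p.1 p.2 = pgrad φ p.1 p.2 - pgrad φ' p.1 p.2 := by
  filter_upwards [ae_poisU_mem ρ hD] with p hp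
  have hf := lt_of_le_of_lt (measure_mono hD.subset) hp.1
  exact ((h.hasPG hD.isOpen hf hp.2).sub (h'.hasPG hD.isOpen hf hp.2)).pgrad_eq

/-- `φ` minus its average over the fibres: a function with the same gradient. -/
def centre (U : Set (E d)) (φ : Config d → ℝ) (μ : Config d) : ℝ := φ μ - fibreAvg U φ μ

theorem smoothIn_centre (hU : MeasurableSet U) (h : SmoothIn U φ) : SmoothIn U (centre U φ) :=
  h.sub ((isExterior_fibreAvg U φ).smoothIn hU (measurable_fibreAvg hU h.1))

theorem pgrad_centre (ρ : ℝ) (hD : Dom U V)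
    (h : SmoothIn U φ) : ∀ᵐ p : Pt d ∂poisU ρ U, pgrad (centre U φ) p.1 p.2 = pgrad φ p.1 p.2 := by
  filter_upwards [ae_poisU_mem ρ hD] with p hp
  have hf := lt_of_le_of_lt (measure_mono hD.subset) hp.1
  have h1 := ((h.hasPG hD.isOpen hf hp.2).sub
    ((isExterior_fibreAvg U φ).hasPG hD.isOpen p.1 hp.2)).pgrad_eq
  rw [sub_zero] at h1
  exact h1

theorem exists_msq_centre_le (hρ : 0 ≤ ρ) (hD : Dom U V) : ∃ K : ℝ≥0, ∀ φ : Config d → ℝ,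
    SmoothIn U φ → msq (poissonLaw d ρ) (centre U φ) ≤ K * msq (poisU ρ U) (uncurry (pgrad φ)) := by
  obtain ⟨K, hK, h⟩ := exists_poincare hρ hD.isOpen hD.convex hD.bddU hD.pos
  refine ⟨K.toNNReal, fun φ hφ => ?_⟩
  rw [ENNReal.coe_toNNReal hK]
  refine (h φ hφ).trans (le_of_eq ?_)
  rw [msq, poisU, lintegral_prod _ ((measurable_pgrad hφ.1).enorm.pow_const 2).aemeasurable]
  rfl

theorem exists_limit_of_msq_le {α : Type*} [MeasurableSpace α]
    {P : Measure α} {ψ : ℕ → α → ℝ} (hm : ∀ j, Measurable (ψ j)) (h2 : ∀ j, msq P (ψ j) < ∞)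
    {K : ℝ≥0} (hd : ∀ j, msq P (fun x => ψ (j + 1) x - ψ j x) ≤ (K * (1 / 4) ^ j : ℝ≥0)) :
    ∃ u : α → ℝ, Measurable u ∧ Tendsto (fun j => msq P fun x => ψ j x - u x) atTop (𝓝 0) := by
  have hmem : ∀ j, MemLp (ψ j) 2 P := fun j =>
    (memLp_two_iff_msq (hm j).aestronglyMeasurable).2 (h2 j)
  have hc : CauchySeq fun j => (hmem j).toLp := by
    refine cauchySeq_of_le_geometric (1 / 2) (NNReal.sqrt K) (by norm_num) fun j => ?_
    rw [dist_comm, dist_eq_norm, ← MemLp.toLp_sub, Lp.norm_toLp]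
    refine ENNReal.toReal_le_of_le_ofReal (by positivity) ?_
    have h1 : eLpNorm (ψ (j + 1) - ψ j) 2 P ^ 2 ≤ (NNReal.sqrt K * (1 / 2) ^ j : ℝ≥0) ^ 2 := by
      rw [eLpNorm_two_sq]
      refine (hd j).trans (le_of_eq ?_)
      rw [← ENNReal.coe_pow]
      congr 1
      rw [mul_pow, NNReal.sq_sqrt, ← pow_mul, mul_comm j 2, pow_mul]
      norm_num
    have h3 := (ENNReal.pow_le_pow_left_iff two_ne_zero).1 h1
    refine h3.trans (le_of_eq ?_)
    rw [← ENNReal.ofReal_coe_nnreal]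
    norm_num
  obtain ⟨x, hx⟩ := cauchySeq_tendsto_of_complete hc
  have hsm := Lp.aestronglyMeasurable x
  refine ⟨hsm.mk x, hsm.stronglyMeasurable_mk.measurable, ?_⟩
  have h1 := ENNReal.Tendsto.pow (n := 2) ((Lp.tendsto_Lp_iff_tendsto_eLpNorm' _ x).1 hx)
  rw [zero_pow two_ne_zero] at h1
  refine h1.congr fun j => ?_
  rw [eLpNorm_two_sq]
  refine msq_congr ?_
  filter_upwards [(hmem j).coeFn_toLp, hsm.ae_eq_mk] with p h3 h4
  rw [Pi.sub_apply, h3, h4]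

/-- A limit of smooth gradients is the gradient of a function in `L²`. -/
theorem exists_potential (hρ : 0 ≤ ρ) (hD : Dom U V)
    {F : Pt d → E d} (hF2 : msq (poisU ρ U) F < ∞) (hFm : Measurable F) (happ : ∀ ε : ℝ≥0∞, ε ≠ 0 →
    ∃ Φ : Config d → ℝ, SmoothIn U Φ ∧ msq (poisU ρ U) (fun p => pgrad Φ p.1 p.2 - F p) ≤ ε) :
    ∃ (u : Config d → ℝ) (ψ : ℕ → Config d → ℝ), Measurable u ∧ (∀ j,
    SmoothIn U (ψ j) ∧ msq (poissonLaw d ρ) (ψ j) < ∞ ∧ msq (poisU ρ U) (uncurry (pgrad (ψ j))) < ∞)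
    ∧ Tendsto (fun j => msq (poissonLaw d ρ) fun μ => ψ j μ - u μ) atTop (𝓝 0)
    ∧ Tendsto (fun j => msq (poisU ρ U) fun p => pgrad (ψ j) p.1 p.2 - F p) atTop (𝓝 0) := by
  obtain ⟨K, hK⟩ := exists_msq_centre_le hρ hD
  have hpos : ∀ k : ℕ, (((1 / 4 : ℝ≥0) ^ k : ℝ≥0) : ℝ≥0∞) ≠ 0 := fun k => by
    rw [ENNReal.coe_ne_zero]; positivity
  choose Φ hΦ hΦF using fun k : ℕ => happ _ (hpos k)
  have hΦm : ∀ k, Measurable fun p : Pt d => pgrad (Φ k) p.1 p.2 := fun k =>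
    measurable_pgrad (hΦ k).1
  -- Each increment is centred separately, rather than each `Φ k`. The Poincaré inequality then
  -- bounds the increments directly, without linearity of the fibre averages, which would require
  -- integrability on the fibres.
  set ψ : ℕ → Config d → ℝ := fun N => Nat.rec (centre U (Φ 0))
    (fun k f μ => f μ + centre U (fun ν => Φ (k + 1) ν - Φ k ν) μ) N with hψ
  have hψs : ∀ k μ, ψ (k + 1) μ = ψ k μ + centre U (fun ν => Φ (k + 1) ν - Φ k ν) μ :=
    fun k μ => rfl
  have hθ : ∀ k, SmoothIn U (centre U fun ν => Φ (k + 1) ν - Φ k ν) := fun k =>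
    smoothIn_centre hD.measU ((hΦ (k + 1)).sub (hΦ k))
  have hsm : ∀ k, SmoothIn U (ψ k) := by
    intro k
    induction k with
    | zero => exact smoothIn_centre hD.measU (hΦ 0)
    | succ k ih => exact ih.add (hθ k)
  have hgr : ∀ k, ∀ᵐ p : Pt d ∂poisU ρ U, pgrad (ψ k) p.1 p.2 = pgrad (Φ k) p.1 p.2 := by
    intro k
    induction k with
    | zero => exact pgrad_centre ρ hD (hΦ 0)
    | succ k ih =>
      filter_upwards [ih, pgrad_add_poisU ρ hD (hsm k) (hθ k),
        pgrad_centre ρ hD ((hΦ (k + 1)).sub (hΦ k)), pgrad_sub_poisU ρ hD (hΦ (k + 1)) (hΦ k)]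
        with p h1 h2 h3 h4
      have h5 : pgrad (ψ (k + 1)) p.1 p.2 =
        pgrad (fun μ => ψ k μ + centre U (fun ν => Φ (k + 1) ν - Φ k ν) μ) p.1 p.2 := rfl
      rw [h5, h2, h3, h4, h1]
      abel
  have hΦ2 : ∀ k, msq (poisU ρ U) (uncurry (pgrad (Φ k))) < ∞ := by
    intro k
    have h1 := msq_add_le (m := poisU ρ U) (f := fun p => pgrad (Φ k) p.1 p.2 - F p) (h := F)
      ((hΦm k).sub hFm)
    simp only [sub_add_cancel] at h1
    exact lt_of_le_of_lt h1 (ENNReal.add_lt_top.2 ⟨mul_lt_top (by simp)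
      ((hΦF k).trans_lt ENNReal.coe_lt_top), mul_lt_top (by simp) hF2⟩)
  have hinc : ∀ k, msq (poissonLaw d ρ) (centre U fun ν => Φ (k + 1) ν - Φ k ν)
      ≤ ((4 * K) * (1 / 4) ^ k : ℝ≥0) := by
    intro k
    refine (hK _ ((hΦ (k + 1)).sub (hΦ k))).trans ?_
    have h1 : msq (poisU ρ U) (uncurry (pgrad fun ν => Φ (k + 1) ν - Φ k ν))
        ≤ ((4 : ℝ≥0) * (1 / 4) ^ k : ℝ≥0) := by
      rw [msq_congr (h := fun p : Pt d => (pgrad (Φ (k + 1)) p.1 p.2 - F p) -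
        (pgrad (Φ k) p.1 p.2 - F p))
        ((pgrad_sub_poisU ρ hD (hΦ (k + 1)) (hΦ k)).mono fun p hp => by
          simpa [uncurry] using hp)]
      refine (msq_sub_le ((hΦm (k + 1)).sub hFm)).trans ?_
      calc _ ≤ 2 * (((1 / 4 : ℝ≥0) ^ (k + 1) : ℝ≥0) : ℝ≥0∞) + 2 * (((1 / 4 : ℝ≥0) ^ k : ℝ≥0) : ℝ≥0∞) := by
            gcongr
            · exact hΦF (k + 1)
            · exact hΦF k
        _ ≤ _ := by
            rw [show (2 : ℝ≥0∞) = ((2 : ℝ≥0) : ℝ≥0∞) by simp, ← ENNReal.coe_mul, ← ENNReal.coe_mul,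
              ← ENNReal.coe_add, ENNReal.coe_le_coe]
            rw [pow_succ]
            have h0 : (0 : ℝ≥0) ≤ (1 / 4) ^ k := bot_le
            rw [← NNReal.coe_le_coe]
            push_cast
            have : (0 : ℝ) ≤ (1 / 4) ^ k := by positivity
            linarith
    calc _ ≤ (K : ℝ≥0∞) * ((4 : ℝ≥0) * (1 / 4) ^ k : ℝ≥0) := by gcongr
      _ = _ := by rw [← ENNReal.coe_mul]; congr 1; ring
  have hψ2 : ∀ k, msq (poissonLaw d ρ) (ψ k) < ∞ := by
    intro k
    induction k with
    | zero => exact (hK _ (hΦ 0)).trans_lt (mul_lt_top ENNReal.coe_lt_top (hΦ2 0))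
    | succ k ih =>
      refine lt_of_le_of_lt (msq_add_le (hsm k).1) (ENNReal.add_lt_top.2
        ⟨mul_lt_top (by simp) ih, mul_lt_top (by simp)
          ((hinc k).trans_lt ENNReal.coe_lt_top)⟩)
  obtain ⟨u, hu, hlim⟩ := exists_limit_of_msq_le (P := poissonLaw d ρ) (fun k => (hsm k).1) hψ2
    (K := 4 * K) fun k => by
      simp only [hψs, add_sub_cancel_left]
      exact hinc k
  refine ⟨u, ψ, hu, fun k => ⟨hsm k, hψ2 k, ?_⟩, hlim, ?_⟩
  · exact (msq_congr (h := uncurry (pgrad (Φ k))) (hgr k)).trans_lt (hΦ2 k)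
  · have h1 : Tendsto (fun k : ℕ => (((1 / 4 : ℝ≥0) ^ k : ℝ≥0) : ℝ≥0∞)) atTop (𝓝 0) := by
      have := NNReal.tendsto_pow_atTop_nhds_zero_of_lt_one (r := 1 / 4)
        (by rw [← NNReal.coe_lt_coe]; norm_num)
      rw [← ENNReal.coe_zero]
      exact ENNReal.tendsto_coe.2 this
    refine tendsto_of_tendsto_of_tendsto_of_le_of_le tendsto_const_nhds h1 (fun _ => bot_le)
      fun k => ?_
    refine (le_of_eq (msq_congr ?_)).trans (hΦF k)
    filter_upwards [hgr k] with p hp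
    rw [hp]

/-! ### The coefficient field seen from the box `V` -/

theorem shift_apply (x : E d) (μ : Config d)
    {s : Set (E d)} (hs : MeasurableSet s) : (shift x μ).1 s = μ.1 ((fun y => y - x) ⁻¹' s) :=
  Measure.map_apply (measurable_id.sub_const x) hs

theorem restr_shift_ball (x : E d) (μ : Config d)
    (r : ℝ) : restr (shift x μ) (Metric.ball 0 r) = shift x (restr μ (Metric.ball x r)) := by
  refine Config.ext_apply fun s hs => ?_
  have hb : MeasurableSet (Metric.ball (0 : E d) r) := Metric.isOpen_ball.measurableSet
  rw [restr_apply _ _ hs, shift_apply _ _ (hs.inter hb), shift_apply _ _ hs,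
    restr_apply _ _ (hs.preimage (measurable_id'.sub_const x))]
  congr 1
  ext y
  simp [dist_eq_norm]

theorem Admissible.aField_congr (h : Admissible Λ a₀) {μ ν : Config d} {x : E d} (hr : restr μ
    (Metric.ball x (1 / 2)) = restr ν (Metric.ball x (1 / 2))) : aField a₀ μ x = aField a₀ ν x := by
  rw [aField, aField, h.finite_range, restr_shift_ball, hr, ← restr_shift_ball, ← h.finite_range]

theorem restr_clip {V B : Set (E d)} (hB : MeasurableSet B)
    (hBV : B ⊆ V) {μ : Config d} (hμ : μ.1 V < ∞) : restr (clip V μ) B = restr μ B := by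
  rw [clip_of_lt hμ, restr_restr _ hB, Set.inter_eq_left.2 hBV]

theorem Admissible.aField_clip (h : Admissible Λ a₀) {x : E d} (hx : Metric.ball x (1 / 2) ⊆ V)
    {μ : Config d} (hμ : μ.1 V < ∞) : aField a₀ (clip V μ) x = aField a₀ μ x :=
  h.aField_congr (restr_clip Metric.isOpen_ball.measurableSet hx hμ)

theorem Admissible.aField_clip_add (h : Admissible Λ a₀)
    {x : E d} (hx : Metric.ball x (1 / 2) ⊆ V) {μ : Config d}
    (hμ : μ.1 V < ∞) (ν : Config d) : aField a₀ (clip V μ + ν) x = aField a₀ (μ + ν) x :=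
  h.aField_congr (by rw [restr_add, restr_add, restr_clip Metric.isOpen_ball.measurableSet hx hμ])

theorem shift_add (x : E d) (μ ν : Config d) : shift x (μ + ν) = shift x μ + shift x ν := by
  refine Config.ext_apply fun s hs => ?_
  rw [shift_apply _ _ hs, Config.add_apply, Config.add_apply, shift_apply _ _ hs, shift_apply _ _ hs]

theorem shift_particle (x y : E d) : shift x (particle y) = particle (y - x) := by
  refine Config.ext_apply fun s hs => ?_
  rw [shift_apply _ _ hs, particle_apply _ hs,
    particle_apply _ (hs.preimage (measurable_id'.sub_const x))]
  rfl

/-- The coefficient `a(μ + δ_z, z)` of a particle at `z`, as a function of the particles in `V`. -/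
def fieldOf (a₀ : Config d → Matrix (Fin d) (Fin d) ℝ)
    (V : Set (E d)) (μ : Config d) (z : E d) : E d →L[ℝ] E d :=
  Matrix.toEuclideanCLM (n := Fin d) (𝕜 := ℝ) (aField a₀ (clip V μ + particle z) z)

theorem measurable_toEuclideanCLM {α : Type*} [MeasurableSpace α]
    {M : α → Matrix (Fin d) (Fin d) ℝ} (h : ∀ i j, Measurable fun x => M x i j) :
    Measurable fun x => Matrix.toEuclideanCLM (n := Fin d) (𝕜 := ℝ) (M x) := by
  have h1 : ∀ x, Matrix.toEuclideanCLM (n := Fin d) (𝕜 := ℝ) (M x) =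
      ∑ i, ∑ j, M x i j • Matrix.toEuclideanCLM (n := Fin d) (𝕜 := ℝ) (Matrix.single i j 1) := by
    intro x
    conv_lhs => rw [Matrix.matrix_eq_sum_single (M x)]
    simp only [map_sum, ← map_smul]
    simp
  simp only [h1]
  exact Finset.measurable_fun_sum _ fun i _ => Finset.measurable_fun_sum _ fun j _ =>
    (h i j).smul_const _

theorem inner_toEuclideanCLM_self_le {M N : Matrix (Fin d) (Fin d) ℝ}
    (h : (N - M).PosSemidef) (x : E d) :
    inner ℝ x (Matrix.toEuclideanCLM (n := Fin d) (𝕜 := ℝ) M x)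
      ≤ inner ℝ x (Matrix.toEuclideanCLM (n := Fin d) (𝕜 := ℝ) N x) := by
  have h1 := h.dotProduct_mulVec_nonneg x.ofLp
  simp only [star_trivial, Matrix.sub_mulVec, dotProduct_sub] at h1
  rw [Matrix.inner_toEuclideanCLM, Matrix.inner_toEuclideanCLM]
  linarith

theorem Admissible.isField (hd : 1 ≤ d)
    (h : Admissible Λ a₀) (hV : MeasurableSet V) : IsField Λ (fieldOf a₀ V) := by
  have hsymm : ∀ μ z x y, inner ℝ (fieldOf a₀ V μ z x) y = inner ℝ x (fieldOf a₀ V μ z y) := by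
    intro μ z x y
    rw [real_inner_comm, fieldOf, Matrix.inner_toEuclideanCLM, Matrix.inner_toEuclideanCLM,
      Matrix.dotProduct_mulVec, dotProduct_comm, ← Matrix.mulVec_transpose]
    have := h.symm (shift z (clip V μ + particle z))
    rw [aField, this.eq]
  have hlow : ∀ μ z x, ‖x‖ ^ 2 ≤ inner ℝ x (fieldOf a₀ V μ z x) := by
    intro μ z x
    have := inner_toEuclideanCLM_self_le (h.lower (shift z (clip V μ + particle z))) x
    rw [map_one] at this
    rw [← real_inner_self_eq_norm_sq]
    exact this
  have hup : ∀ μ z x, inner ℝ x (fieldOf a₀ V μ z x) ≤ Λ * ‖x‖ ^ 2 := by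
    intro μ z x
    have := inner_toEuclideanCLM_self_le (h.upper (shift z (clip V μ + particle z))) x
    rw [map_smul, map_one, smul_apply, inner_smul_right] at this
    rw [← real_inner_self_eq_norm_sq]
    exact this
  refine ⟨?_, hsymm, hlow, ?_, ?_⟩
  · refine measurable_toEuclideanCLM fun i j => ?_
    have h1 : Measurable fun p : Pt d => shift p.2 (clip V p.1 + particle p.2) := by
      simp only [shift_add, shift_particle]
      exact (measurable_shift_clip hV).add (by fun_prop)
    exact (h.measurable i j).comp h1
  · intro μ z
    set T := fieldOf a₀ V μ z with hT
    -- The two bounds are compared on a unit vector, which exists because `d ≥ 1`.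
    have hΛ : 0 ≤ Λ := by
      have i : Fin d := ⟨0, hd⟩
      have h1 := (hlow μ z (EuclideanSpace.single i 1)).trans (hup μ z (EuclideanSpace.single i 1))
      simp at h1
      linarith
    refine T.opNorm_le_bound hΛ fun x => ?_
    set s := ‖T x‖
    set t := ‖x‖
    by_contra! hlt
    have hs : 0 < s := lt_of_le_of_lt (by positivity) hlt
    -- With `s = ‖T x‖` and `t = ‖x‖`, subtracting the lower bound at `s x - t T x` from the upper
    -- bound at `s x + t T x` leaves `4 s³ t ≤ Λ ‖s x + t T x‖² ≤ 4 Λ s² t²`, that is, `s ≤ Λ t`.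
    have h1 := hlow μ z (s • x - t • T x)
    have h2 := hup μ z (s • x + t • T x)
    have h3 : (0 : ℝ) ≤ ‖s • x - t • T x‖ ^ 2 := by positivity
    rw [← hT] at h1 h2
    have h4 := h3.trans h1
    have n1 : ‖s • x + t • T x‖ ^ 2 ≤ (2 * (s * t)) ^ 2 := by
      have : ‖s • x + t • T x‖ ≤ 2 * (s * t) := by
        refine (norm_add_le _ _).trans (le_of_eq ?_)
        rw [norm_smul, norm_smul, Real.norm_of_nonneg (norm_nonneg _),
          Real.norm_of_nonneg (norm_nonneg _)]
        ring
      gcongr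
    have h5 : inner ℝ x (T (T x)) = s ^ 2 := by
      rw [← hsymm, real_inner_self_eq_norm_sq]
    have h6 : inner ℝ (T x) (T x) = s ^ 2 := real_inner_self_eq_norm_sq _
    simp only [map_add, map_sub, map_smul, inner_add_left, inner_add_right, inner_sub_left,
      inner_sub_right, real_inner_smul_left, real_inner_smul_right, h5, h6] at h2 h4
    have h7 : 4 * (s * t * s ^ 2) ≤ Λ * (2 * (s * t)) ^ 2 := by nlinarith
    have ht : t ≠ 0 := by
      intro h0
      have : x = 0 := norm_eq_zero.1 h0
      simp [s, this] at hs
    have ht' : 0 < t := lt_of_le_of_ne (norm_nonneg _) (Ne.symm ht)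
    have h8 : s ^ 2 * (s * t) ≤ s ^ 2 * (t * (Λ * t)) := by nlinarith
    have h9 := le_of_mul_le_mul_left h8 (by positivity)
    rw [mul_comm s t] at h9
    have := le_of_mul_le_mul_left h9 ht'
    linarith
  · intro μ z y hy
    unfold fieldOf
    congr 1
    refine h.aField_congr ?_
    have hb : MeasurableSet (Metric.ball z (1 / 2)) := Metric.isOpen_ball.measurableSet
    rw [restr_add, restr_add]
    congr 1
    by_cases hμ : μ.1 V < ∞
    · rw [clip_of_lt hμ, clip_of_lt ((mass_add_particle_lt hV).2 hμ), restr_add, restr_add,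
        restr_restr (particle y) hb]
      have : restr (particle y) (Metric.ball z (1 / 2) ∩ V) = 0 :=
        restr_particle_of_notMem (hb.inter hV) fun h => hy h.1
      rw [this, add_zero]
    · rw [clip_of_not_lt hμ, clip_of_not_lt (fun h => hμ ((mass_add_particle_lt hV).1 h))]

/-! ### Variational characterization of the corrector -/

/-- The gradient at an added particle. -/
def pull (G : Fld d) (p : Pt d) : E d :=
  G (p.1 + particle p.2) p.2

theorem measurable_pull {G : Fld d} (hG : Measurable (uncurry G)) : Measurable (pull G) :=
  hG.comp (measurable_add_particle.prodMk measurable_snd)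

theorem ae_restrict_exists (hU : MeasurableSet U)
    (μ : Config d) : ∀ᵐ x ∂μ.1.restrict U, x ∈ U ∧ ∃ ν : Config d, μ = ν + particle x :=
  (ae_restrict_mem hU).and (ae_restrict_of_ae (ae_exists_eq_add_particle μ))

theorem clipKernel_eq_restrict (hU : MeasurableSet U)
    {μ : Config d} (h : μ.1 U < ∞) : clipKernel U μ = μ.1.restrict U := by
  rw [clipKernel_apply hU, clip_of_lt h]; rfl

/-- No measurability is asked of `F`: only its values at particles of `U` count, and there it is
replaced by the jointly measurable `F'`. This is how `grad` enters the Mecke formula. -/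
theorem lintegral_mecke_restrict (ρ : ℝ) (hU : MeasurableSet U) (hb : Bornology.IsBounded U)
    {F F' : Config d → E d → ℝ≥0∞} (hF' : Measurable (uncurry F')) (h : ∀ (ν : Config d)
    (x : E d), ν.1 U < ∞ → x ∈ U → F (ν + particle x) x = F' (ν + particle x) x) : ∫⁻ μ, ∫⁻ x in U,
    F μ x ∂μ.1 ∂poissonLaw d ρ = ofReal ρ * ∫⁻ p, F' (p.1 + particle p.2) p.2 ∂poisU ρ U := by
  have hm : Measurable fun p : Pt d => F' (p.1 + particle p.2) p.2 :=
    hF'.comp (measurable_add_particle.prodMk measurable_snd)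
  rw [poisU, lintegral_prod_symm' _ hm, ← lintegral_mecke ρ hU hb hF']
  refine lintegral_congr_ae ?_
  filter_upwards [ae_poissonLaw_lt_top ρ hU hb] with μ hμ
  rw [clipKernel_eq_restrict hU hμ]
  refine lintegral_congr_ae ?_
  filter_upwards [ae_restrict_exists hU μ] with x hx
  obtain ⟨hxU, ν, rfl⟩ := hx
  exact h ν x ((mass_add_particle_lt hU).1 hμ) hxU

theorem lintegral_grad_sub (ρ : ℝ) (hD : Dom U V) (hφ : SmoothIn U φ)
    {G : Fld d} (hG : Measurable (uncurry G)) : ∫⁻ μ, ∫⁻ x in U, ‖grad φ μ x - G μ x‖ₑ ^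
    2 ∂μ.1 ∂poissonLaw d ρ = ofReal ρ * msq (poisU ρ U) (fun p => pgrad φ p.1 p.2 - pull G p) := by
  have hU := hD.measU
  have hm : Measurable fun p : Pt d => ‖pgrad φ (remIn U p) p.2 - G p.1 p.2‖ₑ ^ 2 :=
    ((((measurable_pgrad hφ.1).comp ((measurable_remIn hU).prodMk measurable_snd)).sub
      hG).enorm.pow_const 2)
  rw [lintegral_mecke_restrict ρ hU hD.bddU
    (F' := fun μ x => ‖pgrad φ (remIn U (μ, x)) x - G μ x‖ₑ ^ 2) hm]
  · congr 1
    refine lintegral_congr_ae ?_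
    filter_upwards [ae_poisU_mem ρ hD] with p hp
    rw [remIn_add_particle hU hp.2 (lt_of_le_of_lt (measure_mono hD.subset) hp.1)]
    rfl
  · intro ν x hν hx
    rw [hφ.grad_eq hD.isOpen hν hx, remIn_add_particle hU hx hν]

theorem h1NormSq_sub (ρ : ℝ) (hD : Dom U V)
    (hφ : SmoothIn U φ) (f : Config d → ℝ) {G : Fld d} (hG : Measurable (uncurry G)) :
    h1NormSq ρ U (fun μ => φ μ - f μ) (fun μ x => grad φ μ x - G μ x) = msq (poissonLaw d ρ)
    (fun μ => φ μ - f μ) + ofReal ρ * msq (poisU ρ U) (fun p => pgrad φ p.1 p.2 - pull G p) := by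
  rw [h1NormSq, lintegral_grad_sub ρ hD hφ hG]; rfl

theorem h1NormSq_smooth (ρ : ℝ) (hD : Dom U V) (hφ : SmoothIn U φ) : h1NormSq ρ U φ (grad φ)
    = msq (poissonLaw d ρ) φ + ofReal ρ * msq (poisU ρ U) (uncurry (pgrad φ)) := by
  have h := h1NormSq_sub ρ hD hφ (fun _ => 0) (G := fun _ _ => 0) measurable_const
  simp only [sub_zero, pull] at h
  exact h

/-- The gradients of `H¹` functions are limits of smooth gradients. -/
theorem MemH1.exists_approx (hρ : 0 < ρ) (hD : Dom U V)
    {u : Config d → ℝ} {G : Fld d} (h : MemH1 ρ U u G) : msq (poisU ρ U) (pull G) < ∞ ∧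
    ∃ φ : ℕ → Config d → ℝ, (∀ j, SmoothIn U (φ j) ∧ msq (poisU ρ U) (uncurry (pgrad (φ j))) < ∞) ∧
    Tendsto (fun j => msq (poisU ρ U) fun p => uncurry (pgrad (φ j)) p - pull G p) atTop (𝓝 0) := by
  obtain ⟨-, hGm, φ, hφ, hlim⟩ := h
  have hρ' : ofReal ρ ≠ 0 := by simpa using hρ
  have h2 : ∀ j, msq (poisU ρ U) (uncurry (pgrad (φ j))) < ∞ := fun j => by
    have h1 := (hφ j).2
    rw [h1NormSq_smooth ρ hD (hφ j).1] at h1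
    have h3 := lt_of_le_of_lt le_add_self h1
    exact lt_of_mul_lt_mul_left' (lt_of_lt_of_eq h3 (ENNReal.mul_top hρ').symm)
  have h3 : Tendsto (fun j => msq (poisU ρ U) fun p =>
      uncurry (pgrad (φ j)) p - pull G p) atTop (𝓝 0) := by
    refine tendsto_zero_of_const_mul hρ' ofReal_ne_top (fun j => ?_) hlim
    rw [h1NormSq_sub ρ hD (hφ j).1 u hGm]
    exact le_add_self
  refine ⟨?_, φ, fun j => ⟨(hφ j).1, h2 j⟩, h3⟩
  obtain ⟨j, hj⟩ := (h3.eventually (gt_mem_nhds (zero_lt_one' ℝ≥0∞))).exists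
  have h4 := msq_sub_le (m := poisU ρ U) (f := uncurry (pgrad (φ j)))
    (h := fun p => uncurry (pgrad (φ j)) p - pull G p) (measurable_pgrad (hφ j).1.1)
  simp only [sub_sub_cancel] at h4
  exact lt_of_le_of_lt h4 (ENNReal.add_lt_top.2 ⟨mul_lt_top (by simp) (h2 j),
    mul_lt_top (by simp) (hj.trans (by simp))⟩)

/-- The density of the dual energy. -/
def dens (q : E d) (A : E d →L[ℝ] E d) (x : E d) : ℝ :=
  -(1 / 2) * inner ℝ x (A x) + inner ℝ q x

theorem measurable_dens {α : Type*} [MeasurableSpace α] (q : E d) {A : α → (E d →L[ℝ] E d)} {F :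
    α → E d} (hA : Measurable A) (hF : Measurable F) : Measurable fun p => dens q (A p) (F p) :=
  ((hF.inner (measurable_clm_apply hA hF)).const_mul _).add (measurable_const.inner hF)

theorem integrable_dens {α : Type*} [MeasurableSpace α] {m : Measure α} [IsFiniteMeasure m]
    (q : E d) {A : α → (E d →L[ℝ] E d)} {F : α → E d} (hA : Measurable A) (hF : Measurable F) {M :
    ℝ} (hAM : ∀ p, ‖A p‖ ≤ M) (hF2 : msq m F < ∞) : Integrable (fun p => dens q (A p) (F p)) m :=
  ((integrable_inner_of_msq hF (measurable_clm_apply hA hF) hF2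
    ((msq_clm_apply_le m F hAM).trans_lt (mul_lt_top (by finiteness) hF2))).const_mul _).add
    (integrable_inner_of_msq measurable_const hF (msq_const_lt_top _ _) hF2)

theorem Dom.finite_poisU (ρ : ℝ) (hD : Dom U V) : IsFiniteMeasure (poisU ρ U) :=
  ⟨by rw [poisU_univ]; exact hD.bddU.measure_lt_top⟩

theorem Dom.finite_fvU (hρ : 0 ≤ ρ) (hD : Dom U V) : IsFiniteMeasure (fvU ρ U V) :=
  ⟨by rw [fvU_univ hρ U hD.bdd]; exact hD.bddU.measure_lt_top⟩

theorem measurable_fieldOf_clip (hA : IsField Λ A)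
    (hV : MeasurableSet V) : Measurable fun p : Pt d => A (clip V p.1) p.2 :=
  hA.meas.comp (((measurable_clip hV).comp measurable_fst).prodMk measurable_snd)

theorem clip_clip (hV : MeasurableSet V) (μ : Config d) : clip V (clip V μ) = clip V μ := by
  by_cases h : μ.1 V < ∞
  · rw [clip_of_lt h]
    have h1 : (restr μ V).1 V < ∞ := by rwa [restr_apply _ _ hV, Set.inter_self]
    rw [clip_of_lt h1, restr_restr _ hV, Set.inter_self]
  · rw [clip_of_not_lt h, clip_of_lt (by simp), restr_zero]

theorem fieldOf_clip (a₀ : Config d → Matrix (Fin d) (Fin d) ℝ) (hV : MeasurableSet V)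
    (μ : Config d) (z : E d) : fieldOf a₀ V (clip V μ) z = fieldOf a₀ V μ z := by
  rw [fieldOf, fieldOf, clip_clip hV]

theorem integral_mecke_restrict (hρ : 0 ≤ ρ) (hD : Dom U V) {F F' : Config d → E d → ℝ} (hF' :
    Measurable (uncurry F')) (h : ∀ (ν : Config d) (x : E d), ν.1 V < ∞ → x ∈ U → F (ν + particle x)
    x = F' (ν + particle x) x) (hitg : Integrable (fun p : Pt d => F' (p.1 + particle p.2) p.2)
    (poisU ρ U)) : Integrable (fun μ : Config d => ∫ x in U, F μ x ∂μ.1) (poissonLaw d ρ) ∧ ∫ μ,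
    ∫ x in U, F μ x ∂μ.1 ∂poissonLaw d ρ = ρ * ∫ p, F' (p.1 + particle p.2) p.2 ∂poisU ρ U := by
  have hU := hD.measU
  have hT : Measurable fun p : Pt d => ((p.1 + particle p.2, p.2) : Pt d) :=
    measurable_add_particle.prodMk measurable_snd
  have hcp := poissonLaw_compProd ρ hU hD.bddU
  have hi1 : Integrable (uncurry F') (poissonLaw d ρ ⊗ₘ clipKernel U) := by
    rw [hcp]
    refine Integrable.smul_measure ?_ ofReal_ne_top
    rw [integrable_map_measure hF'.aestronglyMeasurable hT.aemeasurable]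
    exact hitg
  have hae : (fun μ : Config d => ∫ x in U, F μ x ∂μ.1) =ᵐ[poissonLaw d ρ]
      fun μ => ∫ x, F' μ x ∂clipKernel U μ := by
    filter_upwards [ae_poissonLaw_lt_top ρ hD.meas hD.bdd] with μ hμ
    rw [clipKernel_eq_restrict hU (lt_of_le_of_lt (measure_mono hD.subset) hμ)]
    refine integral_congr_ae ?_
    filter_upwards [ae_restrict_exists hU μ] with x hx
    obtain ⟨hxU, ν, rfl⟩ := hx
    exact h ν x ((mass_add_particle_lt hD.meas).1 hμ) hxU
  refine ⟨(integrable_congr hae).2 hi1.integral_compProd, ?_⟩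
  rw [integral_congr_ae hae]
  have h1 := Measure.integral_compProd hi1
  simp only [uncurry] at h1
  have h2 : ∫ p, F' p.1 p.2 ∂((poissonLaw d ρ).prod ((volume : Measure (E d)).restrict U)).map
      (fun p => (p.1 + particle p.2, p.2)) = ∫ p, F' (p.1 + particle p.2) p.2 ∂poisU ρ U :=
    integral_map hT.aemeasurable hF'.aestronglyMeasurable
  rw [← h1, hcp, integral_smul_measure, h2, ENNReal.toReal_ofReal hρ, smul_eq_mul]

/-- The factor `ρ` of the Mecke formula cancels the one in the normalisation, so the intensity
survives only in the law of the surrounding configuration. -/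
theorem dualEnergy_eq (hd : 1 ≤ d) (hρ : 0 < ρ) (hD : Dom U V) (ha : Admissible Λ a₀) (q : E d) {G :
    Fld d} (hG : Measurable (uncurry G)) (hG2 : msq (poisU ρ U) (pull G) < ∞) : dualEnergy a₀ ρ U q
    G = (volume.real U)⁻¹ * ∫ p, dens q (fieldOf a₀ V (clip V p.1) p.2) (pull G p) ∂poisU ρ U := by
  have hA := ha.isField hd hD.meas
  have := hD.finite_poisU ρ
  have hsh : Measurable fun p : Pt d =>
      Matrix.toEuclideanCLM (n := Fin d) (𝕜 := ℝ) (aField a₀ (clip V p.1) p.2) :=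
    measurable_toEuclideanCLM fun i j => (ha.measurable i j).comp (measurable_shift_clip hD.meas)
  have hFm : Measurable fun p : Pt d => dens q
      (Matrix.toEuclideanCLM (n := Fin d) (𝕜 := ℝ) (aField a₀ (clip V p.1) p.2)) (G p.1 p.2) :=
    measurable_dens q hsh hG
  have hae : (fun p : Pt d => dens q (Matrix.toEuclideanCLM (n := Fin d) (𝕜 := ℝ)
      (aField a₀ (clip V (p.1 + particle p.2)) p.2)) (G (p.1 + particle p.2) p.2))
      =ᵐ[poisU ρ U] fun p => dens q (fieldOf a₀ V (clip V p.1) p.2) (pull G p) := by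
    filter_upwards [ae_poisU_mem ρ hD] with p hp
    rw [fieldOf_clip a₀ hD.meas, fieldOf, ha.aField_clip (hD.thick _ hp.2)
      ((mass_add_particle_lt hD.meas).2 hp.1), ha.aField_clip_add (hD.thick _ hp.2) hp.1]
    rfl
  have hitg : Integrable (fun p : Pt d => dens q (fieldOf a₀ V (clip V p.1) p.2)
      (pull G p)) (poisU ρ U) :=
    integrable_dens q (measurable_fieldOf_clip hA hD.meas) (measurable_pull hG)
      (fun p => hA.upper _ _) hG2
  have key := integral_mecke_restrict hρ.le hD
    (F := fun μ x => -(1 / 2) * inner ℝ (G μ x) ((aField a₀ μ x).toEuclideanLin (G μ x))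
        + inner ℝ q (G μ x))
    (F' := fun μ x => dens q (Matrix.toEuclideanCLM (n := Fin d) (𝕜 := ℝ)
      (aField a₀ (clip V μ) x)) (G μ x)) hFm
    (fun ν x hν hx => by
      rw [ha.aField_clip (hD.thick _ hx) ((mass_add_particle_lt hD.meas).2 hν)]
      rfl) ((integrable_congr hae).2 hitg)
  rw [dualEnergy, integral_const_mul, key.2, integral_congr_ae hae, mul_inv, mul_comm ρ⁻¹, mul_assoc,
    inv_mul_cancel_left₀ hρ.ne']

/-- The quadratic form of the corrector. -/
def bform (ρ : ℝ) (U V : Set (E d)) (q : E d) (g : Fld d) : ℝ :=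
  (volume.real U)⁻¹ * ∫ p, inner ℝ q (g p.1 p.2) ∂fvU ρ U V

theorem integral_lift (hρ : 0 ≤ ρ) (hD : Dom U V) {f : Pt d → ℝ}
    (hf : Measurable f) : ∫ p, f (clip V p.1, p.2) ∂poisU ρ U = ∫ p, f p ∂fvU ρ U V := by
  rw [← map_clip_poisU hρ hD, integral_map _ hf.aestronglyMeasurable]
  exact (((measurable_clip hD.meas).comp measurable_fst).prodMk measurable_snd).aemeasurable

section Variational

theorem IsCorr.msq_lift_lt_top (hρ : 0 ≤ ρ)
    (hD : Dom U V) (hA : IsField Λ A) (h : IsCorr U V A q g) : msq (poisU ρ U) (lift V g) < ∞ := by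
  rw [msq_lift hρ hD h.meas]; exact h.msq_fvU_lt_top hρ hD hA

theorem IsCorr.msq_lift_resid_lt_top (hρ : 0 ≤ ρ) (hD : Dom U V)
    (hA : IsField Λ A) (h : IsCorr U V A q g) : msq (poisU ρ U) (lift V (resid A q g)) < ∞ := by
  have := hD.finite_fvU hρ
  rw [msq_lift hρ hD (measurable_resid hA.meas h.meas)]
  exact lt_of_le_of_lt (msq_sub_le (m := fvU ρ U V)
      (f := fun p => A p.1 p.2 (uncurry g p))
      (h := fun _ => q) (hA.measurable_apply h.meas)) (ENNReal.add_lt_top.2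
        ⟨mul_lt_top (by simp) (hA.msq_apply_lt_top (h.msq_fvU_lt_top hρ hD hA)),
          mul_lt_top (by simp) (msq_const_lt_top _ _)⟩)

theorem IsCorr.el_of_tendsto (hρ : 0 < ρ) (hD : Dom U V) (hA : IsField Λ A) (h : IsCorr U V A q g)
    {F : Pt d → E d} (hF : Measurable F) (hF2 : msq (poisU ρ U) F < ∞) {φ : ℕ → Config d → ℝ}
    (hφ : ∀ j, SmoothIn U (φ j) ∧ msq (poisU ρ U) (uncurry (pgrad (φ j))) < ∞)
    (hlim : Tendsto (fun j => msq (poisU ρ U) fun p => uncurry (pgrad (φ j)) p - F p) atTop (𝓝 0)) :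
    ∫ p, inner ℝ (F p) (lift V (resid A q g) p) ∂poisU ρ U = 0 :=
  integral_inner_eq_zero_of_tendsto (f := fun j => uncurry (pgrad (φ j)))
    (fun j => measurable_pgrad (hφ j).1.1) hF
    (measurable_lift hD.meas (measurable_resid hA.meas h.meas)) (fun j => (hφ j).2) hF2
    (h.msq_lift_resid_lt_top hρ.le hD hA) hlim fun j => h.el_poisU hρ hD hA (hφ j).1 (hφ j).2

theorem IsCorr.el_lift (hρ : 0 < ρ) (hD : Dom U V) (hA : IsField Λ A)
    (h : IsCorr U V A q g) : ∫ p, inner ℝ (lift V g p) (lift V (resid A q g) p) ∂poisU ρ U = 0 := by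
  have h2 := h.msq_lift_lt_top hρ.le hD hA
  obtain ⟨u, ψ, -, hψ, -, hlim⟩ := exists_potential hρ.le hD h2 (measurable_lift hD.meas h.meas)
    fun ε hε => h.exists_smooth_approx hρ.le hD hA hε
  exact h.el_of_tendsto hρ hD hA (measurable_lift hD.meas h.meas) h2
    (fun j => ⟨(hψ j).1, (hψ j).2.2⟩) hlim

/-- Completing the square around `y`. The terms in `A y - q` vanish after integration when `y` is
the corrector and `x` is a potential field, which leaves the maximal value minus a quadratic defect.
-/
theorem dens_eq (q : E d) {A : E d →L[ℝ] E d} (hA : ∀ x y, inner ℝ (A x) y = inner ℝ x (A y))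
    (x y : E d) : dens q A x = -(1 / 2) * inner ℝ (x - y)
    (A (x - y)) - inner ℝ x (A y - q) + (1 / 2) * inner ℝ y (A y - q) + (1 / 2) * inner ℝ q y := by
  have h1 : inner ℝ y (A x) = inner ℝ x (A y) := by rw [← hA, real_inner_comm]
  have h2 : inner ℝ x q = inner ℝ q x := real_inner_comm _ _
  have h3 : inner ℝ y q = inner ℝ q y := real_inner_comm _ _
  simp only [dens, map_sub, inner_sub_left, inner_sub_right, h1, h2, h3]
  ring

theorem IsCorr.integral_dens (hρ : 0 < ρ) (hD : Dom U V) (hA : IsField Λ A)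
    (h : IsCorr U V A q g) {F : Pt d → E d} (hF : Measurable F) (hF2 : msq (poisU ρ U) F < ∞)
    (h0 : ∫ p, inner ℝ (F p) (lift V (resid A q g) p) ∂poisU ρ U = 0) : ∫ p,
    dens q (A (clip V p.1) p.2) (F p) ∂poisU ρ U = 1 / 2 * ∫ p, inner ℝ q (g p.1 p.2) ∂fvU ρ U V -
    1 / 2 * ∫ p, inner ℝ (F p - lift V g p) (A (clip V p.1) p.2 (F p - lift V g p)) ∂poisU ρ U := by
  have := hD.finite_poisU ρ
  have hgm := measurable_lift hD.meas h.meas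
  have hrm := measurable_lift hD.meas (measurable_resid (q := q) hA.meas h.meas)
  have hg2 := h.msq_lift_lt_top hρ.le hD hA
  have hr2 := h.msq_lift_resid_lt_top hρ.le hD hA
  have hAm := measurable_fieldOf_clip hA hD.meas
  have hsm : Measurable fun p => F p - lift V g p := hF.sub hgm
  have hs2 : msq (poisU ρ U) (fun p => F p - lift V g p) < ∞ :=
    lt_of_le_of_lt (msq_sub_le hF) (ENNReal.add_lt_top.2 ⟨mul_lt_top (by simp) hF2,
      mul_lt_top (by simp) hg2⟩)
  have i1 := integrable_inner_of_msq hsm (measurable_clm_apply hAm hsm) hs2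
    ((msq_clm_apply_le (poisU ρ U) _ fun p => hA.upper _ _).trans_lt
      (mul_lt_top (by finiteness) hs2))
  have i2 := integrable_inner_of_msq hF hrm hF2 hr2
  have i3 := integrable_inner_of_msq hgm hrm hg2 hr2
  have i4 := integrable_inner_of_msq (m := poisU ρ U) (measurable_const (a := q)) hgm
    (msq_const_lt_top _ _) hg2
  have hpt : ∀ p : Pt d, dens q (A (clip V p.1) p.2) (F p)
      = -(1 / 2) * inner ℝ (F p - lift V g p) (A (clip V p.1) p.2 (F p - lift V g p))
        - inner ℝ (F p) (lift V (resid A q g) p)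
        + (1 / 2) * inner ℝ (lift V g p) (lift V (resid A q g) p)
        + (1 / 2) * inner ℝ q (lift V g p) := fun p => dens_eq q (hA.symm _ _) _ _
  have hq : ∫ p, inner ℝ q (lift V g p) ∂poisU ρ U = ∫ p, inner ℝ q (g p.1 p.2) ∂fvU ρ U V :=
    integral_lift hρ.le hD (f := fun p => inner ℝ q (g p.1 p.2)) (measurable_const.inner h.meas)
  simp only [hpt]
  have j1 : Integrable (fun p => -(1 / 2) * inner ℝ (F p - lift V g p)
      (A (clip V p.1) p.2 (F p - lift V g p)) - inner ℝ (F p) (lift V (resid A q g) p))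
      (poisU ρ U) := (i1.const_mul _).sub i2
  have j2 : Integrable (fun p => -(1 / 2) * inner ℝ (F p - lift V g p)
      (A (clip V p.1) p.2 (F p - lift V g p)) - inner ℝ (F p) (lift V (resid A q g) p)
      + (1 / 2) * inner ℝ (lift V g p) (lift V (resid A q g) p)) (poisU ρ U) :=
    j1.add (i3.const_mul _)
  rw [integral_add j2 (i4.const_mul _), integral_add j1 (i3.const_mul _),
    integral_sub (i1.const_mul _) i2, integral_const_mul, integral_const_mul, integral_const_mul,
    h0, h.el_lift hρ hD hA, hq]
  ring

theorem MemH1.dualEnergy_eq (hd : 1 ≤ d) (hρ : 0 < ρ) (hD : Dom U V) (ha : Admissible Λ a₀) (h :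
    IsCorr U V (fieldOf a₀ V) q g) {u : Config d → ℝ} {G : Fld d} (hG : MemH1 ρ U u G) : dualEnergy
    a₀ ρ U q G = 1 / 2 * bform ρ U V q g - (volume.real U)⁻¹ * (1 / 2 * ∫ p, inner ℝ (pull
    G p - lift V g p) (fieldOf a₀ V (clip V p.1) p.2 (pull G p - lift V g p)) ∂poisU ρ U) := by
  have hA := ha.isField hd hD.meas
  obtain ⟨h2, φ, hφ, hlim⟩ := hG.exists_approx hρ hD
  rw [Bulk.dualEnergy_eq hd hρ hD ha q hG.2.1 h2, h.integral_dens hρ hD hA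
    (measurable_pull hG.2.1) h2 (h.el_of_tendsto hρ hD hA (measurable_pull hG.2.1) h2 hφ hlim), bform]
  ring

/-- The optimal gradient. -/
def optGrad (U V : Set (E d)) (g : Fld d) (μ : Config d) (x : E d) : E d :=
  g (clip V (remIn U (μ, x))) x

theorem pull_optGrad (hD : Dom U V)
    (ρ : ℝ) (g : Fld d) : pull (optGrad U V g) =ᵐ[poisU ρ U] lift V g := by
  filter_upwards [ae_poisU_mem ρ hD] with p hp
  rw [pull, optGrad, remIn_add_particle hD.measU hp.2
    (lt_of_le_of_lt (measure_mono hD.subset) hp.1)]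
  rfl

theorem measurable_optGrad (hD : Dom U V)
    (hg : Measurable (uncurry g)) : Measurable (uncurry (optGrad U V g)) :=
  hg.comp (((measurable_clip hD.meas).comp (measurable_remIn hD.measU)).prodMk measurable_snd)

theorem IsCorr.memH1 (hρ : 0 < ρ) (hD : Dom U V)
    (hA : IsField Λ A) (h : IsCorr U V A q g) : ∃ u, MemH1 ρ U u (optGrad U V g) := by
  have h2 := h.msq_lift_lt_top hρ.le hD hA
  obtain ⟨u, ψ, hu, hψ, hlim, hlim'⟩ := exists_potential hρ.le hD h2
    (measurable_lift hD.meas h.meas) fun ε hε => h.exists_smooth_approx hρ.le hD hA hε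
  have hm := measurable_optGrad hD h.meas
  refine ⟨u, hu, hm, ψ, fun j => ⟨(hψ j).1, ?_⟩, ?_⟩
  · rw [h1NormSq_smooth ρ hD (hψ j).1]
    exact ENNReal.add_lt_top.2 ⟨(hψ j).2.1, mul_lt_top (by simp) (hψ j).2.2⟩
  · have h3 : ∀ j, h1NormSq ρ U (fun μ => ψ j μ - u μ)
        (fun μ x => grad (ψ j) μ x - optGrad U V g μ x)
        = msq (poissonLaw d ρ) (fun μ => ψ j μ - u μ)
        + ofReal ρ * msq (poisU ρ U) (fun p => pgrad (ψ j) p.1 p.2 - lift V g p) := by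
      intro j
      rw [h1NormSq_sub ρ hD (hψ j).1 u hm]
      congr 2
      refine msq_congr ?_
      filter_upwards [pull_optGrad hD ρ g] with p hp
      rw [hp]
    simp only [h3]
    have := hlim.add (ENNReal.Tendsto.const_mul (a := ofReal ρ) hlim' (Or.inr (by simp)))
    simpa using this

theorem integral_quad_nonneg (hA : IsField Λ A)
    (m : Measure (Pt d)) (F : Pt d → E d) : 0 ≤ ∫ p, inner ℝ (F p) (A (clip V p.1) p.2 (F p)) ∂m :=
  integral_nonneg fun p => (sq_nonneg ‖F p‖).trans (hA.lower _ _ _)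

theorem IsCorr.dualEnergy_optGrad (hd : 1 ≤ d)
    (hρ : 0 < ρ) (hD : Dom U V) (ha : Admissible Λ a₀) (h : IsCorr U V (fieldOf a₀ V) q g) :
    dualEnergy a₀ ρ U q (optGrad U V g) = 1 / 2 * bform ρ U V q g := by
  obtain ⟨u, hu⟩ := h.memH1 hρ hD (ha.isField hd hD.meas)
  rw [hu.dualEnergy_eq hd hρ hD ha h]
  have : ∫ p, inner ℝ (pull (optGrad U V g) p - lift V g p)
        (fieldOf a₀ V (clip V p.1) p.2 (pull (optGrad U V g) p - lift V g p)) ∂poisU ρ U = 0 := by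
    refine (integral_congr_ae (g := fun _ => (0 : ℝ)) ?_).trans (by simp)
    filter_upwards [pull_optGrad hD ρ g] with p hp
    rw [hp, sub_self, inner_zero_left]
  rw [this]; ring

theorem MemH1.dualEnergy_le (hd : 1 ≤ d) (hρ : 0 < ρ)
    (hD : Dom U V) (ha : Admissible Λ a₀) (h : IsCorr U V (fieldOf a₀ V) q g) {u : Config d → ℝ}
    {G : Fld d} (hG : MemH1 ρ U u G) : dualEnergy a₀ ρ U q G ≤ 1 / 2 * bform ρ U V q g := by
  rw [hG.dualEnergy_eq hd hρ hD ha h]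
  have := integral_quad_nonneg (V := V) (ha.isField hd hD.meas) (poisU ρ U)
    fun p => pull G p - lift V g p
  have h2 : 0 ≤ (volume.real U)⁻¹ := by positivity
  nlinarith [mul_nonneg h2 this]

theorem IsCorr.exists_isOptimizer (hd : 1 ≤ d) (hρ : 0 < ρ) (hD : Dom U V) (ha : Admissible Λ a₀)
    (h : IsCorr U V (fieldOf a₀ V) q g) : ∃ u, IsOptimizer a₀ U q ρ u (optGrad U V g) := by
  obtain ⟨u, hu⟩ := h.memH1 hρ hD (ha.isField hd hD.meas)
  refine ⟨u, hu, fun v H hv => ?_⟩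
  rw [h.dualEnergy_optGrad hd hρ hD ha]
  exact hv.dualEnergy_le hd hρ hD ha h

theorem IsCorr.nuStar_eq (hd : 1 ≤ d) (hρ : 0 < ρ) (hD : Dom U V) (ha : Admissible Λ a₀)
    (h : IsCorr U V (fieldOf a₀ V) q g) : nuStar a₀ U q ρ = 1 / 2 * bform ρ U V q g := by
  obtain ⟨u, hu⟩ := h.memH1 hρ hD (ha.isField hd hD.meas)
  refine IsGreatest.csSup_eq ⟨⟨u, _, hu, (h.dualEnergy_optGrad hd hρ hD ha).symm⟩, ?_⟩
  rintro t ⟨v, H, hv, rfl⟩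
  exact hv.dualEnergy_le hd hρ hD ha h

/-- All optimizers have the same gradient. -/
theorem IsCorr.pull_eq_of_isOptimizer (hd : 1 ≤ d) (hρ : 0 < ρ)
    (hD : Dom U V) (ha : Admissible Λ a₀) (h : IsCorr U V (fieldOf a₀ V) q g) {u : Config d → ℝ}
    {G : Fld d} (hG : IsOptimizer a₀ U q ρ u G) : pull G =ᵐ[poisU ρ U] lift V g := by
  have hA := ha.isField hd hD.meas
  obtain ⟨v, hv⟩ := h.memH1 hρ hD hA
  have h1 := hG.2 _ _ hv
  rw [h.dualEnergy_optGrad hd hρ hD ha, hG.1.dualEnergy_eq hd hρ hD ha h] at h1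
  have h2 := integral_quad_nonneg (V := V) hA (poisU ρ U) fun p => pull G p - lift V g p
  have hvol : 0 < (volume.real U)⁻¹ := inv_pos.2
    (ENNReal.toReal_pos hD.pos hD.bddU.measure_lt_top.ne)
  -- Optimality forces the quadratic defect to vanish; ellipticity then gives equality almost
  -- everywhere.
  have h3 : ∫ p, inner ℝ (pull G p - lift V g p)
        (fieldOf a₀ V (clip V p.1) p.2 (pull G p - lift V g p)) ∂poisU ρ U = 0 := by
    refine le_antisymm ?_ h2
    by_contra! h4
    have := mul_pos hvol h4
    linarith
  obtain ⟨hp2, -⟩ := hG.1.exists_approx hρ hD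
  have hgm := measurable_lift hD.meas h.meas
  have hsm : Measurable fun p => pull G p - lift V g p := (measurable_pull hG.1.2.1).sub hgm
  have hs2 : msq (poisU ρ U) (fun p => pull G p - lift V g p) < ∞ :=
    lt_of_le_of_lt (msq_sub_le (measurable_pull hG.1.2.1)) (ENNReal.add_lt_top.2
      ⟨mul_lt_top (by simp) hp2, mul_lt_top (by simp)
        (h.msq_lift_lt_top hρ.le hD hA)⟩)
  have h5 := msq_le_of_integral_inner_eq_zero (m := poisU ρ U) (e := fun _ => (0 : E d)) hsm
    (measurable_clm_apply (measurable_fieldOf_clip hA hD.meas) hsm) measurable_const hs2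
    ((msq_clm_apply_le (poisU ρ U) _ fun p => hA.upper _ _).trans_lt
      (mul_lt_top (by finiteness) hs2)) (by simp [msq])
    (Eventually.of_forall fun p => hA.lower _ _ _) (by simpa using h3)
  have h6 : msq (poisU ρ U) (fun p => pull G p - lift V g p) = 0 :=
    le_antisymm (h5.trans (by simp [msq])) bot_le
  rw [msq, lintegral_eq_zero_iff (hsm.enorm.pow_const 2)] at h6
  filter_upwards [h6] with p hp
  have : ‖pull G p - lift V g p‖ₑ = 0 := by simpa using hp
  rw [enorm_eq_zero, sub_eq_zero] at this
  exact this

end Variational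

/-! ### Levels with a parameter -/

theorem enorm_setIntegral_sq_le {f : E d → E d} {B : Set (E d)}
    (hf : Measurable f) : ‖∫ y in B, f y‖ₑ ^ 2 ≤ volume B * ∫⁻ y in B, ‖f y‖ₑ ^ 2 := by
  have h := sq_lintegral_le ((volume : Measure (E d)).restrict B) hf.enorm.aemeasurable
  rw [Measure.restrict_apply_univ] at h
  exact (pow_le_pow_left' (enorm_integral_le_lintegral_enorm _) 2).trans h

section Levels

variable {Z : Type} [MeasurableSpace Z]

/-- The measure `λ_n ⊗ ζ` on `{configurations in V with n particles} × Z`. -/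
abbrev lz (V : Set (E d)) (ζ : Measure Z) (n : ℕ) : Measure (Config d × Z) := (lam V n).prod ζ

/-- Lebesgue measure on `V`. -/
abbrev vol (V : Set (E d)) : Measure (E d) := (volume : Measure (E d)).restrict V

theorem measurable_push : Measurable fun p : Config d × (Z × E d) =>
    ((p.1 + particle p.2.2, p.2.1) : Config d × Z) := by fun_prop

theorem measurable_drop : Measurable fun p : Config d × (Z × E d) =>
    ((p.1, p.2.1) : Config d × Z) := by fun_prop

theorem measurable_assoc {X : Type*} [MeasurableSpace X] :
    Measurable fun q : (X × Z) × E d => (q.1.1, (q.1.2, q.2)) := by fun_prop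

/-- One particle of the configuration is turned into a parameter. Each difference operator thus
enlarges the parameter space by a point, and statements about iterated differences are proved by
induction over all parameter spaces at once. -/
theorem lintegral_lz_succ (V : Set (E d))
    (ζ : Measure Z) [SFinite ζ] (n : ℕ) {F : Config d × Z → ℝ≥0∞} (hF : Measurable F) :
    ∫⁻ p, F p ∂lz V ζ (n + 1) = ∫⁻ p, F (p.1 + particle p.2.2, p.2.1) ∂lz V (ζ.prod (vol V)) n := by
  have h1 : Measurable fun p : Config d × (Z × E d) => F (p.1 + particle p.2.2, p.2.1) :=
    hF.comp measurable_push
  rw [lintegral_prod _ hF.aemeasurable, lintegral_prod _ h1.aemeasurable,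
    lintegral_lam_succ V n hF.lintegral_prod_right']
  have h2 : ∀ η : Config d, ∫⁻ q : Z × E d, F (η + particle q.2, q.1) ∂ζ.prod (vol V)
      = ∫⁻ y in V, (∫⁻ z, F (η + particle y, z) ∂ζ) := fun η => by
    have h3 : Measurable fun q : Z × E d => F (η + particle q.2, q.1) :=
      h1.comp measurable_prodMk_left
    rw [lintegral_prod_symm' _ h3]
  simp only [h2]
  have h4 : Measurable fun r : E d × Config d => ∫⁻ z, F (r.2 + particle r.1, z) ∂ζ := by
    have h5 : Measurable fun r : (E d × Config d) × Z => F (r.1.2 + particle r.1.1, r.2) :=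
      hF.comp (by fun_prop)
    exact h5.lintegral_prod_right'
  exact lintegral_lintegral_swap h4.aemeasurable

theorem lz_succ (V : Set (E d)) (ζ : Measure Z) [SFinite ζ] (n : ℕ) :
    lz V ζ (n + 1) = (lz V (ζ.prod (vol V)) n).map fun p => (p.1 + particle p.2.2, p.2.1) := by
  refine Measure.ext_of_lintegral _ fun F hF => ?_
  rw [lintegral_map hF measurable_push, lintegral_lz_succ V ζ n hF]

theorem lintegral_lz_drop (V : Set (E d))
    (ζ : Measure Z) [SFinite ζ] (n : ℕ) {F : Config d × Z → ℝ≥0∞} (hF : Measurable F) :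
    ∫⁻ p, F (p.1, p.2.1) ∂lz V (ζ.prod (vol V)) n = volume V * ∫⁻ p, F p ∂lz V ζ n := by
  have h1 : Measurable fun p : Config d × (Z × E d) => F (p.1, p.2.1) := hF.comp measurable_drop
  rw [lintegral_prod _ hF.aemeasurable, lintegral_prod _ h1.aemeasurable,
    ← lintegral_const_mul _ hF.lintegral_prod_right']
  refine lintegral_congr fun η => ?_
  have h3 : Measurable fun q : Z × E d => F (η, q.1) := h1.comp measurable_prodMk_left
  have h4 : Measurable fun z : Z => F (η, z) := hF.comp measurable_prodMk_left
  rw [lintegral_prod_symm' _ h3]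
  simp [mul_comm]

theorem lz_drop (V : Set (E d)) (ζ : Measure Z) [SFinite ζ]
    (n : ℕ) : (lz V (ζ.prod (vol V)) n).map (fun p => (p.1, p.2.1)) = volume V • lz V ζ n := by
  refine Measure.ext_of_lintegral _ fun F hF => ?_
  rw [lintegral_map hF measurable_drop, lintegral_lz_drop V ζ n hF, lintegral_smul_measure,
    smul_eq_mul]

theorem lz_assoc (V : Set (E d)) (ζ : Measure Z) [SFinite ζ]
    (n : ℕ) : ((lz V ζ n).prod (vol V)).map MeasurableEquiv.prodAssoc = lz V (ζ.prod (vol V)) n :=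
  Measure.prodAssoc_prod

theorem ae_push {ζ : Measure Z} [SFinite ζ] {n : ℕ} {P : Config d × Z → Prop} (h : ∀ᵐ
    p ∂lz V ζ (n + 1), P p) : ∀ᵐ p ∂lz V (ζ.prod (vol V)) n, P (p.1 + particle p.2.2, p.2.1) := by
  rw [lz_succ] at h
  exact ae_of_ae_map measurable_push.aemeasurable h

theorem ae_drop {ζ : Measure Z} [SFinite ζ] {n : ℕ} {P : Config d × Z → Prop}
    (h : ∀ᵐ p ∂lz V ζ n, P p) : ∀ᵐ p ∂lz V (ζ.prod (vol V)) n, P (p.1, p.2.1) := by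
  have h1 : ∀ᵐ p ∂volume V • lz V ζ n, P p := Measure.ae_smul_measure h _
  rw [← lz_drop] at h1
  exact ae_of_ae_map measurable_drop.aemeasurable h1

theorem ae_lz_assoc {ζ : Measure Z} [SFinite ζ] {n : ℕ} {P : Config d × (Z × E d) → Prop}
    (h : ∀ᵐ p ∂lz V (ζ.prod (vol V)) n, P p) : ∀ᵐ p ∂lz V ζ n, ∀ᵐ y ∂vol V, P (p.1, p.2, y) := by
  rw [← lz_assoc] at h
  exact Measure.ae_ae_of_ae_prod (ae_of_ae_map MeasurableEquiv.prodAssoc.measurable.aemeasurable h)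

theorem lintegral_lz_assoc (ζ : Measure Z)
    [SFinite ζ] (n : ℕ) {F : Config d × (Z × E d) → ℝ≥0∞} (hF : Measurable F) :
    ∫⁻ p, F p ∂lz V (ζ.prod (vol V)) n = ∫⁻ p, (∫⁻ y in V, F (p.1, p.2, y)) ∂lz V ζ n := by
  rw [← lz_assoc, lintegral_map hF MeasurableEquiv.prodAssoc.measurable]
  exact lintegral_prod _ (hF.comp MeasurableEquiv.prodAssoc.measurable).aemeasurable

theorem measurable_fibre {G : Config d × (Z × E d) → ℝ≥0∞} (V : Set (E d))
    (hG : Measurable G) : Measurable fun p : Config d × Z => ∫⁻ y in V, G (p.1, p.2, y) := by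
  have h : Measurable fun q : (Config d × Z) × E d => G (q.1.1, q.1.2, q.2) :=
    hG.comp measurable_assoc
  exact h.lintegral_prod_right' (ν := vol V)

theorem ae_fibre_lt_top {ζ : Measure Z} [SFinite ζ] {n : ℕ} {G : Config d × (Z × E d) → ℝ≥0∞}
    (hG : Measurable G) (h : ∫⁻ p, G p ∂lz V (ζ.prod (vol V)) n < ∞) :
    ∀ᵐ p ∂lz V ζ n, ∫⁻ y in V, G (p.1, p.2, y) < ∞ := by
  rw [lintegral_lz_assoc ζ n hG] at h
  exact ae_lt_top (measurable_fibre V hG) h.ne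

/-- Equality almost everywhere on all levels. -/
def LevEq (V : Set (E d)) (ζ : Measure Z) (F F' : Config d → Z → E d) : Prop :=
  ∀ n, ∀ᵐ p ∂lz V ζ n, F p.1 p.2 = F' p.1 p.2

/-- Square integrability on each level. -/
structure Lev (V : Set (E d)) (ζ : Measure Z) (F : Config d → Z → E d) : Prop where
  meas : Measurable (uncurry F)
  fin : ∀ n, msq (lz V ζ n) (uncurry F) < ∞

variable {ζ : Measure Z} {F F' F'' H : Config d → Z → E d}

theorem LevEq.refl (F : Config d → Z → E d) : LevEq V ζ F F :=
  fun _ => Eventually.of_forall fun _ => rfl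

theorem LevEq.symm (h : LevEq V ζ F F') : LevEq V ζ F' F := fun n => (h n).mono fun _ hp => hp.symm

theorem LevEq.trans (h : LevEq V ζ F F') (h' : LevEq V ζ F' F'') : LevEq V ζ F F'' := fun n => by
  filter_upwards [h n, h' n] with p h1 h2 using h1.trans h2

theorem Lev.congr (h : Lev V ζ F)
    (hF' : Measurable (uncurry F')) (he : LevEq V ζ F F') : Lev V ζ F' :=
  ⟨hF', fun n => (msq_congr (h := uncurry F) (he.symm n)).trans_lt (h.fin n)⟩

theorem Lev.add (h : Lev V ζ F) (h' : Lev V ζ F') : Lev V ζ fun η z => F η z + F' η z :=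
  ⟨h.meas.add h'.meas, fun n => (msq_add_le (f := uncurry F) (h := uncurry F')
    h.meas).trans_lt (ENNReal.add_lt_top.2 ⟨mul_lt_top (by simp) (h.fin n),
      mul_lt_top (by simp) (h'.fin n)⟩)⟩

theorem Lev.sub (h : Lev V ζ F) (h' : Lev V ζ F') : Lev V ζ fun η z => F η z - F' η z :=
  ⟨h.meas.sub h'.meas, fun n => (msq_sub_le (f := uncurry F) (h := uncurry F')
    h.meas).trans_lt (ENNReal.add_lt_top.2 ⟨mul_lt_top (by simp) (h.fin n),
      mul_lt_top (by simp) (h'.fin n)⟩)⟩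

theorem msq_const_smul {α : Type*} [MeasurableSpace α]
    (m : Measure α) (c : ℝ) (f : α → E d) : msq m (fun p => c • f p) = ‖c‖ₑ ^ 2 * msq m f := by
  rw [msq, msq, ← lintegral_const_mul' _ _ (by finiteness)]
  simp only [enorm_smul, mul_pow]

theorem Lev.const_smul (h : Lev V ζ F) (c : ℝ) : Lev V ζ fun η z => c • F η z :=
  ⟨h.meas.const_smul c, fun n => (msq_const_smul _ c (uncurry F)).trans_lt
    (mul_lt_top (by finiteness) (h.fin n))⟩

theorem Lev.clm_apply (h : Lev V ζ F) {b : Config d → Z → (E d →L[ℝ] E d)} (hb :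
    Measurable (uncurry b)) {M : ℝ} (hM : ∀ η z, ‖b η z‖ ≤ M) : Lev V ζ fun η z => b η z (F η z) :=
  ⟨measurable_clm_apply hb h.meas, fun n => (msq_clm_apply_le _ (A := uncurry b)
    (uncurry F) (fun p => hM p.1 p.2)).trans_lt
      (mul_lt_top (by finiteness) (h.fin n))⟩

theorem Lev.integrable_inner (h : Lev V ζ F) (h' : Lev V ζ F') (n : ℕ) :
    Integrable (fun p : Config d × Z => (inner ℝ (F p.1 p.2) (F' p.1 p.2) : ℝ)) (lz V ζ n) :=
  integrable_inner_of_msq h.meas h'.meas (h.fin n) (h'.fin n)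

/-- The function `(η, (z, y)) ↦ F(η + δ_y, z)`. -/
def push (F : Config d → Z → E d) (η : Config d) (r : Z × E d) : E d := F (η + particle r.2) r.1

/-- The function `(η, (z, y)) ↦ F(η + δ_y, z) - F(η, z)`. -/
def dif (F : Config d → Z → E d) (η : Config d) (r : Z × E d) : E d :=
  F (η + particle r.2) r.1 - F η r.1

theorem measurable_push_fun (hF : Measurable (uncurry F)) :
    Measurable (uncurry (push F)) := hF.comp measurable_push

theorem measurable_drop_fun (hF : Measurable (uncurry F)) :
    Measurable (uncurry fun (η : Config d) (r : Z × E d) => F η r.1) :=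
  hF.comp measurable_drop

theorem measurable_dif (hF : Measurable (uncurry F)) :
    Measurable (uncurry (dif F)) := (measurable_push_fun hF).sub (measurable_drop_fun hF)

section SF

variable [SFinite ζ]

theorem msq_push (hF : Measurable (uncurry F))
    (n : ℕ) : msq (lz V (ζ.prod (vol V)) n) (uncurry (push F)) = msq (lz V ζ (n + 1)) (uncurry F) :=
  (lintegral_lz_succ V ζ n (hF.enorm.pow_const 2)).symm

theorem msq_drop (hF : Measurable (uncurry F)) (n : ℕ) :
    msq (lz V (ζ.prod (vol V)) n) (fun p => F p.1 p.2.1) = volume V * msq (lz V ζ n) (uncurry F) :=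
  lintegral_lz_drop V ζ n (hF.enorm.pow_const 2)

theorem LevEq.push (h : LevEq V ζ F F') : LevEq V (ζ.prod (vol V)) (push F) (push F') :=
  fun n => ae_push (h (n + 1))

theorem LevEq.drop (h : LevEq V ζ F F') :
    LevEq V (ζ.prod (vol V)) (fun η r => F η r.1) (fun η r => F' η r.1) :=
  fun n => ae_drop (h n)

theorem LevEq.dif (h : LevEq V ζ F F') : LevEq V (ζ.prod (vol V)) (dif F) (dif F') := fun n => by
  filter_upwards [h.push n, h.drop n] with p h1 h2
  exact congrArg₂ (· - ·) h1 h2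

theorem Lev.push (h : Lev V ζ F) : Lev V (ζ.prod (vol V)) (push F) :=
  ⟨measurable_push_fun h.meas, fun n => (msq_push h.meas n).trans_lt (h.fin _)⟩

variable [IsFiniteMeasure (vol V)]

theorem volume_lt_top_of_vol : volume V < ∞ := by
  have := measure_lt_top (vol V) univ
  rwa [Measure.restrict_apply_univ] at this

theorem Lev.drop (h : Lev V ζ F) : Lev V (ζ.prod (vol V)) (fun η r => F η r.1) :=
  ⟨measurable_drop_fun h.meas, fun n => (msq_drop h.meas n).trans_lt
    (mul_lt_top volume_lt_top_of_vol (h.fin _))⟩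

theorem Lev.dif (h : Lev V ζ F) : Lev V (ζ.prod (vol V)) (dif F) := h.push.sub h.drop

/-! ### The averaging operator -/

/-- The function `η ↦ ∫_V F(η + δ_y, z) dy`. -/
def sb (V : Set (E d)) (F : Config d → Z → E d) (η : Config d) (z : Z) : E d :=
  ∫ y in V, F (η + particle y) z

/-- The function `η ↦ ∫_V H(η, (z, y)) dy`. -/
def av (V : Set (E d)) (H : Config d → Z × E d → E d) (η : Config d) (z : Z) : E d :=
  ∫ y in V, H η (z, y)

theorem sb_eq_av (F : Config d → Z → E d) : sb V F = av V (Bulk.push F) := rfl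

theorem measurable_av {H : Config d → Z × E d → E d}
    (hH : Measurable (uncurry H)) : Measurable (uncurry (av V H)) := by
  have h1 : Measurable fun q : (Config d × Z) × E d => H q.1.1 (q.1.2, q.2) :=
    hH.comp measurable_assoc
  exact (h1.stronglyMeasurable.integral_prod_right (f := fun (p : Config d × Z) y => H p.1 (p.2, y))
    (ν := vol V)).measurable

theorem Lev.ae_integrable {H : Config d → Z × E d → E d} (h : Lev V (ζ.prod (vol V)) H)
    (n : ℕ) : ∀ᵐ p ∂lz V ζ n, Integrable (fun y => H p.1 (p.2, y)) (vol V) := by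
  filter_upwards [ae_fibre_lt_top (h.meas.enorm.pow_const 2) (h.fin n)] with p hp
  have hm : Measurable fun y => H p.1 (p.2, y) :=
    h.meas.comp (measurable_prodMk_left.comp measurable_prodMk_left)
  exact ((memLp_two_iff_msq hm.aestronglyMeasurable).2 hp).integrable (by norm_num)

theorem msq_av_le {H : Config d → Z × E d → E d} (hH : Measurable (uncurry H)) (n : ℕ) :
    msq (lz V ζ n) (uncurry (av V H)) ≤ volume V * msq (lz V (ζ.prod (vol V)) n) (uncurry H) := by
  have h0 : Measurable fun p : Config d × (Z × E d) => ‖H p.1 p.2‖ₑ ^ 2 := hH.enorm.pow_const 2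
  have h2 := lintegral_lz_assoc (V := V) ζ n h0
  refine le_trans ?_ (mul_le_mul_right h2.ge _)
  rw [← lintegral_const_mul' _ _ volume_lt_top_of_vol.ne]
  refine lintegral_mono fun p => ?_
  exact enorm_setIntegral_sq_le (hH.comp (measurable_prodMk_left.comp measurable_prodMk_left))

theorem Lev.av {H : Config d → Z × E d → E d} (h : Lev V (ζ.prod (vol V)) H) : Lev V ζ (av V H) :=
  ⟨measurable_av h.meas, fun n => (msq_av_le h.meas n).trans_lt
    (mul_lt_top volume_lt_top_of_vol (h.fin n))⟩

theorem Lev.sb (h : Lev V ζ F) : Lev V ζ (sb V F) := h.push.av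

theorem LevEq.av {H H' : Config d → Z × E d → E d} (h : LevEq V (ζ.prod (vol V)) H H') :
    LevEq V ζ (av V H) (av V H') := fun n => by
  filter_upwards [ae_lz_assoc (h n)] with p hp
  exact integral_congr_ae hp

theorem LevEq.sb (h : LevEq V ζ F F') : LevEq V ζ (sb V F) (sb V F') := h.push.av

theorem Lev.sb_dif (h : Lev V ζ F) :
    LevEq V (ζ.prod (vol V)) (Bulk.sb V (Bulk.dif F)) (Bulk.dif (Bulk.sb V F)) := fun n => by
  filter_upwards [ae_push (h.push.ae_integrable (n + 1)), ae_drop (h.push.ae_integrable n)]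
    with p h1 h2
  simp only [Bulk.sb, Bulk.dif, Bulk.push] at h1 h2 ⊢
  rw [← integral_sub h1 h2]
  simp only [add_right_comm]

theorem Lev.sb_av {H : Config d → Z × E d → E d} (h : Lev V (ζ.prod (vol V)) H) :
    LevEq V ζ (Bulk.sb V (Bulk.av V H)) (Bulk.av V (Bulk.sb V H)) := fun n => by
  have h0 : Measurable fun p : Config d × ((Z × E d) × E d) =>
      ‖H (p.1 + particle p.2.2) p.2.1‖ₑ ^ 2 := h.push.meas.enorm.pow_const 2
  have h2 : Measurable fun p : Config d × (Z × E d) =>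
      ∫⁻ w in V, ‖H (p.1 + particle w) p.2‖ₑ ^ 2 := measurable_fibre V h0
  have h3 : ∫⁻ p, (∫⁻ w in V, ‖H (p.1 + particle w) p.2‖ₑ ^ 2) ∂lz V (ζ.prod (vol V)) n < ∞ :=
    (lintegral_lz_assoc (V := V) (ζ.prod (vol V)) n h0).symm.trans_lt (h.push.fin n)
  filter_upwards [ae_fibre_lt_top h2 h3] with p hp
  have hm : Measurable fun q : E d × E d => H (p.1 + particle q.1) (p.2, q.2) :=
    h.meas.comp ((measurable_const.add measurable_particle |>.comp measurable_fst).prodMk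
      (measurable_const.prodMk measurable_snd))
  have hm' : Measurable fun q : E d × E d => ‖H (p.1 + particle q.1) (p.2, q.2)‖ₑ ^ 2 :=
    hm.enorm.pow_const 2
  have hi : Integrable (fun q : E d × E d => H (p.1 + particle q.1) (p.2, q.2))
      ((vol V).prod (vol V)) := by
    refine ((memLp_two_iff_msq hm.aestronglyMeasurable).2 ?_).integrable (by norm_num)
    rw [msq, lintegral_prod_symm' _ hm']
    exact hp
  exact integral_integral_swap hi

/-- Pairs of classes of functions, stable under averaging and orthogonal to each other on each
level. -/
structure Polar (V : Set (E d)) (ζ : Measure Z) (T R : Set (Config d → Z → E d)) : Prop where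
  levT : ∀ h ∈ T, Lev V ζ h
  levR : ∀ r ∈ R, Lev V ζ r
  sbT : ∀ h ∈ T, sb V h ∈ T
  sbR : ∀ r ∈ R, sb V r ∈ R
  orth : ∀ h ∈ T, ∀ r ∈ R, ∀ n, ∫ p, inner ℝ (h p.1 p.2) (r p.1 p.2) ∂lz V ζ n = 0

/-- The measurable functions equal to the difference of a function of a class. -/
def difSet (V : Set (E d))
    (ζ : Measure Z) (T : Set (Config d → Z → E d)) : Set (Config d → Z × E d → E d) :=
  {H | Measurable (uncurry H) ∧ ∃ h ∈ T, LevEq V (ζ.prod (vol V)) (dif h) H}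

theorem integral_inner_push (h : Lev V ζ F)
    (h' : Lev V ζ F') (n : ℕ) : ∫ p, inner ℝ (Bulk.push F p.1 p.2) (Bulk.push F' p.1 p.2)
    ∂lz V (ζ.prod (vol V)) n = ∫ p, inner ℝ (F p.1 p.2) (F' p.1 p.2) ∂lz V ζ (n + 1) := by
  rw [lz_succ, integral_map measurable_push.aemeasurable]
  · rfl
  · exact (h.meas.inner h'.meas).aestronglyMeasurable

theorem integral_inner_drop (h : Lev V ζ F)
    (h' : Lev V ζ F') (n : ℕ) : ∫ p, inner ℝ (F p.1 p.2.1) (F' p.1 p.2.1)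
    ∂lz V (ζ.prod (vol V)) n = volume.real V * ∫ p, inner ℝ (F p.1 p.2) (F' p.1 p.2) ∂lz V ζ n := by
  have h1 := integral_map (μ := lz V (ζ.prod (vol V)) n) (φ := fun p => (p.1, p.2.1))
    (f := fun p : Config d × Z => (inner ℝ (F p.1 p.2) (F' p.1 p.2) : ℝ))
    measurable_drop.aemeasurable (h.meas.inner h'.meas).aestronglyMeasurable
  rw [← h1, lz_drop, integral_smul_measure]
  rfl

theorem integral_inner_av {H : Config d → Z × E d → E d}
    (hH : Lev V (ζ.prod (vol V)) H) (h : Lev V ζ F) (n : ℕ) : ∫ p, inner ℝ (F p.1 p.2.1)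
    (H p.1 p.2) ∂lz V (ζ.prod (vol V)) n = ∫ p, inner ℝ (F p.1 p.2) (av V H p.1 p.2) ∂lz V ζ n := by
  have hi : Integrable (fun p : Config d × (Z × E d) => (inner ℝ (F p.1 p.2.1) (H p.1 p.2) : ℝ))
      (lz V (ζ.prod (vol V)) n) :=
    integrable_inner_of_msq h.drop.meas hH.meas (h.drop.fin n) (hH.fin n)
  have hae := hi.aestronglyMeasurable
  rw [← lz_assoc] at hi hae ⊢
  rw [integrable_map_equiv] at hi
  rw [integral_map_equiv]
  refine (integral_prod _ hi).trans ?_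
  refine integral_congr_ae ?_
  filter_upwards [hH.ae_integrable n] with p hp
  exact integral_inner (𝕜 := ℝ) hp (F p.1 p.2)

/-- The product of two differences is expanded into four terms and integrated over the added point.
The terms with both or no factor shifted are orthogonality on the levels `n + 1` and `n`. In the
mixed terms the integration turns the shifted factor into its average, which stays in its class. For
a fixed added point this argument is not available. -/
theorem Polar.dif {T R : Set (Config d → Z → E d)}
    (h : Polar V ζ T R) : Polar V (ζ.prod (vol V)) (difSet V ζ T) (difSet V ζ R) := by
  refine ⟨?_, ?_, ?_, ?_, ?_⟩
  · rintro H ⟨hm, f, hf, he⟩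
    exact (h.levT f hf).dif.congr hm he
  · rintro H ⟨hm, f, hf, he⟩
    exact (h.levR f hf).dif.congr hm he
  · rintro H ⟨hm, f, hf, he⟩
    exact ⟨measurable_av (measurable_push_fun hm), _, h.sbT f hf,
      (h.levT f hf).sb_dif.symm.trans he.sb⟩
  · rintro H ⟨hm, f, hf, he⟩
    exact ⟨measurable_av (measurable_push_fun hm), _, h.sbR f hf,
      (h.levR f hf).sb_dif.symm.trans he.sb⟩
  · rintro H ⟨hm, f, hf, he⟩ K ⟨hm', r, hr, he'⟩ n
    have hf' := h.levT f hf
    have hr' := h.levR r hr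
    have e1 : ∫ p, inner ℝ (H p.1 p.2) (K p.1 p.2) ∂lz V (ζ.prod (vol V)) n
        = ∫ p, (inner ℝ (push f p.1 p.2) (push r p.1 p.2)
            - inner ℝ (r p.1 p.2.1) (push f p.1 p.2)
            - inner ℝ (f p.1 p.2.1) (push r p.1 p.2)
            + inner ℝ (f p.1 p.2.1) (r p.1 p.2.1)) ∂lz V (ζ.prod (vol V)) n := by
      refine integral_congr_ae ?_
      filter_upwards [he n, he' n] with p h1 h2
      rw [← h1, ← h2]
      simp only [Bulk.dif, push, inner_sub_left, inner_sub_right]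
      rw [real_inner_comm (r p.1 p.2.1)]
      ring
    have i1 := hf'.push.integrable_inner hr'.push n
    have i2 := hr'.drop.integrable_inner hf'.push n
    have i3 := hf'.drop.integrable_inner hr'.push n
    have i4 := hf'.drop.integrable_inner hr'.drop n
    have k1 : Integrable (fun p : Config d × (Z × E d) => (inner ℝ (push f p.1 p.2) (push r p.1 p.2)
        - inner ℝ (r p.1 p.2.1) (push f p.1 p.2) : ℝ)) (lz V (ζ.prod (vol V)) n) := i1.sub i2
    have k2 : Integrable (fun p : Config d × (Z × E d) => (inner ℝ (push f p.1 p.2) (push r p.1 p.2)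
        - inner ℝ (r p.1 p.2.1) (push f p.1 p.2) - inner ℝ (f p.1 p.2.1) (push r p.1 p.2) : ℝ))
        (lz V (ζ.prod (vol V)) n) := k1.sub i3
    rw [e1, integral_add k2 i4, integral_sub k1 i3, integral_sub i1 i2]
    rw [integral_inner_push hf' hr', integral_inner_drop hf' hr',
      integral_inner_av hf'.push hr', integral_inner_av hr'.push hf', h.orth f hf r hr,
      h.orth f hf r hr]
    have h5 := h.orth f hf _ (h.sbR r hr) n
    have h6 : ∫ p, inner ℝ (r p.1 p.2) (sb V f p.1 p.2) ∂lz V ζ n = 0 := by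
      rw [← h.orth _ (h.sbT f hf) r hr n]
      exact integral_congr_ae (Eventually.of_forall fun p => real_inner_comm _ _)
    rw [sb_eq_av] at h5 h6
    rw [h5, h6]
    simp

end SF

end Levels

/-! ### Removal of a particle is adjoint to averaging -/

section Removal

variable {Z : Type} [MeasurableSpace Z] {ζ : Measure Z}
  {F F' : Config d → Z → E d}

/-- The function `(η, z) ↦ ∫_V F(η - δ_x, z) dη(x)`. -/
def rmv (V : Set (E d)) (F : Config d → Z → E d) (η : Config d) (z : Z) : E d :=
  removal V (fun μ => F μ z) η

theorem measurable_rmv (hV : MeasurableSet V)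
    (hF : Measurable (uncurry F)) : Measurable (uncurry (rmv V F)) := by
  have h1 : Measurable fun q : (Config d × Z) × E d => F (remIn V (q.1.1, q.2)) q.1.2 :=
    hF.comp (((measurable_remIn hV).comp (by fun_prop)).prodMk (by fun_prop))
  have h2 : StronglyMeasurable (uncurry fun (p : Config d × Z) (x : E d) =>
    F (remIn V (p.1, x)) p.2) := h1.stronglyMeasurable
  exact (h2.integral_kernel_prod_right (κ := (clipKernel V).comap Prod.fst measurable_fst)).measurable

theorem ae_lam_remIn (hV : MeasurableSet V)
    (n : ℕ) : ∀ᵐ q : Pt d ∂(lam V n).prod (vol V), remIn V (q.1 + particle q.2, q.2) = q.1 := by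
  have h1 : ∀ᵐ q : Pt d ∂(lam V n).prod (vol V), q.1.1 V < ∞ := by
    have := Measure.quasiMeasurePreserving_fst (μ := lam V n) (ν := vol V) |>.ae (ae_lam hV n)
    filter_upwards [this] with q hq
    rw [hq.2]; simp
  have h2 : ∀ᵐ q : Pt d ∂(lam V n).prod (vol V), q.2 ∈ V :=
    Measure.quasiMeasurePreserving_snd.ae (ae_restrict_mem hV)
  filter_upwards [h1, h2] with q hq hq'
  exact remIn_add_particle hV hq' hq

theorem ae_clipKernel_univ (hV : MeasurableSet V)
    (n : ℕ) : ∀ᵐ η : Config d ∂lam V n, clipKernel V η univ = n := by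
  filter_upwards [ae_lam hV n] with η hη
  rw [clipKernel_apply hV, clip_eq_self hη.1 (hη.2 ▸ ENNReal.natCast_lt_top _),
    ← measure_add_measure_compl hV, hη.1, hη.2, add_zero]

/-- The Mecke formula on level `n + 1`, applied to the product of `f` at the full configuration and
`f'` at the configuration without the marked particle. -/
theorem integral_inner_removal (hV : MeasurableSet V) [IsFiniteMeasure (vol V)] (n : ℕ)
    {f f' : Config d → E d} (hf : Measurable f) (hf' : Measurable f') (h2 : msq (lam V (n + 1))
    f < ∞) (h2' : msq (lam V n) f' < ∞) : ∫ η, inner ℝ (f η) (removal V f' η) ∂lam V (n + 1)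
    = (n + 1) * ∫ q, inner ℝ (f (q.1 + particle q.2)) (f' q.1) ∂(lam V n).prod (vol V) := by
  have hT : Measurable fun p : Pt d => (p.1 + particle p.2, p.2) :=
    measurable_add_particle.prodMk measurable_snd
  have hfs : Measurable fun q : Pt d => f (q.1 + particle q.2) :=
    hf.comp measurable_add_particle
  have hfs' : Measurable fun q : Pt d => f' q.1 := hf'.comp measurable_fst
  have m1 : msq ((lam V n).prod (vol V)) (fun q => f (q.1 + particle q.2)) < ∞ := by
    rw [lam_succ] at h2
    exact (lintegral_map (hf.enorm.pow_const 2) measurable_add_particle).symm.trans_lt h2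
  have m2 : msq ((lam V n).prod (vol V)) (fun q => f' q.1) < ∞ := by
    rw [msq, lintegral_prod _ (hfs'.enorm.pow_const 2).aemeasurable]
    simp only [lintegral_const]
    rw [lintegral_mul_const _ (hf'.enorm.pow_const 2)]
    exact mul_lt_top h2' (measure_lt_top _ _)
  have hi := integrable_inner_of_msq hfs hfs' m1 m2
  have hgm : Measurable fun p : Pt d => (inner ℝ (f p.1) (f' (remIn V p)) : ℝ) :=
    (hf.comp measurable_fst).inner (hf'.comp (measurable_remIn hV))
  have hfv : Measurable fun q : Pt d => f' (remIn V q) := hf'.comp (measurable_remIn hV)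
  have hae : (fun q : Pt d => (inner ℝ (f (q.1 + particle q.2)) (f' q.1) : ℝ))
      =ᵐ[(lam V n).prod (vol V)]
      (fun p : Pt d => (inner ℝ (f p.1) (f' (remIn V p)) : ℝ)) ∘
        fun p => (p.1 + particle p.2, p.2) := by
    filter_upwards [ae_lam_remIn hV n] with q hq
    simp only [Function.comp, hq]
  have hc : Integrable (fun p : Pt d => (inner ℝ (f p.1) (f' (remIn V p)) : ℝ))
      (lam V (n + 1) ⊗ₘ clipKernel V) := by
    rw [lam_compProd hV]
    refine Integrable.smul_measure ?_ (by finiteness)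
    rw [integrable_map_measure hgm.aestronglyMeasurable hT.aemeasurable]
    exact hi.congr hae
  have e1 : ∫ η, inner ℝ (f η) (removal V f' η) ∂lam V (n + 1)
      = ∫ p, (inner ℝ (f p.1) (f' (remIn V p)) : ℝ) ∂(lam V (n + 1) ⊗ₘ clipKernel V) := by
    rw [Measure.integral_compProd hc]
    refine integral_congr_ae ?_
    have hn : ∫⁻ p, ‖f' (remIn V p)‖ₑ ^ 2 ∂(lam V (n + 1) ⊗ₘ clipKernel V) < ∞ := by
      rw [lam_compProd hV, lintegral_smul_measure, lintegral_map (hfv.enorm.pow_const 2) hT]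
      refine mul_lt_top (by finiteness) (lt_of_le_of_lt (le_of_eq ?_) m2)
      refine lintegral_congr_ae ?_
      filter_upwards [ae_lam_remIn hV n] with q hq
      rw [hq]
    rw [Measure.lintegral_compProd (hfv.enorm.pow_const 2)] at hn
    filter_upwards [ae_lt_top (hfv.enorm.pow_const 2).lintegral_kernel_prod_right' hn.ne,
      ae_clipKernel_univ hV (n + 1)] with η hη hc
    have : IsFiniteMeasure (clipKernel V η) := ⟨by rw [hc]; simp⟩
    have hm : Measurable fun x => f' (remIn V (η, x)) := hfv.comp measurable_prodMk_left
    exact (integral_inner (𝕜 := ℝ) (((memLp_two_iff_msq hm.aestronglyMeasurable).2 hη).integrable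
      (by norm_num)) (f η)).symm
  rw [e1, lam_compProd hV, integral_smul_measure, integral_map hT.aemeasurable
    hgm.aestronglyMeasurable, integral_congr_ae hae]
  simp only [ENNReal.toReal_add (ENNReal.natCast_ne_top n) ENNReal.one_ne_top,
    ENNReal.toReal_natCast, ENNReal.toReal_one, smul_eq_mul, Function.comp_apply]

/-- Cauchy-Schwarz over the `n + 1` particles gives one factor `n + 1`, the Mecke formula the other.
-/
theorem msq_removal_le (hV : MeasurableSet V) (n : ℕ) {f : Config d → E d} (hf : Measurable f) :
    msq (lam V (n + 1)) (removal V f) ≤ (n + 1) ^ 2 * volume V * msq (lam V n) f := by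
  have hm : Measurable fun q : Pt d => f (remIn V q) := hf.comp (measurable_remIn hV)
  have h1 : ∀ᵐ η : Config d ∂lam V (n + 1), ‖removal V f η‖ₑ ^ 2
      ≤ (n + 1) * ∫⁻ x, ‖f (remIn V (η, x))‖ₑ ^ 2 ∂clipKernel V η := by
    filter_upwards [ae_clipKernel_univ hV (n + 1)] with η hc
    rw [Nat.cast_add, Nat.cast_one] at hc
    have h := sq_lintegral_le (clipKernel V η)
      (hm.comp (measurable_prodMk_left (x := η))).enorm.aemeasurable
    rw [hc] at h
    exact (pow_le_pow_left' (enorm_integral_le_lintegral_enorm _) 2).trans h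
  refine (lintegral_mono_ae h1).trans (le_of_eq ?_)
  rw [lintegral_const_mul' _ _ (by finiteness),
    lintegral_lam_mecke hV n (F := fun η x => ‖f (remIn V (η, x))‖ₑ ^ 2) (hm.enorm.pow_const 2)]
  have h2 : ∫⁻ x in V, (∫⁻ η, ‖f (remIn V (η + particle x, x))‖ₑ ^ 2 ∂lam V n)
      = volume V * msq (lam V n) f := by
    have hT : Measurable fun p : Pt d => (p.1 + particle p.2, p.2) :=
      measurable_add_particle.prodMk measurable_snd
    have hmT : Measurable fun q : Pt d => ‖f (remIn V (q.1 + particle q.2, q.2))‖ₑ ^ 2 :=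
      (hm.comp hT).enorm.pow_const 2
    have hf1 : Measurable fun q : Pt d => ‖f q.1‖ₑ ^ 2 :=
      (hf.comp measurable_fst).enorm.pow_const 2
    rw [← lintegral_prod_symm' _ hmT]
    have e : ∫⁻ q, ‖f (remIn V (q.1 + particle q.2, q.2))‖ₑ ^ 2 ∂(lam V n).prod (vol V)
        = ∫⁻ q, ‖f q.1‖ₑ ^ 2 ∂(lam V n).prod (vol V) := by
      refine lintegral_congr_ae ?_
      filter_upwards [ae_lam_remIn hV n] with q hq
      rw [hq]
    rw [e, lintegral_prod_symm' _ hf1]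
    simp [msq, mul_comm]
  rw [h2]
  ring

variable [SFinite ζ]

theorem msq_lz_eq (hF : Measurable (uncurry F))
    (n : ℕ) : msq (lz V ζ n) (uncurry F) = ∫⁻ z, msq (lam V n) (fun η => F η z) ∂ζ :=
  lintegral_prod_symm' _ (hF.enorm.pow_const 2)

theorem rmv_lam_zero (F : Config d → Z → E d)
    (hV : MeasurableSet V) (z : Z) : ∀ᵐ η ∂lam V 0, rmv V F η z = 0 := by
  filter_upwards [ae_clipKernel_univ hV 0] with η hη
  have h0 : clipKernel V η = 0 := by rw [← Measure.measure_univ_eq_zero, hη, Nat.cast_zero]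
  rw [rmv, removal, h0, integral_zero_measure]

variable [IsFiniteMeasure (vol V)]

theorem Lev.rmv (hV : MeasurableSet V) (h : Lev V ζ F) : Lev V ζ (rmv V F) := by
  have hm := measurable_rmv hV h.meas
  refine ⟨hm, fun n => ?_⟩
  rw [msq_lz_eq hm]
  rcases n with _ | n
  · have : ∀ z, msq (lam V 0) (fun η => Bulk.rmv V F η z) = 0 := fun z => by
      rw [msq_congr (h := fun _ => (0 : E d)) (rmv_lam_zero F hV z)]; simp [msq]
    simp [this]
  · refine (lintegral_mono fun z => msq_removal_le hV n
      (h.meas.comp (measurable_prodMk_right (y := z)))).trans_lt ?_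
    rw [lintegral_const_mul' _ _ (by have := (volume_lt_top_of_vol (V := V)).ne; finiteness)]
    refine mul_lt_top (by have := (volume_lt_top_of_vol (V := V)).ne; finiteness) ?_
    exact (msq_lz_eq h.meas n).symm.trans_lt (h.fin n)

theorem Lev.ae_msq_lt_top (h : Lev V ζ F)
    (n : ℕ) : ∀ᵐ z ∂ζ, msq (lam V n) (fun η => F η z) < ∞ := by
  have h1 := h.fin n
  rw [msq_lz_eq h.meas] at h1
  have hm : Measurable fun p : Config d × Z => ‖F p.1 p.2‖ₑ ^ 2 := h.meas.enorm.pow_const 2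
  exact ae_lt_top hm.lintegral_prod_left' h1.ne

theorem lz_eq_map_swap (V : Set (E d)) (ζ : Measure Z)
    [SFinite ζ] (n : ℕ) : lz V (ζ.prod (vol V)) n = (ζ.prod ((lam V n).prod (vol V))).map fun r :
    Z × (Pt d) => ((r.2.1, (r.1, r.2.2)) : Config d × (Z × E d)) := by
  have hT : Measurable fun r : Z × (Pt d) =>
      ((r.2.1, (r.1, r.2.2)) : Config d × (Z × E d)) := by fun_prop
  refine Measure.ext_of_lintegral _ fun G hG => ?_
  have hGT : Measurable fun r : Z × (Pt d) => G (r.2.1, (r.1, r.2.2)) := hG.comp hT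
  have hG2 : Measurable fun r : Z × (Pt d) =>
      G (r.2.1, (r.1, r.2.2)) := hG.comp hT
  rw [lintegral_map hG hT, lintegral_lz_assoc ζ n hG, lintegral_prod_symm' _ (measurable_fibre V hG),
    lintegral_prod _ hGT.aemeasurable]
  refine lintegral_congr fun z => ?_
  have : Measurable fun q : Pt d => G (q.1, (z, q.2)) := hGT.comp measurable_prodMk_left
  rw [lintegral_prod _ this.aemeasurable]

/-- Averaging and removal are adjoint to each other. -/
theorem integral_inner_rmv (hV : MeasurableSet V)
    (h : Lev V ζ F) (h' : Lev V ζ F') (n : ℕ) : ∫ p, inner ℝ (F p.1 p.2) (rmv V F' p.1 p.2)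
    ∂lz V ζ (n + 1) = (n + 1) * ∫ p, inner ℝ (F' p.1 p.2) (sb V F p.1 p.2) ∂lz V ζ n := by
  have i1 := h.integrable_inner (h'.rmv hV) (n + 1)
  have i2 := h'.drop.integrable_inner h.push n
  have hT : Measurable fun r : Z × (Pt d) =>
      ((r.2.1, (r.1, r.2.2)) : Config d × (Z × E d)) := by fun_prop
  rw [sb_eq_av, ← integral_inner_av h.push h', ← integral_const_mul, integral_prod_symm _ i1]
  have e : ∀ᵐ z ∂ζ, ∫ η, inner ℝ (F η z) (rmv V F' η z) ∂lam V (n + 1)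
      = ∫ q : Pt d, (n + 1) * inner ℝ (F' q.1 z) (F (q.1 + particle q.2) z)
        ∂(lam V n).prod (vol V) := by
    filter_upwards [h.ae_msq_lt_top (n + 1), h'.ae_msq_lt_top n] with z h1 h2
    rw [integral_const_mul]
    refine (integral_inner_removal hV n (h.meas.comp (measurable_prodMk_right (y := z)))
      (h'.meas.comp (measurable_prodMk_right (y := z))) h1 h2).trans ?_
    congr 1
    exact integral_congr_ae (Eventually.of_forall fun q => real_inner_comm _ _)
  rw [integral_congr_ae e]
  have i3 := i2.const_mul ((n : ℝ) + 1)
  have hae := i3.aestronglyMeasurable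
  rw [lz_eq_map_swap] at i3 hae ⊢
  rw [integral_map hT.aemeasurable hae]
  rw [integrable_map_measure hae hT.aemeasurable] at i3
  exact (integral_prod _ i3).symm

end Removal

/-! ### The classes of gradients and of solenoidal fields -/

section Classes

/-- Fields that are orthogonal to smooth gradients on every level. -/
def solSet (U V : Set (E d)) : Set (Fld d) :=
  {r | Lev V (vol U) r ∧ ∀ φ, SmoothIn U φ → Lev V (vol U) (pgrad φ) → ∀ n,
    ∫ p, inner ℝ (pgrad φ p.1 p.2) (r p.1 p.2) ∂lz V (vol U) n = 0}

/-- Fields that are orthogonal to `solSet` on every level. -/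
def potSet (U V : Set (E d)) : Set (Fld d) :=
  {h | Lev V (vol U) h ∧ ∀ r ∈ solSet U V, ∀ n,
    ∫ p, inner ℝ (h p.1 p.2) (r p.1 p.2) ∂lz V (vol U) n = 0}

/-- Testing the average with `∇φ` is, by adjointness, testing `r` with the removal of `∇φ`, which is
the gradient of the removal of `φ`. -/
theorem sb_mem_solSet (hD : Dom U V) {r : Fld d} (hr : r ∈ solSet U V) : sb V r ∈ solSet U V := by
  have := hD.finV
  refine ⟨hr.1.sb, fun φ hφ hL n => ?_⟩
  have hpg : LevEq V (vol U) (rmv V (pgrad φ)) (pgrad (removal V φ)) := fun n => by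
    filter_upwards [ae_levU_mem hD n] with p hp
    exact (HasPG.removal hD.isOpen hD.meas hD.subset hφ (by rw [hp.2.1]; simp) hp.2.2).pgrad_eq.symm
  have hs := hφ.removal hD.measU hD.meas hD.subset
  have h1 := hr.2 _ hs ((hL.rmv hD.meas).congr (measurable_pgrad hs.1) hpg) (n + 1)
  have h2 := integral_inner_rmv hD.meas hr.1 hL n
  have h3 : ∫ p, inner ℝ (r p.1 p.2) (rmv V (pgrad φ) p.1 p.2) ∂lz V (vol U) (n + 1) = 0 := by
    rw [← h1]
    refine integral_congr_ae ?_
    filter_upwards [hpg (n + 1)] with p hp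
    rw [hp, real_inner_comm]
  rw [h3] at h2
  exact (mul_eq_zero.1 h2.symm).resolve_left (by positivity)

/-- For each fixed added point `y`, the function `φ(· + δ_y)` is itself a test function, so the
integrand in `y` vanishes. -/
theorem integral_inner_push_pgrad (hD : Dom U V)
    {r : Fld d} (hr : r ∈ solSet U V) (hφ : SmoothIn U φ) (hL : Lev V (vol U) (pgrad φ))
    (n : ℕ) : ∫ p, inner ℝ (r p.1 p.2) (sb V (pgrad φ) p.1 p.2) ∂lz V (vol U) n = 0 := by
  have := hD.finV
  have hi := hr.1.drop.integrable_inner hL.push n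
  rw [sb_eq_av, ← integral_inner_av hL.push hr.1]
  have hfin : ∀ᵐ y ∂vol V, ∀ k, msq (lz V (vol U) k) (fun p => pgrad φ (p.1 + particle y) p.2) < ∞ := by
    refine ae_all_iff.2 fun k => ?_
    have h1 := hL.push.fin k
    have hm : Measurable fun q : (Pt d) × E d =>
        ‖pgrad φ (q.1.1 + particle q.2) q.1.2‖ₑ ^ 2 :=
      (hL.push.meas.comp measurable_assoc).enorm.pow_const 2
    rw [← lz_assoc, msq, lintegral_map (hL.push.meas.enorm.pow_const 2)
      MeasurableEquiv.prodAssoc.measurable] at h1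
    have h2 := (lintegral_prod_symm' _ hm).symm.trans_lt h1
    exact ae_lt_top hm.lintegral_prod_left' h2.ne
  have hae := hi.aestronglyMeasurable
  rw [← lz_assoc] at hi hae ⊢
  rw [integrable_map_equiv] at hi
  rw [integral_map_equiv]
  refine (integral_prod_symm _ hi).trans ?_
  refine (integral_congr_ae (g := fun _ => (0 : ℝ)) ?_).trans (by simp)
  filter_upwards [hfin] with y hy
  have hs := hφ.add_particle hD.measU y
  have e : (fun p : Pt d => pgrad (fun μ => φ (μ + particle y)) p.1 p.2)
      = fun p => pgrad φ (p.1 + particle y) p.2 := funext fun p => pgrad_add_particle φ y p.1 p.2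
  have h5 := hr.2 _ hs ⟨measurable_pgrad hs.1, fun k => by
    change msq _ (fun p : Pt d => pgrad (fun μ => φ (μ + particle y)) p.1 p.2) < ∞
    rw [e]; exact hy k⟩ n
  rw [← h5]
  refine integral_congr_ae (Eventually.of_forall fun p => ?_)
  beta_reduce
  rw [pgrad_add_particle, real_inner_comm]
  rfl

theorem rmv_mem_solSet (hD : Dom U V) {r : Fld d} (hr : r ∈ solSet U V) : rmv V r ∈ solSet U V := by
  have := hD.finV
  refine ⟨hr.1.rmv hD.meas, fun φ hφ hL n => ?_⟩
  rcases n with _ | n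
  · refine (integral_congr_ae (g := fun _ => (0 : ℝ)) ?_).trans (by simp)
    filter_upwards [Measure.quasiMeasurePreserving_fst.ae (ae_clipKernel_univ hD.meas 0)] with p hp
    have h0 : clipKernel V p.1 = 0 := by rw [← Measure.measure_univ_eq_zero, hp, Nat.cast_zero]
    simp only [rmv, removal, h0, integral_zero_measure, inner_zero_right]
  · rw [integral_inner_rmv hD.meas hL hr.1, integral_inner_push_pgrad hD hr hφ hL, mul_zero]

/-- Potential fields are stable under averaging because the adjoint operation, removal, preserves
the solenoidal ones (`rmv_mem_solSet`). -/
theorem polar_potSet (hD : Dom U V) : Polar V (vol U) (potSet U V) (solSet U V) := by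
  have := hD.finV
  refine ⟨fun h hh => hh.1, fun r hr => hr.1, fun h hh => ⟨hh.1.sb, fun r hr n => ?_⟩,
    fun r hr => sb_mem_solSet hD hr, fun h hh r hr n => hh.2 r hr n⟩
  have h1 := integral_inner_rmv hD.meas hh.1 hr.1 n
  rw [hh.2 _ (rmv_mem_solSet hD hr)] at h1
  have h2 := (mul_eq_zero.1 h1.symm).resolve_left (by positivity)
  rw [← h2]
  exact integral_congr_ae (Eventually.of_forall fun p => real_inner_comm _ _)

theorem IsCorr.resid_mem (hD : Dom U V)
    (hA : IsField Λ A) (h : IsCorr U V A q g) : resid A q g ∈ solSet U V := by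
  have hr := h.levL2.resid hD hA q
  exact ⟨⟨hr.1, hr.2⟩, fun φ hφ hL n => h.el φ hφ n (hL.fin n)⟩

theorem IsCorr.mem_potSet (h : IsCorr U V A q g) : g ∈ potSet U V := by
  have hg := h.levL2
  refine ⟨⟨hg.1, hg.2⟩, fun r hr n => ?_⟩
  obtain ⟨φ, hφ, hlim⟩ := h.approx
  exact integral_inner_eq_zero_of_tendsto (m := lz V (vol U) n)
    (f := fun j (p : Pt d) => pgrad (φ j) p.1 p.2)
    (g := fun p : Pt d => g p.1 p.2)
    (h := fun p : Pt d => r p.1 p.2)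
    (fun j => (hφ j).2.1) h.meas hr.1.meas (fun j => (hφ j).2.2 n)
    (hg.2 n) (hr.1.fin n) (hlim n) fun j => hr.2 _ (hφ j).1 ⟨(hφ j).2.1, (hφ j).2.2⟩ n

end Classes

/-! ### Energies of iterated differences -/

section Energies

variable {Z : Type} [MeasurableSpace Z] {ζ : Measure Z} [SFinite ζ]
  {F F' : Config d → Z → E d}

theorem fz_eq_sum (ρ : ℝ) (V : Set (E d))
    (ζ : Measure Z) [SFinite ζ] : (fv ρ V).prod ζ = Measure.sum fun n => fvW ρ V n • lz V ζ n := by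
  rw [fv, Measure.prod_sum_left]
  simp only [Measure.prod_smul_left, fvW]

theorem LevEq.ae_fz (h : LevEq V ζ F F')
    (ρ : ℝ) : ∀ᵐ p ∂(fv ρ V).prod ζ, F p.1 p.2 = F' p.1 p.2 := by
  rw [fz_eq_sum, Measure.ae_sum_iff]
  exact fun n => Measure.ae_smul_measure (h n) _

theorem msq_fz (ρ : ℝ) (V : Set (E d)) (ζ : Measure Z) [SFinite ζ]
    (G : Config d × Z → E d) : msq ((fv ρ V).prod ζ) G = ∑' n, fvW ρ V n * msq (lz V ζ n) G := by
  simp only [msq, fz_eq_sum, lintegral_sum_measure, lintegral_smul_measure, smul_eq_mul]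

/-- At most geometric growth on the levels. -/
structure Geo (V : Set (E d)) (ζ : Measure Z) (F : Config d → Z → E d) : Prop where
  meas : Measurable (uncurry F)
  bound : ∃ K r : ℝ≥0, ∀ n, msq (lz V ζ n) (uncurry F) ≤ K * (r : ℝ≥0∞) ^ n

theorem Geo.lev (h : Geo V ζ F) : Lev V ζ F := by
  obtain ⟨K, r, hK⟩ := h.bound
  exact ⟨h.meas, fun n => (hK n).trans_lt (by finiteness)⟩

theorem Geo.mono (h : Geo V ζ F)
    (hm : Measurable (uncurry F')) {C : ℝ≥0} (hC : ∀ n, msq (lz V ζ n) (uncurry F')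
    ≤ C * (msq (lz V ζ n) (uncurry F) + msq (lz V ζ (n + 1)) (uncurry F))) : Geo V ζ F' := by
  obtain ⟨K, r, hK⟩ := h.bound
  refine ⟨hm, C * K * (1 + r), r, fun n => (hC n).trans ?_⟩
  calc _ ≤ (C : ℝ≥0∞) * (K * r ^ n + K * r ^ (n + 1)) := by gcongr <;> exact hK _
    _ = _ := by push_cast; ring

theorem Geo.congr (h : Geo V ζ F)
    (hm : Measurable (uncurry F')) (he : LevEq V ζ F F') : Geo V ζ F' :=
  h.mono hm (C := 1) fun n => by
    rw [msq_congr (f := uncurry F') (h := uncurry F) (he.symm n)]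
    simp

theorem Geo.sub (h : Geo V ζ F) (h' : Geo V ζ F') : Geo V ζ fun η z => F η z - F' η z := by
  obtain ⟨K, r, hK⟩ := h.bound
  obtain ⟨K', r', hK'⟩ := h'.bound
  refine ⟨h.meas.sub h'.meas, 2 * K + 2 * K', r ⊔ r', fun n => ?_⟩
  refine (msq_sub_le (f := uncurry F) (h := uncurry F') h.meas).trans ?_
  calc _ ≤ 2 * ((K : ℝ≥0∞) * ((r ⊔ r' : ℝ≥0) : ℝ≥0∞) ^ n)
        + 2 * ((K' : ℝ≥0∞) * ((r ⊔ r' : ℝ≥0) : ℝ≥0∞) ^ n) := by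
        gcongr
        · refine (hK n).trans ?_
          gcongr
          exact le_sup_left
        · refine (hK' n).trans ?_
          gcongr
          exact le_sup_right
    _ = _ := by push_cast; ring

theorem Geo.const_smul (h : Geo V ζ F) (c : ℝ) : Geo V ζ fun η z => c • F η z :=
  h.mono (h.meas.const_smul c) (C := ‖c‖₊ ^ 2) fun n => by
    refine (msq_const_smul _ c (uncurry F)).trans_le ?_
    push_cast
    gcongr
    · rfl
    · exact le_self_add

theorem Geo.clm_apply (h : Geo V ζ F) {b : Config d → Z → (E d →L[ℝ] E d)} (hb :
    Measurable (uncurry b)) {M : ℝ} (hM : ∀ η z, ‖b η z‖ ≤ M) : Geo V ζ fun η z => b η z (F η z) :=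
  h.mono (measurable_clm_apply hb h.meas) (C := M.toNNReal ^ 2) fun n => by
    refine (msq_clm_apply_le _ (A := uncurry b) (uncurry F)
      fun p => hM p.1 p.2).trans ?_
    push_cast
    gcongr
    · rfl
    · exact le_self_add

/-- The factorials in the Poisson weights beat any geometric growth, so integrability is obtained
for all intensities at once. -/
theorem Geo.msq_fz_lt_top (h : Geo V ζ F) (hρ : 0 ≤ ρ) : msq ((fv ρ V).prod ζ) (uncurry F) < ∞ := by
  obtain ⟨K, r, hK⟩ := h.bound
  rw [msq_fz]
  calc _ ≤ ∑' n, ofReal (Real.exp (-(ρ * volume.real V)) * K) *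
        ofReal ((ρ * r) ^ n / n.factorial) := by
        refine ENNReal.tsum_le_tsum fun n => (mul_le_mul_right (hK n) _).trans (le_of_eq ?_)
        rw [fvW, ← ENNReal.ofReal_coe_nnreal, ← ENNReal.ofReal_coe_nnreal,
          ← ENNReal.ofReal_pow (by positivity), ← ofReal_mul (by positivity),
          ← ofReal_mul (by positivity), ← ofReal_mul (by positivity)]
        congr 1
        rw [mul_pow]; ring
    _ < ∞ := by
        rw [ENNReal.tsum_mul_left, tsum_ofReal_poisson (by positivity)]
        finiteness

/-- `∫_{V^j} E|D_{y_1} ⋯ D_{y_j} f|² dy`. -/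
def nj (ρ : ℝ) (V : Set (E d)) : ℕ → (Config d → E d) → ℝ≥0∞
  | 0, f => msq (fv ρ V) f
  | j + 1, f => ∫⁻ y in V, nj ρ V j fun η => f (η + particle y) - f η

/-- The integral of `nj` over a parameter. -/
def nn (ρ : ℝ) (V : Set (E d)) (ζ : Measure Z) (j : ℕ) (F : Config d → Z → E d) : ℝ≥0∞ :=
  ∫⁻ z, nj ρ V j (fun η => F η z) ∂ζ

theorem measurable_nj (ρ : ℝ) (V : Set (E d)) (j : ℕ) {Z : Type} [MeasurableSpace Z] {F : Config d →
    Z → E d} (hF : Measurable (uncurry F)) : Measurable fun z => nj ρ V j fun η => F η z := by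
  induction j generalizing Z with
  | zero =>
    have hm : Measurable fun p : Config d × Z => ‖F p.1 p.2‖ₑ ^ 2 := hF.enorm.pow_const 2
    exact hm.lintegral_prod_left'
  | succ j ih => exact (ih (measurable_dif hF)).lintegral_prod_right' (ν := vol V)

theorem nn_zero (hF : Measurable (uncurry F)) : nn ρ V ζ 0 F = msq ((fv ρ V).prod ζ) (uncurry F) :=
  (lintegral_prod_symm' _ (hF.enorm.pow_const 2)).symm

theorem nn_succ (hF : Measurable (uncurry F))
    (j : ℕ) : nn ρ V ζ (j + 1) F = nn ρ V (ζ.prod (vol V)) j (dif F) :=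
  (lintegral_prod _ (measurable_nj ρ V j (measurable_dif hF)).aemeasurable).symm

theorem nn_congr (hF : Measurable (uncurry F)) (hF' : Measurable (uncurry F'))
    (h : LevEq V ζ F F') (j : ℕ) : nn ρ V ζ j F = nn ρ V ζ j F' := by
  induction j generalizing Z with
  | zero =>
    rw [nn_zero hF, nn_zero hF']
    exact msq_congr (h.ae_fz ρ)
  | succ j ih =>
    rw [nn_succ hF, nn_succ hF']
    exact ih (measurable_dif hF) (measurable_dif hF') h.dif

theorem measurable_diff_family {f : Config d → E d} (hf : Measurable f) :
    Measurable (uncurry fun (η : Config d) (y : E d) => f (η + particle y) - f η) :=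
  (hf.comp measurable_add_particle).sub (hf.comp measurable_fst)

theorem nj_add_le (j : ℕ) {f f' : Config d → E d} (hf : Measurable f)
    (hf' : Measurable f') : nj ρ V j (fun η => f η + f' η) ≤ 2 * nj ρ V j f + 2 * nj ρ V j f' := by
  induction j generalizing f f' with
  | zero => exact msq_add_le hf
  | succ j ih =>
    have hm := measurable_nj ρ V j (measurable_diff_family hf)
    calc _ ≤ ∫⁻ y in V, (2 * nj ρ V j (fun η => f (η + particle y) - f η)
          + 2 * nj ρ V j fun η => f' (η + particle y) - f' η) := by
          refine lintegral_mono fun y => ?_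
          refine le_trans (le_of_eq ?_) (ih (f := fun η => f (η + particle y) - f η)
            (f' := fun η => f' (η + particle y) - f' η)
            ((hf.comp (measurable_add_const _)).sub hf)
            ((hf'.comp (measurable_add_const _)).sub hf'))
          congr 1
          funext η
          exact add_sub_add_comm _ _ _ _
      _ = _ := by
          rw [lintegral_add_left (hm.const_mul _), lintegral_const_mul' _ _ (by simp),
            lintegral_const_mul' _ _ (by simp)]
          rfl

theorem nj_zero_fun (j : ℕ) : nj ρ V j (fun _ => (0 : E d)) = 0 := by
  induction j with
  | zero => simp [nj, msq]
  | succ j ih => simp [nj, ih]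

theorem nj_succ_const (j : ℕ) (q : E d) : nj ρ V (j + 1) (fun _ => q) = 0 := by
  simp [nj, nj_zero_fun]

theorem nn_add_le (j : ℕ) (hF : Measurable (uncurry F)) (hF' : Measurable (uncurry F')) :
    nn ρ V ζ j (fun η z => F η z + F' η z) ≤ 2 * nn ρ V ζ j F + 2 * nn ρ V ζ j F' := by
  calc _ ≤ ∫⁻ z, (2 * nj ρ V j (fun η => F η z) + 2 * nj ρ V j fun η => F' η z) ∂ζ :=
        lintegral_mono fun z => nj_add_le j (hF.comp (measurable_prodMk_right (y := z)))
          (hF'.comp (measurable_prodMk_right (y := z)))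
    _ = _ := by
        rw [lintegral_add_left ((measurable_nj ρ V j hF).const_mul _),
          lintegral_const_mul' _ _ (by simp), lintegral_const_mul' _ _ (by simp)]
        rfl

/-! ### Multiplication by a local field -/

/-- The volume of a ball of radius `1/2`. -/
def ballVol (d : ℕ) : ℝ≥0∞ := volume (Metric.ball (0 : E d) (1 / 2))

theorem ballVol_ne_top (d : ℕ) : ballVol d ≠ ∞ := Metric.isBounded_ball.measure_lt_top.ne

theorem volume_ball_half (c : E d) : volume (Metric.ball c (1 / 2)) = ballVol d := by
  rw [ballVol, Measure.addHaar_ball_center]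

/-- The constant in the bound on products. -/
def mulC (d : ℕ) : ℕ → ℝ≥0∞
  | 0 => 1
  | j + 1 => (2 + 8 * ballVol d) * mulC d j

theorem mulC_ne_top (d j : ℕ) : mulC d j ≠ ∞ := by
  have := ballVol_ne_top d
  induction j with
  | zero => simp [mulC]
  | succ j ih => rw [mulC]; finiteness

theorem lintegral_ball_const_le (V : Set (E d)) (c : E d)
    (a : ℝ≥0∞) : ∫⁻ y in V, (Metric.ball c (1 / 2)).indicator (fun _ => a) y ≤ ballVol d * a := by
  calc _ ≤ ∫⁻ y, (Metric.ball c (1 / 2)).indicator (fun _ => a) y := setLIntegral_le_lintegral _ _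
    _ = _ := by
      rw [lintegral_indicator measurableSet_ball, setLIntegral_const, volume_ball_half, mul_comm]

/-- Discrete Leibniz rule `D_y(b f) = b(· + δ_y) D_y f + (D_y b) f`. The second term vanishes unless
`y` lies in the ball around `c`, so integrating in `y` costs the volume of a ball instead of that of
`V`. Its factor 8 is 2 times the square of the bound `2 M` on `D_y b`. -/
theorem nj_mul_le (j : ℕ) {c : E d} {b : Config d → (E d →L[ℝ] E d)} {M : ℝ} (hb : Measurable b)
    (hM : ∀ η, ‖b η‖ ≤ M) (hloc : ∀ η y, y ∉ Metric.ball c (1 / 2) → b (η + particle y) = b η)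
    {f : Config d → E d} (hf : Measurable f) : nj ρ V j (fun η => b η (f η))
    ≤ mulC d j * ofReal M ^ 2 * ∑ i ∈ Finset.range (j + 1), nj ρ V i f := by
  induction j generalizing b M f with
  | zero => simpa [mulC, nj] using msq_clm_apply_le (fv ρ V) f hM
  | succ j ih =>
    have hM0 : 0 ≤ M := (norm_nonneg _).trans (hM 0)
    have hmf := fun i => measurable_nj ρ V i (measurable_diff_family hf)
    have h1 : ∀ y, nj ρ V j (fun η => b (η + particle y) (f (η + particle y)) - b η (f η))
        ≤ 2 * (mulC d j * ofReal M ^ 2 * ∑ i ∈ Finset.range (j + 1),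
            nj ρ V i fun η => f (η + particle y) - f η)
          + (Metric.ball c (1 / 2)).indicator (fun _ => 8 * (mulC d j * ofReal M ^ 2 *
            ∑ i ∈ Finset.range (j + 1), nj ρ V i f)) y := by
      intro y
      have hby : Measurable fun η => b (η + particle y) := hb.comp (measurable_add_const _)
      have hdf : Measurable fun η => f (η + particle y) - f η :=
        (hf.comp (measurable_add_const _)).sub hf
      have e1 : (fun η => b (η + particle y) (f (η + particle y)) - b η (f η))
          = fun η => b (η + particle y) (f (η + particle y) - f η)
            + (b (η + particle y) - b η) (f η) := by
        funext η
        simp only [map_sub, sub_apply]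
        abel
      rw [e1]
      refine (nj_add_le j (measurable_clm_apply hby hdf)
        (measurable_clm_apply (hby.sub hb) hf)).trans (add_le_add ?_ ?_)
      · refine mul_le_mul_right (ih hby (fun η => hM _) (fun η w hw => ?_) hdf) 2
        rw [add_right_comm]; exact hloc _ _ hw
      · by_cases hy : y ∈ Metric.ball c (1 / 2)
        · rw [indicator_of_mem hy]
          refine (mul_le_mul_right (ih (b := fun η => b (η + particle y) - b η) (M := 2 * M)
            (hby.sub hb) (fun η => ?_) (fun η w hw => ?_) hf) 2).trans (le_of_eq ?_)
          · refine (norm_sub_le _ _).trans ?_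
            linarith [hM (η + particle y), hM η]
          · beta_reduce
            rw [add_right_comm, hloc _ _ hw, hloc _ _ hw]
          · rw [ofReal_mul (by norm_num), ENNReal.ofReal_ofNat]
            ring
        · rw [indicator_of_notMem hy]
          simp [hloc _ _ hy, nj_zero_fun]
    have hm1 : Measurable fun y => 2 * (mulC d j * ofReal M ^ 2 *
        ∑ i ∈ Finset.range (j + 1), nj ρ V i fun η => f (η + particle y) - f η) :=
      ((Finset.measurable_fun_sum _ fun i _ => hmf i).const_mul _).const_mul _
    have hCM : mulC d j * ofReal M ^ 2 ≠ ∞ := by have := mulC_ne_top d j; finiteness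
    have hs1 : ∑ i ∈ Finset.range (j + 1), nj ρ V (i + 1) f
        ≤ ∑ i ∈ Finset.range (j + 2), nj ρ V i f := by
      rw [Finset.sum_range_succ' _ (j + 1)]; exact le_self_add
    have hs2 : ∑ i ∈ Finset.range (j + 1), nj ρ V i f
        ≤ ∑ i ∈ Finset.range (j + 2), nj ρ V i f := by
      rw [Finset.sum_range_succ _ (j + 1)]; exact le_self_add
    calc nj ρ V (j + 1) (fun η => b η (f η)) ≤ _ := lintegral_mono fun y => h1 y
      _ ≤ 2 * (mulC d j * ofReal M ^ 2 * ∑ i ∈ Finset.range (j + 1), nj ρ V (i + 1) f)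
          + ballVol d * (8 * (mulC d j * ofReal M ^ 2 *
            ∑ i ∈ Finset.range (j + 1), nj ρ V i f)) := by
          rw [lintegral_add_left hm1]
          refine add_le_add (le_of_eq ?_) (lintegral_ball_const_le _ _ _)
          rw [lintegral_const_mul' _ _ (by simp), lintegral_const_mul' _ _ hCM,
            lintegral_finsetSum _ fun i _ => hmf i]
          rfl
      _ ≤ 2 * (mulC d j * ofReal M ^ 2 * ∑ i ∈ Finset.range (j + 2), nj ρ V i f)
          + ballVol d * (8 * (mulC d j * ofReal M ^ 2 *
            ∑ i ∈ Finset.range (j + 2), nj ρ V i f)) := by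
          gcongr
      _ = _ := by rw [mulC]; ring

/-- A bounded field which depends only on the particles near `c z`. -/
structure Loc (c : Z → E d) (M : ℝ) (b : Config d → Z → (E d →L[ℝ] E d)) : Prop where
  meas : Measurable (uncurry b)
  measc : Measurable c
  bdd : ∀ η z, ‖b η z‖ ≤ M
  loc : ∀ η z y, y ∉ Metric.ball (c z) (1 / 2) → b (η + particle y) z = b η z

/-- The sum of the energies of order less than `s`. -/
def ns (ρ : ℝ) (V : Set (E d)) (ζ : Measure Z) (s : ℕ) (F : Config d → Z → E d) : ℝ≥0∞ :=
  ∑ i ∈ Finset.range s, nn ρ V ζ i F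

theorem ns_mono {s t : ℕ} (h : s ≤ t) (F : Config d → Z → E d) : ns ρ V ζ s F ≤ ns ρ V ζ t F :=
  Finset.sum_le_sum_of_subset (Finset.range_mono h)

theorem ns_dif_le (hF : Measurable (uncurry F))
    (s : ℕ) : ns ρ V (ζ.prod (vol V)) s (dif F) ≤ ns ρ V ζ (s + 1) F := by
  simp only [ns, ← nn_succ hF]
  rw [Finset.sum_range_succ' _ s]
  exact le_self_add

theorem nn_mul_le {c : Z → E d} {M : ℝ}
    {b : Config d → Z → (E d →L[ℝ] E d)} (hb : Loc c M b) (hF : Measurable (uncurry F)) (j : ℕ) :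
    nn ρ V ζ j (fun η z => b η z (F η z)) ≤ mulC d j * ofReal M ^ 2 * ns ρ V ζ (j + 1) F := by
  have hCM : mulC d j * ofReal M ^ 2 ≠ ∞ := by have := mulC_ne_top d j; finiteness
  calc _ ≤ ∫⁻ z, mulC d j * ofReal M ^ 2 *
        ∑ i ∈ Finset.range (j + 1), nj ρ V i (fun η => F η z) ∂ζ :=
        lintegral_mono fun z => nj_mul_le j (hb.meas.comp (measurable_prodMk_right (y := z)))
          (fun η => hb.bdd η z) (fun η y hy => hb.loc η z y hy)
          (hF.comp (measurable_prodMk_right (y := z)))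
    _ = _ := by
        rw [lintegral_const_mul' _ _ hCM, lintegral_finsetSum _ fun i _ => measurable_nj ρ V i hF]
        rfl

/-- The field `(η, (z, y)) ↦ b(η + δ_y, z)`. -/
def pushB (b : Config d → Z → (E d →L[ℝ] E d)) (η : Config d) (r : Z × E d) : E d →L[ℝ] E d :=
  b (η + particle r.2) r.1

/-- The field `(η, (z, y)) ↦ b(η + δ_y, z) - b(η, z)`. -/
def difB (b : Config d → Z → (E d →L[ℝ] E d)) (η : Config d) (r : Z × E d) : E d →L[ℝ] E d :=
  b (η + particle r.2) r.1 - b η r.1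

theorem Loc.push {c : Z → E d} {M : ℝ} {b : Config d → Z → (E d →L[ℝ] E d)} (hb : Loc c M b) :
    Loc (fun r : Z × E d => c r.1) M (pushB b) where
  meas := hb.meas.comp measurable_push
  measc := hb.measc.comp measurable_fst
  bdd η r := hb.bdd _ _
  loc η r y hy := by
    simp only [pushB]
    rw [add_right_comm]; exact hb.loc _ _ _ hy

theorem Loc.dif {c : Z → E d} {M : ℝ} {b : Config d → Z → (E d →L[ℝ] E d)} (hb : Loc c M b) :
    Loc (fun r : Z × E d => c r.1) (2 * M) (difB b) where
  meas := (hb.meas.comp measurable_push).sub (hb.meas.comp measurable_drop)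
  measc := hb.measc.comp measurable_fst
  bdd η r := by
    refine (norm_sub_le _ _).trans ?_
    linarith [hb.bdd (η + particle r.2) r.1, hb.bdd η r.1]
  loc η r y hy := by
    simp only [difB]
    rw [add_right_comm, hb.loc _ _ _ hy, hb.loc _ _ _ hy]

theorem difB_eq_zero {c : Z → E d} {M : ℝ} {b : Config d → Z → (E d →L[ℝ] E d)} (hb : Loc c M b)
    (η : Config d) {r : Z × E d} (hr : r.2 ∉ Metric.ball (c r.1) (1 / 2)) : difB b η r = 0 := by
  rw [difB, hb.loc _ _ _ hr, sub_self]

open Classical in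
/-- Truncation of a family to the parameters `(z, y)` with `y` close to `c z`. -/
def trunc (c : Z → E d) (H : Config d → Z × E d → E d) (η : Config d) (r : Z × E d) : E d :=
  if r.2 ∈ Metric.ball (c r.1) (1 / 2) then H η r else 0

theorem measurableSet_near {c : Z → E d}
    (hc : Measurable c) : MeasurableSet {r : Z × E d | r.2 ∈ Metric.ball (c r.1) (1 / 2)} := by
  simp only [Metric.mem_ball]
  exact measurableSet_lt (measurable_snd.dist (hc.comp measurable_fst)) measurable_const

theorem measurable_trunc {c : Z → E d} (hc : Measurable c) {H : Config d → Z × E d → E d}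
    (hH : Measurable (uncurry H)) : Measurable (uncurry (trunc c H)) :=
  Measurable.ite (measurable_snd (measurableSet_near hc)) hH measurable_const

theorem nj_trunc_le (c : Z → E d) (H : Config d → Z × E d → E d)
    (j : ℕ) (r : Z × E d) : nj ρ V j (fun η => trunc c H η r) ≤ nj ρ V j (fun η => H η r) := by
  by_cases hr : r.2 ∈ Metric.ball (c r.1) (1 / 2)
  · simp only [trunc, if_pos hr, le_refl]
  · simp only [trunc, if_neg hr, nj_zero_fun, zero_le]

theorem nn_trunc_le (c : Z → E d) (H : Config d → Z × E d → E d)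
    (j : ℕ) : nn ρ V (ζ.prod (vol V)) j (trunc c H) ≤ nn ρ V (ζ.prod (vol V)) j H :=
  lintegral_mono fun r => nj_trunc_le c H j r

theorem nn_trunc_drop_le {c : Z → E d} (hc : Measurable c) (hF : Measurable (uncurry F)) (j : ℕ) :
    nn ρ V (ζ.prod (vol V)) j (trunc c fun η r => F η r.1) ≤ ballVol d * nn ρ V ζ j F := by
  rw [nn, lintegral_prod _ (measurable_nj ρ V j
    (measurable_trunc hc (measurable_drop_fun hF))).aemeasurable, nn,
    ← lintegral_const_mul' _ _ (ballVol_ne_top d)]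
  refine lintegral_mono fun z => ?_
  refine le_trans (lintegral_mono fun y => ?_) (lintegral_ball_const_le V (c z) _)
  by_cases hr : y ∈ Metric.ball (c z) (1 / 2)
  · rw [indicator_of_mem hr]
    simp only [trunc, if_pos hr, le_refl]
  · rw [indicator_of_notMem hr]
    simp only [trunc, if_neg hr, nj_zero_fun, zero_le]

/-- Since the difference of the coefficient vanishes away from `c`, its argument may be truncated to
nearby points for free, and energies of truncated fields do not see the volume of `V`. -/
theorem difB_trunc {c : Z → E d}
    {M : ℝ} {b : Config d → Z → (E d →L[ℝ] E d)} (hb : Loc c M b) (H : Config d → Z × E d → E d)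
    (η : Config d) (r : Z × E d) : difB b η r (trunc c H η r) = difB b η r (H η r) := by
  by_cases hr : r.2 ∈ Metric.ball (c r.1) (1 / 2)
  · simp only [trunc, if_pos hr]
  · simp only [trunc, if_neg hr, difB_eq_zero hb η hr, map_zero, zero_apply]

theorem nn_difB_drop_le {c : Z → E d} {M : ℝ} {b : Config d → Z → (E d →L[ℝ] E d)}
    (hb : Loc c M b) (hF : Measurable (uncurry F)) (j : ℕ) : nn ρ V (ζ.prod (vol V)) j (fun η
    r => difB b η r (F η r.1)) ≤ 4 * mulC d j * ofReal M ^ 2 * ballVol d * ns ρ V ζ (j + 1) F := by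
  have h1 := nn_mul_le (ρ := ρ) (V := V) (ζ := ζ.prod (vol V)) hb.dif
    (measurable_trunc hb.measc (measurable_drop_fun hF)) j
  simp only [difB_trunc hb] at h1
  refine h1.trans ?_
  calc _ ≤ mulC d j * ofReal (2 * M) ^ 2 * (ballVol d * ns ρ V ζ (j + 1) F) := by
        gcongr
        rw [ns, ns, Finset.mul_sum]
        exact Finset.sum_le_sum fun i _ => nn_trunc_drop_le hb.measc hF i
    _ = _ := by
        rw [ofReal_mul (by norm_num), ENNReal.ofReal_ofNat]
        ring

/-! ### The energy estimate -/

variable [IsFiniteMeasure (vol V)]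

theorem Geo.dif (h : Geo V ζ F) : Geo V (ζ.prod (vol V)) (dif F) := by
  obtain ⟨K, r, hK⟩ := h.bound
  have hv : volume V = ((volume V).toNNReal : ℝ≥0∞) :=
    (ENNReal.coe_toNNReal volume_lt_top_of_vol.ne).symm
  refine ⟨measurable_dif h.meas, 2 * K * r + 2 * (volume V).toNNReal * K, r, fun n => ?_⟩
  refine (msq_sub_le (f := uncurry (push F)) (h := fun p => F p.1 p.2.1)
    (measurable_push_fun h.meas)).trans ?_
  rw [msq_push h.meas, msq_drop h.meas]
  calc _ ≤ 2 * ((K : ℝ≥0∞) * r ^ (n + 1)) + 2 * (volume V * (K * r ^ n)) := by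
        gcongr <;> exact hK _
    _ = _ := by
        rw [hv]; push_cast; simp only [ENNReal.toNNReal_coe]; ring

theorem Polar.orth_fz {T R : Set (Config d → Z → E d)} (hP : Polar V ζ T R)
    (hρ : 0 ≤ ρ) {h r : Config d → Z → E d} (hT : h ∈ T) (hR : r ∈ R) (hg : Geo V ζ h)
    (hg' : Geo V ζ r) : ∫ p, inner ℝ (h p.1 p.2) (r p.1 p.2) ∂(fv ρ V).prod ζ = 0 := by
  have hi : Integrable (fun p : Config d × Z => (inner ℝ (h p.1 p.2) (r p.1 p.2) : ℝ))
      ((fv ρ V).prod ζ) :=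
    integrable_inner_of_msq hg.meas hg'.meas (hg.msq_fz_lt_top hρ) (hg'.msq_fz_lt_top hρ)
  rw [fz_eq_sum] at hi ⊢
  refine (hasSum_integral_measure hi).unique ?_
  convert hasSum_zero with n
  rw [integral_smul_measure, hP.orth h hT r hR, smul_zero]

/-- Differentiating `r = A h + e` gives an equation of the same type for `dif h`, over a larger
parameter space: the classes become `difSet`, the coefficient becomes the shifted one, and the
source becomes `dif e` plus `difB A` applied to `h`. The last term is local, so only energies of `h`
of lower order are needed for it. The spaces and classes are quantified after the constant so that
the induction can change them. -/
theorem exists_energy_le (d : ℕ) (Λ : ℝ) (j : ℕ) : ∃ C : ℝ≥0∞, C ≠ ∞ ∧ ∀ (ρ : ℝ) (_ : 0 ≤ ρ)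
    (V : Set (E d)) (_ : IsFiniteMeasure (vol V)) (Z : Type) (_ : MeasurableSpace Z) (ζ : Measure Z)
    (_ : SFinite ζ) (T R : Set (Config d → Z → E d)) (_ : Polar V ζ T R) (c : Z → E d) (A :
    Config d → Z → (E d →L[ℝ] E d)) (_ : Loc c Λ A) (_ : ∀ η z x, ‖x‖ ^ 2 ≤ inner ℝ x (A η z x))
    (h r e : Config d → Z → E d) (_ : h ∈ T) (_ : r ∈ R) (_ : Geo V ζ h)
    (_ : Geo V ζ r) (_ : Measurable (uncurry e)) (_ : LevEq V ζ r fun η z => A η z (h η z) + e η z),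
    nn ρ V ζ j h ≤ C * (ns ρ V ζ (j + 1) e + ns ρ V ζ j h) := by
  induction j with
  | zero =>
    refine ⟨1, by simp, ?_⟩
    intro ρ hρ V _ Z _ ζ _ T R hP c A hA hlow h r e hT hR hg hg' he hre
    have hAh := hg.clm_apply hA.meas hA.bdd
    have hge : Geo V ζ e := (hg'.sub hAh).congr he fun n => by
      filter_upwards [hre n] with p hp
      rw [hp]; abel
    have h0 := hP.orth_fz hρ hT hR hg hg'
    have h1 := msq_le_of_integral_inner_eq_zero (m := (fv ρ V).prod ζ) hg.meas hAh.meas hge.meas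
      (hg.msq_fz_lt_top hρ) (hAh.msq_fz_lt_top hρ) (hge.msq_fz_lt_top hρ)
      (Eventually.of_forall fun p => hlow _ _ _) (by
        rw [← h0]
        refine integral_congr_ae ?_
        filter_upwards [hre.ae_fz ρ] with p hp
        rw [hp]; rfl)
    rw [← nn_zero hg.meas, ← nn_zero he] at h1
    simpa [ns] using h1
  | succ j ih =>
    obtain ⟨C, hC, H⟩ := ih
    set K : ℝ≥0∞ := ∑ i ∈ Finset.range (j + 1), 8 * mulC d i * ofReal Λ ^ 2 * ballVol d
      with hK
    have hKt : K ≠ ∞ := by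
      refine (ENNReal.sum_lt_top.2 fun i _ => ?_).ne
      have := mulC_ne_top d i
      have := ballVol_ne_top d
      finiteness
    refine ⟨C * (2 + K + 1), by finiteness, ?_⟩
    intro ρ hρ V _ Z _ ζ _ T R hP c A hA hlow h r e hT hR hg hg' he hre
    have hdr : Measurable (uncurry fun (η : Config d) (s : Z × E d) =>
        difB A η s (h η s.1)) := measurable_clm_apply hA.dif.meas (measurable_drop_fun hg.meas)
    -- The shifted coefficient keeps the ellipticity and the range of `A`; the commutator of the
    -- difference with `A` joins the source.
    have h1 := H ρ hρ V inferInstance (Z × E d) inferInstance (ζ.prod (vol V)) inferInstance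
      _ _ hP.dif (fun s => c s.1) (pushB A) hA.push (fun η z x => hlow _ _ _) (dif h) (dif r)
      (fun η s => dif e η s + difB A η s (h η s.1))
      ⟨measurable_dif hg.meas, h, hT, LevEq.refl _⟩ ⟨measurable_dif hg'.meas, r, hR, LevEq.refl _⟩
      hg.dif hg'.dif ((measurable_dif he).add hdr) (fun n => by
        filter_upwards [hre.dif n] with p hp
        rw [hp]
        simp only [Bulk.dif, pushB, difB, map_sub, sub_apply]
        abel)
    rw [nn_succ hg.meas]
    refine h1.trans ?_
    have h2 : ns ρ V (ζ.prod (vol V)) (j + 1) (fun η s => dif e η s + difB A η s (h η s.1))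
        ≤ 2 * ns ρ V ζ (j + 2) e + K * ns ρ V ζ (j + 1) h := by
      calc _ ≤ ∑ i ∈ Finset.range (j + 1), (2 * nn ρ V (ζ.prod (vol V)) i (dif e)
            + 8 * mulC d i * ofReal Λ ^ 2 * ballVol d * ns ρ V ζ (j + 1) h) := by
            refine Finset.sum_le_sum fun i hi => ?_
            refine (nn_add_le i (measurable_dif he) hdr).trans (add_le_add le_rfl ?_)
            refine (mul_le_mul_right (nn_difB_drop_le hA hg.meas i) 2).trans ?_
            calc _ = 8 * mulC d i * ofReal Λ ^ 2 * ballVol d * ns ρ V ζ (i + 1) h := by ring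
              _ ≤ _ := by
                gcongr
                exact ns_mono (by have := Finset.mem_range.1 hi; omega) h
        _ = 2 * ns ρ V (ζ.prod (vol V)) (j + 1) (dif e) + K * ns ρ V ζ (j + 1) h := by
            rw [Finset.sum_add_distrib, ← Finset.mul_sum, ← Finset.sum_mul]; rfl
        _ ≤ _ := by
            gcongr
            exact ns_dif_le he _
    calc _ ≤ C * (2 * ns ρ V ζ (j + 2) e + K * ns ρ V ζ (j + 1) h + ns ρ V ζ (j + 1) h) := by
          gcongr
          exact ns_dif_le hg.meas _
      _ ≤ C * ((2 + K + 1) * ns ρ V ζ (j + 2) e + (2 + K + 1) * ns ρ V ζ (j + 1) h) := by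
          gcongr C * ?_
          rw [add_assoc]
          refine add_le_add ?_ ?_
          · gcongr; rw [add_assoc]; exact le_self_add
          · calc _ = (K + 1) * ns ρ V ζ (j + 1) h := by ring
              _ ≤ _ := by gcongr; exact le_add_self
      _ = _ := by ring

end Energies

/-! ### Integrated differences -/

section Iop

variable {Z : Type} [MeasurableSpace Z] {ζ : Measure Z} [SFinite ζ]
  [IsFiniteMeasure (vol V)] {F F' : Config d → Z → E d}

/-- `η ↦ ∫_V (F(η + δ_y, z) - F(η, z)) dy`. -/
def iop (V : Set (E d)) (F : Config d → Z → E d) (η : Config d) (z : Z) : E d :=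
  sb V F η z - volume.real V • F η z

theorem Lev.iop (h : Lev V ζ F) : Lev V ζ (iop V F) := h.sb.sub (h.const_smul _)

theorem LevEq.sub {G G' : Config d → Z → E d} (h : LevEq V ζ F F') (h' : LevEq V ζ G G') :
    LevEq V ζ (fun η z => F η z - G η z) (fun η z => F' η z - G' η z) := fun n => by
  filter_upwards [h n, h' n] with p h1 h2
  rw [h1, h2]

theorem LevEq.add {G G' : Config d → Z → E d} (h : LevEq V ζ F F') (h' : LevEq V ζ G G') :
    LevEq V ζ (fun η z => F η z + G η z) (fun η z => F' η z + G' η z) := fun n => by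
  filter_upwards [h n, h' n] with p h1 h2
  rw [h1, h2]

theorem LevEq.const_smul (h : LevEq V ζ F F') (c : ℝ) :
    LevEq V ζ (fun η z => c • F η z) (fun η z => c • F' η z) := fun n => by
  filter_upwards [h n] with p h1
  rw [h1]

theorem LevEq.iop (h : LevEq V ζ F F') : LevEq V ζ (iop V F) (iop V F') :=
  h.sb.sub (h.const_smul _)

theorem Lev.iop_iter (h : Lev V ζ F) (l : ℕ) : Lev V ζ ((Bulk.iop V)^[l] F) := by
  induction l generalizing F with
  | zero => exact h
  | succ l ih => exact ih h.iop

theorem LevEq.iop_iter (h : LevEq V ζ F F')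
    (l : ℕ) : LevEq V ζ ((Bulk.iop V)^[l] F) ((Bulk.iop V)^[l] F') := by
  induction l generalizing F F' with
  | zero => exact h
  | succ l ih => exact ih h.iop

theorem Lev.sb_add (h : Lev V ζ F) (h' : Lev V ζ F') : LevEq
    V ζ (Bulk.sb V fun η z => F η z + F' η z) (fun η z => Bulk.sb V F η z + Bulk.sb V F' η z) :=
  fun n => by
  filter_upwards [h.push.ae_integrable n, h'.push.ae_integrable n] with p h1 h2
  exact integral_add h1 h2

theorem Lev.iop_add (h : Lev V ζ F) (h' : Lev V ζ F') :
    LevEq V ζ (Bulk.iop V fun η z => F η z + F' η z)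
      (fun η z => Bulk.iop V F η z + Bulk.iop V F' η z) := fun n => by
  filter_upwards [h.sb_add h' n] with p hp
  simp only [Bulk.iop, hp, smul_add]
  abel

theorem Lev.iop_iter_add (h : Lev V ζ F) (h' : Lev V ζ F') (l : ℕ) : LevEq V ζ ((Bulk.iop V)^[l]
    fun η z => F η z + F' η z) (fun η z => (Bulk.iop V)^[l] F η z + (Bulk.iop V)^[l] F' η z) := by
  induction l generalizing F F' with
  | zero => exact LevEq.refl _
  | succ l ih => exact ((h.iop_add h').iop_iter l).trans (ih h.iop h'.iop)

theorem Lev.av_sub {H H' : Config d → Z × E d → E d} (h : Lev V (ζ.prod (vol V)) H)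
    (h' : Lev V (ζ.prod (vol V)) H') : LevEq V ζ (Bulk.av V fun η z => H η z - H' η z)
    (fun η z => Bulk.av V H η z - Bulk.av V H' η z) :=
  fun n => by
  filter_upwards [h.ae_integrable n, h'.ae_integrable n] with p h1 h2
  exact integral_sub h1 h2

theorem Lev.iop_av {H : Config d → Z × E d → E d} (h : Lev V (ζ.prod (vol V)) H) :
    LevEq V ζ (Bulk.iop V (Bulk.av V H)) (Bulk.av V (Bulk.iop V H)) := fun n => by
  filter_upwards [h.sb_av n, h.sb.av_sub (h.const_smul (volume.real V)) n] with p h1 h2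
  refine Eq.trans ?_ h2.symm
  rw [Bulk.iop, h1]
  congr 1
  exact (integral_smul _ _).symm

theorem Lev.iop_iter_av {H : Config d → Z × E d → E d} (h : Lev V (ζ.prod (vol V)) H)
    (l : ℕ) : LevEq V ζ ((Bulk.iop V)^[l] (Bulk.av V H)) (Bulk.av V ((Bulk.iop V)^[l] H)) := by
  induction l generalizing H with
  | zero => exact LevEq.refl _
  | succ l ih => exact (h.iop_av.iop_iter l).trans (ih h.iop)

theorem iop_iter_eq_zero (l : ℕ) {F : Config d → Z → E d}
    {z : Z} (h : ∀ η, F η z = 0) (η : Config d) : (iop V)^[l] F η z = 0 := by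
  induction l generalizing F with
  | zero => exact h η
  | succ l ih => exact ih fun η => by simp [iop, sb, h]

/-- Truncation concerns the parameters and `iop` the configuration, so the two commute; shifts by
different points commute as well. -/
theorem iop_iter_trunc_push (c : Z → E d) (l : ℕ)
    (F : Config d → Z → E d) : (iop V)^[l] (trunc c (push F)) = trunc c (push ((iop V)^[l] F)) := by
  induction l generalizing F with
  | zero => rfl
  | succ l ih =>
    rw [Function.iterate_succ_apply, Function.iterate_succ_apply, ← ih]
    congr 1
    funext η r
    by_cases hr : r.2 ∈ Metric.ball (c r.1) (1 / 2)
    · simp only [iop, sb, trunc, if_pos hr, push, add_right_comm]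
    · simp only [iop, sb, trunc, if_neg hr, integral_zero, smul_zero, sub_zero]

/-- `b(η + δ_y) F(η + δ_y) - b(η) F(η + δ_y)`, integrated in `y`. -/
theorem Lev.iop_mul (h : Lev V ζ F) {c : Z → E d} {M : ℝ} {b : Config d → Z → (E d →L[ℝ] E d)}
    (hb : Loc c M b) :
    LevEq V ζ (Bulk.iop V fun η z => b η z (F η z))
      (fun η z => b η z (Bulk.iop V F η z)
        + Bulk.av V (fun η r => difB b η r (trunc c (Bulk.push F) η r)) η z) := fun n => by
  have h1 : Lev V ζ fun η z => b η z (F η z) := h.clm_apply hb.meas hb.bdd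
  filter_upwards [h.push.ae_integrable n, h1.push.ae_integrable n] with p hp hp'
  simp only [difB_trunc hb]
  have e1 : ∫ y in V, difB b p.1 (p.2, y) (Bulk.push F p.1 (p.2, y))
      = ∫ y in V, (Bulk.push (fun η z => b η z (F η z)) p.1 (p.2, y)
        - b p.1 p.2 (Bulk.push F p.1 (p.2, y))) := by
    refine integral_congr_ae (Eventually.of_forall fun y => ?_)
    simp only [difB, Bulk.push, sub_apply]
  rw [Bulk.av, e1, integral_sub hp' ((b p.1 p.2).integrable_comp hp),
    ContinuousLinearMap.integral_comp_comm _ hp]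
  simp only [Bulk.iop, Bulk.sb, map_sub, map_smul, Bulk.push]
  abel

theorem Lev.comp {Z' : Type} [MeasurableSpace Z'] {ζ' : Measure Z'} [SFinite ζ'] {s : Z' → Z}
    (hs : MeasurePreserving s ζ' ζ) (h : Lev V ζ F) : Lev V ζ' fun η z' => F η (s z') := by
  have hp : ∀ n, MeasurePreserving (Prod.map id s) (lz V ζ' n) (lz V ζ n) :=
    fun n => (MeasurePreserving.id (lam V n)).prod hs
  refine ⟨h.meas.comp (measurable_fst.prodMk (hs.measurable.comp measurable_snd)), fun n => ?_⟩
  exact ((hp n).lintegral_comp (h.meas.enorm.pow_const 2)).trans_lt (h.fin n)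

theorem nn_comp {Z' : Type}
    [MeasurableSpace Z'] {ζ' : Measure Z'} {s : Z' → Z} (hs : MeasurePreserving s ζ' ζ)
    (hF : Measurable (uncurry F)) (j : ℕ) : nn ρ V ζ' j (fun η z' => F η (s z')) = nn ρ V ζ j F :=
  hs.lintegral_comp (measurable_nj ρ V j hF)

/-- Exchange of the two added points. -/
def exch (r : (Z × E d) × E d) : (Z × E d) × E d := ((r.1.1, r.2), r.1.2)

theorem measurePreserving_exch (V : Set (E d)) (ζ : Measure Z) [SFinite ζ] :
    MeasurePreserving exch ((ζ.prod (vol V)).prod (vol V)) ((ζ.prod (vol V)).prod (vol V)) := by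
  have hm : Measurable (exch : (Z × E d) × E d → (Z × E d) × E d) := by unfold exch; fun_prop
  refine ⟨hm, Measure.ext_of_lintegral _ fun G hG => ?_⟩
  have hG' : Measurable fun r : (Z × E d) × E d => G ((r.1.1, r.2), r.1.2) := hG.comp hm
  rw [lintegral_map hG hm, lintegral_prod _ hG.aemeasurable]
  refine (lintegral_prod _ hG'.aemeasurable).trans ?_
  rw [lintegral_prod _ hG.lintegral_prod_right'.aemeasurable]
  refine (lintegral_prod _ hG'.lintegral_prod_right'.aemeasurable).trans ?_
  refine lintegral_congr fun z => ?_
  have hs : Measurable fun q : E d × E d => G ((z, q.2), q.1) :=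
    hG.comp (by fun_prop)
  exact lintegral_lintegral_swap hs.aemeasurable

theorem lintegral_fz_assoc (ρ : ℝ)
    (ζ : Measure Z) [SFinite ζ] {G : Config d × (Z × E d) → ℝ≥0∞} (hG : Measurable G) : ∫⁻ p,
    G p ∂(fv ρ V).prod (ζ.prod (vol V)) = ∫⁻ p, (∫⁻ y in V, G (p.1, p.2, y)) ∂(fv ρ V).prod ζ := by
  rw [← Measure.prodAssoc_prod, lintegral_map hG MeasurableEquiv.prodAssoc.measurable]
  exact lintegral_prod _ (hG.comp MeasurableEquiv.prodAssoc.measurable).aemeasurable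

/-- Jensen's inequality for averages of families supported near `c`. -/
theorem nn_av_le {c : Z → E d} (j : ℕ) {H : Config d → Z × E d → E d}
    (h : Lev V (ζ.prod (vol V)) H) (hs : ∀ η r, r.2 ∉ Metric.ball (c r.1) (1 / 2) → H η r = 0) :
    nn ρ V ζ j (av V H) ≤ ballVol d * nn ρ V (ζ.prod (vol V)) j H := by
  induction j generalizing Z with
  | zero =>
    have hm : Measurable fun p : Config d × (Z × E d) => ‖H p.1 p.2‖ₑ ^ 2 := h.meas.enorm.pow_const 2
    have e1 := lintegral_fz_assoc (V := V) ρ ζ hm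
    rw [nn_zero h.av.meas, nn_zero h.meas]
    refine le_trans ?_ (mul_le_mul_right e1.ge _)
    rw [← lintegral_const_mul' _ _ (ballVol_ne_top d)]
    refine lintegral_mono fun p => ?_
    have hmy : Measurable fun y => H p.1 (p.2, y) :=
      h.meas.comp (measurable_prodMk_left.comp measurable_prodMk_left)
    have e2 : av V H p.1 p.2 = ∫ y in Metric.ball (c p.2) (1 / 2) ∩ V, H p.1 (p.2, y) := by
      have h1 := setIntegral_eq_integral_of_forall_compl_eq_zero (μ := vol V)
        (s := Metric.ball (c p.2) (1 / 2)) (f := fun y => H p.1 (p.2, y))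
        (fun y hy => hs p.1 (p.2, y) hy)
      rw [Measure.restrict_restrict measurableSet_ball] at h1
      exact h1.symm
    change ‖av V H p.1 p.2‖ₑ ^ 2 ≤ ballVol d * ∫⁻ y in V, ‖H p.1 (p.2, y)‖ₑ ^ 2
    rw [e2]
    refine (enorm_setIntegral_sq_le hmy).trans ?_
    refine mul_le_mul' ?_ (lintegral_mono_set inter_subset_right)
    exact (measure_mono inter_subset_left).trans (volume_ball_half _).le
  | succ j ih =>
    -- After one difference the point of the difference and the point of the average come in the
    -- wrong order for the induction hypothesis; exchanging them preserves the measure.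
    have hx := measurePreserving_exch V ζ
    have hL : Lev V ((ζ.prod (vol V)).prod (vol V)) (fun η r => dif H η (exch r)) := h.dif.comp hx
    have e1 : LevEq V (ζ.prod (vol V)) (dif (av V H)) (av V fun η r => dif H η (exch r)) :=
      fun n => by
      filter_upwards [ae_push (h.ae_integrable (n + 1)), ae_drop (h.ae_integrable n)] with p h1 h2
      exact (integral_sub h1 h2).symm
    have h3 := ih (c := fun r : Z × E d => c r.1) (ζ := ζ.prod (vol V)) hL fun η r hr => by
      change H _ (r.1.1, r.2) - H _ (r.1.1, r.2) = 0
      rw [hs _ (r.1.1, r.2) hr, hs _ (r.1.1, r.2) hr, sub_zero]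
    rw [nn_succ h.av.meas, nn_congr h.av.dif.meas hL.av.meas e1, nn_succ h.meas]
    exact h3.trans (le_of_eq (by rw [nn_comp hx h.dif.meas]))

theorem Lev.trunc_push (h : Lev V ζ F)
    {c : Z → E d} (hc : Measurable c) : Lev V (ζ.prod (vol V)) (trunc c (Bulk.push F)) := by
  refine ⟨measurable_trunc hc h.push.meas, fun n => lt_of_le_of_lt ?_ (h.push.fin n)⟩
  refine lintegral_mono fun p => ?_
  by_cases hr : p.2.2 ∈ Metric.ball (c p.2.1) (1 / 2)
  · simp only [uncurry, trunc, if_pos hr, le_refl]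
  · simp only [uncurry, trunc, if_neg hr]
    simp

/-- Write `F(· + δ_y) = F + D_y F`: near `c` the first term costs the volume of a ball, and the
second is an energy of the next order. -/
theorem nn_trunc_push_le {c : Z → E d}
    (hc : Measurable c) (hF : Measurable (uncurry F)) (j : ℕ) : nn ρ V (ζ.prod (vol V))
    j (trunc c (push F)) ≤ 2 * ballVol d * nn ρ V ζ j F + 2 * nn ρ V ζ (j + 1) F := by
  have e : trunc c (push F) = fun η r => trunc c (fun η r => F η r.1) η r + trunc c (dif F) η r := by
    funext η r
    by_cases hr : r.2 ∈ Metric.ball (c r.1) (1 / 2)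
    · simp only [trunc, if_pos hr, push, dif]; abel
    · simp only [trunc, if_neg hr, add_zero]
  rw [e, nn_succ hF, mul_assoc]
  refine (nn_add_le j (measurable_trunc hc (measurable_drop_fun hF))
    (measurable_trunc hc (measurable_dif hF))).trans ?_
  gcongr
  · exact nn_trunc_drop_le hc hF j
  · exact nn_trunc_le c _ j

theorem ns_trunc_push_le {c : Z → E d} (hc : Measurable c) (hF : Measurable (uncurry F)) (s : ℕ) :
    ns ρ V (ζ.prod (vol V)) s (trunc c (push F)) ≤ (2 * ballVol d + 2) * ns ρ V ζ (s + 1) F := by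
  calc _ ≤ ∑ i ∈ Finset.range s, (2 * ballVol d * nn ρ V ζ i F + 2 * nn ρ V ζ (i + 1) F) :=
        Finset.sum_le_sum fun i _ => nn_trunc_push_le hc hF i
    _ = 2 * ballVol d * ns ρ V ζ s F + 2 * ∑ i ∈ Finset.range s, nn ρ V ζ (i + 1) F := by
        rw [Finset.sum_add_distrib, ← Finset.mul_sum, ← Finset.mul_sum]; rfl
    _ ≤ 2 * ballVol d * ns ρ V ζ (s + 1) F + 2 * ns ρ V ζ (s + 1) F := by
        gcongr
        · exact ns_mono (Nat.le_succ s) F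
        · rw [ns, Finset.sum_range_succ' _ s]; exact le_self_add
    _ = _ := by ring

/-- The sum of the energies of order less than `s` of the first `l` integrated differences. -/
def nt (ρ : ℝ) (V : Set (E d)) (ζ : Measure Z) (l s : ℕ) (F : Config d → Z → E d) : ℝ≥0∞ :=
  ∑ i ∈ Finset.range l, ns ρ V ζ s ((iop V)^[i] F)

theorem nt_mono {l l' s s' : ℕ}
    (h : l ≤ l') (h' : s ≤ s') (F : Config d → Z → E d) : nt ρ V ζ l s F ≤ nt ρ V ζ l' s' F :=
  (Finset.sum_le_sum fun _ _ => ns_mono h' _).trans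
    (Finset.sum_le_sum_of_subset (Finset.range_mono h))

theorem nt_iop_le (l s : ℕ)
    (F : Config d → Z → E d) : nt ρ V ζ l s (iop V F) ≤ nt ρ V ζ (l + 1) s F := by
  simp only [nt, ← Function.iterate_succ_apply]
  rw [Finset.sum_range_succ' _ l]
  exact le_self_add

theorem nt_trunc_push_le {c : Z → E d} (hc : Measurable c) (h : Lev V ζ F) (l s : ℕ) : nt
    ρ V (ζ.prod (vol V)) l s (trunc c (push F)) ≤ (2 * ballVol d + 2) * nt ρ V ζ l (s + 1) F := by
  simp only [nt, iop_iter_trunc_push, Finset.mul_sum]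
  exact Finset.sum_le_sum fun i _ => ns_trunc_push_le hc (h.iop_iter i).meas s

/-- The integrated differences of a product. -/
theorem exists_nn_iop_mul_le (d l j : ℕ) : ∃ C : ℝ≥0∞, C ≠ ∞ ∧ ∀ (ρ : ℝ)
    (V : Set (E d)) (_ : IsFiniteMeasure (vol V)) (Z : Type) (_ : MeasurableSpace Z) (ζ : Measure Z)
    (_ : SFinite ζ) (c : Z → E d) (M : ℝ) (b : Config d → Z → (E d →L[ℝ] E d)) (_ : Loc c M b)
    (F : Config d → Z → E d) (_ : Lev V ζ F), nn ρ V ζ j ((iop V)^[l] fun η z => b η z (F η z))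
    ≤ C * ofReal M ^ 2 * nt ρ V ζ (l + 1) (j + l + 1) F := by
  induction l with
  | zero =>
    refine ⟨mulC d j, mulC_ne_top d j, ?_⟩
    intro ρ V _ Z _ ζ _ c M b hb F hF
    simpa [nt] using nn_mul_le hb hF.meas j
  | succ l ih =>
    obtain ⟨C, hC, H⟩ := ih
    have hβ := ballVol_ne_top d
    refine ⟨2 * C + 2 * (ballVol d * (C * 4 * (2 * ballVol d + 2))), by finiteness, ?_⟩
    intro ρ V _ Z _ ζ _ c M b hb F hF
    have hT := hF.trunc_push hb.measc
    have hK : Lev V (ζ.prod (vol V)) fun η r => difB b η r (trunc c (push F) η r) :=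
      hT.clm_apply hb.dif.meas hb.dif.bdd
    have hbI := hF.iop.clm_apply hb.meas hb.bdd
    -- One application of `iop` to the product gives `b (iop F)` plus the average of `(D_y b) F(· +
    -- δ_y)`. Both are products to which the hypothesis for `l` applies, the second with an added
    -- point as parameter.
    have e : LevEq V ζ ((iop V)^[l + 1] fun η z => b η z (F η z))
        (fun η z => (iop V)^[l] (fun η z => b η z (iop V F η z)) η z
          + av V ((iop V)^[l] fun η r => difB b η r (trunc c (push F) η r)) η z) := by
      refine ((hF.iop_mul hb).iop_iter l).trans ((hbI.iop_iter_add hK.av l).trans ?_)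
      exact (LevEq.refl _).add (hK.iop_iter_av l)
    have hm1 := (hbI.iop_iter l).meas
    have hm2 := (hK.iop_iter l).av.meas
    rw [nn_congr ((hF.clm_apply hb.meas hb.bdd).iop_iter (l + 1)).meas
      ((hbI.iop_iter l).add (hK.iop_iter l).av).meas e]
    refine (nn_add_le j hm1 hm2).trans ?_
    have h1 := H ρ V inferInstance Z inferInstance ζ inferInstance c M b hb _ hF.iop
    have h2 := H ρ V inferInstance (Z × E d) inferInstance (ζ.prod (vol V)) inferInstance _ _ _
      hb.dif _ hT
    have h3 := nn_av_le (ρ := ρ) (c := c) j (hK.iop_iter l) fun η r hr =>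
      iop_iter_eq_zero l (fun η => by simp [difB_eq_zero hb η hr]) η
    calc _ ≤ 2 * (C * ofReal M ^ 2 * nt ρ V ζ (l + 2) (j + (l + 1) + 1) F)
          + 2 * (ballVol d * (C * ofReal (2 * M) ^ 2 *
            ((2 * ballVol d + 2) * nt ρ V ζ (l + 2) (j + (l + 1) + 1) F))) := by
          gcongr
          · refine h1.trans ?_
            gcongr
            exact (nt_iop_le _ _ _).trans (nt_mono le_rfl (by omega) F)
          · refine h3.trans ?_
            gcongr
            refine h2.trans ?_
            gcongr
            refine (nt_trunc_push_le hb.measc hF _ _).trans ?_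
            gcongr
            exact nt_mono (by omega) (by omega) F
      _ = _ := by
          rw [ofReal_mul (by norm_num), ENNReal.ofReal_ofNat]
          ring

/-- The commutator of integrated differences and multiplication. -/
def comm (V : Set (E d)) (b : Config d → Z → (E d →L[ℝ] E d))
    (l : ℕ) (F : Config d → Z → E d) (η : Config d) (z : Z) : E d :=
  (iop V)^[l] (fun η z => b η z (F η z)) η z - b η z ((iop V)^[l] F η z)

theorem Lev.comm (hF : Lev V ζ F) {c : Z → E d} {M : ℝ}
    {b : Config d → Z → (E d →L[ℝ] E d)} (hb : Loc c M b) (l : ℕ) : Lev V ζ (comm V b l F) :=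
  ((hF.clm_apply hb.meas hb.bdd).iop_iter l).sub ((hF.iop_iter l).clm_apply hb.meas hb.bdd)

/-- In contrast with `exists_nn_iop_mul_le`, the highest power `iop^[l] F` has been subtracted:
every remaining term carries at least one difference of `b` and at most `l - 1` integrated
differences of `F`. This gain makes the induction on `l` possible. -/
theorem exists_nn_comm_le (d l j : ℕ) : ∃ C : ℝ≥0∞, C ≠ ∞ ∧ ∀ (ρ : ℝ) (V : Set (E d)) (_ :
    IsFiniteMeasure (vol V)) (Z : Type) (_ : MeasurableSpace Z) (ζ : Measure Z) (_ : SFinite ζ) (c :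
    Z → E d) (M : ℝ) (b : Config d → Z → (E d →L[ℝ] E d)) (_ : Loc c M b) (F : Config d → Z → E d)
    (_ : Lev V ζ F), nn ρ V ζ j (comm V b l F) ≤ C * ofReal M ^ 2 * nt ρ V ζ l (j + l + 1) F := by
  induction l with
  | zero =>
    refine ⟨0, by simp, ?_⟩
    intro ρ V _ Z _ ζ _ c M b hb F hF
    simp [comm, nn, nj_zero_fun]
  | succ l ih =>
    obtain ⟨C, hC, H⟩ := ih
    obtain ⟨C', hC', H'⟩ := exists_nn_iop_mul_le d l j
    have hβ := ballVol_ne_top d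
    refine ⟨2 * C + 2 * (ballVol d * (C' * 4 * (2 * ballVol d + 2))), by finiteness, ?_⟩
    intro ρ V _ Z _ ζ _ c M b hb F hF
    have hT := hF.trunc_push hb.measc
    have hK : Lev V (ζ.prod (vol V)) fun η r => difB b η r (trunc c (push F) η r) :=
      hT.clm_apply hb.dif.meas hb.dif.bdd
    have hbI := hF.iop.clm_apply hb.meas hb.bdd
    have e : LevEq V ζ (comm V b (l + 1) F) (fun η z => comm V b l (iop V F) η z
          + av V ((iop V)^[l] fun η r => difB b η r (trunc c (push F) η r)) η z) := by
      intro n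
      filter_upwards [((hF.iop_mul hb).iop_iter l).trans ((hbI.iop_iter_add hK.av l).trans
        ((LevEq.refl _).add (hK.iop_iter_av l))) n] with p hp
      simp only [Bulk.comm, Function.iterate_succ_apply, hp]
      abel
    have hm1 := (hF.iop.comm hb l).meas
    have hm2 := (hK.iop_iter l).av.meas
    rw [nn_congr (hF.comm hb (l + 1)).meas ((hF.iop.comm hb l).add (hK.iop_iter l).av).meas e]
    refine (nn_add_le j hm1 hm2).trans ?_
    have h1 := H ρ V inferInstance Z inferInstance ζ inferInstance c M b hb _ hF.iop
    have h2 := H' ρ V inferInstance (Z × E d) inferInstance (ζ.prod (vol V)) inferInstance _ _ _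
      hb.dif _ hT
    have h3 := nn_av_le (ρ := ρ) (c := c) j (hK.iop_iter l) fun η r hr =>
      iop_iter_eq_zero l (fun η => by simp [difB_eq_zero hb η hr]) η
    calc _ ≤ 2 * (C * ofReal M ^ 2 * nt ρ V ζ (l + 1) (j + (l + 1) + 1) F)
          + 2 * (ballVol d * (C' * ofReal (2 * M) ^ 2 *
            ((2 * ballVol d + 2) * nt ρ V ζ (l + 1) (j + (l + 1) + 1) F))) := by
          gcongr
          · refine h1.trans ?_
            gcongr
            exact (nt_iop_le _ _ _).trans (nt_mono le_rfl (by omega) F)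
          · refine h3.trans ?_
            gcongr
            refine h2.trans ?_
            gcongr
            refine (nt_trunc_push_le hb.measc hF _ _).trans ?_
            gcongr
            exact nt_mono (by omega) (by omega) F
      _ = _ := by
          rw [ofReal_mul (by norm_num), ENNReal.ofReal_ofNat]
          ring

/-! ### Uniform energy bounds for the corrector -/

theorem Geo.sb (h : Geo V ζ F) : Geo V ζ (sb V F) :=
  h.mono h.lev.sb.meas (C := (volume V).toNNReal) fun n => by
    rw [ENNReal.coe_toNNReal volume_lt_top_of_vol.ne]
    refine (msq_av_le h.lev.push.meas n).trans ?_
    rw [msq_push h.meas]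
    gcongr
    exact le_add_self

theorem Geo.iop (h : Geo V ζ F) : Geo V ζ (iop V F) := h.sb.sub (h.const_smul _)

theorem Geo.iop_iter (h : Geo V ζ F) (l : ℕ) : Geo V ζ ((Bulk.iop V)^[l] F) := by
  induction l generalizing F with
  | zero => exact h
  | succ l ih => exact ih h.iop

theorem iop_mem_solSet (hD : Dom U V) {r : Fld d} (hr : r ∈ solSet U V) : iop V r ∈ solSet U V := by
  have h1 := sb_mem_solSet hD hr
  refine ⟨hr.1.iop, fun φ hφ hL n => ?_⟩
  have e : ∀ p : Pt d, (inner ℝ (pgrad φ p.1 p.2) (iop V r p.1 p.2) : ℝ)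
      = inner ℝ (pgrad φ p.1 p.2) (sb V r p.1 p.2)
        - volume.real V * inner ℝ (pgrad φ p.1 p.2) (r p.1 p.2) := fun p => by
    rw [iop, inner_sub_right, inner_smul_right]
  simp only [e]
  rw [integral_sub (hL.integrable_inner h1.1 n) ((hL.integrable_inner hr.1 n).const_mul _),
    integral_const_mul, h1.2 φ hφ hL, hr.2 φ hφ hL]
  simp

theorem iop_mem_potSet (hD : Dom U V) {h : Fld d} (hh : h ∈ potSet U V) : iop V h ∈ potSet U V := by
  have h1 := (polar_potSet hD).sbT h hh
  refine ⟨hh.1.iop, fun r hr n => ?_⟩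
  have e : ∀ p : Pt d, (inner ℝ (iop V h p.1 p.2) (r p.1 p.2) : ℝ)
      = inner ℝ (sb V h p.1 p.2) (r p.1 p.2)
        - volume.real V * inner ℝ (h p.1 p.2) (r p.1 p.2) := fun p => by
    rw [iop, inner_sub_left, real_inner_smul_left]
  simp only [e]
  rw [integral_sub (h1.1.integrable_inner hr.1 n) ((hh.1.integrable_inner hr.1 n).const_mul _),
    integral_const_mul, h1.2 r hr, hh.2 r hr]
  simp

theorem iop_iter_mem_solSet (hD : Dom U V)
    {r : Fld d} (hr : r ∈ solSet U V) (l : ℕ) : (iop V)^[l] r ∈ solSet U V := by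
  induction l generalizing r with
  | zero => exact hr
  | succ l ih => exact ih (iop_mem_solSet hD hr)

theorem iop_iter_mem_potSet (hD : Dom U V)
    {h : Fld d} (hh : h ∈ potSet U V) (l : ℕ) : (iop V)^[l] h ∈ potSet U V := by
  induction l generalizing h with
  | zero => exact hh
  | succ l ih => exact ih (iop_mem_potSet hD hh)

theorem IsCorr.geo (hD : Dom U V) (hA : IsField Λ A) (h : IsCorr U V A q g) : Geo V (vol U) g := by
  refine ⟨h.meas, (‖q‖ₑ ^ 2 * volume U).toNNReal, (volume V).toNNReal, fun n => ?_⟩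
  rw [ENNReal.coe_toNNReal hD.bdd.measure_lt_top.ne,
    ENNReal.coe_toNNReal (mul_lt_top (by finiteness) hD.bddU.measure_lt_top).ne]
  exact h.msq_le hD hA n

theorem geo_const (hD : Dom U V) (q : E d) : Geo V (vol U) fun _ _ => q := by
  refine ⟨measurable_const, (‖q‖ₑ ^ 2 * volume U).toNNReal, (volume V).toNNReal, fun n => ?_⟩
  rw [ENNReal.coe_toNNReal hD.bdd.measure_lt_top.ne,
    ENNReal.coe_toNNReal (mul_lt_top (by finiteness) hD.bddU.measure_lt_top).ne]
  refine (msq_const (levU U V n) q).le.trans ?_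
  rw [levU_univ]
  exact le_of_eq (by ring)

theorem IsField.loc (hA : IsField Λ A) : Loc (fun z : E d => z) Λ A :=
  ⟨hA.meas, measurable_id, hA.upper, hA.local_⟩

theorem iop_const (q : E d) : iop V (fun (_ : Config d) (_ : Z) => q) = fun _ _ => 0 := by
  funext η z
  simp [iop, sb, Measure.real]

/-- The constant `q` is killed by the first integrated difference; this is where `l ≠ 0` matters. -/
theorem iop_iter_resid (hD : Dom U V) (hA : IsField Λ A) (h : IsCorr U V A q g) {l : ℕ} (hl : l
    ≠ 0) : LevEq V (vol U) ((iop V)^[l] (resid A q g)) ((iop V)^[l] fun η z => A η z (g η z)) := by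
  obtain ⟨l, rfl⟩ := Nat.exists_eq_succ_of_ne_zero hl
  have hg := (h.geo hD hA).lev.clm_apply hA.meas hA.upper
  have hq : Lev V (vol U) (fun _ _ => -q) := (geo_const hD (-q)).lev
  have h1 : resid A q g = fun η z => A η z (g η z) + -q := by
    funext η z
    rw [resid, sub_eq_add_neg]
  rw [h1]
  refine (hg.iop_iter_add hq (l + 1)).trans fun n => Eventually.of_forall fun p => ?_
  have h0 : (iop V)^[l + 1] (fun (_ : Config d) (_ : E d) => -q) p.1 p.2 = 0 := by
    rw [Function.iterate_succ_apply, iop_const]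
    exact iop_iter_eq_zero (Z := E d) (F := fun _ _ => 0) l (fun _ => rfl) _
  beta_reduce
  rw [h0, add_zero]

theorem fv_univ (hρ : 0 ≤ ρ) (hb : Bornology.IsBounded V) : fv ρ V univ = 1 := by
  have h1 := lintegral_fv ρ V (fun _ => 1)
  simp only [lintegral_const, one_mul, lam_univ] at h1
  rw [h1]
  exact tsum_fvW hρ hb

/-- The energy bounds: the constant depends on neither the domain nor the intensity. -/
theorem exists_nn_corr_le (d : ℕ) (Λ : ℝ) (l : ℕ) : ∀ j : ℕ, ∃ C : ℝ≥0∞, C ≠ ∞ ∧ ∀ (ρ : ℝ)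
    (_ : 0 ≤ ρ) (U V : Set (E d)) (_ : Dom U V) (A : Coef d) (_ : IsField Λ A) (q : E d) (g : Fld d)
    (_ : IsCorr U V A q g), nn ρ V (vol U) j ((iop V)^[l] g) ≤ C * (‖q‖ₑ ^ 2 * volume U) := by
  -- The commutator trades powers of `iop` for differences of higher order. The outer induction
  -- therefore runs on `l` and provides all orders `j` for smaller powers; the inner one, on `j`,
  -- absorbs the lower-order energies left by `exists_energy_le`.
  induction l using Nat.strong_induction_on with
  | _ l ihl =>
  intro j
  induction j using Nat.strong_induction_on with
  | _ j ihj =>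
  obtain ⟨C, hC, H⟩ := exists_energy_le d Λ j
  choose! K hK HK using ihj
  -- The source of the equation for `iop^[l] g`: for `l = 0` it is `-q`, whose differences vanish;
  -- for `l > 0` it is the commutator, bounded through the smaller powers.
  have hS : ∃ S : ℝ≥0∞, S ≠ ∞ ∧ ∀ (ρ : ℝ) (_ : 0 ≤ ρ) (U V : Set (E d)) (_ : Dom U V)
      (A : Coef d) (_ : IsField Λ A) (q : E d)
      (g : Fld d) (_ : IsCorr U V A q g), ∃ e : Fld d,
        Measurable (uncurry e) ∧ LevEq V (vol U) ((iop V)^[l] (resid A q g))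
          (fun η z => A η z ((iop V)^[l] g η z) + e η z) ∧
        ns ρ V (vol U) (j + 1) e ≤ S * (‖q‖ₑ ^ 2 * volume U) := by
    rcases Nat.eq_zero_or_pos l with rfl | hl
    · refine ⟨1, by simp, ?_⟩
      intro ρ hρ U V hD A hA q g h
      have := hD.finV
      refine ⟨fun _ _ => -q, measurable_const, fun n => Eventually.of_forall fun p => ?_, ?_⟩
      · exact sub_eq_add_neg _ _
      · rw [ns, Finset.sum_eq_single_of_mem 0 (by simp)]
        · simp only [nn, nj, msq, lintegral_const, fv_univ hρ hD.bdd, enorm_neg,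
            Measure.restrict_apply_univ]
          simp
        · intro i _ hi
          obtain ⟨i, rfl⟩ := Nat.exists_eq_succ_of_ne_zero hi
          simp [nn, nj_succ_const]
    · choose! K' hK' HK' using ihl
      choose P hP HP using fun i => exists_nn_comm_le d l i
      refine ⟨∑ i ∈ Finset.range (j + 1), P i * ofReal Λ ^ 2 *
        ∑ l' ∈ Finset.range l, ∑ i' ∈ Finset.range (i + l + 1), K' l' i', ?_, ?_⟩
      · refine (ENNReal.sum_lt_top.2 fun i _ => ?_).ne
        refine mul_lt_top (by have := hP i; finiteness) (ENNReal.sum_lt_top.2 fun l' hl' =>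
          ENNReal.sum_lt_top.2 fun i' _ => (hK' l' (Finset.mem_range.1 hl') i').lt_top)
      · intro ρ hρ U V hD A hA q g h
        have := hD.finV
        have hg := (h.geo hD hA).lev
        refine ⟨comm V A l g, (hg.comm hA.loc l).meas, ?_, ?_⟩
        · refine (iop_iter_resid hD hA h hl.ne').trans fun n => Eventually.of_forall fun p => ?_
          simp only [comm]
          abel
        · rw [ns, Finset.sum_mul]
          refine Finset.sum_le_sum fun i _ => ?_
          refine (HP i ρ V inferInstance (E d) inferInstance (vol U) inferInstance _ Λ A hA.loc g
            hg).trans ?_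
          rw [mul_assoc (P i * _)]
          refine mul_le_mul_right ?_ _
          rw [nt, Finset.sum_mul]
          refine Finset.sum_le_sum fun l' hl' => ?_
          rw [ns, Finset.sum_mul]
          exact Finset.sum_le_sum fun i' _ =>
            HK' l' (Finset.mem_range.1 hl') i' ρ hρ U V hD A hA q g h
  obtain ⟨S, hSt, HS⟩ := hS
  refine ⟨C * (S + ∑ i ∈ Finset.range j, K i), ?_, ?_⟩
  · have : ∑ i ∈ Finset.range j, K i ≠ ∞ :=
      (ENNReal.sum_lt_top.2 fun i hi => (hK i (Finset.mem_range.1 hi)).lt_top).ne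
    finiteness
  · intro ρ hρ U V hD A hA q g h
    have := hD.finV
    obtain ⟨e, hem, her, hes⟩ := HS ρ hρ U V hD A hA q g h
    have hr : Geo V (vol U) (resid A q g) :=
      ((h.geo hD hA).clm_apply hA.meas hA.upper).sub (geo_const hD q)
    have h1 := H ρ hρ V inferInstance (E d) inferInstance (vol U) inferInstance _ _
      (polar_potSet hD) _ A hA.loc hA.lower _ _ e (iop_iter_mem_potSet hD h.mem_potSet l)
      (iop_iter_mem_solSet hD (h.resid_mem hD hA) l) ((h.geo hD hA).iop_iter l) (hr.iop_iter l)
      hem her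
    refine h1.trans ?_
    rw [mul_assoc, add_mul, Finset.sum_mul]
    refine mul_le_mul_right (add_le_add hes ?_) _
    exact Finset.sum_le_sum fun i hi => HK i (Finset.mem_range.1 hi) ρ hρ U V hD A hA q g h

end Iop

/-! ### Subadditivity -/

section Subadditivity

variable {U U' V : Set (E d)}
  {g g' : Fld d}

theorem lz_mono (h : U' ⊆ U) (n : ℕ) : lz V (vol U') n ≤ lz V (vol U) n :=
  Measure.prod_mono le_rfl (Measure.restrict_mono h le_rfl)

/-- The restriction of a smooth gradient to a smaller domain is a smooth gradient there, and `L²`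
limits are inherited. This makes the corrector of a large cube a competitor in each of its subcubes.
-/
theorem IsCorr.mem_potSet_of_subset (hD : Dom U V)
    (hD' : Dom U' V) (hUU : U' ⊆ U) (h : IsCorr U V A q g) : g ∈ potSet U' V := by
  have hmono : ∀ (n : ℕ) (F : Pt d → E d), msq (lz V (vol U') n) F ≤ msq (lz V (vol U) n) F :=
    fun n F => lintegral_mono' (lz_mono hUU n) le_rfl
  have hg := h.levL2
  have hL : Lev V (vol U') g := ⟨hg.1, fun n => (hmono n _).trans_lt (hg.2 n)⟩
  refine ⟨hL, fun r hr n => ?_⟩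
  obtain ⟨φ, hφ, hlim⟩ := h.approx
  refine integral_inner_eq_zero_of_tendsto (m := lz V (vol U') n)
    (f := fun j (p : Pt d) => pgrad (φ j) p.1 p.2)
    (g := fun p : Pt d => g p.1 p.2)
    (h := fun p : Pt d => r p.1 p.2)
    (fun j => (hφ j).2.1) h.meas hr.1.meas (fun j => (hmono n _).trans_lt ((hφ j).2.2 n))
    (hL.fin n) (hr.1.fin n) (tendsto_of_tendsto_of_tendsto_of_le_of_le tendsto_const_nhds (hlim n)
      (fun _ => bot_le) fun j => hmono n _) fun j => ?_
  have hs := (hφ j).1.mono hD.measU hD'.measU hUU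
  -- On the levels there are finitely many particles in `V`, so the cutoff of `SmoothIn.mono` equals
  -- 1 there.
  have he : LevEq V (vol U') (pgrad (φ j)) (pgrad fun μ => (if μ.1 (U \ U') < ∞
      then 1 else 0) * φ j μ) := fun k => by
    filter_upwards [ae_levU_mem hD' k] with p hp
    refine ((((hφ j).1.hasPG hD.isOpen (mass_lt_top_of hD.subset hp.2.1)
      (hUU hp.2.2)).congr (Eventually.of_forall fun y => ?_)).pgrad_eq).symm
    rw [if_pos, one_mul]
    refine (mass_add_particle_lt (hD.measU.diff hD'.measU)).2 (lt_of_le_of_lt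
      (measure_mono (sdiff_subset.trans hD.subset)) ?_)
    rw [hp.2.1]; simp
  have hLφ : Lev V (vol U') (pgrad (φ j)) :=
    ⟨(hφ j).2.1, fun k => (hmono k _).trans_lt ((hφ j).2.2 k)⟩
  rw [← hr.2 _ hs (hLφ.congr (measurable_pgrad hs.1) he) n]
  refine integral_congr_ae ?_
  filter_upwards [he n] with p hp
  rw [hp]

theorem poisU_eq_restrict (ρ : ℝ)
    (U : Set (E d)) : poisU ρ U = ((poissonLaw d ρ).prod volume).restrict (univ ×ˢ U) := by
  rw [poisU, ← Measure.prod_restrict, Measure.restrict_univ]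

/-- `|U| ν_*(U) ≤ ∑_k |U_k| ν_*(U_k)` for a partition of `U`. -/
theorem bform_subadditive {ι : Type} [Fintype ι] {W : ι → Set (E d)} (hρ : 0 < ρ) (hD : Dom U V)
    (hW : ∀ k, Dom (W k) V) (hWU : ∀ k, W k ⊆ U) (hdisj : Pairwise (Function.onFun Disjoint W))
    (hvol : volume U ≤ volume (⋃ k, W k)) (hA : IsField Λ A)
    (h : IsCorr U V A q g) {gk : ι → Fld d} (hk : ∀ k, IsCorr (W k) V A q (gk k)) :
    volume.real U * bform ρ U V q g ≤ ∑ k, volume.real (W k) * bform ρ (W k) V q (gk k) := by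
  have hne : ∀ {U : Set (E d)}, Dom U V → volume.real U ≠ 0 := fun h =>
    (ENNReal.toReal_pos h.pos h.bddU.measure_lt_top.ne).ne'
  simp only [bform, mul_inv_cancel_left₀ (hne hD), mul_inv_cancel_left₀ (hne (hW _))]
  have := hD.finite_poisU ρ
  have hFm := measurable_lift hD.meas h.meas
  have hF2 := h.msq_lift_lt_top hρ.le hD hA
  have hAm := measurable_fieldOf_clip hA hD.meas
  set f : Pt d → ℝ := fun p => dens q (A (clip V p.1) p.2) (lift V g p) with hf
  have hi : Integrable f (poisU ρ U) := integrable_dens q hAm hFm (fun p => hA.upper _ _) hF2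
  have e0 := h.integral_dens hρ hD hA hFm hF2 (h.el_lift hρ hD hA)
  simp only [sub_self, map_zero, inner_zero_right, integral_zero, mul_zero, sub_zero] at e0
  -- The corrector of `U` is inserted in the variational problem of the piece; the nonnegative
  -- quadratic defect is dropped.
  have ek : ∀ k, ∫ p, f p ∂poisU ρ (W k) ≤ 1 / 2 * ∫ p, inner ℝ q (gk k p.1 p.2) ∂fvU ρ (W k) V := by
    intro k
    have := (hW k).finV
    have hgeo : Geo V (vol (W k)) g := by
      obtain ⟨K, r, hK⟩ := (h.geo hD hA).bound
      exact ⟨h.meas, K, r, fun n => (lintegral_mono' (lz_mono (hWU k) n) le_rfl).trans (hK n)⟩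
    have hr := ((((hk k).geo (hW k) hA).clm_apply hA.meas hA.upper).sub (geo_const (hW k) q))
    have h0 : ∫ p, inner ℝ (g p.1 p.2) (resid A q (gk k) p.1 p.2) ∂fvU ρ (W k) V = 0 :=
      (polar_potSet (hW k)).orth_fz hρ.le (h.mem_potSet_of_subset hD (hW k) (hWU k))
        ((hk k).resid_mem (hW k) hA) hgeo hr
    have h1 := integral_lift hρ.le (hW k)
      (f := fun p => (inner ℝ (g p.1 p.2) (resid A q (gk k) p.1 p.2) : ℝ))
      (h.meas.inner (measurable_resid hA.meas (hk k).meas))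
    rw [(hk k).integral_dens hρ (hW k) hA hFm (by
      rw [msq_lift hρ.le (hW k) h.meas]; exact hgeo.msq_fz_lt_top hρ.le) (h1.trans h0)]
    have h2 := integral_quad_nonneg (V := V) hA (poisU ρ (W k)) fun p => lift V g p - lift V (gk k) p
    linarith
  have hpart : ∫ p, f p ∂poisU ρ U = ∑ k, ∫ p, f p ∂poisU ρ (W k) := by
    have hU : (⋃ k, W k) =ᵐ[volume] U := ae_eq_of_subset_of_measure_ge (iUnion_subset hWU) hvol
      (MeasurableSet.iUnion fun k => (hW k).measU).nullMeasurableSet hD.bddU.measure_lt_top.ne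
    have e1 : poisU ρ U = poisU ρ (⋃ k, W k) := by rw [poisU, poisU, Measure.restrict_congr_set hU]
    rw [e1, poisU_eq_restrict, prod_iUnion, integral_iUnion_fintype]
    · simp only [poisU_eq_restrict]
    · exact fun k => MeasurableSet.univ.prod (hW k).measU
    · exact fun i j hij => Set.disjoint_prod.2 (Or.inr (hdisj hij))
    · intro k
      rw [poisU_eq_restrict] at hi
      exact hi.mono_measure (Measure.restrict_mono (prod_mono_right (hWU k)) le_rfl)
  have := Finset.sum_le_sum fun k (_ : k ∈ Finset.univ) => ek k
  rw [← hpart, e0, ← Finset.mul_sum] at this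
  linarith

end Subadditivity

/-! ### Translations -/

section Translation

/-- The translate `z + U`. -/
def pre (z : E d) (U : Set (E d)) : Set (E d) := (fun x => x - z) ⁻¹' U

theorem measurableSet_pre (z : E d) (hU : MeasurableSet U) : MeasurableSet (pre z U) :=
  (measurable_id.sub_const z) hU

theorem volume_pre (z : E d) (U : Set (E d)) : volume (pre z U) = volume U := by
  rw [← measure_preimage_add_right volume (-z) U]
  simp only [pre, sub_eq_add_neg]

theorem measurePreserving_pre (z : E d)
    (hU : MeasurableSet U) : MeasurePreserving (fun x => x - z) (vol (pre z U)) (vol U) :=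
  (measurePreserving_sub_right volume z).restrict_preimage hU

theorem measurable_shift (z : E d) : Measurable (shift z : Config d → Config d) :=
  Config.measurable_of_apply fun s hs => by
    simp only [shift_apply _ _ hs]
    exact Config.measurable_apply (measurableSet_pre z hs)

theorem shift_shift (x z : E d) (μ : Config d) : shift x (shift z μ) = shift (x + z) μ :=
  Config.ext_apply fun s hs => by
    rw [shift_apply _ _ hs]
    refine (shift_apply _ _ (measurableSet_pre x hs)).trans ?_
    rw [shift_apply _ _ hs]
    congr 1
    ext y
    simp [pre, sub_sub, add_comm]

theorem shift_zero_fun (μ : Config d) : shift 0 μ = μ :=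
  Config.ext_apply fun s hs => by rw [shift_apply _ _ hs]; simp

theorem shift_neg_shift (z : E d) (μ : Config d) : shift (-z) (shift z μ) = μ := by
  rw [shift_shift, neg_add_cancel, shift_zero_fun]

theorem shift_zero_config (z : E d) : shift z (0 : Config d) = 0 :=
  Config.ext_apply fun s hs => by rw [shift_apply _ _ hs]; rfl

theorem shift_sum_particle (z : E d)
    {n : ℕ} (x : Fin n → E d) : shift z (∑ i, particle (x i)) = ∑ i, particle (x i - z) := by
  induction n with
  | zero => simpa using shift_zero_config z
  | succ n ih => rw [Fin.sum_univ_castSucc, Fin.sum_univ_castSucc, shift_add, shift_particle, ih]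

theorem shift_restr (z : E d)
    (μ : Config d) (hU : MeasurableSet U) : shift z (restr μ (pre z U)) = restr (shift z μ) U :=
  Config.ext_apply fun s hs => by
    rw [shift_apply _ _ hs, restr_apply _ _ hs, shift_apply _ _ (hs.inter hU)]
    exact restr_apply _ _ (measurableSet_pre z hs)

theorem shift_clip (z : E d)
    (μ : Config d) (hV : MeasurableSet V) : shift z (clip (pre z V) μ) = clip V (shift z μ) := by
  have h : (shift z μ).1 V = μ.1 (pre z V) := shift_apply _ _ hV
  by_cases hμ : μ.1 (pre z V) < ∞
  · rw [clip_of_lt hμ, clip_of_lt (h.trans_lt hμ), shift_restr _ _ hV]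
  · rw [clip_of_not_lt hμ, clip_of_not_lt (by rwa [h])]
    exact shift_zero_config z

theorem measurePreserving_shift (z : E d) (hV : MeasurableSet V) [IsFiniteMeasure (vol V)]
    (n : ℕ) : MeasurePreserving (shift z) (lam (pre z V) n) (lam V n) := by
  have : IsFiniteMeasure (vol (pre z V)) :=
    ⟨by rw [Measure.restrict_apply_univ, volume_pre]; exact volume_lt_top_of_vol⟩
  refine ⟨measurable_shift z, ?_⟩
  have h := measurePreserving_pi (fun _ : Fin n => vol (pre z V)) (fun _ => vol V)
    (f := fun _ x => x - z) fun _ => measurePreserving_pre z hV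
  rw [lam, lam, Measure.map_map (measurable_shift z) (measurable_sum_particle _), ← h.map_eq,
    Measure.map_map (measurable_sum_particle _) h.measurable]
  congr 1
  funext x
  exact shift_sum_particle z x

theorem SmoothIn.shift (z : E d)
    (hU : MeasurableSet U) (h : SmoothIn U φ) : SmoothIn (pre z U) fun μ => φ (shift z μ) := by
  refine ⟨h.1.comp (measurable_shift z), fun μ n => ?_⟩
  have h1 : ContDiff ℝ ((⊤ : ℕ∞) : WithTop ℕ∞) (fun x : Fin n → E d => fun i => x i - z) := by
    fun_prop
  have h2 : MapsTo (fun x : Fin n → E d => fun i => x i - z) {x | ∀ i, x i ∈ pre z U}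
      {x | ∀ i, x i ∈ U} := fun x hx i => hx i
  refine ((h.2 (Bulk.shift z μ) n).comp h1.contDiffOn h2).congr fun x _ => ?_
  have : (pre z U)ᶜ = pre z Uᶜ := rfl
  beta_reduce
  rw [shift_add, shift_sum_particle, this, shift_restr _ _ hU.compl]
  rfl

theorem pgrad_shift (z : E d) (φ : Config d → ℝ) (ν : Config d)
    (x : E d) : pgrad (fun μ => φ (shift z μ)) ν x = pgrad φ (shift z ν) (x - z) := by
  rw [pgrad, pgrad]
  simp only [shift_add, shift_particle, add_sub_right_comm]

theorem measurePreserving_shift_prod (z : E d) (hD : Dom U V) (n : ℕ) : MeasurePreserving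
    (fun p : Pt d => (shift z p.1, p.2 - z)) (lz (pre z V) (vol (pre z U)) n) (lz V (vol U) n) := by
  have := hD.finV
  have : IsFiniteMeasure (vol (pre z V)) :=
    ⟨by rw [Measure.restrict_apply_univ, volume_pre]; exact volume_lt_top_of_vol⟩
  exact (measurePreserving_shift z hD.meas n).prod (measurePreserving_pre z hD.measU)

/-- Correctors live on the levels, so only the translation of Lebesgue measure is involved, not the
stationarity of the Poisson law. That of the coefficients is the hypothesis `hAA`, supplied by
`fieldOf_pre`. -/
theorem IsCorr.shift (z : E d) (hD : Dom U V)
    {A A' : Coef d} (hA : Measurable (uncurry A)) (hAA : ∀ η x, A' η x = A (shift z η) (x - z))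
    (h : IsCorr U V A q g) : IsCorr (pre z U) (pre z V) A' q fun η x => g (shift z η) (x - z) := by
  have hP := measurePreserving_shift_prod z hD
  refine ⟨h.meas.comp (hP 0).measurable, ?_, fun φ hφ n hn => ?_⟩
  · obtain ⟨φ, hφ, hlim⟩ := h.approx
    refine ⟨fun j μ => φ j (Bulk.shift z μ), fun j => ⟨(hφ j).1.shift z hD.measU, ?_⟩, fun n => ?_⟩
    · refine ⟨measurable_pgrad ((hφ j).1.shift z hD.measU).1, fun n => ?_⟩
      refine lt_of_le_of_lt (le_of_eq ?_) ((hφ j).2.2 n)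
      rw [msq, msq]
      refine Eq.trans ?_ ((hP n).lintegral_comp ((hφ j).2.1.enorm.pow_const 2))
      simp only [uncurry, pgrad_shift]
      rfl
    · refine Tendsto.congr (fun j => ?_) (hlim n)
      have hm : Measurable fun p : Pt d => ‖pgrad (φ j) p.1 p.2 - g p.1 p.2‖ₑ ^ 2 :=
        ((hφ j).2.1.sub h.meas).enorm.pow_const 2
      rw [msq, msq]
      simp only [pgrad_shift]
      exact ((hP n).lintegral_comp hm).symm
  -- A test function on the translated domain is carried back to `U` by the opposite translation.
  · have e : pre (-z) (pre z U) = U := by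
      ext x; simp [pre]
    have hs := hφ.shift (-z) (measurableSet_pre z hD.measU)
    rw [e] at hs
    have e2 : ∀ p : Pt d, pgrad (fun μ => φ (Bulk.shift (-z) μ)) (Bulk.shift z p.1) (p.2 - z)
        = pgrad φ p.1 p.2 := fun p => by
      rw [pgrad_shift, shift_neg_shift]; simp
    have hm := measurable_pgrad hs.1
    have h1 := h.el _ hs n (lt_of_le_of_lt (le_of_eq (by
      rw [msq, msq]
      refine ((hP n).lintegral_comp (hm.enorm.pow_const 2)).symm.trans ?_
      exact lintegral_congr fun p => by rw [uncurry, e2]; rfl)) hn)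
    rw [← h1]
    have h2 : Measurable fun p : Pt d =>
      (inner ℝ (pgrad (fun μ => φ (Bulk.shift (-z) μ)) p.1 p.2) (resid A q g p.1 p.2) : ℝ) :=
      hm.inner (measurable_resid hA h.meas)
    have h3 : ∫ p, (inner ℝ (pgrad (fun μ => φ (Bulk.shift (-z) μ)) p.1 p.2)
        (resid A q g p.1 p.2) : ℝ) ∂lz V (vol U) n = ∫ p : Pt d,
        (inner ℝ (pgrad (fun μ => φ (Bulk.shift (-z) μ)) (Bulk.shift z p.1) (p.2 - z))
        (resid A q g (Bulk.shift z p.1) (p.2 - z)) : ℝ) ∂lz (pre z V) (vol (pre z U)) n := by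
      rw [← (hP n).map_eq, integral_map (hP n).measurable.aemeasurable h2.aestronglyMeasurable]
    refine Eq.trans ?_ h3.symm
    refine integral_congr_ae (Eventually.of_forall fun p => ?_)
    beta_reduce
    rw [e2]
    simp only [resid, hAA]

theorem Dom.pre (z : E d) (hD : Dom U V) : Dom (pre z U) (pre z V) where
  isOpen := hD.isOpen.preimage (continuous_id.sub continuous_const)
  convex := by
    have : Bulk.pre z U = (fun x => x + (-z)) ⁻¹' U := by ext x; simp [Bulk.pre, sub_eq_add_neg]
    rw [this]; exact hD.convex.translate_preimage_left _
  pos := by rw [volume_pre]; exact hD.pos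
  meas := measurableSet_pre z hD.meas
  bdd := by
    refine (hD.bdd.vadd z).subset fun x hx => ⟨x - z, hx, by simp⟩
  thick x hx y hy := hD.thick (x - z) hx (by simpa using hy)

theorem fieldOf_pre (a₀ : Config d → Matrix (Fin d) (Fin d) ℝ) (z : E d) (hV : MeasurableSet V)
    (η : Config d) (x : E d) : fieldOf a₀ (pre z V) η x = fieldOf a₀ V (shift z η) (x - z) := by
  rw [fieldOf, fieldOf, aField, aField, ← shift_clip z η hV, ← shift_particle z x, ← shift_add,
    shift_shift, sub_add_cancel]

theorem bform_pre (z : E d) (hD : Dom U V) (hg : Measurable (uncurry g)) :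
    bform ρ (pre z U) (pre z V) q (fun η x => g (shift z η) (x - z)) = bform ρ U V q g := by
  have hP := measurePreserving_shift_prod z hD
  have hr : ∀ W : Set (E d), volume.real (pre z W) = volume.real W := fun W =>
    congrArg ENNReal.toReal (volume_pre z W)
  have hW : fvW ρ (pre z V) = fvW ρ V := by funext n; rw [fvW, fvW, hr]
  have hm : Measurable fun p : Pt d => (inner ℝ q (g p.1 p.2) : ℝ) :=
    measurable_const.inner hg
  have e : fvU ρ U V = (fvU ρ (pre z U) (pre z V)).map
      fun p : Pt d => (shift z p.1, p.2 - z) := by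
    rw [fvU_eq_sum, fvU_eq_sum, Measure.map_sum (hP 0).measurable.aemeasurable, hW]
    refine congrArg Measure.sum (funext fun n => ?_)
    rw [Measure.map_smul]
    exact congrArg _ (hP n).map_eq.symm
  rw [bform, bform, hr, e, integral_map (hP 0).measurable.aemeasurable hm.aestronglyMeasurable]

end Translation

/-! ### The matrices -/

section Matrices

variable
  {p q : E d} {f g g' : Fld d}

theorem const_mem_potSet (hD : Dom U V) (p : E d) : (fun _ _ => p) ∈ potSet U V := by
  have := hD.finV
  have hs := smoothIn_linFun hD.measU p
  have he : LevEq V (vol U) (pgrad (linFun U p)) fun _ _ => p := fun n => by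
    filter_upwards [ae_levU_mem hD n] with w hw
    exact (hasPG_linFun hD.isOpen p (mass_lt_top_of hD.subset hw.2.1) hw.2.2).pgrad_eq
  have hL := (geo_const hD p).lev
  refine ⟨hL, fun r hr n => ?_⟩
  rw [← hr.2 _ hs (hL.congr (measurable_pgrad hs.1) he.symm) n]
  refine integral_congr_ae ?_
  filter_upwards [he n] with w hw
  rw [hw]

theorem Geo.integrable_inner (h : Geo V (vol U) f) (h' : Geo V (vol U) g)
    (hρ : 0 ≤ ρ) : Integrable (fun w : Pt d => (inner ℝ (f w.1 w.2) (g w.1 w.2) : ℝ)) (fvU ρ U V) :=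
  integrable_inner_of_msq h.meas h'.meas (h.msq_fz_lt_top hρ) (h'.msq_fz_lt_top hρ)

theorem Geo.integrable_const_inner (h : Geo V (vol U) f) (hD : Dom U V)
    (hρ : 0 ≤ ρ) (q : E d) : Integrable (fun w : Pt d => (inner ℝ q (f w.1 w.2) : ℝ)) (fvU ρ U V) :=
  have := hD.finV
  (geo_const hD q).integrable_inner h hρ

theorem IsCorr.geo_flux (hD : Dom U V)
    (hA : IsField Λ A) (h : IsCorr U V A q g) : Geo V (vol U) fun η z => A η z (g η z) :=
  have := hD.finV
  (h.geo hD hA).clm_apply hA.meas hA.upper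

theorem IsCorr.integral_inner_flux (hρ : 0 ≤ ρ) (hD : Dom U V) (hA : IsField Λ A)
    (h : IsCorr U V A q g) (hf : f ∈ potSet U V) (hfg : Geo V (vol U) f) : ∫ w, inner ℝ (f w.1 w.2)
    q ∂fvU ρ U V = ∫ w, inner ℝ (f w.1 w.2) (A w.1 w.2 (g w.1 w.2)) ∂fvU ρ U V := by
  have := hD.finV
  have hr : Geo V (vol U) (resid A q g) := (h.geo_flux hD hA).sub (geo_const hD q)
  have h0 : ∫ w, inner ℝ (f w.1 w.2) (resid A q g w.1 w.2) ∂fvU ρ U V = 0 :=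
    (polar_potSet hD).orth_fz hρ hf (h.resid_mem hD hA) hfg hr
  simp only [resid, inner_sub_right] at h0
  rw [integral_sub (hfg.integrable_inner (h.geo_flux hD hA) hρ)
    (hfg.integrable_inner (geo_const hD q) hρ)] at h0
  linarith

/-- By the two Euler-Lagrange equations each side is the integral of `g · A g'`, and `A` is
symmetric. -/
theorem IsCorr.integral_symm (hρ : 0 ≤ ρ)
    (hD : Dom U V) (hA : IsField Λ A) (h : IsCorr U V A q g) (h' : IsCorr U V A p g') :
    ∫ w, inner ℝ p (g w.1 w.2) ∂fvU ρ U V = ∫ w, inner ℝ q (g' w.1 w.2) ∂fvU ρ U V := by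
  have := hD.finV
  simp only [fun w : Pt d => real_inner_comm (g w.1 w.2) p,
    fun w : Pt d => real_inner_comm (g' w.1 w.2) q]
  rw [h'.integral_inner_flux hρ hD hA h.mem_potSet (h.geo hD hA),
    h.integral_inner_flux hρ hD hA h'.mem_potSet (h'.geo hD hA)]
  refine integral_congr_ae (Eventually.of_forall fun w => ?_)
  beta_reduce
  rw [real_inner_comm, hA.symm]

theorem integral_const_fvU (hρ : 0 ≤ ρ)
    (hD : Dom U V) (c : ℝ) : ∫ _, c ∂fvU ρ U V = volume.real U * c := by
  rw [integral_const, smul_eq_mul, measureReal_def, fvU_univ hρ U hD.bdd, measureReal_def]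

theorem IsCorr.integral_const_flux (hρ : 0 ≤ ρ)
    (hD : Dom U V) (hA : IsField Λ A) (h : IsCorr U V A q g) (p : E d) :
    volume.real U * inner ℝ p q = ∫ w, inner ℝ p (A w.1 w.2 (g w.1 w.2)) ∂fvU ρ U V := by
  have := hD.finV
  rw [← integral_const_fvU hρ hD]
  exact h.integral_inner_flux hρ hD hA (const_mem_potSet hD p) (geo_const hD p)

theorem Dom.vol_pos (hD : Dom U V) : 0 < volume.real U :=
  ENNReal.toReal_pos hD.pos hD.bddU.measure_lt_top.ne

/-- Young's inequality in the norm of `A`: expand `0 ≤ (q - Λ x) · A (q - Λ x)` and use `q · A q ≤ Λ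
|q|²`. -/
theorem IsField.inner_le (hA : IsField Λ A) (hΛ : 0 < Λ) (η : Config d)
    (z q x : E d) : inner ℝ q (A η z x) ≤ 1 / 2 * ‖q‖ ^ 2 + Λ / 2 * inner ℝ x (A η z x) := by
  have h1 := (sq_nonneg _).trans (hA.lower η z (q - Λ • x))
  have h2 : inner ℝ q (A η z q) ≤ ‖q‖ * (Λ * ‖q‖) := (real_inner_le_norm _ _).trans
    (mul_le_mul_of_nonneg_left ((A η z).le_of_opNorm_le (hA.upper _ _) q) (norm_nonneg q))
  have h3 : inner ℝ x (A η z q) = inner ℝ q (A η z x) := by rw [real_inner_comm, hA.symm]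
  simp only [map_sub, map_smul, inner_sub_left, inner_sub_right, real_inner_smul_left,
    real_inner_smul_right, h3] at h1
  refine le_of_mul_le_mul_left (a := 2 * Λ) ?_ (by positivity)
  linarith

theorem IsCorr.bform_eq (hρ : 0 ≤ ρ) (hD : Dom U V) (hA : IsField Λ A) (h : IsCorr U V A q g) :
    volume.real U * bform ρ U V q g = ∫ w, inner ℝ (g w.1 w.2) (A w.1 w.2 (g w.1 w.2)) ∂fvU ρ U V :=
    by
  have := hD.finV
  rw [← h.integral_inner_flux hρ hD hA h.mem_potSet (h.geo hD hA), bform,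
    mul_inv_cancel_left₀ hD.vol_pos.ne']
  simp only [real_inner_comm]

/-- The quantity equals both the mean of `g · q` and that of `g · A g`; combine `g · q ≤ |q|²/2 +
|g|²/2` with `|g|² ≤ g · A g`. -/
theorem IsCorr.bform_le (hρ : 0 ≤ ρ)
    (hD : Dom U V) (hA : IsField Λ A) (h : IsCorr U V A q g) : bform ρ U V q g ≤ ‖q‖ ^ 2 := by
  have := hD.finV
  have := hD.finite_fvU hρ
  have hv := hD.vol_pos
  have hg := h.geo hD hA
  have e1 := h.bform_eq hρ hD hA
  have e2 := h.integral_inner_flux hρ hD hA h.mem_potSet hg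
  have e3 : ∫ w, inner ℝ (g w.1 w.2) q ∂fvU ρ U V ≤ ∫ w, (1 / 2 * ‖q‖ ^ 2
      + 1 / 2 * inner ℝ (g w.1 w.2) (A w.1 w.2 (g w.1 w.2))) ∂fvU ρ U V := by
    refine integral_mono (hg.integrable_inner (geo_const hD q) hρ) ((integrable_const _).add
      ((hg.integrable_inner (h.geo_flux hD hA) hρ).const_mul _)) fun w => ?_
    have h1 := norm_sub_sq_real (g w.1 w.2) q
    have h2 := hA.lower w.1 w.2 (g w.1 w.2)
    have h3 := sq_nonneg ‖g w.1 w.2 - q‖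
    beta_reduce
    linarith
  rw [integral_add (integrable_const _) ((hg.integrable_inner (h.geo_flux hD hA) hρ).const_mul _),
    integral_const_fvU hρ hD, integral_const_mul] at e3
  refine le_of_mul_le_mul_left ?_ hv
  linarith

/-- Testing the equation with the constant field `q` gives `|q|²` as the mean of `q · A g`, to which
Young's inequality in the norm of `A` applies. -/
theorem IsCorr.le_bform (hρ : 0 ≤ ρ) (hΛ : 0 < Λ)
    (hD : Dom U V) (hA : IsField Λ A) (h : IsCorr U V A q g) : ‖q‖ ^ 2 ≤ Λ * bform ρ U V q g := by
  have := hD.finV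
  have := hD.finite_fvU hρ
  have hv := hD.vol_pos
  have hg := h.geo hD hA
  have e1 := h.bform_eq hρ hD hA
  have e2 := h.integral_const_flux hρ hD hA q
  have hi : Integrable (fun w : Pt d => (inner ℝ q (A w.1 w.2 (g w.1 w.2)) : ℝ))
      (fvU ρ U V) :=
    (h.geo_flux hD hA).integrable_const_inner hD hρ q
  have e3 : ∫ w, inner ℝ q (A w.1 w.2 (g w.1 w.2)) ∂fvU ρ U V ≤ ∫ w, (1 / 2 * ‖q‖ ^ 2
      + Λ / 2 * inner ℝ (g w.1 w.2) (A w.1 w.2 (g w.1 w.2))) ∂fvU ρ U V := by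
    refine integral_mono hi ((integrable_const _).add
      ((hg.integrable_inner (h.geo_flux hD hA) hρ).const_mul _)) fun w => ?_
    exact hA.inner_le hΛ w.1 w.2 q (g w.1 w.2)
  rw [integral_add (integrable_const _) ((hg.integrable_inner (h.geo_flux hD hA) hρ).const_mul _),
    integral_const_fvU hρ hD, integral_const_mul, ← e1, ← e2, real_inner_self_eq_norm_sq] at e3
  refine le_of_mul_le_mul_left ?_ hv
  clear e1 e2 hi hg
  linarith

theorem Admissible.pos (hd : 1 ≤ d) (ha : Admissible Λ a₀) : 0 < Λ := by
  have hA := ha.isField hd (V := ∅) MeasurableSet.empty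
  have h1 := hA.lower 0 0 (EuclideanSpace.single ⟨0, hd⟩ 1)
  have h2 := (real_inner_le_norm _ _).trans (mul_le_mul_of_nonneg_left
    ((fieldOf a₀ ∅ 0 0).le_of_opNorm_le (hA.upper 0 0) (EuclideanSpace.single ⟨0, hd⟩ 1))
    (norm_nonneg (EuclideanSpace.single (⟨0, hd⟩ : Fin d) (1 : ℝ))))
  simp only [PiLp.norm_single, norm_one, one_pow, one_mul, mul_one] at h1 h2
  linarith

theorem two_nuStar_bounds (hd : 1 ≤ d) (hρ : 0 < ρ) (hD : Dom U V) (ha : Admissible Λ a₀)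
    (p : E d) : 2 * nuStar a₀ U p ρ ≤ ‖p‖ ^ 2 ∧ ‖p‖ ^ 2 ≤ Λ * (2 * nuStar a₀ U p ρ) := by
  obtain ⟨g, h⟩ := exists_isCorr hD (ha.isField hd hD.meas) p
  rw [h.nuStar_eq hd hρ hD ha, ← mul_assoc, mul_one_div_cancel two_ne_zero, one_mul]
  exact ⟨h.bform_le hρ.le hD (ha.isField hd hD.meas),
    h.le_bform hρ.le (ha.pos hd) hD (ha.isField hd hD.meas)⟩

theorem aStarInv_isSymm (a₀ : Config d → Matrix (Fin d) (Fin d) ℝ)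
    (U : Set (E d)) (ρ : ℝ) : (aStarInv a₀ U ρ).IsSymm := by
  ext i j
  simp only [Matrix.transpose_apply, aStarInv, Matrix.of_apply,
    add_comm (EuclideanSpace.single j (1 : ℝ))]
  ring

theorem toEuclideanLin_apply_coord (M : Matrix (Fin d) (Fin d) ℝ) (p : E d) (i : Fin d) :
    M.toEuclideanLin p i = ∑ j, M i j * p j := rfl

theorem sum_smul_single (p : E d) : ∑ i, p i • EuclideanSpace.single i (1 : ℝ) = p := by
  simpa using (EuclideanSpace.basisFun (Fin d) ℝ).sum_repr p

/-- `2 ν_*` is the diagonal of `b(p, q) = |U|⁻¹ ∫ p · g_q`. Linearity in `p` is obvious, and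
linearity in `q` follows from symmetry; linearity or uniqueness of the chosen correctors is not
needed. -/
theorem inner_aStarInv (hd : 1 ≤ d) (hρ : 0 < ρ) (hD : Dom U V) (ha : Admissible Λ a₀)
    (p : E d) : inner ℝ p ((aStarInv a₀ U ρ).toEuclideanLin p) = 2 * nuStar a₀ U p ρ := by
  have := hD.finV
  have hA := ha.isField hd hD.meas
  choose g hg using exists_isCorr hD hA
  have hi : ∀ p q, Integrable (fun w : Pt d => (inner ℝ p (g q w.1 w.2) : ℝ))
      (fvU ρ U V) := fun p q => ((hg q).geo hD hA).integrable_const_inner hD hρ.le p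
  set b : E d → E d → ℝ := fun p q => (volume.real U)⁻¹ * ∫ w, inner ℝ p (g q w.1 w.2) ∂fvU ρ U V
  have hsymm : ∀ p q, b p q = b q p := fun p q => by
    simp only [b]; rw [(hg q).integral_symm hρ.le hD hA (hg p)]
  have hadd : ∀ p p' q, b (p + p') q = b p q + b p' q := fun p p' q => by
    simp only [b, inner_add_left]
    rw [integral_add (hi _ _) (hi _ _), mul_add]
  have hsmul : ∀ (c : ℝ) p q, b (c • p) q = c • b p q := fun c p q => by
    simp only [b, real_inner_smul_left, smul_eq_mul]
    rw [integral_const_mul]; ring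
  let B : E d →ₗ[ℝ] E d →ₗ[ℝ] ℝ := LinearMap.mk₂ ℝ b hadd hsmul
    (fun p q q' => by rw [hsymm, hadd, hsymm q, hsymm q'])
    (fun c p q => by rw [hsymm, hsmul, hsymm q])
  have hB : ∀ p q, B p q = b p q := fun p q => rfl
  have hN : ∀ p, nuStar a₀ U p ρ = 1 / 2 * B p p := fun p => (hg p).nuStar_eq hd hρ hD ha
  have hM : ∀ i j, aStarInv a₀ U ρ i j
      = B (EuclideanSpace.single i 1) (EuclideanSpace.single j 1) := fun i j => by
    simp only [aStarInv, Matrix.of_apply, hN, map_add, LinearMap.add_apply]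
    rw [hB (EuclideanSpace.single j 1) (EuclideanSpace.single i 1), hsymm, ← hB]
    ring
  have h1 : ∀ i, (aStarInv a₀ U ρ).toEuclideanLin p i = B (EuclideanSpace.single i 1) p := fun i => by
    conv_rhs => rw [← sum_smul_single p]
    simp only [toEuclideanLin_apply_coord, hM, map_sum, map_smul, smul_eq_mul, mul_comm]
  rw [hN, ← mul_assoc, mul_one_div_cancel two_ne_zero, one_mul]
  have h2 : B p p = ∑ i, p i * B (EuclideanSpace.single i 1) p := by
    have := congrArg (fun x => B x p) (sum_smul_single p)
    simpa only [map_sum, map_smul, LinearMap.sum_apply, LinearMap.smul_apply, smul_eq_mul]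
      using this.symm
  simp only [h2, PiLp.inner_apply, h1]
  exact Finset.sum_congr rfl fun i _ => by simp [mul_comm]

end Matrices

/-! ### Inverses of elliptic matrices -/

section Inverse

variable {M : Matrix (Fin d) (Fin d) ℝ}

theorem inner_toEuclideanLin_symm (hM : M.IsSymm)
    (x y : E d) : inner ℝ (M.toEuclideanLin x) y = inner ℝ x (M.toEuclideanLin y) := by
  have h : M.IsHermitian := by rw [Matrix.IsHermitian, Matrix.conjTranspose_eq_transpose_of_trivial]; exact hM
  exact (Matrix.isSymmetric_toEuclideanLin_iff.2 h) x y

/-- `Λ⁻¹ ≤ M ≤ 1`. -/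
structure Elliptic (Λ : ℝ) (M : Matrix (Fin d) (Fin d) ℝ) : Prop where
  pos : 0 < Λ
  symm : M.IsSymm
  upper : ∀ x : E d, inner ℝ x (M.toEuclideanLin x) ≤ ‖x‖ ^ 2
  lower : ∀ x : E d, ‖x‖ ^ 2 ≤ Λ * inner ℝ x (M.toEuclideanLin x)

theorem Elliptic.isUnit_det (h : Elliptic Λ M) : IsUnit M.det := by
  rw [isUnit_iff_ne_zero]
  intro h0
  obtain ⟨v, hv, hMv⟩ := Matrix.exists_mulVec_eq_zero_iff.2 h0
  have h1 : M.toEuclideanLin (WithLp.toLp 2 v) = 0 := by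
    ext i; exact congrFun hMv i
  have h2 := h.lower (WithLp.toLp 2 v)
  rw [h1, inner_zero_right, mul_zero] at h2
  exact hv (by simpa using pow_eq_zero_iff (two_ne_zero) |>.1 (le_antisymm h2 (sq_nonneg _)))

theorem posSemidef_of_inner {N : Matrix (Fin d) (Fin d) ℝ}
    (hN : N.IsSymm) (h : ∀ x : E d, 0 ≤ inner ℝ x (N.toEuclideanLin x)) : N.PosSemidef := by
  refine Matrix.PosSemidef.of_dotProduct_mulVec_nonneg
    (by rw [Matrix.IsHermitian, Matrix.conjTranspose_eq_transpose_of_trivial]; exact hN) fun v => ?_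
  have := h (WithLp.toLp 2 v)
  simp only [PiLp.inner_apply, toEuclideanLin_apply_coord] at this
  refine this.trans_eq (Finset.sum_congr rfl fun i _ => ?_)
  simp [Matrix.mulVec, dotProduct, mul_comm]

/-- Put `y = M⁻¹ x`. The lower bound on `x · y` comes from `0 ≤ (y - x) · M (y - x)` and `M ≤ 1`;
the upper bound from `|y|² ≤ Λ y · x` and `0 ≤ |y - Λ x|²`. -/
theorem Elliptic.inv_bounds (h : Elliptic Λ M) :
    (M⁻¹ - 1).PosSemidef ∧ (Λ • (1 : Matrix (Fin d) (Fin d) ℝ) - M⁻¹).PosSemidef := by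
  have hs : (M⁻¹).IsSymm := by rw [Matrix.IsSymm, Matrix.transpose_nonsing_inv, h.symm]
  have hMy : ∀ x : E d, M.toEuclideanLin ((M⁻¹).toEuclideanLin x) = x := fun x => by
    ext i
    simp [Matrix.toEuclideanLin, Matrix.mul_nonsing_inv _ h.isUnit_det]
  refine ⟨posSemidef_of_inner (hs.sub Matrix.isSymm_one) fun x => ?_,
    posSemidef_of_inner ((Matrix.isSymm_one.smul Λ).sub hs) fun x => ?_⟩
  all_goals
    set y := (M⁻¹).toEuclideanLin x with hy
    have hx : M.toEuclideanLin y = x := hMy x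
    simp only [map_sub, map_smul, LinearMap.sub_apply, LinearMap.smul_apply, inner_sub_right,
      Matrix.toLpLin_one, LinearMap.id_apply, real_inner_smul_right, ← hy, real_inner_self_eq_norm_sq]
  · have h1 := h.lower (y - x)
    have h2 := h.upper x
    have h3 : 0 ≤ inner ℝ (y - x) (M.toEuclideanLin (y - x)) :=
      nonneg_of_mul_nonneg_right ((sq_nonneg _).trans h1) h.pos
    have h4 := inner_toEuclideanLin_symm h.symm y x
    simp only [map_sub, inner_sub_left, inner_sub_right, hx, real_inner_self_eq_norm_sq] at h3 h4
    rw [real_inner_comm] at h3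
    linarith
  · have h1 := h.lower y
    have h2 := norm_sub_sq_real y (Λ • x)
    have h3 := sq_nonneg ‖y - Λ • x‖
    rw [norm_smul, mul_pow, Real.norm_eq_abs, sq_abs, real_inner_smul_right] at h2
    rw [hx] at h1
    rw [real_inner_comm x y] at *
    refine nonneg_of_mul_nonneg_right (a := Λ) ?_ h.pos
    nlinarith

theorem Elliptic.tendsto_inv (h : Elliptic Λ M) {N : ℕ → Matrix (Fin d) (Fin d) ℝ}
    (hN : Tendsto N atTop (𝓝 M)) : Tendsto (fun m => (N m)⁻¹) atTop (𝓝 M⁻¹) := by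
  simp only [Matrix.inv_def, Ring.inverse_eq_inv]
  have h1 : Tendsto (fun m => (N m).det) atTop (𝓝 M.det) :=
    ((continuous_id.matrix_det).tendsto M).comp hN
  have h2 : Tendsto (fun m => (N m).adjugate) atTop (𝓝 M.adjugate) :=
    ((continuous_id.matrix_adjugate).tendsto M).comp hN
  exact (h1.inv₀ h.isUnit_det.ne_zero).smul h2

end Inverse

/-! ### Cubes -/

section Cubes

open scoped Pointwise

theorem dom_cube (d m : ℕ) : Dom (cube d m) (Metric.thickening (1 / 2) (cube d m)) := by
  have ho : IsOpen (cube d m) := by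
    have : cube d m = ⋂ i, {x : E d | -((3 : ℝ) ^ m / 2) < x i ∧ x i < (3 : ℝ) ^ m / 2} := by
      ext x; simp [cube]
    rw [this]
    refine isOpen_iInter_of_finite fun i => ?_
    have hc : Continuous fun x : E d => x i := by fun_prop
    exact (isOpen_lt continuous_const hc).inter (isOpen_lt hc continuous_const)
  have hb : Bornology.IsBounded (cube d m) := by
    refine (Metric.isBounded_ball (x := (0 : E d)) (r := Real.sqrt (d * (3 ^ m / 2) ^ 2) + 1)).subset
      fun x hx => ?_
    rw [mem_ball_zero_iff, EuclideanSpace.norm_eq]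
    refine lt_of_le_of_lt (Real.sqrt_le_sqrt (y := d * ((3 : ℝ) ^ m / 2) ^ 2) ?_) (lt_add_one _)
    refine (Finset.sum_le_card_nsmul _ _ (((3 : ℝ) ^ m / 2) ^ 2) fun i _ => ?_).trans (by simp)
    rw [Real.norm_eq_abs]
    exact pow_le_pow_left₀ (abs_nonneg _) (abs_le.2 ⟨(hx i).1.le, (hx i).2.le⟩) 2
  refine ⟨ho, fun x hx y hy a b ha hb hab i => ?_, (ho.measure_pos _ ⟨0, fun i => ?_⟩).ne',
    Metric.isOpen_thickening.measurableSet, hb.thickening, fun z hz => Metric.ball_subset_thickening hz _⟩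
  · have := convex_Ioo (-((3 : ℝ) ^ m / 2)) (3 ^ m / 2) (hx i) (hy i) ha hb hab
    simpa using this
  · have : (0 : ℝ) < 3 ^ m := by positivity
    simp

theorem nuStar_pre (hd : 1 ≤ d) (hρ : 0 < ρ) (hD : Dom U V)
    (ha : Admissible Λ a₀) (z q : E d) : nuStar a₀ (pre z U) q ρ = nuStar a₀ U q ρ := by
  have hA := ha.isField hd hD.meas
  obtain ⟨g, h⟩ := exists_isCorr hD hA q
  rw [h.nuStar_eq hd hρ hD ha, (h.shift z hD hA.meas (fieldOf_pre a₀ z hD.meas)).nuStar_eq hd hρ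
    (hD.pre z) ha, bform_pre z hD h.meas]

/-- The centres of the cubes of side `3^m` that tile `cube d (m + 1)`. -/
def cellCentre (d m : ℕ) (k : Fin d → Fin 3) : E d :=
  WithLp.toLp 2 fun i => (3 : ℝ) ^ m * ((k i : ℕ) - 1)

/-- Up to a null set the large cube is tiled by `3^d` translates of the small one, on each of which
`ν_*` is the same; subadditivity then compares the two values. -/
theorem nuStar_cube_succ_le (hd : 1 ≤ d) (hρ : 0 < ρ) (ha : Admissible Λ a₀)
    (q : E d) (m : ℕ) : nuStar a₀ (cube d (m + 1)) q ρ ≤ nuStar a₀ (cube d m) q ρ := by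
  set U := cube d (m + 1) with hU
  set V := Metric.thickening (1 / 2) U with hV
  have hD : Dom U V := dom_cube d (m + 1)
  have hA := ha.isField hd hD.meas
  set W : (Fin d → Fin 3) → Set (E d) := fun k => pre (cellCentre d m k) (cube d m) with hWdef
  have h3 : (0 : ℝ) < 3 ^ m := by positivity
  have hmem : ∀ k x, x ∈ W k ↔ ∀ i, -((3 : ℝ) ^ m / 2) < x i - 3 ^ m * ((k i : ℕ) - 1) ∧
      x i - 3 ^ m * ((k i : ℕ) - 1) < (3 : ℝ) ^ m / 2 := fun k x => Iff.rfl
  have hWU : ∀ k, W k ⊆ U := fun k x hx i => by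
    have h1 := (hmem k x).1 hx i
    have h2 : ((k i : ℕ) : ℝ) ≤ 2 := by exact_mod_cast Nat.le_of_lt_succ (k i).2
    have h4 : (0 : ℝ) ≤ (k i : ℕ) := by positivity
    rw [pow_succ]
    constructor <;> nlinarith
  -- The small cubes keep the box `V` of the large one, so that a single field serves all of them;
  -- the value of `ν_*` does not depend on the box.
  have hW : ∀ k, Dom (W k) V := fun k =>
    have h := (dom_cube d m).pre (cellCentre d m k)
    ⟨h.isOpen, h.convex, h.pos, hD.meas, hD.bdd, fun z hz => hD.thick z (hWU k hz)⟩
  have hdisj : Pairwise (Function.onFun Disjoint W) := fun k k' hkk => by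
    refine Set.disjoint_left.2 fun x hx hx' => hkk (funext fun i => ?_)
    have h1 := (hmem k x).1 hx i
    have h2 := (hmem k' x).1 hx' i
    have h4 : ((k i : ℕ) : ℝ) < (k' i : ℕ) + 1 := by
      by_contra hc; push Not at hc; nlinarith
    have h5 : ((k' i : ℕ) : ℝ) < (k i : ℕ) + 1 := by
      by_contra hc; push Not at hc; nlinarith
    have h6 : (k i : ℕ) < (k' i : ℕ) + 1 := by exact_mod_cast h4
    have h7 : (k' i : ℕ) < (k i : ℕ) + 1 := by exact_mod_cast h5
    exact Fin.ext (by omega)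
  have hUm : volume U = 3 ^ d * volume (cube d m) := by
    have : U = (3 : ℝ) • cube d m := by
      ext x
      rw [Set.mem_smul_set_iff_inv_smul_mem₀ three_ne_zero]
      refine forall_congr' fun i => ?_
      simp only [PiLp.smul_apply, smul_eq_mul, pow_succ]
      constructor <;> rintro ⟨h1, h2⟩ <;> constructor <;> linarith
    rw [this, Measure.addHaar_smul, finrank_euclideanSpace_fin, abs_of_pos (by positivity),
      ENNReal.ofReal_pow (by norm_num), ENNReal.ofReal_ofNat]
  have hWv : ∀ k, volume (W k) = volume (cube d m) := fun k => volume_pre _ _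
  have hvol : volume U ≤ volume (⋃ k, W k) := by
    rw [measure_iUnion hdisj fun k => (hW k).measU, tsum_fintype, hUm]
    simp [hWv]
  obtain ⟨g, hg⟩ := exists_isCorr hD hA q
  choose gk hgk using fun k => exists_isCorr (hW k) hA q
  have key := bform_subadditive hρ hD hW hWU hdisj hvol hA hg hgk
  have e0 := hg.nuStar_eq hd hρ hD ha
  have ek : ∀ k, bform ρ (W k) V q (gk k) = 2 * nuStar a₀ (cube d m) q ρ := fun k => by
    rw [← nuStar_pre hd hρ (dom_cube d m) ha (cellCentre d m k) q]
    have := (hgk k).nuStar_eq hd hρ (hW k) ha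
    change _ = 2 * nuStar a₀ (W k) q ρ
    rw [this]; ring
  simp only [ek, measureReal_def, hWv, hUm, Finset.sum_const, Finset.card_univ, Fintype.card_fun,
    Fintype.card_fin, nsmul_eq_mul, ENNReal.toReal_mul, ENNReal.toReal_pow, ENNReal.toReal_ofNat] at key
  push_cast at key
  have hv : 0 < (3 : ℝ) ^ d * (volume (cube d m)).toReal := mul_pos (by positivity)
    (ENNReal.toReal_pos (dom_cube d m).pos (dom_cube d m).bddU.measure_lt_top.ne)
  rw [← mul_assoc, mul_le_mul_iff_right₀ hv] at key
  linarith

theorem elliptic_aStarInv (hd : 1 ≤ d)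
    (hρ : 0 < ρ) (ha : Admissible Λ a₀) (m : ℕ) : Elliptic Λ (aStarInv a₀ (cube d m) ρ) := by
  have hD := dom_cube d m
  refine ⟨ha.pos hd, aStarInv_isSymm _ _ _, fun x => ?_, fun x => ?_⟩ <;>
    rw [inner_aStarInv hd hρ hD ha]
  · exact (two_nuStar_bounds hd hρ hD ha x).1
  · exact (two_nuStar_bounds hd hρ hD ha x).2

theorem aStar_inv (hd : 1 ≤ d) (hρ : 0 < ρ)
    (ha : Admissible Λ a₀) (m : ℕ) : (aStar a₀ (cube d m) ρ)⁻¹ = aStarInv a₀ (cube d m) ρ :=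
  Matrix.nonsing_inv_nonsing_inv _ (elliptic_aStarInv hd hρ ha m).isUnit_det

theorem nuStar_cube_eq (hd : 1 ≤ d) (hρ : 0 < ρ) (ha : Admissible Λ a₀)
    (m : ℕ) (p : E d) : nuStar a₀ (cube d m) p ρ = 1 / 2 * invForm (aStar a₀ (cube d m) ρ) p := by
  rw [invForm, aStar_inv hd hρ ha, inner_aStarInv hd hρ (dom_cube d m) ha]
  ring

/-- Monotonicity and the lower bound give the limits of `ν_*`, hence by polarization those of the
inverse matrices. The ellipticity bounds pass to the limit, so the limit is invertible and inversion
is continuous there. -/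
theorem tendsto_aStar (hd : 1 ≤ d) (hρ : 0 < ρ)
    (ha : Admissible Λ a₀) : Tendsto (fun m => aStar a₀ (cube d m) ρ) atTop (𝓝 (aBar a₀ ρ)) ∧ ∀ q :
    E d, Tendsto (fun m => 2 * nuStar a₀ (cube d m) q ρ) atTop (𝓝 (invForm (aBar a₀ ρ) q)) := by
  have hN : ∀ q, ∃ l, Tendsto (fun m => nuStar a₀ (cube d m) q ρ) atTop (𝓝 l) := fun q =>
    ⟨_, tendsto_atTop_ciInf (antitone_nat_of_succ_le fun m => nuStar_cube_succ_le hd hρ ha q m)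
      ⟨0, by
        rintro _ ⟨m, rfl⟩
        have := (sq_nonneg _).trans (two_nuStar_bounds hd hρ (dom_cube d m) ha q).2
        have := nonneg_of_mul_nonneg_right this (ha.pos hd)
        linarith⟩⟩
  choose N hN using hN
  set M : Matrix (Fin d) (Fin d) ℝ := Matrix.of fun i j =>
    N (EuclideanSpace.single i 1 + EuclideanSpace.single j 1)
      - N (EuclideanSpace.single i 1) - N (EuclideanSpace.single j 1)
  have hM : Tendsto (fun m => aStarInv a₀ (cube d m) ρ) atTop (𝓝 M) :=
    tendsto_pi_nhds.2 fun i => tendsto_pi_nhds.2 fun j => ((hN _).sub (hN _)).sub (hN _)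
  have hq : ∀ q : E d, Tendsto (fun m => 2 * nuStar a₀ (cube d m) q ρ) atTop
      (𝓝 (inner ℝ q (M.toEuclideanLin q))) := fun q => by
    have hc : Continuous fun M : Matrix (Fin d) (Fin d) ℝ => inner ℝ q (M.toEuclideanLin q) := by
      simp only [PiLp.inner_apply, toEuclideanLin_apply_coord]
      fun_prop
    exact ((hc.tendsto M).comp hM).congr fun m => inner_aStarInv hd hρ (dom_cube d m) ha q
  have hE : Elliptic Λ M := by
    refine ⟨ha.pos hd, ?_, fun x => ?_, fun x => ?_⟩
    · ext i j
      simp only [M, Matrix.transpose_apply, Matrix.of_apply, add_comm (EuclideanSpace.single j (1 : ℝ))]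
      ring
    · exact le_of_tendsto' (hq x) fun m => (two_nuStar_bounds hd hρ (dom_cube d m) ha x).1
    · exact ge_of_tendsto' ((hq x).const_mul Λ) fun m =>
        (two_nuStar_bounds hd hρ (dom_cube d m) ha x).2
  have hlim := hE.tendsto_inv hM
  have hbar : aBar a₀ ρ = M⁻¹ := hlim.limUnder_eq
  refine ⟨by rw [hbar]; exact hlim, fun q => ?_⟩
  rw [invForm, hbar, Matrix.nonsing_inv_nonsing_inv _ hE.isUnit_det]
  exact hq q

end Cubes

/-! ### Iterated differences -/

section IterDiff

variable {k : ℕ} {Z : Type} [MeasurableSpace Z] {ζ : Measure Z} [SFinite ζ]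
  {F F' f : Config d → Z → E d} {W : Type*} [AddCommGroup W]

theorem addDiff_iterDiff (k : ℕ) (x : Fin k → E d)
    (y : E d) (f : Config d → W) : addDiff y (iterDiff k x f) = iterDiff k x (addDiff y f) := by
  induction k with
  | zero => rfl
  | succ k ih =>
    rw [iterDiff, iterDiff, ← ih]
    funext μ
    simp only [addDiff, add_right_comm μ]
    abel

theorem iterDiff_add_particle (k : ℕ) (x : Fin k → E d) (f : Config d → W) (z : E d) (ν :
    Config d) : iterDiff k x f (ν + particle z) = iterDiff k x (fun η => f (η + particle z)) ν := by
  induction k generalizing ν with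
  | zero => rfl
  | succ k ih => simp only [iterDiff, addDiff, ← ih, add_right_comm ν]

theorem iterDiff_congr {S : Set (Config d)}
    (hS : ∀ η ∈ S, ∀ y, η + particle y ∈ S) {f f' : Config d → W} (h : ∀ η ∈ S, f η = f' η) (k : ℕ)
    (x : Fin k → E d) {μ : Config d} (hμ : μ ∈ S) : iterDiff k x f μ = iterDiff k x f' μ := by
  induction k generalizing μ with
  | zero => exact h μ hμ
  | succ k ih => rw [iterDiff, iterDiff, addDiff, addDiff, ih _ (hS μ hμ _), ih _ hμ]

theorem iterDiff_sub (k : ℕ) (x : Fin k → E d) (f f' : Config d → W) (μ : Config d) :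
    iterDiff k x (fun η => f η - f' η) μ = iterDiff k x f μ - iterDiff k x f' μ := by
  induction k generalizing μ with
  | zero => rfl
  | succ k ih => simp only [iterDiff, addDiff, ih]; abel

theorem iterDiff_clm (k : ℕ) (x : Fin k → E d) (L : E d →L[ℝ] E d) (f : Config d → E d)
    (μ : Config d) : iterDiff k x (fun η => L (f η)) μ = L (iterDiff k x f μ) := by
  induction k generalizing μ with
  | zero => rfl
  | succ k ih => simp only [iterDiff, addDiff, ih, map_sub]

theorem clip_add_particle (hV : MeasurableSet V)
    (hν : ν.1 V < ∞) (y : E d) : clip V (ν + particle y) = clip V ν + restr (particle y) V := by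
  rw [clip_of_lt hν, clip_of_lt ((mass_add_particle_lt hV).2 hν), restr_add]

-- A particle added outside `V` is not seen by `clip V`, so its difference operator gives zero.
-- Hence the integrals over all of `ℝ^d` reduce to integrals over `V`.
open Classical in
theorem iterDiff_clip (hV : MeasurableSet V) (k : ℕ)
    (x : Fin k → E d) (f : Config d → W) (hν : ν.1 V < ∞) : iterDiff k x (fun η => f (clip V η))
    ν = if ∀ i, x i ∈ V then iterDiff k x f (clip V ν) else 0 := by
  induction k generalizing ν with
  | zero => simp [iterDiff]
  | succ k ih =>
    rw [iterDiff, addDiff, ih _ hν, ih _ ((mass_add_particle_lt hV).2 hν), clip_add_particle hV hν]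
    simp only [Fin.forall_fin_succ]
    by_cases h0 : x 0 ∈ V
    · rw [restr_particle_of_mem hV h0]
      by_cases h1 : ∀ i : Fin k, x i.succ ∈ V <;> simp [h0, h1, iterDiff, addDiff]
    · simp [restr_particle_of_notMem hV h0, h0]

/-- The iterated difference as a function of the added particles, the configuration and the
parameter. -/
def itd (k : ℕ) (F : Config d → Z → E d) (p : (Fin k → E d) × (Config d × Z)) : E d :=
  iterDiff k p.1 (fun η => F η p.2.2) p.2.1

/-- Moves the first added particle to the parameters. -/
def peel (p : (Fin (k + 1) → E d) × (Config d × Z)) : (Fin k → E d) × (Config d × (Z × E d)) :=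
  (fun i => p.1 i.succ, (p.2.1, (p.2.2, p.1 0)))

theorem itd_succ (F : Config d → Z → E d)
    (p : (Fin (k + 1) → E d) × (Config d × Z)) : itd (k + 1) F p = itd k (dif F) (peel p) :=
  congrFun (addDiff_iterDiff k (fun i => p.1 i.succ) (p.1 0) fun η => F η p.2.2) p.2.1

theorem measurePreserving_peel (κ : Measure (Config d)) [SFinite κ] (ζ : Measure Z) [SFinite ζ]
    (τ : Measure (E d)) [SigmaFinite τ] (k : ℕ) : MeasurePreserving peel ((Measure.pi fun _ : Fin
    (k + 1) => τ).prod (κ.prod ζ)) ((Measure.pi fun _ : Fin k => τ).prod (κ.prod (ζ.prod τ))) := by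
  have h1 := (measurePreserving_piFinSuccAbove (fun _ : Fin (k + 1) => τ) 0).prod
    (MeasurePreserving.id (κ.prod ζ))
  have h2 := (Measure.measurePreserving_swap (μ := τ) (ν := Measure.pi fun _ : Fin k => τ)).prod
    (MeasurePreserving.id (κ.prod ζ))
  have h3 := measurePreserving_prodAssoc (Measure.pi fun _ : Fin k => τ) τ (κ.prod ζ)
  have h4 := (MeasurePreserving.id (Measure.pi fun _ : Fin k => τ)).prod
    (Measure.measurePreserving_swap (μ := τ) (ν := κ.prod ζ))
  have h5 := (MeasurePreserving.id (Measure.pi fun _ : Fin k => τ)).prod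
    (measurePreserving_prodAssoc κ ζ τ)
  exact h5.comp (h4.comp (h3.comp (h2.comp h1)))

theorem measurable_peel : Measurable (peel : (Fin (k + 1) → E d) × (Config d × Z) → _) := by
  unfold peel
  fun_prop

theorem measurable_itd (hF : Measurable (uncurry F)) (k : ℕ) : Measurable (itd k F) := by
  induction k generalizing Z with
  | zero => exact hF.comp measurable_snd
  | succ k ih => rw [funext (itd_succ F)]; exact (ih (measurable_dif hF)).comp measurable_peel

/-! ### Absolute continuity of the Poisson process under the addition of a particle -/

/-- The Mecke formula for the indicator of a null set: its left side vanishes, so the law with an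
added particle does not charge the set either, first for the added point in a ball and then in the
whole space. -/
theorem ae_poisson_add_particle (hρ : 0 < ρ) {S : Set (Config d × Z)} (hS : MeasurableSet S)
    (h : ∀ᵐ p ∂(poissonLaw d ρ).prod ζ, p ∈ S) : ∀ᵐ p ∂(poissonLaw d ρ).prod (ζ.prod volume),
    ((p.1 + particle p.2.2, p.2.1) : Config d × Z) ∈ S := by
  have hi : Measurable (Sᶜ.indicator (1 : Config d × Z → ℝ≥0∞)) := measurable_one.indicator hS.compl
  have hi' : Measurable fun p : Config d × (Z × E d) =>
      Sᶜ.indicator (1 : Config d × Z → ℝ≥0∞) (p.1 + particle p.2.2, p.2.1) := hi.comp measurable_push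
  have h0 : ∫⁻ p, Sᶜ.indicator 1 p ∂(poissonLaw d ρ).prod ζ = 0 := by
    rw [lintegral_indicator_one hS.compl]; exact h
  have key : ∫⁻ p, Sᶜ.indicator (1 : Config d × Z → ℝ≥0∞) (p.1 + particle p.2.2, p.2.1)
      ∂(poissonLaw d ρ).prod (ζ.prod volume) = 0 := by
    rw [lintegral_prod_symm' _ hi', lintegral_prod _ hi'.lintegral_prod_left'.aemeasurable]
    rw [lintegral_prod_symm' _ hi, lintegral_eq_zero_iff hi.lintegral_prod_left'] at h0
    rw [← lintegral_zero (μ := ζ)]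
    refine lintegral_congr_ae ?_
    filter_upwards [h0] with z hz
    have hiz : Measurable fun μ : Config d => Sᶜ.indicator (1 : Config d × Z → ℝ≥0∞) (μ, z) :=
      hi.comp (measurable_id.prodMk measurable_const)
    have hJ : Measurable fun y : E d => ∫⁻ ν, Sᶜ.indicator (1 : Config d × Z → ℝ≥0∞)
        (ν + particle y, z) ∂poissonLaw d ρ := by
      have : Measurable fun p : Pt d =>
        Sᶜ.indicator (1 : Config d × Z → ℝ≥0∞) (p.1 + particle p.2, z) :=
        hi.comp ((measurable_fst.add (measurable_particle.comp measurable_snd)).prodMk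
          measurable_const)
      exact this.lintegral_prod_left'
    refine (lintegral_eq_zero_iff hJ).2 ?_
    have hb : ∀ n : ℕ, ∀ᵐ y ∂(volume : Measure (E d)).restrict (Metric.ball 0 n),
        ∫⁻ ν, Sᶜ.indicator (1 : Config d × Z → ℝ≥0∞) (ν + particle y, z) ∂poissonLaw d ρ = 0 := by
      intro n
      have hm := lintegral_mecke ρ (V := Metric.ball (0 : E d) n) Metric.isOpen_ball.measurableSet
        Metric.isBounded_ball (F := fun μ _ => Sᶜ.indicator (1 : Config d × Z → ℝ≥0∞) (μ, z))
        (hiz.comp measurable_fst)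
      have hz' : ∫⁻ μ, ∫⁻ _, Sᶜ.indicator (1 : Config d × Z → ℝ≥0∞) (μ, z)
          ∂clipKernel (Metric.ball (0 : E d) n) μ ∂poissonLaw d ρ = 0 := by
        rw [← lintegral_zero (μ := poissonLaw d ρ)]
        refine lintegral_congr_ae ?_
        filter_upwards [(lintegral_eq_zero_iff hiz).1 hz] with μ hμ
        simp only [Pi.zero_apply] at hμ
        rw [hμ, lintegral_zero]
      rw [hz', eq_comm, mul_eq_zero] at hm
      exact (lintegral_eq_zero_iff hJ).1 (hm.resolve_left (by simpa using hρ))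
    have := (ae_restrict_iUnion_iff _ _).2 hb
    rwa [Metric.iUnion_ball_nat, Measure.restrict_univ] at this
  rw [lintegral_eq_zero_iff hi'] at key
  filter_upwards [key] with p hp
  by_contra hc
  simp [indicator, hc] at hp

/-- Iterated differences evaluate a field at configurations with added particles, and yet they are
well defined on classes of fields. This is why the coefficients do not depend on the version of the
optimal gradient. -/
theorem ae_itd_eq (hρ : 0 < ρ) (hF : Measurable (uncurry F)) (hF' : Measurable (uncurry F'))
    (h : ∀ᵐ p ∂(poissonLaw d ρ).prod ζ, F p.1 p.2 = F' p.1 p.2) (k : ℕ) : ∀ᵐ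
    p ∂(volume : Measure (Fin k → E d)).prod ((poissonLaw d ρ).prod ζ), itd k F p = itd k F' p := by
  induction k generalizing Z with
  | zero => exact Measure.quasiMeasurePreserving_snd.ae h
  | succ k ih =>
    have h1 := ae_poisson_add_particle hρ (measurableSet_eq_fun hF hF') h
    have h2 := ((measurePreserving_prodAssoc (poissonLaw d ρ) ζ
      (volume : Measure (E d))).symm _).quasiMeasurePreserving.ae
      (Measure.quasiMeasurePreserving_fst.ae h)
    have h3 := (measurePreserving_peel (poissonLaw d ρ) ζ volume k).quasiMeasurePreserving.ae
      (ih (measurable_dif hF) (measurable_dif hF') (by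
        filter_upwards [h1, h2] with p e1 e2
        exact congrArg₂ (· - ·) e1 e2))
    filter_upwards [h3] with p hp
    rwa [itd_succ, itd_succ]

/-! ### Integrals of iterated differences -/

instance (V : Set (E d)) : IsProbabilityMeasure (Measure.pi fun _ : Fin 0 => vol V) :=
  ⟨by rw [Measure.pi_of_empty]; simp⟩

variable [IsFiniteMeasure (vol V)]

theorem Geo.msq_itd_lt_top (hF : Geo V ζ F) (hρ : 0 ≤ ρ)
    (k : ℕ) : msq ((Measure.pi fun _ : Fin k => vol V).prod ((fv ρ V).prod ζ)) (itd k F) < ∞ := by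
  induction k generalizing Z with
  | zero =>
    refine (measurePreserving_snd.lintegral_comp (hF.meas.enorm.pow_const 2)).trans_lt
      (hF.msq_fz_lt_top hρ)
  | succ k ih =>
    have h1 := (measurePreserving_peel (fv ρ V) ζ (vol V) k).lintegral_comp
      ((measurable_itd (measurable_dif hF.meas) k).enorm.pow_const 2)
    simp only [← itd_succ] at h1
    exact h1.trans_lt (ih hF.dif)

theorem integral_fz_congr {Z' : Type} [MeasurableSpace Z'] {ζ' : Measure Z'} [SFinite ζ']
    {h : Config d × Z → ℝ} {h' : Config d × Z' → ℝ} (hi : Integrable h ((fv ρ V).prod ζ))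
    (hi' : Integrable h' ((fv ρ V).prod ζ')) (e : ∀ n, ∫ p, h p ∂lz V ζ n = ∫ p, h' p ∂lz V ζ' n) :
    ∫ p, h p ∂(fv ρ V).prod ζ = ∫ p, h' p ∂(fv ρ V).prod ζ' := by
  rw [fz_eq_sum] at hi hi' ⊢
  rw [fz_eq_sum]
  refine (hasSum_integral_measure hi).unique ((hasSum_integral_measure hi').congr_fun fun n => ?_)
  rw [integral_smul_measure, integral_smul_measure, e]

theorem Lev.av_dif (h : Lev V ζ F) : LevEq V ζ (Bulk.av V (Bulk.dif F)) (Bulk.iop V F) := fun n => by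
  filter_upwards [h.push.av_sub h.drop n] with p hp
  refine hp.trans ?_
  simp [Bulk.av, Bulk.iop, Bulk.sb, Bulk.push]

theorem Geo.drop (h : Geo V ζ F) : Geo V (ζ.prod (vol V)) fun η r => F η r.1 := by
  obtain ⟨K, r, hK⟩ := h.bound
  refine ⟨measurable_drop_fun h.meas, (volume V).toNNReal * K, r, fun n => ?_⟩
  refine (msq_drop h.meas n).trans_le ?_
  rw [ENNReal.coe_mul, ENNReal.coe_toNNReal volume_lt_top_of_vol.ne, mul_assoc]
  gcongr
  exact hK n

/-- The added points are integrated one at a time. One of them is made a parameter, the hypothesis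
is applied to `dif F`, and the average of `dif F` over that parameter is `iop V F`. -/
theorem integral_inner_itd (hρ : 0 ≤ ρ) (hf : Geo V ζ f) (hF : Geo V ζ F) (k : ℕ) : ∫ p,
    inner ℝ (f p.2.1 p.2.2) (itd k F p) ∂(Measure.pi fun _ : Fin k => vol V).prod ((fv ρ V).prod ζ)
    = ∫ p, inner ℝ (f p.1 p.2) ((iop V)^[k] F p.1 p.2) ∂(fv ρ V).prod ζ := by
  induction k generalizing Z with
  | zero =>
    have hm : Measurable fun p : Config d × Z => (inner ℝ (f p.1 p.2) (F p.1 p.2) : ℝ) :=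
      hf.meas.inner hF.meas
    have h1 : MeasurePreserving Prod.snd
      ((Measure.pi fun _ : Fin 0 => vol V).prod ((fv ρ V).prod ζ)) ((fv ρ V).prod ζ) :=
      measurePreserving_snd
    conv_rhs => rw [← h1.map_eq]
    exact (integral_map h1.measurable.aemeasurable hm.aestronglyMeasurable).symm
  | succ k ih =>
    have hP := measurePreserving_peel (fv ρ V) ζ (vol V) k
    have hm : Measurable fun p : (Fin k → E d) × (Config d × (Z × E d)) =>
        (inner ℝ (f p.2.1 p.2.2.1) (itd k (dif F) p) : ℝ) :=
      (hf.drop.meas.comp measurable_snd).inner (measurable_itd (measurable_dif hF.meas) k)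
    have h1 := integral_map (μ := (Measure.pi fun _ => vol V).prod ((fv ρ V).prod ζ))
      (f := fun p : (Fin k → E d) × (Config d × (Z × E d)) =>
      (inner ℝ (f p.2.1 p.2.2.1) (itd k (dif F) p) : ℝ)) hP.measurable.aemeasurable
      hm.aestronglyMeasurable
    rw [hP.map_eq, ih hf.drop hF.dif] at h1
    simp only [itd_succ]
    refine h1.symm.trans (integral_fz_congr ?_ ?_ fun n => ?_)
    · exact integrable_inner_of_msq hf.drop.meas (hF.dif.iop_iter k).meas
        (hf.drop.msq_fz_lt_top hρ) ((hF.dif.iop_iter k).msq_fz_lt_top hρ)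
    · exact integrable_inner_of_msq hf.meas (hF.iop_iter (k + 1)).meas
        (hf.msq_fz_lt_top hρ) ((hF.iop_iter (k + 1)).msq_fz_lt_top hρ)
    · rw [integral_inner_av (hF.dif.iop_iter k).lev hf.lev]
      refine integral_congr_ae ?_
      filter_upwards [hF.dif.lev.iop_iter_av k n, hF.lev.av_dif.iop_iter k n] with p e1 e2
      rw [← e1, e2, Function.iterate_succ_apply]

end IterDiff

/-! ### The coefficients -/

section Coefficients

variable {k m : ℕ} {f F g : Fld d}


/-- Absolute convergence on the whole space: the integrand vanishes unless all added points lie in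
`V`, and there the image of the Poisson law under `clip` is the finite-volume law. -/
theorem integral_inner_itd_clip (hρ : 0 ≤ ρ) (hD : Dom U V) (hf : Geo V (vol U) f)
    (hF : Geo V (vol U) F) (k : ℕ) : Integrable (fun p : (Fin k → E d) × (Pt d) => (inner ℝ (f (clip
    V p.2.1) p.2.2) (itd k (fun η z => F (clip V η) z) p) : ℝ)) (volume.prod (poisU ρ U)) ∧ ∫ p,
    inner ℝ (f (clip V p.2.1) p.2.2) (itd k (fun η z => F (clip V η) z) p) ∂(volume : Measure (Fin
    k → E d)).prod (poisU ρ U) = ∫ p, inner ℝ (f p.1 p.2) ((iop V)^[k] F p.1 p.2) ∂fvU ρ U V := by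
  classical
  have := hD.finV
  have := hD.finite_fvU hρ
  set B : Set (Fin k → E d) := univ.pi fun _ => V with hB
  have hBm : MeasurableSet B := MeasurableSet.univ_pi fun _ => hD.meas
  have hpi : (volume : Measure (Fin k → E d)).restrict B = Measure.pi fun _ => vol V :=
    Measure.restrict_pi_pi (fun _ : Fin k => (volume : Measure (E d))) fun _ => V
  set h : (Fin k → E d) × (Pt d) → ℝ := fun p => inner ℝ (f p.2.1 p.2.2) (itd k F p)
  have hm : Measurable h := (hf.meas.comp measurable_snd).inner (measurable_itd hF.meas k)
  have hi : Integrable h ((Measure.pi fun _ => vol V).prod (fvU ρ U V)) :=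
    integrable_inner_of_msq (hf.meas.comp measurable_snd) (measurable_itd hF.meas k) (by
      have hm2 : Measurable fun p : (Fin k → E d) × (Pt d) => ‖f p.2.1 p.2.2‖ₑ ^ 2 :=
        (hf.meas.comp measurable_snd).enorm.pow_const 2
      rw [msq, lintegral_prod _ hm2.aemeasurable]
      dsimp only
      rw [lintegral_const]
      exact mul_lt_top (hf.msq_fz_lt_top hρ) (measure_lt_top _ _))
      (hF.msq_itd_lt_top hρ k)
  have hcl : MeasurePreserving (Prod.map id fun p : Pt d => (clip V p.1, p.2))
      ((Measure.pi fun _ : Fin k => vol V).prod (poisU ρ U))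
      ((Measure.pi fun _ => vol V).prod (fvU ρ U V)) :=
    (MeasurePreserving.id _).prod ⟨((measurable_clip hD.meas).comp measurable_fst).prodMk
      measurable_snd, map_clip_poisU hρ hD⟩
  have hr : ((volume : Measure (Fin k → E d)).prod (poisU ρ U)).restrict (B ×ˢ univ)
      = (Measure.pi fun _ => vol V).prod (poisU ρ U) := by
    rw [← Measure.prod_restrict, Measure.restrict_univ, hpi]
  have hfin : ∀ᵐ p ∂(volume : Measure (Fin k → E d)).prod (poisU ρ U),
      p.2.1.1 V < ∞ :=
    Measure.quasiMeasurePreserving_snd.ae (Measure.quasiMeasurePreserving_fst.ae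
      (ae_poissonLaw_lt_top ρ hD.meas hD.bdd))
  have he : (fun p : (Fin k → E d) × (Pt d) => (inner ℝ (f (clip V p.2.1) p.2.2)
      (itd k (fun η z => F (clip V η) z) p) : ℝ)) =ᵐ[volume.prod (poisU ρ U)]
      (B ×ˢ univ).indicator (h ∘ Prod.map id fun p : Pt d => (clip V p.1, p.2)) := by
    filter_upwards [hfin] with p hp
    rw [itd, iterDiff_clip hD.meas k p.1 (fun η => F η p.2.2) hp]
    by_cases hx : ∀ i, p.1 i ∈ V
    · have hp' : p ∈ B ×ˢ (univ : Set (Pt d)) := ⟨fun i _ => hx i, mem_univ _⟩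
      rw [if_pos hx, indicator_of_mem hp']; rfl
    · have hp' : p ∉ B ×ˢ (univ : Set (Pt d)) := fun hc => hx fun i => hc.1 i (mem_univ i)
      rw [if_neg hx, inner_zero_right, indicator_of_notMem hp']
  have hms : MeasurableSet (B ×ˢ (univ : Set (Pt d))) := hBm.prod MeasurableSet.univ
  refine ⟨Integrable.congr ?_ he.symm, ?_⟩
  · rw [integrable_indicator_iff hms, IntegrableOn, hr]
    exact (hcl.integrable_comp hm.aestronglyMeasurable).2 hi
  · rw [integral_congr_ae he, integral_indicator hms, hr]
    refine Eq.trans ?_ (integral_inner_itd hρ hf hF k)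
    change _ = ∫ p, h p ∂(Measure.pi fun _ => vol V).prod (fvU ρ U V)
    rw [← hcl.map_eq, integral_map hcl.measurable.aemeasurable hm.aestronglyMeasurable]
    rfl

/-- In the first integral `iop^[k] g` is a potential field, against which the flux `A g` may be
replaced by `q`. In the second, for `k ≠ 0`, `iop^[k] (A g)` is the image of the residual, hence
solenoidal and orthogonal to `g`. -/
theorem IsCorr.integral_iop_iter (hρ : 0 ≤ ρ) (hD : Dom U V) (hA : IsField Λ A) (h :
    IsCorr U V A q g) (hk : k ≠ 0) : ∫ p, inner ℝ (A p.1 p.2 (g p.1 p.2)) ((iop V)^[k] g p.1 p.2)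
    ∂fvU ρ U V - ∫ p, inner ℝ (g p.1 p.2) ((iop V)^[k] (fun η z => A η z (g η z)) p.1 p.2)
    ∂fvU ρ U V = ∫ p, inner ℝ q ((iop V)^[k] g p.1 p.2) ∂fvU ρ U V := by
  have := hD.finV
  have hg := h.geo hD hA
  have h1 := h.integral_inner_flux hρ hD hA (iop_iter_mem_potSet hD h.mem_potSet k) (hg.iop_iter k)
  have h2 : ∫ p, inner ℝ (g p.1 p.2) ((iop V)^[k] (resid A q g) p.1 p.2) ∂fvU ρ U V = 0 :=
    (polar_potSet hD).orth_fz hρ h.mem_potSet (iop_iter_mem_solSet hD (h.resid_mem hD hA) k) hg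
      (((h.geo_flux hD hA).sub (geo_const hD q)).iop_iter k)
  have h3 : ∫ p, inner ℝ (g p.1 p.2) ((iop V)^[k] (fun η z => A η z (g η z)) p.1 p.2) ∂fvU ρ U V
      = 0 := by
    rw [← h2]
    refine integral_congr_ae ?_
    filter_upwards [(iop_iter_resid hD hA h hk).ae_fz ρ] with p hp
    rw [hp]
  rw [h3, sub_zero]
  simp only [fun p : Pt d => real_inner_comm ((iop V)^[k] g p.1 p.2)]
  exact h1.symm

/-- The unmarked coefficient is frozen, so it commutes with the difference operators, and by
symmetry it moves onto the first gradient. What remains is `Ψ`, the pairing of `A g` with the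
differences of `g` minus the pairing of `g` with the differences of `A g`. -/
theorem IsOptimizer.coeff_eq (hd : 1 ≤ d) (hρ : 0 < ρ) (ha : Admissible Λ a₀) (hk : k ≠ 0) (hD :
    Dom (cube d m) V) (h : IsCorr (cube d m) V (fieldOf a₀ V) q g) {ψ : Config d → ℝ} {G : Fld d}
    (hG : IsOptimizer a₀ (cube d m) q ρ ψ G) : CoeffIntegrable a₀ ρ m k G ∧ coeff a₀ ρ m k G =
    (volume.real (cube d m))⁻¹ * ∫ p, inner ℝ q ((iop V)^[k] g p.1 p.2) ∂fvU ρ (cube d m) V := by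
  have := hD.finV
  have hA := ha.isField hd hD.meas
  set U := cube d m with hU
  set A := fieldOf a₀ V with hAdef
  set Γ : Fld d := fun η z => pull G (η, z) with hΓ
  have hΓm : Measurable (uncurry Γ) := measurable_pull hG.1.2.1
  have hAΓm : Measurable (uncurry fun η z => A η z (Γ η z)) :=
    measurable_clm_apply hA.meas hΓm
  have hgm : Measurable (uncurry fun η z => g (clip V η) z) :=
    measurable_lift hD.meas h.meas
  have hAgm : Measurable (uncurry fun η z => A (clip V η) z (g (clip V η) z)) :=
    measurable_lift hD.meas (h.geo_flux hD hA).meas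
  have e1 : ∀ᵐ p ∂poisU ρ U, Γ p.1 p.2 = g (clip V p.1) p.2 :=
    h.pull_eq_of_isOptimizer hd hρ hD ha hG
  have e2 : ∀ᵐ p ∂poisU ρ U, A p.1 p.2 (Γ p.1 p.2) = A (clip V p.1) p.2 (g (clip V p.1) p.2) := by
    filter_upwards [e1] with p hp
    rw [hp, hAdef, fieldOf_clip a₀ hD.meas]
  set Ψ : (Fin k → E d) × (Pt d) → ℝ := fun p =>
    inner ℝ (A p.2.1 p.2.2 (Γ p.2.1 p.2.2)) (itd k Γ p)
      - inner ℝ (Γ p.2.1 p.2.2) (itd k (fun η z => A η z (Γ η z)) p) with hΨ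
  have hΨm : Measurable Ψ := ((hAΓm.comp measurable_snd).inner (measurable_itd hΓm k)).sub
    ((hΓm.comp measurable_snd).inner (measurable_itd hAΓm k))
  have i1 := integral_inner_itd_clip hρ.le hD (h.geo_flux hD hA) (h.geo hD hA) k
  have i2 := integral_inner_itd_clip hρ.le hD (h.geo hD hA) (h.geo_flux hD hA) k
  have hae : Ψ =ᵐ[volume.prod (poisU ρ U)] fun p =>
      inner ℝ (A (clip V p.2.1) p.2.2 (g (clip V p.2.1) p.2.2))
        (itd k (fun η z => g (clip V η) z) p)
      - inner ℝ (g (clip V p.2.1) p.2.2)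
        (itd k (fun η z => A (clip V η) z (g (clip V η) z)) p) := by
    filter_upwards [ae_itd_eq hρ hΓm hgm e1 k,
      ae_itd_eq hρ hAΓm hAgm e2 k,
      Measure.quasiMeasurePreserving_snd.ae e1, Measure.quasiMeasurePreserving_snd.ae e2]
      with p h1 h2 h3 h4
    simp only [hΨ, h1, h2, h4]
    rw [h3]
  have hitg : Integrable Ψ (volume.prod (poisU ρ U)) := (i1.1.sub i2.1).congr hae.symm
  have hval : ∫ p, Ψ p ∂(volume : Measure (Fin k → E d)).prod (poisU ρ U)
      = ∫ p, inner ℝ q ((iop V)^[k] g p.1 p.2) ∂fvU ρ U V := by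
    rw [integral_congr_ae hae, integral_sub i1.1 i2.1, i1.2, i2.2]
    exact h.integral_iop_iter hρ.le hD hA hk
  have hS : ∀ η ∈ {η : Config d | η.1 V < ∞}, ∀ y,
      η + particle y ∈ {η : Config d | η.1 V < ∞} :=
    fun η hη y => (mass_add_particle_lt hD.meas).2 hη
  have hpt : ∀ (x : Fin k → E d) (ν : Config d) (z : E d), ν.1 V < ∞ → z ∈ U →
      inner ℝ (G (ν + particle z) z) (iterDiff k x (fun μ' => (aField a₀ (ν + particle z) z
        - aField a₀ μ' z).toEuclideanLin (G μ' z)) (ν + particle z)) = Ψ (x, (ν, z)) := by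
    intro x ν z hν hz
    have hf : ∀ η : Config d, η.1 V < ∞ → ∀ v : E d,
        (aField a₀ (η + particle z) z).toEuclideanLin v = A η z v := fun η hη v => by
      rw [hAdef, fieldOf, ha.aField_clip_add (hD.thick z hz) hη]; rfl
    rw [iterDiff_add_particle, iterDiff_congr hS (f' := fun η => A ν z (Γ η z) - A η z (Γ η z))
      (fun η hη => by rw [map_sub, LinearMap.sub_apply, hf ν hν, hf η hη]; rfl) k x hν,
      iterDiff_sub, iterDiff_clm, inner_sub_right, ← hA.symm]
    rfl
  -- The Mecke formula for fixed added points. `coeffIntegrand` contains `aField`, so it is compared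
  -- at the particles with the measurable `Ψ`; integrability is known for almost every `x` by
  -- Fubini.
  have hmecke : ∀ x : Fin k → E d, Integrable (fun w => Ψ (x, w)) (poisU ρ U) →
      Integrable (coeffIntegrand a₀ ρ m k G x) (poissonLaw d ρ) ∧
      ∫ μ, coeffIntegrand a₀ ρ m k G x μ ∂poissonLaw d ρ
        = (volume.real U)⁻¹ * ∫ w, Ψ (x, w) ∂poisU ρ U := by
    intro x hx
    have hw : (fun w : Pt d => Ψ (x, (remIn V (w.1 + particle w.2, w.2), w.2)))
        =ᵐ[poisU ρ U] fun w => Ψ (x, w) := by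
      filter_upwards [Measure.quasiMeasurePreserving_fst.ae (ae_poissonLaw_lt_top ρ hD.meas hD.bdd),
        Measure.quasiMeasurePreserving_snd.ae (ae_restrict_mem hD.measU)] with w h1 h2
      rw [remIn_add_particle hD.meas (hD.subset h2) h1]
    have hM := integral_mecke_restrict hρ.le hD
      (F := fun μ z => inner ℝ (G μ z) (iterDiff k x (fun μ' => (aField a₀ μ z
        - aField a₀ μ' z).toEuclideanLin (G μ' z)) μ))
      (F' := fun μ z => Ψ (x, (remIn V (μ, z), z)))
      (hΨm.comp (measurable_const.prodMk ((measurable_remIn hD.meas).prodMk measurable_snd)))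
      (fun ν z hν hz => by
        rw [remIn_add_particle hD.meas (hD.subset hz) hν]; exact hpt x ν z hν hz)
      (hx.congr hw.symm)
    rw [integral_congr_ae hw] at hM
    refine ⟨hM.1.const_mul _, ?_⟩
    simp only [coeffIntegrand]
    rw [integral_const_mul]
    refine (congrArg _ hM.2).trans ?_
    field_simp
    rw [← hU]
  have hxa := hitg.prod_right_ae
  have hc : (fun x : Fin k → E d => ∫ μ, coeffIntegrand a₀ ρ m k G x μ ∂poissonLaw d ρ)
      =ᵐ[volume] fun x => (volume.real U)⁻¹ * ∫ w, Ψ (x, w) ∂poisU ρ U := by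
    filter_upwards [hxa] with x hx using (hmecke x hx).2
  refine ⟨⟨by filter_upwards [hxa] with x hx using (hmecke x hx).1,
    (hitg.integral_prod_left.const_mul _).congr hc.symm⟩, ?_⟩
  rw [coeff, integral_congr_ae hc, integral_const_mul, ← integral_prod _ hitg, hval]

end Coefficients

/-! ### Derivatives in the intensity -/

section Derivatives

variable {F g : Fld d}


theorem summable_mul_pow_div_factorial {a : ℕ → ℝ} {K r : ℝ}
    (ha : ∀ n, |a n| ≤ K * r ^ n) (x : ℝ) : Summable fun n => a n * (x ^ n / n.factorial) := by
  refine Summable.of_norm_bounded ((Real.summable_pow_div_factorial (r * |x|)).mul_left K) fun n => ?_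
  rw [norm_mul, norm_div, norm_pow, Real.norm_eq_abs, Real.norm_eq_abs, Real.norm_natCast]
  refine (mul_le_mul_of_nonneg_right (ha n) (by positivity)).trans_eq ?_
  rw [mul_pow]; ring

theorem hasDerivAt_tsum_pow_div_factorial {a : ℕ → ℝ} {K r : ℝ}
    (ha : ∀ n, |a n| ≤ K * r ^ n) (x : ℝ) : HasDerivAt (fun x => ∑' n, a n * (x ^ n / n.factorial))
    (∑' n, a (n + 1) * (x ^ n / n.factorial)) x := by
  have ha' : ∀ n, |a (n + 1)| ≤ K * r * r ^ n := fun n => (ha (n + 1)).trans_eq (by rw [pow_succ]; ring)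
  set g' : ℕ → ℝ → ℝ := fun n y => a n * (n * y ^ (n - 1) / n.factorial)
  have hg0 : ∀ y, g' 0 y = 0 := fun y => by simp [g']
  have hg1 : ∀ n y, g' (n + 1) y = a (n + 1) * (y ^ n / n.factorial) := fun n y => by
    have : ((n : ℝ) + 1) ≠ 0 := by positivity
    simp only [g', Nat.factorial_succ, Nat.add_sub_cancel]
    push_cast
    rw [mul_div_mul_left _ _ this]
  have hx := summable_mul_pow_div_factorial ha'
  have h := hasDerivAt_tsum_of_isPreconnected (t := Metric.ball (0 : ℝ) (|x| + 1)) (y₀ := 0) (y := x)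
    (g := fun n y => a n * (y ^ n / n.factorial)) (g' := g')
    (u := fun n => |g' n (|x| + 1)|) ?_ Metric.isOpen_ball
    (convex_ball (0 : ℝ) _).isPreconnected (fun n y _ => ((hasDerivAt_pow n y).div_const _).const_mul _)
    (fun n y hy => ?_) (by simp; positivity) ?_ (by simp)
  · have h2 : Summable fun n => g' n x := (summable_nat_add_iff 1).1 ((hx x).congr fun n => (hg1 n x).symm)
    rw [h2.tsum_eq_zero_add, hg0, zero_add] at h
    simpa only [hg1] using h
  · refine (summable_nat_add_iff 1).1 ((hx (|x| + 1)).abs.congr fun n => ?_)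
    rw [hg1]
  · simp only [g', norm_mul, Real.norm_eq_abs, abs_mul, norm_div, abs_div, norm_pow, abs_pow]
    have : |y| ≤ |(|x| + 1)| := by
      rw [mem_ball_zero_iff, Real.norm_eq_abs] at hy
      exact hy.le.trans (le_abs_self _)
    gcongr
  · exact summable_of_ne_finset_zero (s := {0}) fun n hn => by
      rw [Finset.mem_singleton] at hn; simp [hn]

/-- The integral of `q · F` for the Poisson process of intensity `ρ` in `V`. -/
def expect (U V : Set (E d)) (q : E d) (F : Fld d) (ρ : ℝ) : ℝ :=
  ∫ p, inner ℝ q (F p.1 p.2) ∂fvU ρ U V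

theorem Geo.expect_eq (hF : Geo V (vol U) F)
    (hD : Dom U V) (hρ : 0 ≤ ρ) (q : E d) : expect U V q F ρ = Real.exp (-(ρ * volume.real V))
    * ∑' n, (∫ p, inner ℝ q (F p.1 p.2) ∂lz V (vol U) n) * (ρ ^ n / n.factorial) := by
  have hi := hF.integrable_const_inner hD hρ q
  rw [fvU_eq_sum] at hi
  rw [expect, fvU_eq_sum, ← (hasSum_integral_measure hi).tsum_eq, ← tsum_mul_left]
  refine tsum_congr fun n => ?_
  rw [integral_smul_measure, fvW, ENNReal.toReal_ofReal (by positivity), smul_eq_mul]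
  change _ * (∫ p, inner ℝ q (F p.1 p.2) ∂lz V (vol U) n) = _
  ring

/-- With `a n` the integral over level `n` and `v = |V|`, the function is `exp(-ρ v) ∑ a n ρ^n /
n!`. Differentiation replaces `a n` by `a (n + 1) - v a n`, and this is the integral of `iop V F`
over level `n`. -/
theorem Geo.hasDerivAt_expect (hF : Geo V (vol U) F) (hD : Dom U V)
    (hρ : 0 < ρ) (q : E d) : HasDerivAt (expect U V q F) (expect U V q (Bulk.iop V F) ρ) ρ := by
  have := hD.finV
  set v := volume.real V
  set a : ℕ → ℝ := fun n => ∫ p, inner ℝ q (F p.1 p.2) ∂lz V (vol U) n with ha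
  have hq := geo_const hD q
  obtain ⟨K, r, hK⟩ := hF.bound
  obtain ⟨K', r', hK'⟩ := hq.bound
  have hb : ∀ n, |a n| ≤ (1 + K * K') * ((1 + r * r' : ℝ≥0) : ℝ) ^ n := fun n => by
    have h1 : ‖a n‖ₑ ^ 2 ≤ _ := enorm_integral_inner_sq_le (m := lz V (vol U) n)
      (f := fun _ => q) (h := uncurry F) measurable_const hF.meas
    have h2 : ‖a n‖ₑ ^ 2 ≤ ((K * K' * (r * r') ^ n : ℝ≥0) : ℝ≥0∞) :=
      (h1.trans (mul_le_mul' (hK' n) (hK n))).trans_eq (by push_cast; rw [mul_pow]; ring)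
    have h3 : |a n| ^ 2 ≤ K * K' * (r * r') ^ n := by
      rw [← ofReal_norm, ← ENNReal.ofReal_pow (norm_nonneg _), ← ENNReal.ofReal_coe_nnreal,
        ENNReal.ofReal_le_ofReal_iff (by positivity)] at h2
      exact_mod_cast h2
    have h4 : ((r : ℝ) * r') ^ n ≤ (1 + r * r') ^ n := by gcongr; linarith
    have h5 : (1 : ℝ) ≤ (1 + r * r') ^ n := one_le_pow₀ (le_add_of_nonneg_right (by positivity))
    have h6 : (0 : ℝ) ≤ K * K' := by positivity
    push_cast
    refine (pow_le_pow_iff_left₀ (abs_nonneg _) (by positivity) two_ne_zero).1 (h3.trans ?_)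
    have h7 : 1 ≤ (1 + (K : ℝ) * K') * (1 + r * r') ^ n := one_le_mul_of_one_le_of_one_le
      (le_add_of_nonneg_right h6) h5
    refine le_trans ?_ (le_self_pow₀ h7 two_ne_zero)
    exact mul_le_mul (by linarith) h4 (by positivity) (by positivity)
  have hexp : HasDerivAt (fun ρ => Real.exp (-(ρ * v))) (Real.exp (-(ρ * v)) * -v) ρ := by
    simpa using ((hasDerivAt_id ρ).mul_const v).neg.exp
  have hser := hexp.mul (hasDerivAt_tsum_pow_div_factorial hb ρ)
  have heq : expect U V q F =ᶠ[𝓝 ρ] fun ρ => Real.exp (-(ρ * v)) * ∑' n, a n * (ρ ^ n / n.factorial) := by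
    filter_upwards [lt_mem_nhds hρ] with ρ' hρ' using hF.expect_eq hD hρ'.le q
  have hlev : ∀ n, ∫ p, inner ℝ q (Bulk.iop V F p.1 p.2) ∂lz V (vol U) n = a (n + 1) - v * a n := by
    intro n
    have h1 := integral_inner_av hF.lev.push hq.lev n
    have h2 := (integral_inner_push hq.lev hF.lev n).symm.trans h1
    have i1 := hq.lev.integrable_inner hF.lev.sb n
    have i2 := (hq.lev.integrable_inner hF.lev n).const_mul v
    simp only [Bulk.iop, inner_sub_right, real_inner_smul_right]
    rw [integral_sub i1 i2, integral_const_mul]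
    exact congrArg (· - v * a n) h2.symm
  refine (hser.congr_of_eventuallyEq heq).congr_deriv ?_
  have s0 := summable_mul_pow_div_factorial hb ρ
  have s1 := summable_mul_pow_div_factorial (a := fun n => a (n + 1)) (r := ((1 + r * r' : ℝ≥0) : ℝ))
    (K := (1 + K * K') * ((1 + r * r' : ℝ≥0) : ℝ))
    (fun n => (hb (n + 1)).trans_eq (by rw [pow_succ']; ring)) ρ
  rw [hF.iop.expect_eq hD hρ.le]
  simp only [hlev, sub_mul, mul_assoc]
  rw [s1.tsum_sub (s0.mul_left v), tsum_mul_left]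
  ring

end Derivatives

/-! ### Limits of functions with bounded derivatives -/

section Limits

variable {B : ℕ → ℝ} {D : ℕ → ℝ → ℝ} {x y : ℝ}

/-- `D k` is the `k`-th derivative of `D 0` on the half-line, and it is bounded by `B k`. -/
structure Chain (B : ℕ → ℝ) (D : ℕ → ℝ → ℝ) : Prop where
  deriv : ∀ k x, 0 < x → HasDerivAt (D k) (D (k + 1) x) x
  bdd : ∀ k x, 0 < x → |D k x| ≤ B k

theorem hasDerivAt_taylor_sum (a : ℕ → ℝ) (k : ℕ)
    (x y : ℝ) : HasDerivAt (fun y => ∑ l ∈ Finset.range (k + 1), a l * ((y - x) ^ l / l.factorial))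
    (∑ l ∈ Finset.range k, a (l + 1) * ((y - x) ^ l / l.factorial)) y := by
  have h : HasDerivAt (fun y => ∑ l ∈ Finset.range (k + 1), a l * ((y - x) ^ l / l.factorial))
      (∑ l ∈ Finset.range (k + 1), a l * (l * (y - x) ^ (l - 1) * 1 / l.factorial)) y :=
    HasDerivAt.fun_sum fun l _ =>
      ((((hasDerivAt_id y).sub_const x).pow l).div_const _).const_mul _
  refine h.congr_deriv ?_
  rw [Finset.sum_range_succ']
  simp only [CharP.cast_eq_zero, zero_mul, zero_div, mul_zero, add_zero, mul_one,
    Nat.add_sub_cancel, Nat.factorial_succ]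
  refine Finset.sum_congr rfl fun l _ => ?_
  push_cast
  rw [mul_div_mul_left _ _ (by positivity)]

/-- The derivative of the remainder of `D j` at order `k + 1` is the remainder of `D (j + 1)` at
order `k`; the mean value inequality then adds one power of `|y - x|`. The factor `1/k!` is given
up. -/
theorem Chain.taylor (h : Chain B D) (k j : ℕ) (hx : 0 < x) (hy : 0 < y) : |D j y -
    ∑ l ∈ Finset.range k, D (j + l) x * ((y - x) ^ l / l.factorial)| ≤ B (j + k) * |y - x| ^ k := by
  induction k generalizing j y with
  | zero => simpa using h.bdd j y hy
  | succ k ih =>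
    have hpos : ∀ t ∈ uIcc x y, 0 < t := fun t ht => (lt_min hx hy).trans_le ht.1
    have hB : 0 ≤ B (j + (k + 1)) := (abs_nonneg _).trans (h.bdd _ x hx)
    have key := Convex.norm_image_sub_le_of_norm_hasDerivWithin_le (s := uIcc x y) (x := x) (y := y)
      (f := fun y => D j y - ∑ l ∈ Finset.range (k + 1), D (j + l) x * ((y - x) ^ l / l.factorial))
      (C := B (j + (k + 1)) * |y - x| ^ k)
      (fun t ht => ((h.deriv j t (hpos t ht)).sub
        (hasDerivAt_taylor_sum (fun l => D (j + l) x) k x t)).hasDerivWithinAt)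
      (fun t ht => ?_) (convex_uIcc x y) left_mem_uIcc right_mem_uIcc
    · rw [Finset.sum_range_succ' (n := k) (f := fun l => D (j + l) x * ((x - x) ^ l / l.factorial))]
        at key
      simpa [pow_succ, mul_assoc] using key
    · have h1 := ih (j + 1) (hpos t ht)
      simp only [add_right_comm j, add_assoc j] at h1 ⊢
      refine h1.trans ?_
      gcongr B (j + (k + 1)) * ?_ ^ k
      exact abs_sub_left_of_mem_uIcc ht

/-- A difference quotient with step `t` approximates the next derivative up to `B t`, uniformly in
`m`. Convergence of `D m k` at two points thus makes `D m (k + 1)` a Cauchy sequence, and the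
quadratic bound passes to the limit and identifies its derivatives. -/
theorem Chain.limit {D : ℕ → ℕ → ℝ → ℝ}
    (h : ∀ m, Chain B (D m)) (h0 : ∀ x, 0 < x → ∃ l, Tendsto (fun m => D m 0 x) atTop (𝓝 l)) :
    ∃ c : ℕ → ℝ → ℝ, Chain B c ∧ ∀ k x, 0 < x → Tendsto (fun m => D m k x) atTop (𝓝 (c k x)) := by
  have hq : ∀ m k {x y : ℝ}, 0 < x → 0 < y →
      |D m k y - D m k x - (y - x) * D m (k + 1) x| ≤ B (k + 2) * |y - x| ^ 2 := by
    intro m k x y hx hy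
    have h1 := (h m).taylor 2 k hx hy
    simp only [Finset.sum_range_succ, Finset.range_zero, Finset.sum_empty, zero_add, add_zero, pow_zero,
      Nat.factorial_zero, Nat.cast_one, div_one, mul_one, pow_one, Nat.factorial_one] at h1
    rwa [← sub_sub, mul_comm (D m (k + 1) x)] at h1
  have hB : ∀ k, 0 ≤ B k := fun k => (abs_nonneg _).trans ((h 0).bdd k 1 one_pos)
  have hlim : ∀ k x, 0 < x → ∃ l, Tendsto (fun m => D m k x) atTop (𝓝 l) := by
    intro k
    induction k with
    | zero => exact h0
    | succ k ih =>
      intro x hx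
      refine cauchySeq_tendsto_of_complete (Metric.cauchySeq_iff'.2 fun ε hε => ?_)
      set b := B (k + 2) + 1 with hb
      have hbp : 0 < b := by linarith [hB (k + 2)]
      -- With this step the Taylor error `B (k + 2) t²` is less than `t ε / 4`. Two such errors and
      -- the Cauchy error `t ε / 2` of the increments add up to `t ε`.
      set t := ε / (4 * b) with ht
      have htp : 0 < t := by positivity
      obtain ⟨l, hl⟩ := ih x hx
      obtain ⟨l', hl'⟩ := ih (x + t) (by linarith)
      obtain ⟨N, hN⟩ := Metric.cauchySeq_iff'.1 ((hl'.sub hl).cauchySeq) (t * (ε / 2)) (by positivity)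
      refine ⟨N, fun n hn => ?_⟩
      have h1 := hq n k hx (y := x + t) (by linarith)
      have h2 := hq N k hx (y := x + t) (by linarith)
      have h3 := hN n hn
      rw [Real.dist_eq] at h3 ⊢
      rw [add_sub_cancel_left, sq_abs] at h1 h2
      have h4 : B (k + 2) * t ^ 2 < t * (ε / 4) := by
        have : t * (ε / 4) = b * t ^ 2 := by rw [ht]; field_simp
        rw [this]; gcongr; linarith
      refine lt_of_mul_lt_mul_left (a := t) ?_ htp.le
      rw [← abs_of_pos htp, ← abs_mul, abs_of_pos htp]
      rw [abs_le] at h1 h2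
      rw [abs_lt] at h3 ⊢
      constructor <;> linarith [h1.1, h1.2, h2.1, h2.2, h3.1, h3.2]
  choose! c hc using hlim
  refine ⟨c, ⟨fun k x hx => ?_, fun k x hx => ?_⟩, hc⟩
  · have hqc : ∀ y, 0 < y → |c k y - c k x - (y - x) * c (k + 1) x| ≤ B (k + 2) * |y - x| ^ 2 :=
      fun y hy => le_of_tendsto' ((((hc k y hy).sub (hc k x hx)).sub
        ((hc (k + 1) x hx).const_mul _)).abs) fun m => hq m k hx hy
    rw [hasDerivAt_iff_isLittleO]
    refine Asymptotics.IsBigO.trans_isLittleO (Asymptotics.IsBigO.of_bound (B (k + 2)) ?_)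
      (Asymptotics.isLittleO_pow_sub_sub x one_lt_two)
    filter_upwards [lt_mem_nhds hx] with y hy
    simpa using hqc y hy
  · exact le_of_tendsto' (hc k x hx).abs fun m => (h m).bdd k x hx

theorem Chain.iteratedDeriv_eq (h : Chain B D) {f : ℝ → ℝ}
    (hf : ∀ x, 0 < x → f x = D 0 x) (l : ℕ) (hx : 0 < x) : iteratedDeriv l f x = D l x := by
  induction l generalizing x with
  | zero => simpa using hf x hx
  | succ l ih =>
    rw [iteratedDeriv_succ]
    refine ((h.deriv l x hx).congr_of_eventuallyEq ?_).deriv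
    filter_upwards [lt_mem_nhds hx] with y hy using ih hy

theorem Chain.contDiffOn (h : Chain B D)
    {f : ℝ → ℝ} (hf : ∀ x, 0 < x → f x = D 0 x) : ContDiffOn ℝ ((⊤ : ℕ∞) : WithTop ℕ∞) f (Ioi 0) :=
  contDiffOn_of_differentiableOn_deriv fun k _ x hx =>
    ((h.deriv k x hx).differentiableAt.differentiableWithinAt).congr
      (fun _ hy => (iteratedDerivWithin_of_isOpen isOpen_Ioi hy).trans (h.iteratedDeriv_eq hf k hy))
      ((iteratedDerivWithin_of_isOpen isOpen_Ioi hx).trans (h.iteratedDeriv_eq hf k hx))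

/-- The derivatives of the finite-volume quantities, with bounds uniform in the domain. -/
theorem exists_chain (d : ℕ) (Λ r : ℝ) : ∃ B : ℕ → ℝ, ∀ (U V : Set (E d)) (_ : Dom U V)
    (A : Coef d) (_ : IsField Λ A) (q : E d) (_ : ‖q‖ = r) (g : Fld d) (_ : IsCorr U V A q g),
    Chain B fun k ρ => (volume.real U)⁻¹ * expect U V q ((iop V)^[k] g) ρ := by
  -- Only the order `j = 0` of the energy bounds is needed in the end. By Cauchy-Schwarz, `|E ∫ q ·
  -- iop^[k] g|²` is at most `|q|² |U|` times `C |q|² |U|`, which is proportional to `|U|²`.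
  choose C hC hCb using fun k => exists_nn_corr_le d Λ k 0
  refine ⟨fun k => (1 + (C k).toReal) * r ^ 2, fun U V hD A hA q hq g h =>
    ⟨fun k ρ hρ => ?_, fun k ρ hρ => ?_⟩⟩ <;> have := hD.finV
  · rw [Function.iterate_succ_apply']
    exact (((h.geo hD hA).iop_iter k).hasDerivAt_expect hD hρ q).const_mul _
  · have hg := (h.geo hD hA).iop_iter k
    have h1 := enorm_integral_inner_sq_le (m := fvU ρ U V) (f := fun _ => q)
      (h := uncurry ((iop V)^[k] g)) measurable_const hg.meas
    have h2 := hCb k ρ hρ.le U V hD A hA q g h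
    rw [nn_zero hg.meas] at h2
    have hv := hD.vol_pos
    have h3 : |expect U V q ((iop V)^[k] g) ρ| ^ 2
        ≤ (r ^ 2 * volume.real U) * ((C k).toReal * (r ^ 2 * volume.real U)) := by
      have h4 := h1.trans (mul_le_mul' ((msq_const (fvU ρ U V) q).le.trans_eq
        (by rw [fvU_univ hρ.le U hD.bdd])) h2)
      have hU : volume U ≠ ∞ := hD.bddU.measure_lt_top.ne
      have h5 := ENNReal.toReal_mono (by finiteness [hC k]) h4
      simp only [ENNReal.toReal_mul, ENNReal.toReal_pow, toReal_enorm, hq] at h5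
      exact h5
    rw [abs_mul, abs_inv, abs_of_pos hv, inv_mul_le_iff₀ hv]
    refine (pow_le_pow_iff_left₀ (abs_nonneg _) (by positivity) two_ne_zero).1 (h3.trans ?_)
    have h6 : (C k).toReal ≤ (1 + (C k).toReal) ^ 2 := by
      nlinarith [ENNReal.toReal_nonneg (a := C k)]
    calc _ = (C k).toReal * (volume.real U * r ^ 2) ^ 2 := by ring
      _ ≤ (1 + (C k).toReal) ^ 2 * (volume.real U * r ^ 2) ^ 2 := by gcongr
      _ = _ := by ring

end Limits

end Bulk

end

/-! ### The theorem -/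

theorem theorem2p2 (d : ℕ) (hd : 1 ≤ d) (Λ r : ℝ) :
    ∃ C : ℕ → ℝ, ∀ a₀ : Config d → Matrix (Fin d) (Fin d) ℝ, Admissible Λ a₀ →
      ∀ q : E d, ‖q‖ = r →
      -- the finite-volume matrices, the bulk diffusion matrix and the optimizers are well defined
      (∀ ρ₀ : ℝ, 0 < ρ₀ →
        (∀ m : ℕ, (aStar a₀ (cube d m) ρ₀ - 1).PosSemidef ∧
          (Λ • (1 : Matrix (Fin d) (Fin d) ℝ) - aStar a₀ (cube d m) ρ₀).PosSemidef ∧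
          ∀ p : E d, nuStar a₀ (cube d m) p ρ₀ = 1 / 2 * invForm (aStar a₀ (cube d m) ρ₀) p) ∧
        Tendsto (fun m : ℕ => aStar a₀ (cube d m) ρ₀) atTop (𝓝 (aBar a₀ ρ₀)) ∧
        ∀ m : ℕ, ∃ ψ G, IsOptimizer a₀ (cube d m) q ρ₀ ψ G) ∧
      ∃ c : ℕ → ℝ → ℝ,
        -- for every version of the optimizers, the limit exists and equals `c_k(ρ₀)`
        (∀ k : ℕ, 1 ≤ k → ∀ ρ₀ : ℝ, 0 < ρ₀ →
          ∀ (ψ : ℕ → Config d → ℝ) (G : ℕ → Config d → E d → E d),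
            (∀ m, IsOptimizer a₀ (cube d m) q ρ₀ (ψ m) (G m)) →
            (∀ m, CoeffIntegrable a₀ ρ₀ m k (G m)) ∧
              Tendsto (fun m => coeff a₀ ρ₀ m k (G m)) atTop (𝓝 (c k ρ₀))) ∧
        -- the expansion, with a constant that depends only on `d`, `Λ`, `k` and `|q|`
        (∀ k : ℕ, 1 ≤ k → ∀ ρ₀ : ℝ, 0 < ρ₀ → ∀ ρ : ℝ, 0 < ρ₀ + ρ →
          |invForm (aBar a₀ (ρ₀ + ρ)) q - (invForm (aBar a₀ ρ₀) q
              + ∑ l ∈ Finset.Icc 1 k, c l ρ₀ * (ρ ^ l / (l.factorial : ℝ)))|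
            ≤ C k * |ρ| ^ (k + 1)) ∧
        -- smoothness
        ContDiffOn ℝ ((⊤ : ℕ∞) : WithTop ℕ∞) (fun ρ => invForm (aBar a₀ ρ) q) (Ioi 0) ∧
        ∀ l : ℕ, 1 ≤ l → ∀ ρ₀ : ℝ, 0 < ρ₀ →
          iteratedDeriv l (fun ρ => invForm (aBar a₀ ρ) q) ρ₀ = c l ρ₀ := by
  obtain ⟨B, hB⟩ := exists_chain d Λ r
  -- The Taylor remainder of order `k + 1` is controlled by the bound on the derivative of that
  -- order.
  refine ⟨fun k => B (k + 1), fun a₀ ha q hq => ?_⟩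
  have hD := dom_cube d
  have hA := fun m => ha.isField hd (hD m).meas
  choose g hg using fun m => exists_isCorr (hD m) (hA m) q
  have hch := fun m => hB _ _ (hD m) _ (hA m) q hq _ (hg m)
  -- The entry of order 0 of each chain is `2 ν_*(□_m, q, ρ)`.
  have h0 : ∀ ρ, 0 < ρ → Tendsto (fun m => (volume.real (cube d m))⁻¹ *
      expect (cube d m) (Metric.thickening (1 / 2) (cube d m)) q (g m) ρ) atTop
      (𝓝 (invForm (aBar a₀ ρ) q)) := fun ρ hρ =>
    ((tendsto_aStar hd hρ ha).2 q).congr fun m => by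
      rw [(hg m).nuStar_eq hd hρ (hD m) ha, ← mul_assoc, mul_one_div_cancel two_ne_zero, one_mul]
      rfl
  obtain ⟨c, hc, hlim⟩ := Chain.limit hch fun ρ hρ => ⟨_, h0 ρ hρ⟩
  have hf : ∀ ρ, 0 < ρ → invForm (aBar a₀ ρ) q = c 0 ρ := fun ρ hρ =>
    tendsto_nhds_unique (h0 ρ hρ) (hlim 0 ρ hρ)
  refine ⟨fun ρ hρ => ⟨fun m => ⟨(elliptic_aStarInv hd hρ ha m).inv_bounds.1,
    (elliptic_aStarInv hd hρ ha m).inv_bounds.2, nuStar_cube_eq hd hρ ha m⟩,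
    (tendsto_aStar hd hρ ha).1, fun m => ?_⟩, c, fun k hk ρ hρ ψ G hG => ?_, fun k _ ρ₀ hρ₀ ρ hρ => ?_,
    hc.contDiffOn hf, fun l _ ρ hρ => hc.iteratedDeriv_eq hf l hρ⟩
  · obtain ⟨u, hu⟩ := (hg m).exists_isOptimizer hd hρ (hD m) ha
    exact ⟨u, _, hu⟩
  · have h := fun m => (hG m).coeff_eq hd hρ ha (Nat.one_le_iff_ne_zero.1 hk) (hD m) (hg m)
    exact ⟨fun m => (h m).1, (hlim k ρ hρ).congr fun m => (h m).2.symm⟩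
  -- The sum runs over `l = 0, …, k`; the term `l = 0` is the value at `ρ₀` and is split off.
  · have h := hc.taylor (k + 1) 0 hρ₀ hρ
    rw [add_sub_cancel_left, Finset.range_eq_Ico, Finset.sum_eq_sum_Ico_succ_bot k.succ_pos] at h
    simpa [hf _ hρ, hf _ hρ₀, Finset.Ico_add_one_right_eq_Icc] using h
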